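/- **Setting.** Let $n\ge 3$, let indices $i,j$ run over $[n]=\mathbb Z/n$, and let $c_{ii}=2$, $c_{i,i\pm1}=-1$, $m_{i,i\pm1}=\mp1$, and $c_{ij}=m_{ij}=0$ otherwise. Let $q,d\in\mathbb C^\times$ be such that $q$, $qd$, $qd^{-1}$ are not roots of unity. For $b\in\mathbb Z^{[n]}$ let $\ddot U^{(b)}$ be the shifted quantum toroidal algebra of $\mathfrak{sl}_n$: the associative unital $\mathbb C$-algebra generated by $e_{i,r},f_{i,r}$ ($r\in\mathbb Z$), $\psi^+_{i,r}$ ($r\ge0$), $\psi^-_{i,r}$ ($r\le b_i$), $(\psi^+_{i,0})^{-1}$, $(\psi^-_{i,b_i})^{-1}$. With $e_i(z)=\sum_r e_{i,r}z^{-r}$, $f_i(z)=\sum_r f_{i,r}z^{-r}$, $\psi_i^\pm(z)=\sum_r\psi^\pm_{i,r}z^{-r}$, $\delta(z)=\sum_{r\in\mathbb Z}z^r$ and $\epsilon,\epsilon'\in\{\pm\}$, the relations are: $[\psi_i^{\epsilon}(z),\psi_j^{\epsilon'}(w)]=0$; $(\psi^+_{i,0})^{-1}$ and $(\psi^-_{i,b_i})^{-1}$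 are two-sided inverses of $\psi^+_{i,0}$ and $\psi^-_{i,b_i}$; and $$(d^{m_{ij}}z-q^{c_{ij}}w)\,x_i(z)e_j(w)=(q^{c_{ij}}d^{m_{ij}}z-w)\,e_j(w)x_i(z),\quad x_i\in\{e_i,\psi_i^{\pm}\},$$ $$(q^{c_{ij}}d^{m_{ij}}z-w)\,x_i(z)f_j(w)=(d^{m_{ij}}z-q^{c_{ij}}w)\,f_j(w)x_i(z),\quad x_i\in\{f_i,\psi_i^{\pm}\},$$ $$[e_i(z),f_j(w)]=\tfrac{\delta_{ij}}{q-q^{-1}}\,\delta(z/w)\,(\psi_i^+(z)-\psi_i^-(z)),$$ $$\mathrm{Sym}_{z_1,z_2}\big(x_i(z_1)x_i(z_2)x_{i\pm1}(w)-(q+q^{-1})x_i(z_1)x_{i\pm1}(w)x_i(z_2)+x_{i\pm1}(w)x_i(z_1)x_i(z_2)\big)=0,\quad x=e\text{ or }x=f .$$ Let $\ddot U^{(b),>}$ and $\ddot U^{(b),<}$ be the subalgebras generated by all $e_{i,r}$ and by all $f_{i,r}$, respectively. *Shuffle algebras.* Let $\mathbb S^{[n]}=\bigoplus_{k\in\mathbb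 N^{[n]}}\mathbb S^{[n]}_k$, where $\mathbb S^{[n]}_k$ consists of the fractions $$\frac{f(\{x_{i,r}\}_{1\le r\le k_i})}{\prod_i\prod_{r\le k_i,\,s\le k_{i+1}}(x_{i,r}-x_{i+1,s})},\qquad f\ \text{a Laurent polynomial invariant under}\ S_k=\textstyle\prod_i S(k_i),$$ with product $$F\star G=\frac1{\prod_ik_i!\,l_i!}\,\mathrm{Sym}_{S_{k+l}}\Big(F(\{x_{i,r}\}_{r\le k_i})\,G(\{x_{i,r}\}_{k_i<r\le k_i+l_i})\prod_{i,j}\prod_{r\le k_i}\prod_{k_j<s\le k_j+l_j}\zeta_{ij}(x_{i,r}/x_{j,s})\Big)$$ for $F\in\mathbb S^{[n]}_k$, $G\in\mathbb S^{[n]}_l$, where $\mathrm{Sym}$ is the sum over all permutations and $\zeta_{i,i+1}(z/w)=\frac{d^{-1}z-qw}{z-w}$, $\zeta_{i,i-1}(z/w)=\frac{z-qd^{-1}w}{z-w}$, $\zeta_{ii}(z/w)=\frac{z-q^{-2}w}{z-w}$, and $\zeta_{ij}=1$ otherwise. Let $S^{[n]}\subset\mathbb S^{[n]}$ be the subspace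 of the elements whose components vanish whenever $x_{i,1}=qd^{\epsilon}x_{i+\epsilon,1}=q^2x_{i,2}$, for all $i$ and $\epsilon=\pm1$. *Difference operators.* Let $a\in\mathbb N^{[n]}$ satisfy $N_i:=b_i+2a_i-a_{i-1}-a_{i+1}\ge0$ for all $i$, let $\mathsf z_{i,s}\in\mathbb C^\times$ ($1\le s\le N_i$), and fix an orientation of the cyclic quiver on $[n]$; $j-i$ means that $i,j$ are adjacent. Let $\tilde{\mathcal A}^q$ be the $\mathbb C$-algebra generated by $\mathsf w_{i,r}^{\pm1/2}$, $D_{i,r}^{\pm1}$ ($1\le r\le a_i$), where the $\mathsf w$'s commute, the $D$'s commute and $D_{i,r}\mathsf w_{j,s}^{1/2}=q^{\delta_{ij}\delta_{rs}}\mathsf w_{j,s}^{1/2}D_{i,r}$, localized at all $\mathsf w_{i,r}-q^m\mathsf w_{i,s}$ ($r\ne s$, $m\in\mathbb Z$). Let $\tilde{\mathcal A}^{q,\prime}\supset\tilde{\mathcal A}^q$ be its further localization at all $\mathsf w_{i,r}-q^md\,\mathsf w_{i+1,s}$ ($m\in\mathbb Z$). Put $\mathsf Z_i(z)=\prod_s(1-q\mathsf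 z_{i,s}/z)$, $W_i(z)=\prod_r(1-\mathsf w_{i,r}/z)$, $W_{i,r}(z)=\prod_{s\ne r}(1-\mathsf w_{i,s}/z)$, and $$Y_{i,r}(z)=\frac1{q-q^{-1}}\prod_{t\le a_i}\mathsf w_{i,t}\prod_{j\to i}\prod_{t\le a_j}\mathsf w_{j,t}^{-1/2}\cdot\frac{\mathsf Z_i(z)\prod_{j\to i}W_j(zq^{-1}d^{m_{ij}})}{W_{i,r}(z)},$$ $$Y'_{i,r}(z)=\frac1{1-q^2}\prod_{j\leftarrow i}\prod_{t\le a_j}\mathsf w_{j,t}^{-1/2}\cdot\frac{\prod_{j\leftarrow i}W_j(zq^{-1}d^{m_{ij}})}{W_{i,r}(zq^{-2})}.$$ **Theorem.** There is a unique $\mathbb C$-algebra homomorphism $\tilde\Phi\colon\ddot U^{(b)}\to\tilde{\mathcal A}^q$ with $$e_i(z)\mapsto\frac{-q}{1-q^2}\prod_{t\le a_i}\mathsf w_{i,t}\prod_{j\to i}\prod_{t\le a_j}\mathsf w_{j,t}^{-1/2}\sum_{r\le a_i}\delta\Big(\frac{\mathsf w_{i,r}}z\Big)\frac{\mathsf Z_i(\mathsf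 w_{i,r})}{W_{i,r}(\mathsf w_{i,r})}\prod_{j\to i}W_j(q^{-1}d^{m_{ij}}z)\,D_{i,r}^{-1},$$ $$f_i(z)\mapsto\frac1{1-q^2}\prod_{j\leftarrow i}\prod_{t\le a_j}\mathsf w_{j,t}^{-1/2}\sum_{r\le a_i}\delta\Big(\frac{q^2\mathsf w_{i,r}}z\Big)\frac1{W_{i,r}(\mathsf w_{i,r})}\prod_{j\leftarrow i}W_j(q^{-1}d^{m_{ij}}z)\,D_{i,r},$$ $$\psi_i^\pm(z)\mapsto\prod_{t\le a_i}\mathsf w_{i,t}\prod_{j-i}\prod_{t\le a_j}\mathsf w_{j,t}^{-1/2}\Big(\frac{\mathsf Z_i(z)}{W_i(z)W_i(q^{-2}z)}\prod_{j-i}W_j(q^{-1}d^{m_{ij}}z)\Big)^\pm,$$ where $(\cdot)^\pm$ is the expansion in $z^{\mp1}$. Moreover: (a) There is a $\mathbb C$-algebra homomorphism $\hat\Phi\colon\mathbb S^{[n]}\to\tilde{\mathcal A}^{q,\prime}$ that sends $E\in\mathbb S^{[n]}_k$ to $q^{\sum_i(k_i-k_i^2)}$ times the sum, over all families $m^{(i)}_r\in\mathbb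 N$ ($i\in[n]$, $1\le r\le a_i$) with $\sum_rm^{(i)}_r=k_i$ for all $i$, of $$\prod_{i,r}\prod_{p\le m_r^{(i)}}Y_{i,r}(x^{(i)}_{r,p})\cdot E\big(\{x^{(i)}_{r,p}\}\big)\cdot\prod_{i,r}\prod_{p_1<p_2\le m^{(i)}_r}\zeta_{ii}^{-1}\Big(\frac{x^{(i)}_{r,p_1}}{x^{(i)}_{r,p_2}}\Big)\prod_i\prod_{r_1\ne r_2}\prod_{p_1,p_2}\zeta_{ii}^{-1}\Big(\frac{x^{(i)}_{r_1,p_1}}{x^{(i)}_{r_2,p_2}}\Big)\prod_{j\to i}\prod_{r_1,r_2}\prod_{p_1,p_2}\zeta_{ij}^{-1}\Big(\frac{x^{(i)}_{r_1,p_1}}{x^{(j)}_{r_2,p_2}}\Big)\cdot\prod_{i,r}D_{i,r}^{-m_r^{(i)}},$$ where $x^{(i)}_{r,p}=\mathsf w_{i,r}q^{-2(p-1)}$, $1\le p\le m_r^{(i)}$. It maps $S^{[n]}$ into $\tilde{\mathcal A}^q$. There is an algebra homomorphism $\Upsilon\colon\ddot U^{(b),>}\to\mathbb S^{[n]}$ with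 image in $S^{[n]}$ and $\Upsilon(e_{i,r})=x_{i,1}^r$ for all $i,r$, and $\hat\Phi\circ\Upsilon=\tilde\Phi|_{\ddot U^{(b),>}}$. (b) There is a $\mathbb C$-algebra homomorphism $\hat\Phi\colon\mathbb S^{[n],\mathrm{op}}\to\tilde{\mathcal A}^{q,\prime}$ that sends $F\in\mathbb S^{[n]}_k$ to the sum, over the same families, of $$\prod_{i,r}\prod_{p\le m_r^{(i)}}Y'_{i,r}(x^{(i)}_{r,p})\cdot F\big(\{x^{(i)}_{r,p}\}\big)\cdot\prod_{i,r}\prod_{p_1<p_2\le m^{(i)}_r}\zeta_{ii}^{-1}\Big(\frac{x^{(i)}_{r,p_2}}{x^{(i)}_{r,p_1}}\Big)\prod_i\prod_{r_1\ne r_2}\prod_{p_1,p_2}q^{-1}\zeta_{ii}^{-1}\Big(\frac{x^{(i)}_{r_2,p_2}}{x^{(i)}_{r_1,p_1}}\Big)\prod_{j\leftarrow i}\prod_{r_1,r_2}\prod_{p_1,p_2}\zeta_{ji}^{-1}\Big(\frac{x^{(j)}_{r_2,p_2}}{x^{(i)}_{r_1,p_1}}\Big)\cdot\prod_{i,r}D_{i,r}^{m_r^{(i)}},$$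 where $x^{(i)}_{r,p}=\mathsf w_{i,r}q^{2p}$, $1\le p\le m_r^{(i)}$. It maps $S^{[n]}$ into $\tilde{\mathcal A}^q$. There is an algebra homomorphism $\Upsilon\colon\ddot U^{(b),<}\to\mathbb S^{[n],\mathrm{op}}$ with image in $S^{[n]}$ and $\Upsilon(f_{i,r})=x_{i,1}^r$ for all $i,r$, and $\hat\Phi\circ\Upsilon=\tilde\Phi|_{\ddot U^{(b),<}}$. -/

import Mathlib

set_option linter.unusedSectionVars false

open scoped BigOperators DirectSum

noncomputable section

namespace ToroidalShuffle

/-- The field of rational functions over `ℂ` in the variables `X`. -/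
def RatFun (X : Type) : Type := FractionRing (MvPolynomial X ℂ)

instance (X : Type) : Field (RatFun X) :=
  inferInstanceAs (Field (FractionRing (MvPolynomial X ℂ)))

instance (X : Type) : Algebra (MvPolynomial X ℂ) (RatFun X) :=
  inferInstanceAs (Algebra (MvPolynomial X ℂ) (FractionRing (MvPolynomial X ℂ)))

instance (X : Type) : IsFractionRing (MvPolynomial X ℂ) (RatFun X) :=
  inferInstanceAs (IsFractionRing (MvPolynomial X ℂ) (FractionRing (MvPolynomial X ℂ)))

instance (X : Type) : Algebra ℂ (RatFun X) :=
  ((algebraMap (MvPolynomial X ℂ) (RatFun X)).comp MvPolynomial.C).toAlgebra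

instance (X : Type) : IsScalarTower ℂ (MvPolynomial X ℂ) (RatFun X) :=
  IsScalarTower.of_algebraMap_eq fun _ => rfl

/-- A variable, as a rational function. -/
def rvar {X : Type} (v : X) : RatFun X := algebraMap (MvPolynomial X ℂ) (RatFun X) (MvPolynomial.X v)

theorem rvar_ne_zero {X : Type} (v : X) : rvar v ≠ 0 := by
  unfold rvar
  simp

theorem rvar_injective {X : Type} : Function.Injective (rvar (X := X)) := fun _ _ h =>
  MvPolynomial.X_injective ((IsFractionRing.injective (MvPolynomial X ℂ) (RatFun X)) h)

theorem ratFun_hom_ext {X : Type} {L : Type*} [Field L] [Algebra ℂ L] {f g : RatFun X →ₐ[ℂ] L}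
    (h : ∀ v, f (rvar v) = g (rvar v)) : f = g := by
  apply IsLocalization.algHom_ext (R := ℂ) (nonZeroDivisors (MvPolynomial X ℂ))
  apply MvPolynomial.algHom_ext
  intro v
  exact h v

/-- Injective renaming of variables. -/
def relabel {X : Type} (f : X → X) (hf : Function.Injective f) : RatFun X →ₐ[ℂ] RatFun X :=
  IsFractionRing.liftAlgHom (K := RatFun X) (L := RatFun X)
    (g := (Algebra.algHom ℂ (MvPolynomial X ℂ) (RatFun X)).comp (MvPolynomial.rename f))
    (by
      rw [AlgHom.coe_comp]
      exact (IsFractionRing.injective (MvPolynomial X ℂ) (RatFun X)).comp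
        (MvPolynomial.rename_injective f hf))

@[simp] theorem relabel_rvar {X : Type} (f : X → X) (hf : Function.Injective f) (v : X) :
    relabel f hf (rvar v) = rvar (f v) := by
  unfold relabel rvar
  rw [IsFractionRing.liftAlgHom_apply, IsFractionRing.lift_algebraMap]
  exact congrArg (algebraMap (MvPolynomial X ℂ) (RatFun X)) (MvPolynomial.rename_X f v)

theorem relabel_relabel {X : Type} (f g : X → X) (hf : Function.Injective f)
    (hg : Function.Injective g) (F : RatFun X) :
    relabel f hf (relabel g hg F) = relabel (f ∘ g) (hf.comp hg) F := by
  have : (relabel f hf).comp (relabel g hg) = relabel (f ∘ g) (hf.comp hg) :=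
    ratFun_hom_ext (by simp)
  exact DFunLike.congr_fun this F

theorem relabel_id {X : Type} (F : RatFun X) :
    relabel id Function.injective_id F = F := by
  have : relabel (id : X → X) Function.injective_id = AlgHom.id ℂ _ :=
    ratFun_hom_ext (by simp)
  exact DFunLike.congr_fun this F

/-- Laurent polynomials in the variables belonging to `s`. -/
def Laurent {X : Type} (s : Set X) : Subalgebra ℂ (RatFun X) :=
  Algebra.adjoin ℂ (rvar '' s ∪ (fun v => (rvar v)⁻¹) '' s)

theorem rvar_mem_Laurent {X : Type} {s : Set X} {v : X} (h : v ∈ s) : rvar v ∈ Laurent s :=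
  Algebra.subset_adjoin (Or.inl ⟨v, h, rfl⟩)

theorem rvar_inv_mem_Laurent {X : Type} {s : Set X} {v : X} (h : v ∈ s) :
    (rvar v)⁻¹ ∈ Laurent s :=
  Algebra.subset_adjoin (Or.inr ⟨v, h, rfl⟩)

theorem relabel_mem_Laurent {X : Type} {s t : Set X} (f : X → X) (hf : Function.Injective f)
    (hst : ∀ v ∈ s, f v ∈ t) {F : RatFun X} (hF : F ∈ Laurent s) : relabel f hf F ∈ Laurent t := by
  have : Laurent s ≤ (Laurent t).comap (relabel f hf) := by
    refine Algebra.adjoin_le ?_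
    rintro _ (⟨v, hv, rfl⟩ | ⟨v, hv, rfl⟩)
    · simpa using rvar_mem_Laurent (hst v hv)
    · simpa using rvar_inv_mem_Laurent (hst v hv)
  exact this hF

theorem Laurent_mono {X : Type} {s t : Set X} (h : s ⊆ t) : Laurent s ≤ Laurent t := by
  refine Algebra.adjoin_mono ?_
  gcongr

theorem relabel_eq_of_eqOn {X : Type} {s : Set X} (f g : X → X) (hf : Function.Injective f)
    (hg : Function.Injective g)
    (h : ∀ v ∈ s, f v = g v) {F : RatFun X} (hF : F ∈ Laurent s) :
    relabel f hf F = relabel g hg F := by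
  have : Laurent s ≤ AlgHom.equalizer (relabel f hf) (relabel g hg) := by
    refine Algebra.adjoin_le ?_
    rintro _ (⟨v, hv, rfl⟩ | ⟨v, hv, rfl⟩)
    · simp [h v hv]
    · simp [h v hv]
  exact this hF

theorem X_sub_X_dvd {X : Type} [DecidableEq X] (u v : X) (P : MvPolynomial X ℂ)
    (hP : MvPolynomial.rename (Function.update id u v) P = 0) :
    (MvPolynomial.X u - MvPolynomial.X v : MvPolynomial X ℂ) ∣ P := by
  have key : ∀ Q : MvPolynomial X ℂ, (MvPolynomial.X u - MvPolynomial.X v : MvPolynomial X ℂ) ∣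
      Q - MvPolynomial.rename (Function.update id u v) Q := by
    intro Q
    induction Q using MvPolynomial.induction_on with
    | C a => simp
    | add p q hp hq =>
      rw [map_add, add_sub_add_comm]
      exact dvd_add hp hq
    | mul_X p w hp =>
      have : p * MvPolynomial.X w
          - MvPolynomial.rename (Function.update id u v) (p * MvPolynomial.X w)
        = (p - MvPolynomial.rename (Function.update id u v) p) * MvPolynomial.X w
        + MvPolynomial.rename (Function.update id u v) p *
          (MvPolynomial.X w - MvPolynomial.X (Function.update id u v w)) := by
        rw [map_mul, MvPolynomial.rename_X]; ring
      rw [this]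
      refine dvd_add (hp.mul_right _) (Dvd.dvd.mul_left ?_ _)
      by_cases hu : w = u
      · subst hu; simp
      · simp [Function.update_of_ne hu]
  simpa [hP] using key P

theorem prod_X_sub_X_dvd {X ι : Type} [DecidableEq X] (t : Finset ι) (u v : ι → X)
    (huv : ∀ i ∈ t, u i ≠ v i)
    (hne : ∀ i ∈ t, ∀ j ∈ t, i ≠ j → ¬ (u i = u j ∧ v i = v j) ∧ ¬ (u i = v j ∧ v i = u j))
    (P : MvPolynomial X ℂ)
    (hP : ∀ i ∈ t, MvPolynomial.rename (Function.update id (u i) (v i)) P = 0) :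
    (∏ i ∈ t, (MvPolynomial.X (u i) - MvPolynomial.X (v i) : MvPolynomial X ℂ)) ∣ P := by
  classical
  induction t using Finset.induction_on with
  | empty => simp
  | insert a t ha ih =>
    obtain ⟨Q, rfl⟩ := ih (fun i hi => huv i (Finset.mem_insert_of_mem hi))
      (fun i hi j hj => hne i (Finset.mem_insert_of_mem hi) j (Finset.mem_insert_of_mem hj))
      (fun i hi => hP i (Finset.mem_insert_of_mem hi))
    rw [Finset.prod_insert ha, mul_comm]
    refine mul_dvd_mul_left _ (X_sub_X_dvd _ _ _ ?_)
    have h0 := hP a (Finset.mem_insert_self _ _)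
    rw [map_mul, map_prod] at h0
    refine (mul_eq_zero.1 h0).resolve_left ?_
    refine Finset.prod_ne_zero_iff.2 ?_
    intro i hi h
    rw [map_sub, MvPolynomial.rename_X, MvPolynomial.rename_X, sub_eq_zero] at h
    have h := MvPolynomial.X_injective h
    have h1 := huv i (Finset.mem_insert_of_mem hi)
    have h2 := hne i (Finset.mem_insert_of_mem hi) a (Finset.mem_insert_self _ _)
      (by rintro rfl; exact ha hi)
    simp only [Function.update_apply, id] at h
    split_ifs at h <;> simp_all

variable {n : ℕ}

/-- The variables `x_{i,r}`, with `i` a residue modulo `n`; the index `r` is counted from `0`. -/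
abbrev Var (n : ℕ) : Type := (_ : ZMod n) × ℕ

/-- The variable `x_{i,r}`, with `r` counted from `0`. -/
def xv (i : ZMod n) (r : ℕ) : RatFun (Var n) := rvar ⟨i, r⟩

/-- The variables `x_{i,r}` with `r < k_i`. -/
def varSet (k : ZMod n → ℕ) : Set (Var n) := {v | v.2 < k v.1}

/-- The group `S_k = ∏ S(k_i)`. -/
abbrev SymGroup (k : ZMod n → ℕ) : Type := ∀ i, Equiv.Perm (Fin (k i))

/-- The action of `S_k` on the variables: it permutes the `x_{i,r}` with `r < k_i`. -/
def permVar (k : ZMod n → ℕ) : SymGroup k →* Equiv.Perm (Var n) where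
  toFun σ := Equiv.sigmaCongrRight fun i => (σ i).extendDomain (Fin.equivSubtype (n := k i))
  map_one' := by
    ext v <;> simp
  map_mul' σ τ := by
    apply Equiv.ext
    rintro ⟨i, r⟩
    simp [Equiv.Perm.mul_apply, ← Equiv.Perm.extendDomain_mul]

/-- The action of `S_k` on rational functions. -/
def symAct (k : ZMod n → ℕ) (σ : SymGroup k) : RatFun (Var n) →ₐ[ℂ] RatFun (Var n) :=
  relabel (permVar k σ) (permVar k σ).injective

@[simp] theorem permVar_fst (k : ZMod n → ℕ) (σ : SymGroup k) (v : Var n) :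
    (permVar k σ v).1 = v.1 := rfl

theorem permVar_lt (k : ZMod n → ℕ) (σ : SymGroup k) (i : ZMod n) (r : Fin (k i)) :
    permVar k σ ⟨i, r⟩ = ⟨i, (σ i r : ℕ)⟩ := by
  have := Equiv.Perm.extendDomain_apply_image (σ i) (Fin.equivSubtype (n := k i)) r
  simpa [permVar] using this

theorem permVar_of_le (k : ZMod n → ℕ) (σ : SymGroup k) (v : Var n) (h : k v.1 ≤ v.2) :
    permVar k σ v = v := by
  obtain ⟨i, r⟩ := v
  have := Equiv.Perm.extendDomain_apply_not_subtype (σ i) (Fin.equivSubtype (n := k i))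
    (b := r) (by simpa using h)
  simpa [permVar] using this

theorem permVar_mem (k : ZMod n → ℕ) (σ : SymGroup k) {v : Var n} (h : v ∈ varSet k) :
    permVar k σ v ∈ varSet k := by
  obtain ⟨i, r⟩ := v
  have := permVar_lt k σ i ⟨r, h⟩
  simp only at this
  rw [this]
  exact (σ i ⟨r, h⟩).2

theorem exists_permVar (k : ZMod n → ℕ) (τ : Equiv.Perm (Var n)) (h1 : ∀ v, (τ v).1 = v.1)
    (h2 : ∀ v, k v.1 ≤ v.2 → τ v = v) : ∃ σ, permVar k σ = τ := by
  have h3 : ∀ v ∈ varSet k, τ v ∈ varSet k := by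
    intro v hv
    by_contra h
    have h' : k (τ v).1 ≤ (τ v).2 := not_lt.1 h
    have := τ.injective (h2 _ h')
    rw [this] at h
    exact h hv
  have h1' : ∀ v, (τ⁻¹ v).1 = v.1 := fun v => by
    have := h1 (τ⁻¹ v); simpa using this.symm
  have h2' : ∀ v, k v.1 ≤ v.2 → τ⁻¹ v = v := fun v hv => by
    rw [Equiv.Perm.inv_eq_iff_eq]; exact (h2 v hv).symm
  have h3' : ∀ v ∈ varSet k, τ⁻¹ v ∈ varSet k := by
    intro v hv
    by_contra h
    have h' : k (τ⁻¹ v).1 ≤ (τ⁻¹ v).2 := not_lt.1 h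
    have := τ⁻¹.injective (h2' _ h')
    rw [this] at h
    exact h hv
  have aux : ∀ (ρ : Equiv.Perm (Var n)) (i : ZMod n) (r : ℕ), (ρ ⟨i, r⟩).1 = i →
      ρ ⟨i, r⟩ = ⟨i, (ρ ⟨i, r⟩).2⟩ := by
    intro ρ i r h
    exact Sigma.ext h (by simp)
  have b1 : ∀ i (r : Fin (k i)), (τ ⟨i, r⟩).2 < k i := fun i r => by
    have := h3 ⟨i, r⟩ r.2
    simpa [varSet, h1] using this
  have b2 : ∀ i (r : Fin (k i)), (τ⁻¹ ⟨i, r⟩).2 < k i := fun i r => by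
    have := h3' ⟨i, r⟩ r.2
    have h := h1' ⟨i, r⟩
    change (τ⁻¹ ⟨i, r⟩).2 < k (τ⁻¹ ⟨i, r⟩).1 at this
    rwa [h] at this
  obtain ⟨σ, hσ⟩ : ∃ σ : SymGroup k, ∀ i r, (σ i r : ℕ) = (τ ⟨i, r⟩).2 := by
    refine ⟨fun i => ⟨fun r => ⟨(τ ⟨i, r⟩).2, b1 i r⟩, fun r => ⟨(τ⁻¹ ⟨i, r⟩).2, b2 i r⟩,
      ?_, ?_⟩, fun _ _ => rfl⟩
    · intro r
      apply Fin.ext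
      simp only
      rw [← aux τ i r (h1 _)]
      simp
    · intro r
      apply Fin.ext
      simp only
      rw [← aux τ⁻¹ i r (h1' _)]
      simp
  refine ⟨σ, Equiv.ext ?_⟩
  rintro ⟨i, r⟩
  by_cases hr : r < k i
  · have := permVar_lt k σ i ⟨r, hr⟩
    simp only [hσ] at this
    rw [this]
    exact (aux τ i r (h1 _)).symm
  · rw [permVar_of_le k _ _ (not_lt.1 hr), h2 _ (not_lt.1 hr)]

theorem symAct_mul (k : ZMod n → ℕ) (σ τ : SymGroup k) (F : RatFun (Var n)) :
    symAct k (σ * τ) F = symAct k σ (symAct k τ F) := by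
  simp only [symAct, relabel_relabel]
  congr 2
  simp


/-! sums over the symmetric group -/

variable [NeZero n]

/-- The action of arbitrary permutations of the variables on rational functions. -/
def act (τ : Equiv.Perm (Var n)) : RatFun (Var n) →ₐ[ℂ] RatFun (Var n) := relabel τ τ.injective

theorem act_act (σ τ : Equiv.Perm (Var n)) (F : RatFun (Var n)) :
    act σ (act τ F) = act (σ * τ) F := by
  simp only [act, relabel_relabel]
  congr 1

@[simp] theorem act_rvar (σ : Equiv.Perm (Var n)) (v : Var n) :
    act σ (rvar v) = rvar (σ v) := by simp [act]

/-- The sum over `S_k` of all permuted copies of `F`. -/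
def symSum (k : ZMod n → ℕ) (F : RatFun (Var n)) : RatFun (Var n) :=
  ∑ σ : SymGroup k, symAct k σ F

theorem symAct_eq (k : ZMod n → ℕ) (σ : SymGroup k) : symAct k σ = act (permVar k σ) := rfl

theorem symSum_act (k : ZMod n → ℕ) (σ : SymGroup k) (F : RatFun (Var n)) :
    symSum k (symAct k σ F) = symSum k F := by
  unfold symSum
  simp only [← symAct_mul]
  exact Fintype.sum_equiv (Equiv.mulRight σ) _ _ (fun _ => rfl)

theorem symAct_symSum (k : ZMod n → ℕ) (σ : SymGroup k) (F : RatFun (Var n)) :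
    symAct k σ (symSum k F) = symSum k F := by
  unfold symSum
  rw [map_sum]
  simp only [← symAct_mul]
  exact Fintype.sum_equiv (Equiv.mulLeft σ) _ _ (fun _ => rfl)

theorem symSum_add (k : ZMod n → ℕ) (F G : RatFun (Var n)) :
    symSum k (F + G) = symSum k F + symSum k G := by
  simp [symSum, Finset.sum_add_distrib]

theorem symSum_smul (k : ZMod n → ℕ) (c : ℂ) (F : RatFun (Var n)) :
    symSum k (c • F) = c • symSum k F := by
  unfold symSum
  rw [Finset.smul_sum]
  exact Finset.sum_congr rfl fun σ _ => map_smul (symAct k σ) c F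

theorem symSum_sum (k : ZMod n → ℕ) {ι : Type} [Fintype ι] (f : ι → RatFun (Var n)) :
    symSum k (∑ i, f i) = ∑ i, symSum k (f i) := by
  simp only [symSum, map_sum]
  exact Finset.sum_comm

theorem symSum_sum_act (k : ZMod n → ℕ) {ι : Type} [Fintype ι] (τ : ι → Equiv.Perm (Var n))
    (hτ : ∀ i, ∃ σ, permVar k σ = τ i) (F : RatFun (Var n)) :
    symSum k (∑ i, act (τ i) F) = (Fintype.card ι : ℂ) • symSum k F := by
  rw [symSum_sum, Finset.sum_congr rfl (g := fun _ => symSum k F)]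
  · rw [Finset.sum_const, Finset.card_univ, Nat.cast_smul_eq_nsmul]
  · intro i _
    obtain ⟨σ, hσ⟩ := hτ i
    rw [← hσ, ← symAct_eq, symSum_act]

/-- `k! = ∏ k_i!`. -/
def multiFactorial (k : ZMod n → ℕ) : ℕ := ∏ i, (k i).factorial

theorem card_symGroup (k : ZMod n → ℕ) : Fintype.card (SymGroup k) = multiFactorial k := by
  simp [SymGroup, multiFactorial, Fintype.card_perm]

theorem multiFactorial_ne_zero (k : ZMod n → ℕ) : (multiFactorial k : ℂ) ≠ 0 := by
  rw [Nat.cast_ne_zero]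
  exact Finset.prod_ne_zero_iff.2 fun i _ => Nat.factorial_ne_zero _

/-- The substitution `x_{i,r} ↦ x_{i,k_i+r}`. -/
def shift (k : ZMod n → ℕ) : RatFun (Var n) →ₐ[ℂ] RatFun (Var n) :=
  relabel (fun v => ⟨v.1, k v.1 + v.2⟩) (by
    rintro ⟨i, r⟩ ⟨j, s⟩ h
    obtain ⟨rfl, h⟩ := Sigma.mk.inj_iff.1 h
    simpa using h)

@[simp] theorem shift_rvar (k : ZMod n → ℕ) (v : Var n) :
    shift k (rvar v) = rvar ⟨v.1, k v.1 + v.2⟩ :=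
  relabel_rvar _ _ v

theorem shift_shift (k l : ZMod n → ℕ) (F : RatFun (Var n)) :
    shift k (shift l F) = shift (k + l) F := by
  have : (shift k).comp (shift l) = shift (k + l) := ratFun_hom_ext (by simp [add_assoc])
  exact DFunLike.congr_fun this F

theorem shift_zero (F : RatFun (Var n)) : shift 0 F = F := by
  have : shift (0 : ZMod n → ℕ) = AlgHom.id ℂ _ := ratFun_hom_ext (by simp)
  exact DFunLike.congr_fun this F

/-- The shift by `k`, as a bijection onto the variables `x_{i,r}` with `k_i ≤ r`. -/
def shiftEquiv (k : ZMod n → ℕ) : Var n ≃ {v : Var n // k v.1 ≤ v.2} where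
  toFun v := ⟨⟨v.1, k v.1 + v.2⟩, Nat.le_add_right _ _⟩
  invFun v := ⟨v.1.1, v.1.2 - k v.1.1⟩
  left_inv v := by simp
  right_inv v := by
    obtain ⟨⟨i, r⟩, h⟩ := v
    simp only at h
    simp [Nat.add_sub_cancel' h]

/-- The permutation `τ` transported by the shift by `k`. -/
def shiftPerm (k : ZMod n → ℕ) (τ : Equiv.Perm (Var n)) : Equiv.Perm (Var n) :=
  τ.extendDomain (shiftEquiv k)

theorem shiftPerm_of_lt (k : ZMod n → ℕ) (τ : Equiv.Perm (Var n)) (v : Var n) (h : v.2 < k v.1) :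
    shiftPerm k τ v = v :=
  Equiv.Perm.extendDomain_apply_not_subtype _ _ (by simpa using h)

theorem shiftPerm_shift (k : ZMod n → ℕ) (τ : Equiv.Perm (Var n)) (v : Var n) :
    shiftPerm k τ ⟨v.1, k v.1 + v.2⟩ = ⟨(τ v).1, k (τ v).1 + (τ v).2⟩ :=
  Equiv.Perm.extendDomain_apply_image τ (shiftEquiv k) v

theorem shift_act (k : ZMod n → ℕ) (τ : Equiv.Perm (Var n)) (F : RatFun (Var n)) :
    shift k (act τ F) = act (shiftPerm k τ) (shift k F) := by
  have : (shift k).comp (act τ) = (act (shiftPerm k τ)).comp (shift k) :=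
    ratFun_hom_ext (by intro v; simp [shiftPerm_shift])
  exact DFunLike.congr_fun this F

theorem le_or_eq_shift (k : ZMod n → ℕ) (v : Var n) :
    v.2 < k v.1 ∨ ∃ u : Var n, v = ⟨u.1, k u.1 + u.2⟩ := by
  obtain ⟨i, r⟩ := v
  rcases lt_or_ge r (k i) with h | h
  · exact Or.inl h
  · exact Or.inr ⟨⟨i, r - k i⟩, by simp [Nat.add_sub_cancel' h]⟩

theorem exists_shiftPerm (k l : ZMod n → ℕ) (σ : SymGroup l) :
    ∃ σ', permVar (k + l) σ' = shiftPerm k (permVar l σ) := by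
  apply exists_permVar
  · intro v
    rcases le_or_eq_shift k v with h | ⟨u, rfl⟩
    · rw [shiftPerm_of_lt _ _ _ h]
    · rw [shiftPerm_shift]; simp
  · intro v hv
    rcases le_or_eq_shift k v with h | ⟨u, rfl⟩
    · rw [shiftPerm_of_lt _ _ _ h]
    · rw [shiftPerm_shift, permVar_of_le]
      simpa using hv

theorem exists_permVar_add (k l : ZMod n → ℕ) (σ : SymGroup k) :
    ∃ σ', permVar (k + l) σ' = permVar k σ := by
  apply exists_permVar
  · intro v; simp
  · intro v hv
    apply permVar_of_le
    have : k v.1 + l v.1 ≤ v.2 := hv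
    omega

/-! zeta -/

/-- The factor `ζ_{ij}(z/w)`. -/
def zeta {L : Type*} [Field L] [Algebra ℂ L] (q d : ℂˣ) (i j : ZMod n) (z w : L) : L :=
  if j = i then (z - ((q : ℂ) ^ (-2 : ℤ)) • w) / (z - w)
  else if j = i + 1 then ((d : ℂ)⁻¹ • z - (q : ℂ) • w) / (z - w)
  else if j = i - 1 then (z - ((q : ℂ) * (d : ℂ)⁻¹) • w) / (z - w)
  else 1

theorem map_zeta {L L' : Type*} [Field L] [Algebra ℂ L] [Field L'] [Algebra ℂ L'] (q d : ℂˣ)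
    (i j : ZMod n) (z w : L) (f : L →ₐ[ℂ] L') : f (zeta q d i j z w) = zeta q d i j (f z) (f w) := by
  unfold zeta
  split_ifs <;> simp

/-- The product of `ζ_{ij}(x_{i,r}/x_{j,s})` over all `i, j`, over `r` in the first group of
variables (`r < k_i`) and over `s` in the second one (`k_j ≤ s < k_j + l_j`). -/
def zetaProd (q d : ℂˣ) (k l : ZMod n → ℕ) : RatFun (Var n) :=
  ∏ i, ∏ j, ∏ r ∈ Finset.range (k i), ∏ s ∈ Finset.Ico (k j) (k j + l j),
    zeta q d i j (xv i r) (xv j s)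

/-- The shuffle product `(k! l!)⁻¹ Sym (F(x_{i,r}, r < k_i) G(x_{i,r}, k_i ≤ r) ∏ ζ_{ij})`, the
symmetrization being the full sum over `S_{k+l}`. -/
def star (q d : ℂˣ) (k l : ZMod n → ℕ) (F G : RatFun (Var n)) : RatFun (Var n) :=
  ((multiFactorial k : ℂ) * (multiFactorial l : ℂ))⁻¹ •
    symSum (k + l) (F * shift k G * zetaProd q d k l)

/-- The variables `x_{i,r}` with `k_i ≤ r < k_i + l_i`. -/
def block (k l : ZMod n → ℕ) : Finset (Var n) :=
  Finset.univ.sigma fun i => Finset.Ico (k i) (k i + l i)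

theorem mem_block (k l : ZMod n → ℕ) (v : Var n) :
    v ∈ block k l ↔ k v.1 ≤ v.2 ∧ v.2 < k v.1 + l v.1 := by simp [block]

theorem zetaProd_eq (q d : ℂˣ) (k l : ZMod n → ℕ) : zetaProd q d k l =
    ∏ u ∈ block 0 k, ∏ v ∈ block k l, zeta q d u.1 v.1 (rvar u) (rvar v) := by
  unfold zetaProd block
  simp only [Finset.prod_sigma, xv]
  refine Finset.prod_congr rfl fun i _ => ?_
  rw [Finset.prod_comm]
  simp only [Pi.zero_apply, zero_add, Finset.range_eq_Ico]

theorem map_zetaProd (q d : ℂˣ) (k l : ZMod n → ℕ) (τ : Equiv.Perm (Var n))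
    (h1 : ∀ v, (τ v).1 = v.1)
    (hk : ∀ v, τ v ∈ block 0 k ↔ v ∈ block 0 k) (hl : ∀ v, τ v ∈ block k l ↔ v ∈ block k l) :
    act τ (zetaProd q d k l) = zetaProd q d k l := by
  rw [zetaProd_eq]
  simp only [map_prod, map_zeta, act_rvar]
  refine Finset.prod_equiv τ (fun v => (hk v).symm) fun u _ => ?_
  refine Finset.prod_equiv τ (fun v => (hl v).symm) fun v _ => ?_
  rw [h1, h1]

theorem block_shift (k l m : ZMod n → ℕ) (v : Var n) :
    (⟨v.1, k v.1 + v.2⟩ : Var n) ∈ block (k + l) m ↔ v ∈ block l m := by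
  simp only [mem_block, Pi.add_apply]
  omega

theorem prod_block_shift (k l m : ZMod n → ℕ) (f : Var n → RatFun (Var n)) :
    ∏ v ∈ block l m, f ⟨v.1, k v.1 + v.2⟩ = ∏ v ∈ block (k + l) m, f v := by
  refine Finset.prod_bij (fun v _ => ⟨v.1, k v.1 + v.2⟩) ?_ ?_ ?_ ?_
  · intro v hv; exact (block_shift k l m v).2 hv
  · rintro ⟨i, r⟩ _ ⟨j, s⟩ _ h
    obtain ⟨rfl, h⟩ := Sigma.mk.inj_iff.1 h
    simpa using h
  · intro v hv
    rcases le_or_eq_shift k v with h | ⟨u, rfl⟩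
    · have := (mem_block _ _ _).1 hv
      simp only [Pi.add_apply] at this
      omega
    · exact ⟨u, (block_shift k l m u).1 hv, rfl⟩
  · intro v _; rfl

theorem prod_block_add (k l m : ZMod n → ℕ) (f : Var n → RatFun (Var n)) :
    ∏ v ∈ block k (l + m), f v = (∏ v ∈ block k l, f v) * ∏ v ∈ block (k + l) m, f v := by
  classical
  rw [← Finset.prod_union]
  · refine Finset.prod_congr ?_ fun _ _ => rfl
    ext v
    simp only [Finset.mem_union, mem_block, Pi.add_apply]
    omega
  · rw [Finset.disjoint_left]
    intro v h1 h2
    simp only [mem_block, Pi.add_apply] at h1 h2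
    omega

theorem zetaProd_cocycle (q d : ℂˣ) (k l m : ZMod n → ℕ) :
    zetaProd q d k l * zetaProd q d (k + l) m =
      shift k (zetaProd q d l m) * zetaProd q d k (l + m) := by
  have e : shift k (zetaProd q d l m)
      = ∏ u ∈ block k l, ∏ v ∈ block (k + l) m, zeta q d u.1 v.1 (rvar u) (rvar v) := by
    rw [zetaProd_eq]
    simp only [map_prod, map_zeta, shift_rvar]
    refine (prod_block_shift k 0 l
      (fun u => ∏ v ∈ block l m, zeta q d u.1 v.1 (rvar u) (rvar ⟨v.1, k v.1 + v.2⟩))).trans ?_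
    rw [add_zero]
    refine Finset.prod_congr rfl fun u _ => ?_
    exact prod_block_shift k l m (fun v => zeta q d u.1 v.1 (rvar u) (rvar v))
  rw [e, zetaProd_eq, zetaProd_eq, zetaProd_eq, prod_block_add 0 k l, zero_add]
  simp only [prod_block_add k l m, Finset.prod_mul_distrib]
  ring

theorem symSum_mul_of_fixed (k l : ZMod n → ℕ) (A B : RatFun (Var n))
    (hB : ∀ σ : SymGroup k, symAct k σ B = B) :
    symSum (k + l) (symSum k A * B) = (multiFactorial k : ℂ) • symSum (k + l) (A * B) := by
  have : symSum k A * B = ∑ σ : SymGroup k, act (permVar k σ) (A * B) := by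
    unfold symSum
    rw [Finset.sum_mul]
    refine Finset.sum_congr rfl fun σ _ => ?_
    rw [map_mul, ← symAct_eq, hB]
  rw [this, symSum_sum_act _ _ (exists_permVar_add k l), card_symGroup]

theorem symSum_mul_shift_of_fixed (k l : ZMod n → ℕ) (A B : RatFun (Var n))
    (hB : ∀ σ : SymGroup l, act (shiftPerm k (permVar l σ)) B = B) :
    symSum (k + l) (shift k (symSum l A) * B)
      = (multiFactorial l : ℂ) • symSum (k + l) (shift k A * B) := by
  have : shift k (symSum l A) * B
      = ∑ σ : SymGroup l, act (shiftPerm k (permVar l σ)) (shift k A * B) := by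
    unfold symSum
    rw [map_sum, Finset.sum_mul]
    refine Finset.sum_congr rfl fun σ _ => ?_
    rw [map_mul, hB, symAct_eq, shift_act]
  rw [this, symSum_sum_act _ _ (exists_shiftPerm k l), card_symGroup]

theorem star_assoc (q d : ℂˣ) (k l m : ZMod n → ℕ) (F G H : RatFun (Var n))
    (hF : ∀ τ : Equiv.Perm (Var n), (∀ v ∈ varSet k, τ v = v) → act τ F = F) :
    star q d (k + l) m (star q d k l F G) H = star q d k (l + m) F (star q d l m G H) := by
  have h1 : ∀ σ : SymGroup (k + l),
      symAct (k + l) σ (shift (k + l) H * zetaProd q d (k + l) m)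
        = shift (k + l) H * zetaProd q d (k + l) m := by
    intro σ
    rw [map_mul]
    congr 1
    · have : (symAct (k + l) σ).comp (shift (k + l)) = shift (k + l) := by
        apply ratFun_hom_ext
        intro v
        simp only [AlgHom.comp_apply, shift_rvar, symAct_eq, act_rvar]
        rw [permVar_of_le]
        simp
      exact DFunLike.congr_fun this H
    · rw [symAct_eq]
      have hb : ∀ v : Var n, (permVar (k + l) σ v) ∈ block 0 (k + l) ↔ v ∈ block 0 (k + l) := by
        intro v
        have : ∀ v : Var n, v ∈ block 0 (k + l) ↔ v ∈ varSet (k + l) := by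
          intro v; simp [mem_block, varSet]
        rw [this, this]
        refine ⟨fun h => ?_, permVar_mem _ _⟩
        by_contra h'
        rw [permVar_of_le _ _ _ (not_lt.1 h')] at h
        exact h' h
      refine map_zetaProd _ _ _ _ _ (fun v => rfl) hb ?_
      intro v
      by_cases hv : (k + l) v.1 ≤ v.2
      · rw [permVar_of_le _ _ _ hv]
      · have h2 : v ∈ varSet (k + l) := not_le.1 hv
        have h3 := permVar_mem _ σ h2
        simp only [varSet, Set.mem_ofPred_eq] at h2 h3
        simp only [mem_block]
        omega
  have h2 : ∀ σ : SymGroup (l + m), act (shiftPerm k (permVar (l + m) σ))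
      (F * zetaProd q d k (l + m)) = F * zetaProd q d k (l + m) := by
    intro σ
    rw [map_mul, hF _ (fun v hv => shiftPerm_of_lt _ _ _ hv)]
    congr 1
    refine map_zetaProd _ _ _ _ _ ?_ ?_ ?_
    · intro v
      rcases le_or_eq_shift k v with h | ⟨u, rfl⟩
      · rw [shiftPerm_of_lt _ _ _ h]
      · rw [shiftPerm_shift]; simp
    · intro v
      rcases le_or_eq_shift k v with h | ⟨u, rfl⟩
      · rw [shiftPerm_of_lt _ _ _ h]
      · rw [shiftPerm_shift]; simp [mem_block]
    · intro v
      rcases le_or_eq_shift k v with h | ⟨u, rfl⟩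
      · rw [shiftPerm_of_lt _ _ _ h]
      · rw [shiftPerm_shift, ← add_zero k, add_zero k, ← add_zero k]
        by_cases hu : u ∈ varSet (l + m)
        · have h3 := permVar_mem _ σ hu
          simp only [varSet, Set.mem_ofPred_eq] at hu h3
          simp only [mem_block, Pi.add_apply, Pi.zero_apply] at hu h3 ⊢
          omega
        · rw [permVar_of_le _ _ _ (not_lt.1 hu)]
  have e1 : star q d (k + l) m (star q d k l F G) H
      = ((multiFactorial k : ℂ) * multiFactorial l * multiFactorial m)⁻¹ •
        symSum (k + l + m) (F * shift k G * shift (k + l) H *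
          (zetaProd q d k l * zetaProd q d (k + l) m)) := by
    unfold star
    rw [smul_mul_assoc, smul_mul_assoc, symSum_smul, mul_assoc (symSum _ _),
      symSum_mul_of_fixed _ _ _ _ h1, smul_smul, smul_smul]
    refine congrArg₂ (· • ·) ?_ (congrArg (symSum _) ?_)
    · have := multiFactorial_ne_zero (k + l)
      have := multiFactorial_ne_zero k
      have := multiFactorial_ne_zero l
      have := multiFactorial_ne_zero m
      field_simp
    · ring
  have e2 : star q d k (l + m) F (star q d l m G H)
      = ((multiFactorial k : ℂ) * multiFactorial l * multiFactorial m)⁻¹ •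
        symSum (k + (l + m)) (F * shift k G * shift (k + l) H *
          (shift k (zetaProd q d l m) * zetaProd q d k (l + m))) := by
    unfold star
    rw [map_smul, mul_smul_comm, smul_mul_assoc, symSum_smul,
      mul_comm F (shift k _), mul_assoc (shift k _),
      symSum_mul_shift_of_fixed _ _ _ _ h2, smul_smul, smul_smul]
    refine congrArg₂ (· • ·) ?_ (congrArg (symSum _) ?_)
    · have := multiFactorial_ne_zero (l + m)
      have := multiFactorial_ne_zero k
      have := multiFactorial_ne_zero l
      have := multiFactorial_ne_zero m
      field_simp
    · rw [map_mul, map_mul, shift_shift]; ring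
  rw [e1, e2, zetaProd_cocycle, add_assoc]


/-! closure -/

theorem coe_block (k : ZMod n → ℕ) : ((block 0 k : Finset (Var n)) : Set (Var n)) = varSet k := by
  ext v
  simp [mem_block, varSet]

theorem exists_monomial {X : Type} {s : Finset X} {F : RatFun X} (hF : F ∈ Laurent (s : Set X)) :
    ∃ (e : ℕ) (P : MvPolynomial X ℂ), P ∈ MvPolynomial.supported ℂ (s : Set X) ∧
      F * (∏ v ∈ s, rvar v) ^ e = algebraMap _ (RatFun X) P := by
  classical
  have hX : ∀ v ∈ s, (MvPolynomial.X v : MvPolynomial X ℂ) ∈ MvPolynomial.supported ℂ (s : Set X) :=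
    fun v hv => MvPolynomial.X_mem_supported.2 hv
  have hM : algebraMap _ (RatFun X) (∏ v ∈ s, (MvPolynomial.X v : MvPolynomial X ℂ))
      = ∏ v ∈ s, rvar v := by simp [rvar]
  have hM' : (∏ v ∈ s, (MvPolynomial.X v : MvPolynomial X ℂ))
      ∈ MvPolynomial.supported ℂ (s : Set X) := prod_mem hX
  induction hF using Algebra.adjoin_induction with
  | mem x hx =>
    rcases hx with ⟨v, hv, rfl⟩ | ⟨v, hv, rfl⟩
    · exact ⟨0, MvPolynomial.X v, hX v hv, by simp [rvar]⟩
    · refine ⟨1, ∏ u ∈ s.erase v, MvPolynomial.X u,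
        prod_mem fun u hu => hX u (Finset.mem_of_mem_erase hu), ?_⟩
      have hv' : v ∈ s := hv
      rw [← Finset.mul_prod_erase s _ hv', pow_one, inv_mul_cancel_left₀ (rvar_ne_zero v)]
      simp [rvar]
  | algebraMap r => exact ⟨0, algebraMap _ _ r, Subalgebra.algebraMap_mem _ _, by
      rw [pow_zero, mul_one]; exact IsScalarTower.algebraMap_apply ℂ _ _ r⟩
  | add x y _ _ hx hy =>
    obtain ⟨e, P, hP, h⟩ := hx
    obtain ⟨e', P', hP', h'⟩ := hy
    refine ⟨e + e', P * (∏ v ∈ s, MvPolynomial.X v) ^ e' + P' * (∏ v ∈ s, MvPolynomial.X v) ^ e,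
      add_mem (mul_mem hP (pow_mem hM' _)) (mul_mem hP' (pow_mem hM' _)), ?_⟩
    rw [map_add, map_mul, map_mul, map_pow, map_pow, ← h, ← h', hM]
    ring
  | mul x y _ _ hx hy =>
    obtain ⟨e, P, hP, h⟩ := hx
    obtain ⟨e', P', hP', h'⟩ := hy
    refine ⟨e + e', P * P', mul_mem hP hP', ?_⟩
    rw [map_mul, ← h, ← h']
    ring

theorem algebraMap_mem_Laurent {X : Type} {s : Set X} {P : MvPolynomial X ℂ}
    (hP : P ∈ MvPolynomial.supported ℂ s) : algebraMap _ (RatFun X) P ∈ Laurent s := by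
  have : MvPolynomial.supported ℂ s ≤
      (Laurent s).comap (Algebra.algHom ℂ (MvPolynomial X ℂ) (RatFun X)) := by
    refine Algebra.adjoin_le ?_
    rintro _ ⟨v, hv, rfl⟩
    exact rvar_mem_Laurent hv
  exact this hP

/-- The product of the Vandermonde determinants of the groups of variables. -/
def vand (k : ZMod n → ℕ) : RatFun (Var n) :=
  ∏ i, (Matrix.vandermonde fun r : Fin (k i) => xv i r).det

theorem symAct_vand (k : ZMod n → ℕ) (σ : SymGroup k) :
    symAct k σ (vand k) = (∏ i, ((Equiv.Perm.sign (σ i) : ℤ) : RatFun (Var n))) * vand k := by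
  unfold vand
  rw [map_prod, ← Finset.prod_mul_distrib]
  refine Finset.prod_congr rfl fun i _ => ?_
  rw [AlgHom.map_det, ← Matrix.det_permute]
  congr 1
  ext r s
  simp only [AlgHom.mapMatrix_apply, Matrix.map_apply, Matrix.vandermonde_apply, map_pow,
    Matrix.submatrix_apply, id, xv, symAct_eq, act_rvar, permVar_lt]

theorem act_eq_algebraMap_rename (τ : Equiv.Perm (Var n)) (P : MvPolynomial (Var n) ℂ) :
    act τ (algebraMap _ (RatFun (Var n)) P)
      = algebraMap _ (RatFun (Var n)) (MvPolynomial.rename τ P) := by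
  have : (act τ).comp (Algebra.algHom ℂ (MvPolynomial (Var n) ℂ) (RatFun (Var n)))
      = (Algebra.algHom ℂ (MvPolynomial (Var n) ℂ) (RatFun (Var n))).comp
        (MvPolynomial.rename τ) := by
    apply MvPolynomial.algHom_ext
    intro v
    rw [AlgHom.comp_apply, AlgHom.comp_apply, MvPolynomial.rename_X]
    exact act_rvar τ v
  exact DFunLike.congr_fun this P

theorem symAct_prod_rvar (k : ZMod n → ℕ) (σ : SymGroup k) :
    symAct k σ (∏ v ∈ block 0 k, rvar v) = ∏ v ∈ block 0 k, rvar v := by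
  rw [map_prod]
  have hb : ∀ v : Var n, (permVar k σ v) ∈ block 0 k ↔ v ∈ block 0 k := by
    intro v
    rw [← Finset.mem_coe, ← Finset.mem_coe, coe_block]
    refine ⟨fun h => ?_, permVar_mem _ _⟩
    by_contra h'
    rw [permVar_of_le _ _ _ (not_lt.1 h')] at h
    exact h' h
  exact Finset.prod_equiv (permVar k σ) (fun v => (hb v).symm) fun v _ => by
    rw [symAct_eq, act_rvar]

/-- The pairs of variables of the same colour. -/
def vandPairs (k : ZMod n → ℕ) : Finset ((t : (i : ZMod n) × Fin (k i)) × Fin (k t.1)) :=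
  Finset.univ.sigma fun t => Finset.Ioi t.2

theorem mem_vandPairs (k : ZMod n → ℕ) (i : ZMod n) (r s : Fin (k i)) :
    (⟨⟨i, r⟩, s⟩ : (t : (i : ZMod n) × Fin (k i)) × Fin (k t.1)) ∈ vandPairs k ↔ r < s := by
  simp [vandPairs]

theorem vand_eq_pairs (k : ZMod n → ℕ) : vand k =
    ∏ t ∈ vandPairs k,
      (xv t.1.1 (t.2 : Fin (k t.1.1)) - xv t.1.1 t.1.2) := by
  rw [vandPairs, Finset.prod_sigma, ← Finset.univ_sigma_univ, Finset.prod_sigma]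
  simp only [vand, Matrix.det_vandermonde]

theorem vand_ne_zero (k : ZMod n → ℕ) : vand k ≠ 0 := by
  unfold vand
  rw [Finset.prod_ne_zero_iff]
  intro i _
  rw [Matrix.det_vandermonde_ne_zero_iff]
  intro r s h
  have := rvar_injective h
  simpa [Fin.ext_iff] using this

theorem rename_update_eq_zero (k : ZMod n → ℕ) (G : RatFun (Var n))
    (hG : ∀ σ : SymGroup k, symAct k σ G = G) (e : ℕ) (P : MvPolynomial (Var n) ℂ)
    (hP : G * vand k * (∏ v ∈ block 0 k, rvar v) ^ e = algebraMap _ (RatFun (Var n)) P)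
    (i : ZMod n) (r s : Fin (k i)) (h1 : r < s) :
    MvPolynomial.rename (Function.update id (⟨i, s⟩ : Var n) ⟨i, r⟩) P = 0 := by
  classical
  set σ : SymGroup k := Pi.mulSingle i (Equiv.swap r s) with hσ
  have hσj : σ i = Equiv.swap r s := by rw [hσ, Pi.mulSingle_eq_same]
  have hsign : (∏ j, ((Equiv.Perm.sign (σ j) : ℤ) : RatFun (Var n))) = -1 := by
    rw [Finset.prod_eq_single i]
    · rw [hσ, Pi.mulSingle_eq_same, Equiv.Perm.sign_swap h1.ne]; simp
    · intro j _ hj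
      rw [hσ, Pi.mulSingle_eq_of_ne hj]; simp
    · simp
  have h2 := congrArg (symAct k σ) hP
  rw [map_mul, map_mul, map_pow, hG, symAct_prod_rvar, symAct_vand, hsign, symAct_eq,
    act_eq_algebraMap_rename] at h2
  have h3 : MvPolynomial.rename (permVar k σ) P = -P := by
    apply IsFractionRing.injective (MvPolynomial (Var n) ℂ) (RatFun (Var n))
    rw [← h2, map_neg, ← hP]; ring
  have h4 : (Function.update id (⟨i, s⟩ : Var n) ⟨i, r⟩) ∘ (permVar k σ)
      = Function.update id (⟨i, s⟩ : Var n) ⟨i, r⟩ := by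
    funext v
    obtain ⟨j, t⟩ := v
    by_cases hj : j = i
    · subst hj
      by_cases htk : t < k j
      · have := permVar_lt k σ j ⟨t, htk⟩
        simp only [hσj] at this
        rw [Function.comp_apply, this]
        by_cases e1 : t = r
        · subst e1
          have e3 : (⟨(r : ℕ), htk⟩ : Fin (k j)) = r := rfl
          rw [e3, Equiv.swap_apply_left]
          rw [Function.update_self, Function.update_of_ne]
          · rfl
          · intro h; simp at h; omega
        · by_cases e2 : t = s
          · subst e2
            have e3 : (⟨(s : ℕ), htk⟩ : Fin (k j)) = s := rfl
            rw [e3, Equiv.swap_apply_right]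
            rw [Function.update_self, Function.update_of_ne]
            · rfl
            · intro h; simp at h; omega
          · rw [Equiv.swap_apply_of_ne_of_ne]
            · intro h; apply e1; rw [← h]
            · intro h; apply e2; rw [← h]
      · rw [Function.comp_apply, permVar_of_le _ _ _ (not_lt.1 htk)]
    · have : permVar k σ ⟨j, t⟩ = ⟨j, t⟩ := by
        by_cases htk : t < k j
        · have := permVar_lt k σ j ⟨t, htk⟩
          simp only at this
          rw [this, hσ, Pi.mulSingle_eq_of_ne hj]; rfl
        · rw [permVar_of_le _ _ _ (not_lt.1 htk)]
      rw [Function.comp_apply, this]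
  have h5 := congrArg (MvPolynomial.rename (Function.update id (⟨i, s⟩ : Var n) ⟨i, r⟩)) h3
  rw [MvPolynomial.rename_rename, h4, map_neg] at h5
  exact self_eq_neg.1 h5

theorem vandPairs_ne (k : ZMod n → ℕ) (i : ZMod n) (r s : Fin (k i)) (i' : ZMod n)
    (r' s' : Fin (k i')) (h1 : r < s) (h1' : r' < s')
    (hne : (⟨⟨i, r⟩, s⟩ : (t : (i : ZMod n) × Fin (k i)) × Fin (k t.1)) ≠ ⟨⟨i', r'⟩, s'⟩) :
    ¬ ((⟨i, s⟩ : Var n) = ⟨i', s'⟩ ∧ (⟨i, r⟩ : Var n) = ⟨i', r'⟩) ∧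
      ¬ ((⟨i, s⟩ : Var n) = ⟨i', r'⟩ ∧ (⟨i, r⟩ : Var n) = ⟨i', s'⟩) := by
  rw [Fin.lt_def] at h1 h1'
  constructor
  · rintro ⟨ha, hb⟩
    obtain ⟨rfl, ha⟩ := Sigma.mk.inj_iff.1 ha
    obtain ⟨-, hb⟩ := Sigma.mk.inj_iff.1 hb
    obtain rfl := Fin.ext (eq_of_heq ha)
    obtain rfl := Fin.ext (eq_of_heq hb)
    exact hne rfl
  · rintro ⟨ha, hb⟩
    obtain ⟨rfl, ha⟩ := Sigma.mk.inj_iff.1 ha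
    obtain ⟨-, hb⟩ := Sigma.mk.inj_iff.1 hb
    have ha := eq_of_heq ha
    have hb := eq_of_heq hb
    omega

/-- The product of the Vandermonde determinants, as a polynomial. -/
def vandPoly (k : ZMod n → ℕ) : MvPolynomial (Var n) ℂ :=
  ∏ t ∈ vandPairs k, (MvPolynomial.X ⟨t.1.1, (t.2 : ℕ)⟩ - MvPolynomial.X ⟨t.1.1, (t.1.2 : ℕ)⟩)

theorem vandPoly_dvd (k : ZMod n → ℕ) (P : MvPolynomial (Var n) ℂ)
    (hP : ∀ (i : ZMod n) (r s : Fin (k i)), r < s →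
      MvPolynomial.rename (Function.update id (⟨i, s⟩ : Var n) ⟨i, r⟩) P = 0) :
    vandPoly k ∣ P := by
  refine prod_X_sub_X_dvd (vandPairs k) (fun t => (⟨t.1.1, (t.2 : ℕ)⟩ : Var n))
      (fun t => (⟨t.1.1, (t.1.2 : ℕ)⟩ : Var n)) ?_ ?_ P ?_
  · intro t ht heq
    have h1 : t.1.2 < t.2 := (mem_vandPairs k t.1.1 t.1.2 t.2).1 ht
    have h2 := eq_of_heq (Sigma.mk.inj_iff.1 heq).2
    rw [Fin.lt_def] at h1
    exact h1.ne' h2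
  · intro t ht t' ht' hne
    exact vandPairs_ne k t.1.1 t.1.2 t.2 t'.1.1 t'.1.2 t'.2
      ((mem_vandPairs k t.1.1 t.1.2 t.2).1 ht) ((mem_vandPairs k t'.1.1 t'.1.2 t'.2).1 ht') hne
  · intro t ht
    exact hP t.1.1 t.1.2 t.2 ((mem_vandPairs k t.1.1 t.1.2 t.2).1 ht)

theorem algebraMap_vandPoly (k : ZMod n → ℕ) :
    algebraMap _ (RatFun (Var n)) (vandPoly k) = vand k := by
  rw [vand_eq_pairs, vandPoly, map_prod]
  refine Finset.prod_congr rfl fun t _ => ?_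
  rw [map_sub]
  rfl

theorem mem_supported_of_mul {X : Type} (s : Set X) (W Q : MvPolynomial X ℂ) (hW0 : W ≠ 0)
    (hW : W ∈ MvPolynomial.supported ℂ s) (h : W * Q ∈ MvPolynomial.supported ℂ s) :
    Q ∈ MvPolynomial.supported ℂ s := by
  classical
  let ρ : MvPolynomial X ℂ →ₐ[ℂ] MvPolynomial X ℂ :=
    MvPolynomial.aeval fun v => if v ∈ s then MvPolynomial.X v else 1
  have hρ : ∀ p ∈ MvPolynomial.supported ℂ s, ρ p = p := by
    intro p hp
    have : MvPolynomial.supported ℂ s ≤ AlgHom.equalizer ρ (AlgHom.id ℂ _) := by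
      refine Algebra.adjoin_le ?_
      rintro _ ⟨v, hv, rfl⟩
      simp [ρ, hv]
    exact this hp
  have hρ' : ∀ p, ρ p ∈ MvPolynomial.supported ℂ s := by
    intro p
    induction p using MvPolynomial.induction_on with
    | C a =>
      rw [MvPolynomial.algHom_C]
      exact Subalgebra.algebraMap_mem _ a
    | add p q hp hq => rw [map_add]; exact add_mem hp hq
    | mul_X p v hp =>
      rw [map_mul]
      refine mul_mem hp ?_
      simp only [ρ, MvPolynomial.aeval_X]
      split_ifs with hv
      · exact MvPolynomial.X_mem_supported.2 hv
      · exact one_mem _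
  have := hρ _ h
  rw [map_mul, hρ _ hW] at this
  rw [← mul_left_cancel₀ hW0 this]
  exact hρ' Q

theorem mem_Laurent_of_mul_vand (k : ZMod n → ℕ) (G : RatFun (Var n))
    (hG : ∀ σ : SymGroup k, symAct k σ G = G) (h : G * vand k ∈ Laurent (varSet k)) :
    G ∈ Laurent (varSet k) := by
  rw [← coe_block] at h ⊢
  obtain ⟨e, P, hPs, hP⟩ := exists_monomial h
  obtain ⟨Q, rfl⟩ := vandPoly_dvd k P (rename_update_eq_zero k G hG e P hP)
  have hW0 : vandPoly k ≠ 0 := by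
    intro h0
    apply vand_ne_zero k
    rw [← algebraMap_vandPoly, h0, map_zero]
  have hQ : Q ∈ MvPolynomial.supported ℂ ((block 0 k : Finset (Var n)) : Set (Var n)) := by
    refine mem_supported_of_mul _ _ _ hW0 ?_ hPs
    refine prod_mem fun t _ => ?_
    refine sub_mem (MvPolynomial.X_mem_supported.2 ?_) (MvPolynomial.X_mem_supported.2 ?_)
    · simp [mem_block]
    · simp [mem_block]
  have hM0 : (∏ v ∈ block 0 k, rvar v : RatFun (Var n)) ^ e ≠ 0 :=
    pow_ne_zero _ (Finset.prod_ne_zero_iff.2 fun v _ => rvar_ne_zero v)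
  have hGQ : G * (∏ v ∈ block 0 k, rvar v) ^ e = algebraMap _ _ Q := by
    apply mul_left_cancel₀ (vand_ne_zero k)
    rw [← algebraMap_vandPoly, ← map_mul, ← hP, algebraMap_vandPoly]; ring
  have : G = algebraMap _ (RatFun (Var n)) Q * (∏ v ∈ block 0 k, (rvar v)⁻¹) ^ e := by
    rw [← hGQ, Finset.prod_inv_distrib, inv_pow, mul_inv_cancel_right₀ hM0]
  rw [this]
  exact mul_mem (algebraMap_mem_Laurent hQ)
    (pow_mem (prod_mem fun v hv => rvar_inv_mem_Laurent hv) _)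


/-! graded components -/

/-- The denominator `∏_i ∏_{r, s} (x_{i,r} - x_{i+1,s})`. -/
def poleDen (k : ZMod n → ℕ) : RatFun (Var n) :=
  ∏ i, ∏ r ∈ Finset.range (k i), ∏ s ∈ Finset.range (k (i + 1)), (xv i r - xv (i + 1) s)

/-- One factor of the denominator. -/
def poleFactor (u v : Var n) : RatFun (Var n) := if v.1 = u.1 + 1 then rvar u - rvar v else 1

theorem poleDen_eq (k : ZMod n → ℕ) :
    poleDen k = ∏ u ∈ block 0 k, ∏ v ∈ block 0 k, poleFactor u v := by
  unfold poleDen block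
  simp only [Finset.prod_sigma, Pi.zero_apply, zero_add, ← Finset.range_eq_Ico, poleFactor, xv]
  refine Finset.prod_congr rfl fun i _ => Finset.prod_congr rfl fun r _ => ?_
  rw [Finset.prod_eq_single (i + 1)]
  · simp
  · intro j _ hj
    simp [hj]
  · simp

/-- One factor of the Vandermonde product. -/
def vandFactor (u v : Var n) : RatFun (Var n) :=
  if v.1 = u.1 ∧ u.2 < v.2 then rvar v - rvar u else 1

theorem vand_eq (k : ZMod n → ℕ) :
    vand k = ∏ u ∈ block 0 k, ∏ v ∈ block 0 k, vandFactor u v := by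
  unfold vand block
  simp only [Finset.prod_sigma, Pi.zero_apply, zero_add, ← Finset.range_eq_Ico, vandFactor, xv,
    Matrix.det_vandermonde]
  refine Finset.prod_congr rfl fun i _ => ?_
  rw [Finset.prod_range]
  refine Finset.prod_congr rfl fun r _ => ?_
  rw [Finset.prod_eq_single i]
  · rw [Finset.prod_range]
    simp only [true_and, Fin.val_fin_lt]
    rw [← Finset.prod_filter]
    refine Finset.prod_congr ?_ fun _ _ => rfl
    ext s; simp
  · intro j _ hj
    simp [hj]
  · simp

theorem act_poleFactor (τ : Equiv.Perm (Var n)) (h1 : ∀ v, (τ v).1 = v.1) (u v : Var n) :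
    act τ (poleFactor u v) = poleFactor (τ u) (τ v) := by
  unfold poleFactor
  rw [h1, h1]
  split_ifs <;> simp

theorem permVar_mem_block (k : ZMod n → ℕ) (σ : SymGroup k) (v : Var n) :
    (permVar k σ v) ∈ block 0 k ↔ v ∈ block 0 k := by
  rw [← Finset.mem_coe, ← Finset.mem_coe, coe_block]
  refine ⟨fun h => ?_, permVar_mem _ _⟩
  by_contra h'
  rw [permVar_of_le _ _ _ (not_lt.1 h')] at h
  exact h' h

theorem symAct_poleDen (k : ZMod n → ℕ) (σ : SymGroup k) : symAct k σ (poleDen k) = poleDen k := by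
  rw [poleDen_eq, symAct_eq]
  simp only [map_prod]
  refine Finset.prod_equiv (permVar k σ) (fun v => (permVar_mem_block k σ v).symm) fun u _ => ?_
  refine Finset.prod_equiv (permVar k σ) (fun v => (permVar_mem_block k σ v).symm) fun v _ => ?_
  exact act_poleFactor _ (fun _ => rfl) _ _

theorem poleDen_mem (k : ZMod n → ℕ) : poleDen k ∈ Laurent (varSet k) := by
  rw [poleDen_eq, ← coe_block]
  refine prod_mem fun u hu => prod_mem fun v hv => ?_
  unfold poleFactor
  split_ifs
  · exact sub_mem (rvar_mem_Laurent hu) (rvar_mem_Laurent hv)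
  · exact one_mem _

theorem add_one_ne [Fact (3 ≤ n)] (i : ZMod n) : i + 1 ≠ i := by
  have : Fact (1 < n) := ⟨lt_of_lt_of_le (by norm_num) (Fact.out : 3 ≤ n)⟩
  simp

theorem poleDen_ne_zero [Fact (3 ≤ n)] (k : ZMod n → ℕ) : poleDen k ≠ 0 := by
  unfold poleDen
  refine Finset.prod_ne_zero_iff.2 fun i _ => Finset.prod_ne_zero_iff.2 fun r _ =>
    Finset.prod_ne_zero_iff.2 fun s _ => ?_
  rw [sub_ne_zero]
  intro h
  exact add_one_ne i (congrArg Sigma.fst (rvar_injective h)).symm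

/-- The graded component of degree `k` of the big shuffle algebra: fractions of symmetric Laurent
polynomials by `∏ (x_{i,r} - x_{i+1,s})`. -/
def shuffleComp (k : ZMod n → ℕ) : Submodule ℂ (RatFun (Var n)) where
  carrier := {F | ∃ f ∈ Laurent (varSet k), (∀ σ : SymGroup k, symAct k σ f = f) ∧
    F = f / poleDen k}
  add_mem' := by
    rintro _ _ ⟨f, hf, hf', rfl⟩ ⟨g, hg, hg', rfl⟩
    exact ⟨f + g, add_mem hf hg, fun σ => by rw [map_add, hf', hg'], (add_div _ _ _).symm⟩
  zero_mem' := ⟨0, zero_mem _, fun _ => map_zero _, (zero_div _).symm⟩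
  smul_mem' := by
    rintro c _ ⟨f, hf, hf', rfl⟩
    exact ⟨c • f, Subalgebra.smul_mem _ hf _, fun σ => by rw [map_smul, hf'],
      (smul_div_assoc _ _ _).symm⟩

theorem act_of_mem {k : ZMod n → ℕ} {F : RatFun (Var n)} (hF : F ∈ shuffleComp k)
    (τ : Equiv.Perm (Var n)) (hτ : ∀ v ∈ varSet k, τ v = v) : act τ F = F := by
  obtain ⟨f, hf, -, rfl⟩ := hF
  have : ∀ g ∈ Laurent (varSet k), act τ g = g := by
    intro g hg
    have := relabel_eq_of_eqOn τ id τ.injective Function.injective_id hτ hg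
    rw [relabel_id] at this
    exact this
  rw [map_div₀, this _ hf, this _ (poleDen_mem k)]

theorem symAct_of_mem {k : ZMod n → ℕ} {F : RatFun (Var n)} (hF : F ∈ shuffleComp k)
    (σ : SymGroup k) : symAct k σ F = F := by
  obtain ⟨f, hf, hf', rfl⟩ := hF
  rw [map_div₀, hf', symAct_poleDen]

theorem mul_poleDen_mem {k : ZMod n → ℕ} {F : RatFun (Var n)} (hF : F ∈ shuffleComp k) :
    F * poleDen k ∈ Laurent (varSet k) := by
  obtain ⟨f, hf, hf', rfl⟩ := hF
  by_cases h : poleDen k = 0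
  · simp [h]
  · rwa [div_mul_cancel₀ _ h]

theorem prod_block_split (k l : ZMod n → ℕ) (g : Var n → Var n → RatFun (Var n)) :
    ∏ u ∈ block 0 (k + l), ∏ v ∈ block 0 (k + l), g u v =
      (∏ u ∈ block 0 k, ∏ v ∈ block 0 k, g u v) * (∏ u ∈ block k l, ∏ v ∈ block k l, g u v) *
      ((∏ u ∈ block 0 k, ∏ v ∈ block k l, (g u v * g v u))) := by
  have e : ∏ u ∈ block k l, ∏ v ∈ block 0 k, g u v = ∏ u ∈ block 0 k, ∏ v ∈ block k l, g v u :=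
    Finset.prod_comm
  simp only [prod_block_add 0 k l, zero_add, Finset.prod_mul_distrib, e]
  ring

theorem shift_poleDen (k l : ZMod n → ℕ) :
    shift k (poleDen l) = ∏ u ∈ block k l, ∏ v ∈ block k l, poleFactor u v := by
  have h : ∀ u v : Var n, shift k (poleFactor u v)
      = poleFactor ⟨u.1, k u.1 + u.2⟩ ⟨v.1, k v.1 + v.2⟩ := by
    intro u v
    unfold poleFactor
    split_ifs <;> simp
  rw [poleDen_eq]
  simp only [map_prod, h]
  refine (prod_block_shift k 0 l
    (fun u => ∏ v ∈ block 0 l, poleFactor u ⟨v.1, k v.1 + v.2⟩)).trans ?_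
  rw [add_zero]
  refine Finset.prod_congr rfl fun u _ => ?_
  refine (prod_block_shift k 0 l (fun v => poleFactor u v)).trans ?_
  rw [add_zero]

theorem cross_factor_mem (q d : ℂˣ) {s : Set (Var n)} {u v : Var n} (hu : u ∈ s) (hv : v ∈ s)
    (huv : u.1 = v.1 → u.2 < v.2) :
    zeta q d u.1 v.1 (rvar u) (rvar v) * (poleFactor u v * poleFactor v u)
      * (vandFactor u v * vandFactor v u) ∈ Laurent s := by
  have hu' := rvar_mem_Laurent hu
  have hv' := rvar_mem_Laurent hv
  have hp : ∀ a ∈ s, ∀ b ∈ s, poleFactor a b ∈ Laurent s := by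
    intro a ha b hb
    unfold poleFactor
    split_ifs
    · exact sub_mem (rvar_mem_Laurent ha) (rvar_mem_Laurent hb)
    · exact one_mem _
  have hw : ∀ a ∈ s, ∀ b ∈ s, vandFactor a b ∈ Laurent s := by
    intro a ha b hb
    unfold vandFactor
    split_ifs
    · exact sub_mem (rvar_mem_Laurent hb) (rvar_mem_Laurent ha)
    · exact one_mem _
  have hne : rvar u - rvar v ≠ 0 := by
    rw [sub_ne_zero]
    intro h
    have := rvar_injective h
    subst this
    exact lt_irrefl _ (huv rfl)
  have hsm : ∀ c c' : ℂ, c • rvar u - c' • rvar v ∈ Laurent s := fun c c' =>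
    sub_mem (Subalgebra.smul_mem _ hu' _) (Subalgebra.smul_mem _ hv' _)
  have hsm' : ∀ c' : ℂ, rvar u - c' • rvar v ∈ Laurent s := fun c' =>
    sub_mem hu' (Subalgebra.smul_mem _ hv' _)
  unfold zeta
  split_ifs with h1 h2 h3
  · have : vandFactor u v = -(rvar u - rvar v) := by
      unfold vandFactor; rw [if_pos ⟨h1, huv h1.symm⟩]; ring
    rw [this]
    have e : ∀ A B C : RatFun (Var n), A / (rvar u - rvar v) * B * (-(rvar u - rvar v) * C)
        = -(A * B * C) := by intro A B C; field_simp
    rw [e]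
    exact neg_mem (mul_mem (mul_mem (hsm' _) (mul_mem (hp _ hu _ hv) (hp _ hv _ hu))) (hw _ hv _ hu))
  · have : poleFactor u v = rvar u - rvar v := by
      unfold poleFactor; rw [if_pos h2]
    rw [this]
    have e : ∀ A B C : RatFun (Var n), A / (rvar u - rvar v) * ((rvar u - rvar v) * B) * C
        = A * B * C := by intro A B C; field_simp
    rw [e]
    exact mul_mem (mul_mem (hsm _ _) (hp _ hv _ hu)) (mul_mem (hw _ hu _ hv) (hw _ hv _ hu))
  · have : poleFactor v u = -(rvar u - rvar v) := by
      unfold poleFactor; rw [if_pos (by rw [h3]; ring)]; ring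
    rw [this]
    have e : ∀ A B C : RatFun (Var n), A / (rvar u - rvar v) * (B * -(rvar u - rvar v)) * C
        = -(A * B * C) := by intro A B C; field_simp
    rw [e]
    exact neg_mem (mul_mem (mul_mem (hsm' _) (hp _ hu _ hv))
      (mul_mem (hw _ hu _ hv) (hw _ hv _ hu)))
  · rw [one_mul]
    exact mul_mem (mul_mem (hp _ hu _ hv) (hp _ hv _ hu)) (mul_mem (hw _ hu _ hv) (hw _ hv _ hu))

theorem shift_mem_Laurent (k l : ZMod n → ℕ) {F : RatFun (Var n)}
    (hF : F ∈ Laurent (varSet l)) : shift k F ∈ Laurent (varSet (k + l)) := by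
  refine relabel_mem_Laurent _ _ ?_ hF
  intro v hv
  simpa [varSet] using hv

theorem star_term_mem (q d : ℂˣ) {k l : ZMod n → ℕ} {F G : RatFun (Var n)}
    (hF : F ∈ shuffleComp k) (hG : G ∈ shuffleComp l) :
    F * shift k G * zetaProd q d k l * poleDen (k + l) * vand (k + l)
      ∈ Laurent (varSet (k + l)) := by
  have h1 : F * poleDen k ∈ Laurent (varSet (k + l)) :=
    Laurent_mono (fun v hv => lt_of_lt_of_le hv (Nat.le_add_right _ _)) (mul_poleDen_mem hF)
  have h2 := shift_mem_Laurent k l (mul_poleDen_mem hG)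
  rw [map_mul, shift_poleDen] at h2
  have hA : ∀ u ∈ block 0 k, u ∈ varSet (k + l) := by
    intro u hu
    simp only [mem_block, Pi.zero_apply, zero_add] at hu
    exact lt_of_lt_of_le hu.2 (Nat.le_add_right _ _)
  have hB : ∀ u ∈ block k l, u ∈ varSet (k + l) := by
    intro u hu
    simp only [mem_block] at hu
    exact hu.2
  have hw : ∀ a ∈ varSet (k + l), ∀ b ∈ varSet (k + l),
      vandFactor a b ∈ Laurent (varSet (k + l)) := by
    intro a ha b hb
    unfold vandFactor
    split_ifs
    · exact sub_mem (rvar_mem_Laurent hb) (rvar_mem_Laurent ha)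
    · exact one_mem _
  have h3 : (∏ u ∈ block 0 k, ∏ v ∈ block k l,
      (zeta q d u.1 v.1 (rvar u) (rvar v) * (poleFactor u v * poleFactor v u)
      * (vandFactor u v * vandFactor v u))) ∈ Laurent (varSet (k + l)) := by
    refine prod_mem fun u hu => prod_mem fun v hv => ?_
    refine cross_factor_mem q d (hA u hu) (hB v hv) ?_
    intro h
    simp only [mem_block, Pi.zero_apply, zero_add] at hu hv
    rw [← h] at hv
    omega
  have h4 : (∏ u ∈ block 0 k, ∏ v ∈ block 0 k, vandFactor u v) ∈ Laurent (varSet (k + l)) :=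
    prod_mem fun u hu => prod_mem fun v hv => hw _ (hA u hu) _ (hA v hv)
  have h5 : (∏ u ∈ block k l, ∏ v ∈ block k l, vandFactor u v) ∈ Laurent (varSet (k + l)) :=
    prod_mem fun u hu => prod_mem fun v hv => hw _ (hB u hu) _ (hB v hv)
  rw [poleDen_eq] at h1
  have := mul_mem (mul_mem (mul_mem h1 h2) h3) (mul_mem h4 h5)
  rw [poleDen_eq, vand_eq, prod_block_split k l poleFactor, prod_block_split k l vandFactor,
    zetaProd_eq]
  convert this using 1
  simp only [Finset.prod_mul_distrib]
  ring

theorem star_mem [Fact (3 ≤ n)] (q d : ℂˣ) {k l : ZMod n → ℕ} {F G : RatFun (Var n)}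
    (hF : F ∈ shuffleComp k) (hG : G ∈ shuffleComp l) :
    star q d k l F G ∈ shuffleComp (k + l) := by
  have hsym : ∀ σ : SymGroup (k + l), symAct (k + l) σ (star q d k l F G) = star q d k l F G := by
    intro σ
    unfold star
    rw [map_smul, symAct_symSum]
  refine ⟨star q d k l F G * poleDen (k + l), ?_, ?_, ?_⟩
  · apply mem_Laurent_of_mul_vand
    · intro σ
      rw [map_mul, hsym, symAct_poleDen]
    · unfold star symSum
      rw [smul_mul_assoc, smul_mul_assoc, Finset.sum_mul, Finset.sum_mul]
      refine Subalgebra.smul_mem _ (sum_mem fun σ _ => ?_) _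
      have h := relabel_mem_Laurent (permVar (k + l) σ) (permVar (k + l) σ).injective
        (fun v hv => permVar_mem (k + l) σ hv) (star_term_mem q d hF hG)
      change symAct (k + l) σ _ ∈ _ at h
      rw [map_mul, map_mul, symAct_poleDen, symAct_vand] at h
      set c := ∏ i, ((Equiv.Perm.sign (σ i) : ℤ) : RatFun (Var n)) with hc
      have hcc : c * c = 1 := by
        rw [hc, ← Finset.prod_mul_distrib]
        refine Finset.prod_eq_one fun i _ => ?_
        rcases Int.units_eq_one_or (Equiv.Perm.sign (σ i)) with h | h <;> simp [h]
      have hcm : c ∈ Laurent (varSet (k + l)) := by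
        rw [hc]
        exact prod_mem fun i _ => intCast_mem _ _
      have h' := mul_mem hcm h
      convert h' using 1
      linear_combination (-(symAct (k + l) σ (F * shift k G * zetaProd q d k l)
        * poleDen (k + l) * vand (k + l))) * hcc
  · intro σ
    rw [map_mul, hsym, symAct_poleDen]
  · rw [mul_div_cancel_right₀ _ (poleDen_ne_zero _)]

theorem multiFactorial_zero : multiFactorial (0 : ZMod n → ℕ) = 1 := by
  simp [multiFactorial]

theorem poleDen_zero : poleDen (0 : ZMod n → ℕ) = 1 := by simp [poleDen]

theorem algebraMap_mem_shuffleComp (c : ℂ) :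
    algebraMap ℂ (RatFun (Var n)) c ∈ shuffleComp (0 : ZMod n → ℕ) :=
  ⟨_, Subalgebra.algebraMap_mem _ c, fun σ => AlgHom.commutes _ _, by rw [poleDen_zero, div_one]⟩

theorem star_algebraMap_left (q d : ℂˣ) (k : ZMod n → ℕ) (c : ℂ) {F : RatFun (Var n)}
    (hF : F ∈ shuffleComp k) : star q d 0 k (algebraMap ℂ _ c) F = c • F := by
  have h : zetaProd q d (0 : ZMod n → ℕ) k = 1 := by simp [zetaProd]
  unfold star
  rw [h, shift_zero, mul_one, zero_add, multiFactorial_zero, ← Algebra.smul_def, symSum_smul]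
  have : symSum k F = (multiFactorial k : ℂ) • F := by
    unfold symSum
    rw [Finset.sum_congr rfl fun σ _ => symAct_of_mem hF σ, Finset.sum_const, Finset.card_univ,
      card_symGroup, Nat.cast_smul_eq_nsmul]
  rw [this, smul_smul, smul_smul]
  congr 1
  have := multiFactorial_ne_zero k
  field_simp
  simp

theorem star_algebraMap_right (q d : ℂˣ) (k : ZMod n → ℕ) (c : ℂ) {F : RatFun (Var n)}
    (hF : F ∈ shuffleComp k) : star q d k 0 F (algebraMap ℂ _ c) = c • F := by
  have h : zetaProd q d k (0 : ZMod n → ℕ) = 1 := by simp [zetaProd]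
  unfold star
  rw [h, AlgHom.commutes, mul_one, add_zero, multiFactorial_zero, mul_comm F, ← Algebra.smul_def,
    symSum_smul]
  have : symSum k F = (multiFactorial k : ℂ) • F := by
    unfold symSum
    rw [Finset.sum_congr rfl fun σ _ => symAct_of_mem hF σ, Finset.sum_const, Finset.card_univ,
      card_symGroup, Nat.cast_smul_eq_nsmul]
  rw [this, smul_smul, smul_smul]
  congr 1
  have := multiFactorial_ne_zero k
  field_simp
  simp

theorem star_add_left (q d : ℂˣ) (k l : ZMod n → ℕ) (F F' G : RatFun (Var n)) :
    star q d k l (F + F') G = star q d k l F G + star q d k l F' G := by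
  unfold star
  rw [← smul_add, ← symSum_add, add_mul, add_mul]

theorem star_add_right (q d : ℂˣ) (k l : ZMod n → ℕ) (F G G' : RatFun (Var n)) :
    star q d k l F (G + G') = star q d k l F G + star q d k l F G' := by
  unfold star
  rw [← smul_add, ← symSum_add, map_add, mul_add, add_mul]

/-- The graded component of degree `k`, as a type that remembers the parameters of the product. -/
def ShuffleComp (_q _d : ℂˣ) (k : ZMod n → ℕ) : Type := shuffleComp k

section Alg

variable (q d : ℂˣ)

instance (k : ZMod n → ℕ) : AddCommGroup (ShuffleComp q d k) :=
  inferInstanceAs (AddCommGroup (shuffleComp k))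

instance (k : ZMod n → ℕ) : Module ℂ (ShuffleComp q d k) :=
  inferInstanceAs (Module ℂ (shuffleComp k))

/-- The rational function underlying an element of the graded component. -/
def ShuffleComp.val {q d : ℂˣ} {k : ZMod n → ℕ} : ShuffleComp q d k →ₗ[ℂ] RatFun (Var n) :=
  (shuffleComp k).subtype

/-- An element of the graded component from a rational function. -/
def ShuffleComp.mk {q d : ℂˣ} {k : ZMod n → ℕ} (F : RatFun (Var n)) (hF : F ∈ shuffleComp k) :
    ShuffleComp q d k := ⟨F, hF⟩

theorem shuffleComp_ext {k l : ZMod n → ℕ} (F : ShuffleComp q d k) (G : ShuffleComp q d l)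
    (h : k = l) (h' : F.val = G.val) :
    (⟨k, F⟩ : GradedMonoid (ShuffleComp q d)) = ⟨l, G⟩ := by
  subst h
  have : F = G := Subtype.ext h'
  rw [this]

variable [Fact (3 ≤ n)]

instance : GradedMonoid.GMul (fun k : ZMod n → ℕ => ShuffleComp q d k) where
  mul {k l} F G := .mk (star q d k l F.val G.val) (star_mem q d F.2 G.2)

instance : GradedMonoid.GOne (fun k : ZMod n → ℕ => ShuffleComp q d k) where
  one := .mk (algebraMap ℂ _ 1) (algebraMap_mem_shuffleComp 1)

instance : GradedMonoid.GMonoid (fun k : ZMod n → ℕ => ShuffleComp q d k) where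
  one_mul F := shuffleComp_ext q d _ _ (zero_add _)
    ((star_algebraMap_left q d _ 1 F.2.2).trans (one_smul _ _))
  mul_one F := shuffleComp_ext q d _ _ (add_zero _)
    ((star_algebraMap_right q d _ 1 F.2.2).trans (one_smul _ _))
  mul_assoc F G H := shuffleComp_ext q d _ _ (add_assoc _ _ _)
    (star_assoc q d _ _ _ F.2.1 G.2.1 H.2.1 (act_of_mem F.2.2))

instance : DirectSum.GSemiring (fun k : ZMod n → ℕ => ShuffleComp q d k) where
  mul_zero {k l} F := Subtype.ext (by
    change star q d k l F.val 0 = 0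
    simpa using star_add_right q d k l F.val 0 0)
  zero_mul {k l} F := Subtype.ext (by
    change star q d k l 0 F.val = 0
    simpa using star_add_left q d k l 0 0 F.val)
  mul_add {k l} F G H := Subtype.ext (star_add_right q d k l F.val G.val H.val)
  add_mul {k l} F G H := Subtype.ext (star_add_left q d k l F.val G.val H.val)
  natCast m := .mk (algebraMap ℂ _ m) (algebraMap_mem_shuffleComp m)
  natCast_zero := Subtype.ext (by
    change algebraMap ℂ (RatFun (Var n)) ((0 : ℕ) : ℂ) = 0
    simp)
  natCast_succ m := Subtype.ext (by
    change algebraMap ℂ (RatFun (Var n)) ((m + 1 : ℕ) : ℂ)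
      = algebraMap ℂ (RatFun (Var n)) (m : ℂ) + algebraMap ℂ (RatFun (Var n)) 1
    rw [← map_add]; simp)

instance : DirectSum.GAlgebra ℂ (fun k : ZMod n → ℕ => ShuffleComp q d k) where
  toFun :=
    { toFun := fun c => .mk (algebraMap ℂ _ c) (algebraMap_mem_shuffleComp c)
      map_zero' := Subtype.ext (map_zero (algebraMap ℂ (RatFun (Var n))))
      map_add' := fun a b => Subtype.ext (map_add (algebraMap ℂ (RatFun (Var n))) a b) }
  map_one := rfl
  map_mul a b := shuffleComp_ext q d _ _ (zero_add _).symm (by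
    refine Eq.symm ((star_algebraMap_left q d 0 a (algebraMap_mem_shuffleComp b)).trans ?_)
    change a • algebraMap ℂ (RatFun (Var n)) b = algebraMap ℂ (RatFun (Var n)) (a * b)
    rw [Algebra.smul_def, map_mul])
  commutes c F := shuffleComp_ext q d _ _ (add_comm _ _)
    ((star_algebraMap_left q d _ c F.2.2).trans (star_algebraMap_right q d _ c F.2.2).symm)
  smul_def c F := shuffleComp_ext q d _ _ (zero_add _).symm
    (star_algebraMap_left q d _ c F.2.2).symm

/-- The big shuffle algebra `𝕊^{[n]}`, with the shuffle product. -/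
abbrev Shuffle : Type := ⨁ k : ZMod n → ℕ, ShuffleComp q d k

end Alg



/-! more shuffle -/

theorem xv_zpow_mem [Fact (3 ≤ n)] (i : ZMod n) (r : ℤ) :
    xv i 0 ^ r ∈ shuffleComp (Pi.single i 1 : ZMod n → ℕ) := by
  have hm : (⟨i, 0⟩ : Var n) ∈ varSet (Pi.single i 1 : ZMod n → ℕ) := by simp [varSet]
  have hp : poleDen (Pi.single i 1 : ZMod n → ℕ) = 1 := by
    unfold poleDen
    refine Finset.prod_eq_one fun j _ => Finset.prod_eq_one fun r hr =>
      Finset.prod_eq_one fun s hs => ?_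
    exfalso
    rw [Finset.mem_range] at hr hs
    by_cases hj : j = i
    · subst hj
      rw [Pi.single_eq_of_ne (add_one_ne j)] at hs
      omega
    · rw [Pi.single_eq_of_ne hj] at hr
      omega
  refine ⟨xv i 0 ^ r, ?_, ?_, ?_⟩
  · rcases r with r | r
    · rw [Int.ofNat_eq_natCast, zpow_natCast]
      exact pow_mem (rvar_mem_Laurent hm) _
    · rw [zpow_negSucc, ← inv_pow]
      exact pow_mem (rvar_inv_mem_Laurent hm) _
  · intro σ
    rw [map_zpow₀]
    congr 1
    have h : permVar _ σ ⟨i, 0⟩ = (⟨i, 0⟩ : Var n) := by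
      have h1 := permVar_mem _ σ hm
      rcases hv : permVar _ σ (⟨i, 0⟩ : Var n) with ⟨j, t⟩
      have h2 : j = i := by
        have := permVar_fst _ σ (⟨i, 0⟩ : Var n)
        rw [hv] at this
        exact this
      subst h2
      rw [hv] at h1
      have : t = 0 := by simpa [varSet] using h1
      rw [this]
    unfold xv
    rw [symAct_eq, act_rvar, h]
  · rw [hp, div_one]

/-- The element `x_{i,1}^r` of degree `(0, …, 1, …, 0)`. -/
def xpow [Fact (3 ≤ n)] (q d : ℂˣ) (i : ZMod n) (r : ℤ) :
    ShuffleComp q d (Pi.single i 1 : ZMod n → ℕ) :=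
  .mk (xv i 0 ^ r) (xv_zpow_mem i r)

/-- The value of a rational function at a point. -/
def evalRat {X : Type} {L : Type*} [Field L] [Algebra ℂ L] (p : X → L) (F : RatFun X) : L :=
  MvPolynomial.aeval p (IsFractionRing.num (MvPolynomial X ℂ) F) /
    MvPolynomial.aeval p (IsFractionRing.den (MvPolynomial X ℂ) F : MvPolynomial X ℂ)

/-- The specialization `x_{i,1} = q d^ε x_{i+ε,1} = q² x_{i,2}`, the other variables staying free. -/
def wheelPoint (q d : ℂˣ) (i : ZMod n) (ε : ℤ) (v : Var n) : RatFun (Var n) :=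
  if v = ⟨i, 0⟩ then ((q : ℂ) ^ 2) • xv i 1
  else if v = ⟨i + ε, 0⟩ then ((q : ℂ) * (d : ℂ) ^ (-ε)) • xv i 1
  else rvar v

/-- The shuffle algebra `S^{[n]}`: the elements of `𝕊^{[n]}` subject to the wheel conditions. -/
def wheelSet (q d : ℂˣ) : Set (Shuffle (n := n) q d) :=
  {E | ∀ (k : ZMod n → ℕ) (i : ZMod n) (ε : ℤ), (ε = 1 ∨ ε = -1) → 2 ≤ k i → 1 ≤ k (i + ε) →
    evalRat (wheelPoint q d i ε) (E k).val = 0}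

/-! shifted toroidal algebra -/

/-- The matrix `c_{ij}`. -/
def cartan (i j : ZMod n) : ℤ :=
  if j = i then 2 else if j = i + 1 ∨ j = i - 1 then -1 else 0

/-- The matrix `m_{ij}`. -/
def mMat (i j : ZMod n) : ℤ :=
  if j = i + 1 then -1 else if j = i - 1 then 1 else 0

/-- Generators `e_{i,r}`, `f_{i,r}`, `ψ^+_{i,r}` (`r ≥ -b^+_i`), `ψ^-_{i,r}` (`r ≤ b^-_i`) and the
inverses of `ψ^+_{i,-b^+_i}` and `ψ^-_{i,b^-_i}`. -/
inductive Gen (bp bm : ZMod n → ℤ) : Type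
  | e (i : ZMod n) (r : ℤ)
  | f (i : ZMod n) (r : ℤ)
  | psiP (i : ZMod n) (r : {r : ℤ // -bp i ≤ r})
  | psiM (i : ZMod n) (r : {r : ℤ // r ≤ bm i})
  | psiPInv (i : ZMod n)
  | psiMInv (i : ZMod n)

section Toroidal

variable (q d : ℂˣ) (bp bm : ZMod n → ℤ)

/-- The generator `e_{i,r}` in the free algebra. -/
def Gen.eF (i : ZMod n) (r : ℤ) : FreeAlgebra ℂ (Gen bp bm) := FreeAlgebra.ι ℂ (Gen.e i r)
/-- The generator `f_{i,r}` in the free algebra. -/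
def Gen.fF (i : ZMod n) (r : ℤ) : FreeAlgebra ℂ (Gen bp bm) := FreeAlgebra.ι ℂ (Gen.f i r)

/-- The coefficient of `z^{-r}` in the series `ψ^+_i(z)` (for `true`) or `ψ^-_i(z)` (for `false`). -/
def Gen.psiF (ε : Bool) (i : ZMod n) (r : ℤ) : FreeAlgebra ℂ (Gen bp bm) :=
  if ε then (if h : -bp i ≤ r then FreeAlgebra.ι ℂ (Gen.psiP i ⟨r, h⟩) else 0)
  else (if h : r ≤ bm i then FreeAlgebra.ι ℂ (Gen.psiM i ⟨r, h⟩) else 0)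

/-- The expression `x y z - (q + q⁻¹) x z y + z x y`. -/
def serre {A : Type*} [Ring A] [Algebra ℂ A] (q : ℂˣ) (x y z : A) : A :=
  x * y * z - ((q : ℂ) + (q : ℂ)⁻¹) • (x * z * y) + z * x * y

open Gen in
/-- The defining relations, coefficient by coefficient in the generating series. In the order listed:
the `ψ`s commute and their leading coefficients are invertible; the quadratic relations for `e e`, `f f`,
`ψ e`, `ψ f`; the commutator of `e` and `f`; the cubic Serre relations for `e` and for `f`. -/
inductive Rel : FreeAlgebra ℂ (Gen bp bm) → FreeAlgebra ℂ (Gen bp bm) → Prop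
  | T1_comm (ε ε' : Bool) (i j : ZMod n) (r s : ℤ) :
      Rel (psiF bp bm ε i r * psiF bp bm ε' j s) (psiF bp bm ε' j s * psiF bp bm ε i r)
  | T1_plus_right (i : ZMod n) :
      Rel (psiF bp bm true i (-bp i) * FreeAlgebra.ι ℂ (Gen.psiPInv i)) 1
  | T1_plus_left (i : ZMod n) :
      Rel (FreeAlgebra.ι ℂ (Gen.psiPInv i) * psiF bp bm true i (-bp i)) 1
  | T1_minus_right (i : ZMod n) :
      Rel (psiF bp bm false i (bm i) * FreeAlgebra.ι ℂ (Gen.psiMInv i)) 1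
  | T1_minus_left (i : ZMod n) :
      Rel (FreeAlgebra.ι ℂ (Gen.psiMInv i) * psiF bp bm false i (bm i)) 1
  | T2 (i j : ZMod n) (r s : ℤ) :
      Rel (((d : ℂ) ^ mMat i j) • (eF bp bm i (r + 1) * eF bp bm j s)
            - ((q : ℂ) ^ cartan i j) • (eF bp bm i r * eF bp bm j (s + 1)))
          (((q : ℂ) ^ cartan i j * (d : ℂ) ^ mMat i j) • (eF bp bm j s * eF bp bm i (r + 1))
            - eF bp bm j (s + 1) * eF bp bm i r)
  | T3 (i j : ZMod n) (r s : ℤ) :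
      Rel (((q : ℂ) ^ cartan i j * (d : ℂ) ^ mMat i j) • (fF bp bm i (r + 1) * fF bp bm j s)
            - fF bp bm i r * fF bp bm j (s + 1))
          (((d : ℂ) ^ mMat i j) • (fF bp bm j s * fF bp bm i (r + 1))
            - ((q : ℂ) ^ cartan i j) • (fF bp bm j (s + 1) * fF bp bm i r))
  | T4 (ε : Bool) (i j : ZMod n) (r s : ℤ) :
      Rel (((d : ℂ) ^ mMat i j) • (psiF bp bm ε i (r + 1) * eF bp bm j s)
            - ((q : ℂ) ^ cartan i j) • (psiF bp bm ε i r * eF bp bm j (s + 1)))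
          (((q : ℂ) ^ cartan i j * (d : ℂ) ^ mMat i j) • (eF bp bm j s * psiF bp bm ε i (r + 1))
            - eF bp bm j (s + 1) * psiF bp bm ε i r)
  | T5 (ε : Bool) (i j : ZMod n) (r s : ℤ) :
      Rel (((q : ℂ) ^ cartan i j * (d : ℂ) ^ mMat i j) • (psiF bp bm ε i (r + 1) * fF bp bm j s)
            - psiF bp bm ε i r * fF bp bm j (s + 1))
          (((d : ℂ) ^ mMat i j) • (fF bp bm j s * psiF bp bm ε i (r + 1))
            - ((q : ℂ) ^ cartan i j) • (fF bp bm j (s + 1) * psiF bp bm ε i r))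
  | T6_same (i : ZMod n) (r s : ℤ) :
      Rel (eF bp bm i r * fF bp bm i s - fF bp bm i s * eF bp bm i r)
          (((q : ℂ) - (q : ℂ)⁻¹)⁻¹ •
            (psiF bp bm true i (r + s) - psiF bp bm false i (r + s)))
  | T6_ne (i j : ZMod n) (hij : i ≠ j) (r s : ℤ) :
      Rel (eF bp bm i r * fF bp bm j s - fF bp bm j s * eF bp bm i r) 0
  | T7 (i j : ZMod n) (hij : j = i + 1 ∨ j = i - 1) (r₁ r₂ s : ℤ) :
      Rel (serre q (eF bp bm i r₁) (eF bp bm i r₂) (eF bp bm j s)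
            + serre q (eF bp bm i r₂) (eF bp bm i r₁) (eF bp bm j s)) 0
  | T8 (i j : ZMod n) (hij : j = i + 1 ∨ j = i - 1) (r₁ r₂ s : ℤ) :
      Rel (serre q (fF bp bm i r₁) (fF bp bm i r₂) (fF bp bm j s)
            + serre q (fF bp bm i r₂) (fF bp bm i r₁) (fF bp bm j s)) 0

/-- The shifted quantum toroidal algebra of `sl_n` with shifts `b^+` and `b^-`. -/
def ToroidalTwo : Type := RingQuot (Rel q d bp bm)

instance : Ring (ToroidalTwo q d bp bm) := inferInstanceAs (Ring (RingQuot (Rel q d bp bm)))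

instance : Algebra ℂ (ToroidalTwo q d bp bm) :=
  inferInstanceAs (Algebra ℂ (RingQuot (Rel q d bp bm)))

/-- The quotient map from the free algebra. -/
def ToroidalTwo.proj : FreeAlgebra ℂ (Gen bp bm) →ₐ[ℂ] ToroidalTwo q d bp bm := RingQuot.mkAlgHom ℂ (Rel q d bp bm)

end Toroidal

/-- The shifted quantum toroidal algebra with shifts `(0, b)`. -/
abbrev Toroidal (q d : ℂˣ) (b : ZMod n → ℤ) : Type := ToroidalTwo q d 0 b

namespace Toroidal

variable (q d : ℂˣ) (b : ZMod n → ℤ)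

/-- The element `e_{i,r}`. -/
def e (i : ZMod n) (r : ℤ) : Toroidal q d b := ToroidalTwo.proj q d 0 b (Gen.eF 0 b i r)
/-- The element `f_{i,r}`. -/
def f (i : ZMod n) (r : ℤ) : Toroidal q d b := ToroidalTwo.proj q d 0 b (Gen.fF 0 b i r)
/-- The element `ψ^±_{i,r}`, the coefficient of `z^{-r}` in `ψ^±_i(z)`. -/
def psi (ε : Bool) (i : ZMod n) (r : ℤ) : Toroidal q d b :=
  ToroidalTwo.proj q d 0 b (Gen.psiF 0 b ε i r)

/-- The positive subalgebra. -/
def pos : Subalgebra ℂ (Toroidal q d b) :=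
  Algebra.adjoin ℂ (Set.range fun ir : ZMod n × ℤ => e q d b ir.1 ir.2)

/-- The negative subalgebra. -/
def neg : Subalgebra ℂ (Toroidal q d b) :=
  Algebra.adjoin ℂ (Set.range fun ir : ZMod n × ℤ => f q d b ir.1 ir.2)

/-- The element `e_{i,r}` of the positive subalgebra. -/
def ePos (i : ZMod n) (r : ℤ) : pos q d b :=
  ⟨e q d b i r, Algebra.subset_adjoin ⟨(i, r), rfl⟩⟩

/-- The element `f_{i,r}` of the negative subalgebra. -/
def fNeg (i : ZMod n) (r : ℤ) : neg q d b :=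
  ⟨f q d b i r, Algebra.subset_adjoin ⟨(i, r), rfl⟩⟩

end Toroidal

/-! difference operators -/

/-- The index set of the variables `w_{i,r}`. -/
abbrev WVar (a : ZMod n → ℕ) : Type := (i : ZMod n) × Fin (a i)

/-- The field of rational functions in the `w_{i,r}^{1/2}`. -/
abbrev WField (a : ZMod n → ℕ) : Type := RatFun (WVar a)

/-- The rescaling `v ↦ q^{m_v} v` of the variables, on polynomials. -/
def scalePoly (q : ℂˣ) {X : Type} (m : X → ℤ) : MvPolynomial X ℂ →ₐ[ℂ] MvPolynomial X ℂ :=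
  MvPolynomial.aeval fun v => MvPolynomial.C ((q : ℂ) ^ m v) * MvPolynomial.X v

theorem scalePoly_neg (q : ℂˣ) {X : Type} (m : X → ℤ) (P : MvPolynomial X ℂ) :
    scalePoly q (-m) (scalePoly q m P) = P := by
  have : (scalePoly q (-m)).comp (scalePoly q m) = AlgHom.id ℂ (MvPolynomial X ℂ) := by
    apply MvPolynomial.algHom_ext
    intro v
    simp only [scalePoly, AlgHom.comp_apply, MvPolynomial.aeval_X, map_mul, MvPolynomial.algHom_C,
      AlgHom.id_apply, Pi.neg_apply, MvPolynomial.algebraMap_eq]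
    rw [← mul_assoc, ← map_mul, ← zpow_add₀ q.ne_zero]
    simp
  exact DFunLike.congr_fun this P

/-- The rescaling `v ↦ q^{m_v} v` of the variables, on rational functions. -/
def scaleHom (q : ℂˣ) {X : Type} (m : X → ℤ) : RatFun X →ₐ[ℂ] RatFun X :=
  IsFractionRing.liftAlgHom (K := RatFun X) (L := RatFun X)
    (g := (Algebra.algHom ℂ (MvPolynomial X ℂ) (RatFun X)).comp (scalePoly q m))
    (by
      rw [AlgHom.coe_comp]
      exact (IsFractionRing.injective (MvPolynomial X ℂ) (RatFun X)).comp
        (Function.LeftInverse.injective (scalePoly_neg q m)))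

@[simp] theorem scaleHom_rvar (q : ℂˣ) {X : Type} (m : X → ℤ) (v : X) :
    scaleHom q m (rvar v) = ((q : ℂ) ^ m v) • rvar v := by
  unfold scaleHom rvar
  rw [IsFractionRing.liftAlgHom_apply, IsFractionRing.lift_algebraMap]
  refine (congrArg (algebraMap (MvPolynomial X ℂ) (RatFun X))
    (MvPolynomial.aeval_X _ v)).trans ?_
  rw [map_mul, Algebra.smul_def]
  rfl

/-- The group of the monomials `∏ D_{i,r}^{m_{i,r}}`. -/
def ShiftGroup (_q : ℂˣ) (a : ZMod n → ℕ) : Type := Multiplicative (WVar a → ℤ)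

instance (q : ℂˣ) (a : ZMod n → ℕ) : CommGroup (ShiftGroup q a) :=
  inferInstanceAs (CommGroup (Multiplicative (WVar a → ℤ)))

/-- The monomial with given exponents. -/
def ShiftGroup.ofExp (q : ℂˣ) {a : ZMod n → ℕ} (m : WVar a → ℤ) : ShiftGroup q a :=
  Multiplicative.ofAdd m

/-- The exponents of a monomial. -/
def ShiftGroup.exp {q : ℂˣ} {a : ZMod n → ℕ} (g : ShiftGroup q a) : WVar a → ℤ :=
  Multiplicative.toAdd g

instance (q : ℂˣ) (a : ZMod n → ℕ) : MulSemiringAction (ShiftGroup q a) (WField a) where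
  smul g F := scaleHom q g.exp F
  one_smul F := by
    have : scaleHom q (1 : ShiftGroup q a).exp = AlgHom.id ℂ (WField a) := by
      refine ratFun_hom_ext fun v => ?_
      rw [scaleHom_rvar]
      have : (1 : ShiftGroup q a).exp v = 0 := rfl
      simp [this]
    exact DFunLike.congr_fun this F
  mul_smul g h F := by
    have : scaleHom q (g * h).exp = (scaleHom q g.exp).comp (scaleHom q h.exp) := by
      refine ratFun_hom_ext fun v => ?_
      rw [AlgHom.comp_apply, scaleHom_rvar, scaleHom_rvar, map_smul, scaleHom_rvar, smul_smul,
        ← zpow_add₀ q.ne_zero]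
      have : (g * h).exp v = g.exp v + h.exp v := rfl
      rw [this, add_comm]
    exact DFunLike.congr_fun this F
  smul_zero g := map_zero (scaleHom q g.exp)
  smul_add g := map_add (scaleHom q g.exp)
  smul_one g := map_one (scaleHom q g.exp)
  smul_mul g := map_mul (scaleHom q g.exp)

/-- All difference operators `∑ c_m(w^{1/2}) ∏ D_{i,r}^{m_{i,r}}` with rational coefficients: the
skew group algebra in which `D_{i,r} w_{j,s}^{1/2} = q^{δ_{ij} δ_{rs}} w_{j,s}^{1/2} D_{i,r}`. -/
def DiffOp (q : ℂˣ) (a : ZMod n → ℕ) : Type := SkewMonoidAlgebra (WField a) (ShiftGroup q a)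

instance (q : ℂˣ) (a : ZMod n → ℕ) : Ring (DiffOp q a) :=
  inferInstanceAs (Ring (SkewMonoidAlgebra (WField a) (ShiftGroup q a)))

instance (q : ℂˣ) (a : ZMod n → ℕ) : Module ℂ (DiffOp q a) :=
  inferInstanceAs (Module ℂ (SkewMonoidAlgebra (WField a) (ShiftGroup q a)))

theorem smul_scalar_comm (q : ℂˣ) (a : ZMod n → ℕ) (g : ShiftGroup q a) (c : ℂ) (F : WField a) :
    g • (c • F) = c • (g • F) :=
  map_smul (scaleHom q g.exp) c F

theorem skew_smul_mul (q : ℂˣ) (a : ZMod n → ℕ) (c : ℂ)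
    (x y : SkewMonoidAlgebra (WField a) (ShiftGroup q a)) : (c • x) * y = c • (x * y) := by
  induction x using SkewMonoidAlgebra.induction_on with
  | zero => rw [smul_zero, zero_mul, smul_zero]
  | single g F =>
    induction y using SkewMonoidAlgebra.induction_on with
    | zero => rw [mul_zero, mul_zero, smul_zero]
    | single h G =>
      rw [SkewMonoidAlgebra.smul_single, SkewMonoidAlgebra.single_mul_single,
        SkewMonoidAlgebra.single_mul_single, SkewMonoidAlgebra.smul_single, smul_mul_assoc]
    | add y y' hy hy' => rw [mul_add, mul_add, smul_add, hy, hy']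
  | add x x' hx hx' => rw [smul_add, add_mul, add_mul, smul_add, hx, hx']

theorem skew_mul_smul (q : ℂˣ) (a : ZMod n → ℕ) (c : ℂ)
    (x y : SkewMonoidAlgebra (WField a) (ShiftGroup q a)) : x * (c • y) = c • (x * y) := by
  induction x using SkewMonoidAlgebra.induction_on with
  | zero => rw [zero_mul, zero_mul, smul_zero]
  | single g F =>
    induction y using SkewMonoidAlgebra.induction_on with
    | zero => rw [smul_zero, mul_zero, smul_zero]
    | single h G =>
      rw [SkewMonoidAlgebra.smul_single, SkewMonoidAlgebra.single_mul_single,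
        SkewMonoidAlgebra.single_mul_single, SkewMonoidAlgebra.smul_single, smul_scalar_comm,
        mul_smul_comm]
    | add y y' hy hy' => rw [smul_add, mul_add, mul_add, smul_add, hy, hy']
  | add x x' hx hx' => rw [add_mul, add_mul, smul_add, hx, hx']

instance (q : ℂˣ) (a : ZMod n → ℕ) : Algebra ℂ (DiffOp q a) :=
  Algebra.ofModule (skew_smul_mul q a) (skew_mul_smul q a)


section Target

variable (q d : ℂˣ) (a : ZMod n → ℕ)

/-- A function of the variables, seen as a multiplication operator. -/
def func (c : WField a) : DiffOp q a :=
  (SkewMonoidAlgebra.single 1 c : SkewMonoidAlgebra (WField a) (ShiftGroup q a))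

/-- The monomial `∏ D_{i,r} ^ m_{i,r}`. -/
def Dmon (m : WVar a → ℤ) : DiffOp q a :=
  (SkewMonoidAlgebra.single (ShiftGroup.ofExp q m) 1 :
    SkewMonoidAlgebra (WField a) (ShiftGroup q a))

variable {a} in
/-- The generator `w_{i,r}^{1/2}`. -/
def sqrtW (i : ZMod n) (r : Fin (a i)) : WField a := rvar ⟨i, r⟩

variable {a} in
/-- The element `w_{i,r}`. -/
def wv (i : ZMod n) (r : Fin (a i)) : WField a := sqrtW i r ^ 2

/-- The generators `w_{i,r}^{± 1/2}`, `D_{i,r}^{± 1}` and `(w_{i,r} - q^m w_{i,s})⁻¹`, `r ≠ s`. -/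
def diffGenerators : Set (DiffOp q a) :=
  {x | ∃ i r, x = func q a (sqrtW i r) ∨ x = func q a (sqrtW i r)⁻¹ ∨
      x = Dmon q a (Pi.single ⟨i, r⟩ 1) ∨ x = Dmon q a (Pi.single ⟨i, r⟩ (-1))} ∪
  {x | ∃ (i : ZMod n) (r s : Fin (a i)) (m : ℤ), r ≠ s ∧
      x = func q a (wv i r - ((q : ℂ) ^ m) • wv i s)⁻¹}

/-- The algebra generated by the `w_{i,r}^{±1/2}` and `D_{i,r}^{±1}`, localized at the
`w_{i,r} - q^m w_{i,s}` with `r ≠ s`. -/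
def diffAlg : Subalgebra ℂ (DiffOp q a) := Algebra.adjoin ℂ (diffGenerators q a)

/-- The further localization at the `w_{i,r} - q^m d w_{i+1,s}`. -/
def diffAlgLoc : Subalgebra ℂ (DiffOp q a) :=
  Algebra.adjoin ℂ (diffGenerators q a ∪
    {x | ∃ (i : ZMod n) (r : Fin (a i)) (s : Fin (a (i + 1))) (m : ℤ),
      x = func q a (wv i r - ((q : ℂ) ^ m * (d : ℂ)) • wv (i + 1) s)⁻¹})

end Target

section GKLO

/-- The vertices `j` with an arrow `j → i`. An orientation of the cyclic quiver is encoded by a Boolean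
for each vertex: `o j = true` means that the edge between `j` and `j + 1` is oriented `j → j + 1`,
and `o j = false` that it is oriented `j + 1 → j`. -/
def arrowsInto (o : ZMod n → Bool) (i : ZMod n) : Finset (ZMod n) :=
  Finset.univ.filter fun j => (i = j + 1 ∧ o j = true) ∨ (j = i + 1 ∧ o i = false)

/-- The vertices `j` with an arrow `i → j`. -/
def arrowsFrom (o : ZMod n → Bool) (i : ZMod n) : Finset (ZMod n) :=
  Finset.univ.filter fun j => i ∈ arrowsInto o j

/-- The vertices adjacent to `i`. -/
def neighbours (i : ZMod n) : Finset (ZMod n) := {i + 1, i - 1}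

variable (q d : ℂˣ) {a : ZMod n → ℕ} {N : ZMod n → ℕ} (z : ∀ i, Fin (N i) → ℂˣ)
  (o : ZMod n → Bool)

/-- A constant, as a rational function. -/
def cst (a : ZMod n → ℕ) (c : ℂ) : WField a := algebraMap ℂ (WField a) c

section Field

variable {L : Type*} [Field L] [Algebra (WField a) L]

variable (a) in
/-- `Z_i(x) = ∏_s (1 - q z_{i,s} / x)`. -/
def Zf (i : ZMod n) (x : L) : L :=
  ∏ s, (1 - algebraMap (WField a) L (cst a (q * z i s)) / x)

/-- `W_j(x) = ∏_t (1 - w_{j,t} / x)`. -/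
def Wf (j : ZMod n) (x : L) : L := ∏ t : Fin (a j), (1 - algebraMap (WField a) L (wv j t) / x)

/-- `W_{i,r}(x) = ∏_{t ≠ r} (1 - w_{i,t} / x)`. -/
def Wr (i : ZMod n) (r : Fin (a i)) (x : L) : L :=
  ∏ t ∈ Finset.univ.erase r, (1 - algebraMap (WField a) L (wv i t) / x)

/-- `W_j(q⁻¹ d^{m_{ij}} x)`. -/
def Wtw (i j : ZMod n) (x : L) : L :=
  Wf (a := a) j (algebraMap (WField a) L (cst a ((q : ℂ)⁻¹ * (d : ℂ) ^ mMat i j)) * x)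

variable (a) in
/-- The rational function of `x` whose expansions are the images of `ψ^±_i(x)`. -/
def gammaFun (i : ZMod n) (x : L) : L :=
  algebraMap (WField a) L
      ((∏ t, wv i t) * ∏ j ∈ neighbours i, ∏ t : Fin (a j), (sqrtW j t)⁻¹) *
    (Zf q a z i x / (Wf (a := a) i x *
        Wf (a := a) i (algebraMap (WField a) L (cst a ((q : ℂ) ^ (-2 : ℤ))) * x)) *
      ∏ j ∈ neighbours i, Wtw q d (a := a) i j x)

end Field

variable (a) in
/-- The image of `e_{i,p}`. -/
def eImage (i : ZMod n) (p : ℤ) : DiffOp q a :=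
  func q a (cst a (-(q : ℂ) / (1 - (q : ℂ) ^ 2)) * (∏ t, wv i t) *
      ∏ j ∈ arrowsInto o i, ∏ t : Fin (a j), (sqrtW j t)⁻¹) *
    ∑ r : Fin (a i), func q a (wv i r ^ p * (Zf q a z i (wv i r) / Wr i r (wv i r)) *
        ∏ j ∈ arrowsInto o i, Wtw q d (a := a) i j (wv i r)) *
      Dmon q a (Pi.single ⟨i, r⟩ (-1))

variable (a) in
/-- The image of `f_{i,p}`. -/
def fImage (i : ZMod n) (p : ℤ) : DiffOp q a :=
  func q a (cst a (1 / (1 - (q : ℂ) ^ 2)) *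
      ∏ j ∈ arrowsFrom o i, ∏ t : Fin (a j), (sqrtW j t)⁻¹) *
    ∑ r : Fin (a i), func q a ((cst a ((q : ℂ) ^ 2) * wv i r) ^ p * (1 / Wr i r (wv i r)) *
        ∏ j ∈ arrowsFrom o i, Wtw q d (a := a) i j (cst a ((q : ℂ) ^ 2) * wv i r)) *
      Dmon q a (Pi.single ⟨i, r⟩ 1)

variable (a) in
/-- The coefficient of `z^{-p}` in the expansion in powers of `z⁻¹`: `z` is the inverse of the formal
variable of the Laurent series. -/
def psiPlusImage (i : ZMod n) (p : ℤ) : DiffOp q a :=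
  func q a ((gammaFun q d a z i
    (HahnSeries.single (-1 : ℤ) 1 : LaurentSeries (WField a))).coeff p)

variable (a) in
/-- The coefficient of `z^{-p}` in the expansion in powers of `z`: `z` is the formal variable. -/
def psiMinusImage (i : ZMod n) (p : ℤ) : DiffOp q a :=
  func q a ((gammaFun q d a z i
    (HahnSeries.single (1 : ℤ) 1 : LaurentSeries (WField a))).coeff (-p))

/-- `Φ` takes the prescribed values on the generating series. -/
structure IsGKLO {b : ZMod n → ℤ} (Φ : Toroidal q d b →ₐ[ℂ] diffAlg q a) : Prop where
  map_e : ∀ i p, (Φ (Toroidal.e q d b i p) : DiffOp q a) = eImage q d a z o i p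
  map_f : ∀ i p, (Φ (Toroidal.f q d b i p) : DiffOp q a) = fImage q d a o i p
  map_psiPlus : ∀ i p, (Φ (Toroidal.psi q d b true i p) : DiffOp q a) = psiPlusImage q d a z i p
  map_psiMinus : ∀ i p, (Φ (Toroidal.psi q d b false i p) : DiffOp q a) = psiMinusImage q d a z i p

/-! explicit formulas -/

/-- `Y_{i,r}(x)`. -/
def Yfun (i : ZMod n) (r : Fin (a i)) (x : WField a) : WField a :=
  cst a (1 / ((q : ℂ) - (q : ℂ)⁻¹)) * (∏ t, wv i t) *
    (∏ j ∈ arrowsInto o i, ∏ t : Fin (a j), (sqrtW j t)⁻¹) *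
    (Zf q a z i x * (∏ j ∈ arrowsInto o i, Wtw q d (a := a) i j x) / Wr i r x)

/-- The primed factor `Y_{i,r}` used on the negative half. -/
def YfunMinus (i : ZMod n) (r : Fin (a i)) (x : WField a) : WField a :=
  cst a (1 / (1 - (q : ℂ) ^ 2)) *
    (∏ j ∈ arrowsFrom o i, ∏ t : Fin (a j), (sqrtW j t)⁻¹) *
    ((∏ j ∈ arrowsFrom o i, Wtw q d (a := a) i j x) /
      Wr i r (cst a ((q : ℂ) ^ (-2 : ℤ)) * x))

variable (a) in
/-- The families of natural numbers `m^{(i)}_r` with `∑_r m^{(i)}_r = k_i`. -/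
def splittings (k : ZMod n → ℕ) : Finset (∀ i, Fin (a i) → ℕ) :=
  Fintype.piFinset fun i => Finset.univ.piAntidiag (k i)

/-- The specialization in which the variables `x_{i,1}, …, x_{i,k_i}` take the values `pt i r p`,
`p < m^{(i)}_r`. -/
def pointList (pt : ∀ i, Fin (a i) → ℕ → WField a) (m : ∀ i, Fin (a i) → ℕ) (v : Var n) :
    WField a :=
  ((List.finRange (a v.1)).flatMap fun r => (List.range (m v.1 r)).map fun p => pt v.1 r p).getD
    v.2 0

/-- The point `w_{i,r} q^{-2p}`, with `p` counted from `0`. -/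
def ptPlus (i : ZMod n) (r : Fin (a i)) (p : ℕ) : WField a :=
  cst a ((q : ℂ) ^ (-2 * (p : ℤ))) * wv i r

/-- The point `w_{i,r} q^{2(p+1)}`, with `p` counted from `0`. -/
def ptMinus (i : ZMod n) (r : Fin (a i)) (p : ℕ) : WField a :=
  cst a ((q : ℂ) ^ (2 * ((p : ℤ) + 1))) * wv i r

variable (a) in
/-- The summand of the first formula at `m`, without the `D`s. -/
def coeffPlus (m : ∀ i, Fin (a i) → ℕ) (E : RatFun (Var n)) : WField a :=
  (∏ i, ∏ r, ∏ p ∈ Finset.range (m i r), Yfun q d z o i r (ptPlus q i r p)) *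
    evalRat (pointList (ptPlus q) m) E *
    (∏ i, ∏ r, ∏ p₂ ∈ Finset.range (m i r), ∏ p₁ ∈ Finset.range p₂,
      (zeta q d i i (ptPlus q i r p₁) (ptPlus q (a := a) i r p₂))⁻¹) *
    (∏ i, ∏ r₁, ∏ r₂ ∈ Finset.univ.erase r₁, ∏ p₁ ∈ Finset.range (m i r₁),
      ∏ p₂ ∈ Finset.range (m i r₂),
        (zeta q d i i (ptPlus q i r₁ p₁) (ptPlus q (a := a) i r₂ p₂))⁻¹) *
    (∏ i, ∏ j ∈ arrowsInto o i, ∏ r₁, ∏ r₂, ∏ p₁ ∈ Finset.range (m i r₁),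
      ∏ p₂ ∈ Finset.range (m j r₂),
        (zeta q d i j (ptPlus q i r₁ p₁) (ptPlus q (a := a) j r₂ p₂))⁻¹)

variable (a) in
/-- The summand of the second formula at `m`, without the `D`s. -/
def coeffMinus (m : ∀ i, Fin (a i) → ℕ) (F : RatFun (Var n)) : WField a :=
  (∏ i, ∏ r, ∏ p ∈ Finset.range (m i r), YfunMinus q d o i r (ptMinus q i r p)) *
    evalRat (pointList (ptMinus q) m) F *
    (∏ i, ∏ r, ∏ p₂ ∈ Finset.range (m i r), ∏ p₁ ∈ Finset.range p₂,
      (zeta q d i i (ptMinus q i r p₂) (ptMinus q (a := a) i r p₁))⁻¹) *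
    (∏ i, ∏ r₁, ∏ r₂ ∈ Finset.univ.erase r₁, ∏ p₁ ∈ Finset.range (m i r₁),
      ∏ p₂ ∈ Finset.range (m i r₂),
        (cst a (q : ℂ)⁻¹ * (zeta q d i i (ptMinus q i r₂ p₂) (ptMinus q (a := a) i r₁ p₁))⁻¹)) *
    (∏ i, ∏ j ∈ arrowsFrom o i, ∏ r₁, ∏ r₂, ∏ p₁ ∈ Finset.range (m i r₁),
      ∏ p₂ ∈ Finset.range (m j r₂),
        (zeta q d j i (ptMinus q j r₂ p₂) (ptMinus q (a := a) i r₁ p₁))⁻¹)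

variable (a) in
/-- The explicit image of an element of degree `k` (positive half). -/
def hatPlus (k : ZMod n → ℕ) (E : RatFun (Var n)) : DiffOp q a :=
  ((q : ℂ) ^ (∑ i, ((k i : ℤ) - (k i : ℤ) ^ 2))) •
    ∑ m ∈ splittings a k, func q a (coeffPlus q d a z o m E) *
      Dmon q a (fun v => -(m v.1 v.2 : ℤ))

variable (a) in
/-- The explicit image of an element of degree `k` (negative half). -/
def hatMinus (k : ZMod n → ℕ) (F : RatFun (Var n)) : DiffOp q a :=
  ∑ m ∈ splittings a k, func q a (coeffMinus q d a o m F) *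
    Dmon q a (fun v => (m v.1 v.2 : ℤ))

end GKLO


end ToroidalShuffle
end

open ToroidalShuffle

set_option linter.unusedSectionVars false
open scoped BigOperators DirectSum

noncomputable section

namespace ToroidalShuffle


/-! evaluation of rational functions -/

section Evaluation

variable {X : Type} {L : Type} [Field L] [Algebra ℂ L]

/-- `F` is regular at the point `p`, with value `y`. -/
def HasEval (p : X → L) (F : RatFun X) (y : L) : Prop :=
  ∃ P Q : MvPolynomial X ℂ, MvPolynomial.aeval p Q ≠ 0 ∧
    F * algebraMap _ (RatFun X) Q = algebraMap _ (RatFun X) P ∧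
    y = MvPolynomial.aeval p P / MvPolynomial.aeval p Q

theorem HasEval.evalRat_eq {p : X → L} {F : RatFun X} {y : L} (h : HasEval p F y) :
    evalRat p F = y := by
  obtain ⟨P, Q, hQ, hF, rfl⟩ := h
  have hQ0 : Q ≠ 0 := by rintro rfl; simp at hQ
  have hinj := IsFractionRing.injective (MvPolynomial X ℂ) (RatFun X)
  set N := IsFractionRing.num (MvPolynomial X ℂ) F with hN
  set D : MvPolynomial X ℂ := (IsFractionRing.den (MvPolynomial X ℂ) F : MvPolynomial X ℂ) with hD
  have hD0 : D ≠ 0 := nonZeroDivisors.ne_zero (IsFractionRing.den (MvPolynomial X ℂ) F).2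
  have hFD : F * algebraMap _ (RatFun X) D = algebraMap _ (RatFun X) N := by
    have h1 := IsFractionRing.mk'_num_den (MvPolynomial X ℂ) F
    rw [IsLocalization.mk'_eq_iff_eq_mul] at h1
    exact h1.symm
  have hcross : N * Q = P * D := by
    apply hinj
    rw [map_mul, map_mul, ← hF, ← hFD]; ring
  have hdvd : D ∣ Q := by
    have hrel : IsRelPrime D N := (IsFractionRing.num_den_reduced (MvPolynomial X ℂ) F).symm
    exact hrel.dvd_of_dvd_mul_left (Dvd.intro_left P hcross.symm)
  have hDp : MvPolynomial.aeval p D ≠ 0 := by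
    obtain ⟨R, hR⟩ := hdvd
    intro h0
    apply hQ
    rw [hR, map_mul, h0, zero_mul]
  unfold evalRat
  rw [div_eq_div_iff hDp hQ, ← map_mul, ← map_mul, hcross]

theorem HasEval.congr {p : X → L} {F : RatFun X} {y y' : L} (h : HasEval p F y) (hy : y = y') :
    HasEval p F y' := hy ▸ h

theorem HasEval.poly (p : X → L) (P : MvPolynomial X ℂ) :
    HasEval p (algebraMap _ (RatFun X) P) (MvPolynomial.aeval p P) :=
  ⟨P, 1, by simp, by simp, by simp⟩

theorem HasEval.var (p : X → L) (v : X) : HasEval p (rvar v) (p v) :=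
  (HasEval.poly p (MvPolynomial.X v)).congr (by simp)

theorem HasEval.const (p : X → L) (c : ℂ) :
    HasEval p (algebraMap ℂ (RatFun X) c) (algebraMap ℂ L c) :=
  (HasEval.poly p (MvPolynomial.C c)).congr (by simp)

theorem HasEval.add {p : X → L} {F G : RatFun X} {y z : L} (hF : HasEval p F y)
    (hG : HasEval p G z) : HasEval p (F + G) (y + z) := by
  obtain ⟨P, Q, hQ, hF, rfl⟩ := hF
  obtain ⟨P', Q', hQ', hG, rfl⟩ := hG
  refine ⟨P * Q' + P' * Q, Q * Q', by simp [hQ, hQ'], ?_, ?_⟩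
  · simp only [map_add, map_mul, ← hF, ← hG]; ring
  · simp only [map_add, map_mul]; field_simp

theorem HasEval.mul {p : X → L} {F G : RatFun X} {y z : L} (hF : HasEval p F y)
    (hG : HasEval p G z) : HasEval p (F * G) (y * z) := by
  obtain ⟨P, Q, hQ, hF, rfl⟩ := hF
  obtain ⟨P', Q', hQ', hG, rfl⟩ := hG
  refine ⟨P * P', Q * Q', by simp [hQ, hQ'], ?_, ?_⟩
  · simp only [map_mul, ← hF, ← hG]; ring
  · simp only [map_mul]; field_simp

theorem HasEval.inv {p : X → L} {F : RatFun X} {y : L} (hF : HasEval p F y) (hy : y ≠ 0) :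
    HasEval p F⁻¹ y⁻¹ := by
  obtain ⟨P, Q, hQ, hF, rfl⟩ := hF
  have hP : MvPolynomial.aeval p P ≠ 0 := fun h => hy (by rw [h, zero_div])
  have hQ0 : algebraMap _ (RatFun X) Q ≠ 0 := by
    intro h
    have : Q = 0 := IsFractionRing.injective (MvPolynomial X ℂ) (RatFun X) (h.trans (map_zero _).symm)
    simp [this] at hQ
  have hP0 : algebraMap _ (RatFun X) P ≠ 0 := by
    intro h
    have : P = 0 := IsFractionRing.injective (MvPolynomial X ℂ) (RatFun X) (h.trans (map_zero _).symm)
    simp [this] at hP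
  refine ⟨Q, P, hP, ?_, by rw [inv_div]⟩
  have hF0 : F ≠ 0 := by rintro rfl; rw [zero_mul] at hF; exact hP0 hF.symm
  rw [← hF]; field_simp

theorem HasEval.div {p : X → L} {F G : RatFun X} {y z : L} (hF : HasEval p F y)
    (hG : HasEval p G z) (hz : z ≠ 0) : HasEval p (F / G) (y / z) := by
  rw [div_eq_mul_inv, div_eq_mul_inv]
  exact hF.mul (hG.inv hz)

theorem HasEval.one (p : X → L) : HasEval p 1 1 := by
  simpa using HasEval.poly p 1

theorem HasEval.zero (p : X → L) : HasEval p 0 0 := by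
  simpa using HasEval.poly p 0

theorem HasEval.smul {p : X → L} {F : RatFun X} {y : L} (c : ℂ) (hF : HasEval p F y) :
    HasEval p (c • F) (c • y) := by
  rw [Algebra.smul_def, Algebra.smul_def]
  exact (HasEval.const p c).mul hF

theorem HasEval.neg {p : X → L} {F : RatFun X} {y : L} (hF : HasEval p F y) :
    HasEval p (-F) (-y) := by
  simpa using hF.smul (-1)

theorem HasEval.sub {p : X → L} {F G : RatFun X} {y z : L} (hF : HasEval p F y)
    (hG : HasEval p G z) : HasEval p (F - G) (y - z) := by
  rw [sub_eq_add_neg, sub_eq_add_neg]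
  exact hF.add hG.neg

theorem HasEval.sum {p : X → L} {ι : Type*} (s : Finset ι) {F : ι → RatFun X} {y : ι → L}
    (h : ∀ i ∈ s, HasEval p (F i) (y i)) : HasEval p (∑ i ∈ s, F i) (∑ i ∈ s, y i) := by
  classical
  induction s using Finset.induction_on with
  | empty => simpa using HasEval.zero p
  | insert a s ha ih =>
    rw [Finset.sum_insert ha, Finset.sum_insert ha]
    exact (h a (Finset.mem_insert_self _ _)).add
      (ih fun i hi => h i (Finset.mem_insert_of_mem hi))

theorem HasEval.prod {p : X → L} {ι : Type*} (s : Finset ι) {F : ι → RatFun X} {y : ι → L}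
    (h : ∀ i ∈ s, HasEval p (F i) (y i)) : HasEval p (∏ i ∈ s, F i) (∏ i ∈ s, y i) := by
  classical
  induction s using Finset.induction_on with
  | empty => simpa using HasEval.one p
  | insert a s ha ih =>
    rw [Finset.prod_insert ha, Finset.prod_insert ha]
    exact (h a (Finset.mem_insert_self _ _)).mul
      (ih fun i hi => h i (Finset.mem_insert_of_mem hi))

theorem HasEval.pow {p : X → L} {F : RatFun X} {y : L} (hF : HasEval p F y) (e : ℕ) :
    HasEval p (F ^ e) (y ^ e) := by
  induction e with
  | zero => simpa using HasEval.one p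
  | succ e ih => rw [pow_succ, pow_succ]; exact ih.mul hF

theorem relabel_algebraMap (f : X → X) (hf : Function.Injective f) (P : MvPolynomial X ℂ) :
    relabel f hf (algebraMap _ (RatFun X) P) = algebraMap _ (RatFun X) (MvPolynomial.rename f P) := by
  unfold relabel
  rw [IsFractionRing.liftAlgHom_apply, IsFractionRing.lift_algebraMap]
  rfl

theorem HasEval.relabel_of_comp {p : X → L} {F : RatFun X} {y : L} (f : X → X) (hf : Function.Injective f)
    (h : HasEval (p ∘ f) F y) : HasEval p (relabel f hf F) y := by
  obtain ⟨P, Q, hQ, hF, rfl⟩ := h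
  refine ⟨MvPolynomial.rename f P, MvPolynomial.rename f Q, ?_, ?_, ?_⟩
  · rwa [MvPolynomial.aeval_rename]
  · rw [← relabel_algebraMap f hf, ← relabel_algebraMap f hf, ← map_mul, hF]
  · rw [MvPolynomial.aeval_rename, MvPolynomial.aeval_rename]

theorem HasEval.zpow {p : X → L} {F : RatFun X} {y : L} (hF : HasEval p F y) (hy : y ≠ 0) (e : ℤ) :
    HasEval p (F ^ e) (y ^ e) := by
  cases e with
  | ofNat e => simpa using hF.pow e
  | negSucc e => rw [zpow_negSucc, zpow_negSucc]; exact (hF.pow _).inv (pow_ne_zero _ hy)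

theorem HasEval.self (F : RatFun X) : HasEval rvar F F := by
  have h : ∀ P : MvPolynomial X ℂ, MvPolynomial.aeval rvar P
      = algebraMap _ (RatFun X) P := by
    intro P
    have : MvPolynomial.aeval (R := ℂ) (rvar (X := X))
        = Algebra.algHom ℂ (MvPolynomial X ℂ) (RatFun X) :=
      MvPolynomial.algHom_ext fun v => by rw [MvPolynomial.aeval_X]; rfl
    exact DFunLike.congr_fun this P
  obtain ⟨P, Q, hQ, rfl⟩ := IsFractionRing.div_surjective (A := MvPolynomial X ℂ) F
  have hQ0 : algebraMap _ (RatFun X) Q ≠ 0 := by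
    rw [Ne, FaithfulSMul.algebraMap_eq_zero_iff]
    exact nonZeroDivisors.ne_zero hQ
  refine ⟨P, Q, ?_, ?_, ?_⟩
  · rwa [h]
  · field_simp
  · rw [h, h]

end Evaluation

section ShuffleEvaluation

variable {n : ℕ} [NeZero n] {L : Type} [Field L] [Algebra ℂ L]

/-- The coordinates of `p` indexed by the variables `x_{i,r}`, `r < k_i`, are nonzero and pairwise
distinct. -/
structure Generic (k : ZMod n → ℕ) (p : Var n → L) : Prop where
  injOn : Set.InjOn p (varSet k)
  ne_zero : ∀ v ∈ varSet k, p v ≠ 0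

theorem Generic.mono {k l : ZMod n → ℕ} {p : Var n → L} (h : Generic l p)
    (hkl : ∀ i, k i ≤ l i) : Generic k p :=
  ⟨h.injOn.mono fun v hv => lt_of_lt_of_le hv (hkl v.1),
    fun v hv => h.ne_zero v (lt_of_lt_of_le hv (hkl v.1))⟩

theorem generic_rvar (k : ZMod n → ℕ) : Generic k (rvar (X := Var n)) :=
  ⟨rvar_injective.injOn, fun v _ => rvar_ne_zero v⟩

/-- The value of the denominator at a point. -/
def poleDenAt (k : ZMod n → ℕ) (p : Var n → L) : L :=
  ∏ i, ∏ r ∈ Finset.range (k i), ∏ s ∈ Finset.range (k (i + 1)), (p ⟨i, r⟩ - p ⟨i + 1, s⟩)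

theorem hasEval_poleDen (k : ZMod n → ℕ) (p : Var n → L) :
    HasEval p (poleDen k) (poleDenAt k p) :=
  HasEval.prod _ fun _ _ => HasEval.prod _ fun _ _ => HasEval.prod _ fun _ _ =>
    (HasEval.var p _).sub (HasEval.var p _)

variable [Fact (3 ≤ n)]

theorem Generic.poleDenAt_ne_zero {k : ZMod n → ℕ} {p : Var n → L} (h : Generic k p) :
    poleDenAt k p ≠ 0 := by
  refine Finset.prod_ne_zero_iff.2 fun i _ => Finset.prod_ne_zero_iff.2 fun r hr =>
    Finset.prod_ne_zero_iff.2 fun s hs => ?_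
  rw [sub_ne_zero]
  intro he
  have := h.injOn (Finset.mem_range.1 hr : (⟨i, r⟩ : Var n) ∈ varSet k)
    (Finset.mem_range.1 hs : (⟨i + 1, s⟩ : Var n) ∈ varSet k) he
  exact add_one_ne i (congrArg Sigma.fst this).symm

theorem exists_numerator {k : ZMod n → ℕ} {F : RatFun (Var n)} (hF : F ∈ shuffleComp k) :
    ∃ (e : ℕ) (P : MvPolynomial (Var n) ℂ), P ∈ MvPolynomial.supported ℂ (varSet k) ∧
      F * poleDen k * (∏ v ∈ block 0 k, rvar v) ^ e = algebraMap _ (RatFun (Var n)) P := by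
  have h := mul_poleDen_mem hF
  rw [← coe_block] at h ⊢
  exact exists_monomial h

theorem Generic.prod_ne_zero {k : ZMod n → ℕ} {p : Var n → L} (h : Generic k p) (e : ℕ) :
    (∏ v ∈ block 0 k, p v) ^ e ≠ 0 :=
  pow_ne_zero _ (Finset.prod_ne_zero_iff.2 fun v hv => h.ne_zero v (by
    rw [← coe_block]; exact hv))

theorem hasEval_of_numerator {k : ZMod n → ℕ} {F : RatFun (Var n)} {e : ℕ}
    {P : MvPolynomial (Var n) ℂ}
    (hP : F * poleDen k * (∏ v ∈ block 0 k, rvar v) ^ e = algebraMap _ (RatFun (Var n)) P)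
    {p : Var n → L} (h : Generic k p) :
    HasEval p F (MvPolynomial.aeval p P / (poleDenAt k p * (∏ v ∈ block 0 k, p v) ^ e)) := by
  have h0 : (∏ v ∈ block 0 k, rvar v : RatFun (Var n)) ^ e ≠ 0 :=
    (generic_rvar k).prod_ne_zero e
  have hF : F = algebraMap _ (RatFun (Var n)) P / (poleDen k * (∏ v ∈ block 0 k, rvar v) ^ e) := by
    rw [eq_div_iff (mul_ne_zero (poleDen_ne_zero k) h0), ← hP, mul_assoc]
  rw [hF]
  exact (HasEval.poly p P).div ((hasEval_poleDen k p).mul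
    ((HasEval.prod _ fun v _ => HasEval.var p v).pow e))
    (mul_ne_zero h.poleDenAt_ne_zero (h.prod_ne_zero e))

theorem hasEval_evalRat {k : ZMod n → ℕ} {F : RatFun (Var n)} (hF : F ∈ shuffleComp k)
    {p : Var n → L} (h : Generic k p) : HasEval p F (evalRat p F) := by
  obtain ⟨e, P, -, hP⟩ := exists_numerator hF
  have := hasEval_of_numerator hP h
  rwa [this.evalRat_eq]

theorem evalRat_congr {k : ZMod n → ℕ} {F : RatFun (Var n)} (hF : F ∈ shuffleComp k)
    {p p' : Var n → L} (h : Generic k p) (hp : ∀ v ∈ varSet k, p v = p' v) :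
    evalRat p F = evalRat p' F := by
  obtain ⟨e, P, hPs, hP⟩ := exists_numerator hF
  have h' : Generic k p' := ⟨fun u hu v hv huv => h.injOn hu hv (by rw [hp u hu, hp v hv, huv]),
    fun v hv => hp v hv ▸ h.ne_zero v hv⟩
  rw [(hasEval_of_numerator hP h).evalRat_eq, (hasEval_of_numerator hP h').evalRat_eq]
  congr 1
  · have : MvPolynomial.supported ℂ (varSet k) ≤
        AlgHom.equalizer (MvPolynomial.aeval p) (MvPolynomial.aeval p') := by
      refine Algebra.adjoin_le ?_
      rintro _ ⟨v, hv, rfl⟩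
      simp [hp v hv]
    exact this hPs
  · congr 1
    · refine Finset.prod_congr rfl fun i _ => Finset.prod_congr rfl fun r hr =>
        Finset.prod_congr rfl fun s hs => ?_
      rw [hp _ (Finset.mem_range.1 hr : (⟨i, r⟩ : Var n) ∈ varSet k),
        hp _ (Finset.mem_range.1 hs : (⟨i + 1, s⟩ : Var n) ∈ varSet k)]
    · congr 1
      refine Finset.prod_congr rfl fun v hv => hp v ?_
      rw [← coe_block]; exact hv

theorem Generic.comp {k l : ZMod n → ℕ} {p : Var n → L} (h : Generic k p) (f : Var n → Var n)
    (hf : Set.InjOn f (varSet l)) (hm : Set.MapsTo f (varSet l) (varSet k)) :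
    Generic l (p ∘ f) :=
  ⟨h.injOn.comp hf hm, fun _ hv => h.ne_zero _ (hm hv)⟩

theorem evalRat_perm {k : ZMod n → ℕ} {F : RatFun (Var n)} (hF : F ∈ shuffleComp k)
    {p : Var n → L} (h : Generic k p) (σ : SymGroup k) :
    evalRat (p ∘ permVar k σ) F = evalRat p F := by
  have h' : Generic k (p ∘ permVar k σ) :=
    h.comp _ (permVar k σ).injective.injOn fun v hv => permVar_mem k σ hv
  have := (hasEval_evalRat hF h').relabel_of_comp _ (permVar k σ).injective
  change HasEval p (symAct k σ F) _ at this
  rw [symAct_of_mem hF] at this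
  exact this.evalRat_eq.symm

theorem hasEval_zeta (q d : ℂˣ) (i j : ZMod n) {p : Var n → L} {u v : Var n} (h : p u ≠ p v) :
    HasEval p (zeta q d i j (rvar u) (rvar v)) (zeta q d i j (p u) (p v)) := by
  have h' := sub_ne_zero.2 h
  have hu := HasEval.var p u
  have hv := HasEval.var p v
  unfold zeta
  split_ifs
  · exact (hu.sub (hv.smul _)).div (hu.sub hv) h'
  · exact ((hu.smul _).sub (hv.smul _)).div (hu.sub hv) h'
  · exact (hu.sub (hv.smul _)).div (hu.sub hv) h'
  · exact HasEval.one p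

/-- The substitution underlying `shift`. -/
def shiftVar (k : ZMod n → ℕ) (v : Var n) : Var n := ⟨v.1, k v.1 + v.2⟩

theorem shiftVar_injective (k : ZMod n → ℕ) : Function.Injective (shiftVar k) := by
  rintro ⟨i, r⟩ ⟨j, s⟩ h
  obtain ⟨rfl, h⟩ := Sigma.mk.inj_iff.1 h
  simpa using h

/-- The value of a shuffle product at a generic point, as a sum over the symmetric group. -/
theorem hasEval_star (q d : ℂˣ) {k l : ZMod n → ℕ} {F G : RatFun (Var n)}
    (hF : F ∈ shuffleComp k) (hG : G ∈ shuffleComp l) {p : Var n → L} (h : Generic (k + l) p) :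
    HasEval p (star q d k l F G) (((multiFactorial k : ℂ) * (multiFactorial l : ℂ))⁻¹ •
      ∑ σ : SymGroup (k + l), evalRat (p ∘ permVar (k + l) σ) F *
        evalRat (p ∘ permVar (k + l) σ ∘ shiftVar k) G *
        ∏ u ∈ block 0 k, ∏ v ∈ block k l, zeta q d u.1 v.1 (p (permVar (k + l) σ u))
          (p (permVar (k + l) σ v))) := by
  unfold star
  refine HasEval.smul _ ?_
  unfold symSum
  refine HasEval.sum _ fun σ _ => ?_
  rw [zetaProd_eq]
  refine HasEval.relabel_of_comp _ (permVar (k + l) σ).injective ?_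
  have h' : Generic (k + l) (p ∘ permVar (k + l) σ) :=
    h.comp _ (permVar _ σ).injective.injOn fun v hv => permVar_mem _ σ hv
  refine ((hasEval_evalRat hF (h'.mono fun i => ?_)).mul ?_).mul ?_
  · exact Nat.le_add_right _ _
  · refine HasEval.relabel_of_comp (shiftVar k) (shiftVar_injective k) ?_
    refine hasEval_evalRat hG (h'.comp _ (shiftVar_injective k).injOn fun v hv => ?_)
    simpa [varSet, shiftVar] using hv
  · refine HasEval.prod _ fun u hu => HasEval.prod _ fun v hv => ?_
    refine hasEval_zeta q d u.1 v.1 ?_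
    rw [mem_block] at hu hv
    simp only [Pi.zero_apply, zero_add] at hu
    refine h'.injOn.ne (x := u) (y := v) ?_ ?_ ?_
    · exact lt_of_lt_of_le hu.2 (Nat.le_add_right _ _)
    · exact hv.2
    · rintro rfl
      omega

end ShuffleEvaluation

/-! evaluation at coloured finite sets of points -/

section Coloured

variable {n : ℕ} [NeZero n] {L : Type} [Field L] [Algebra ℂ L] {ι : Type} [DecidableEq ι]

/-- The variables `x_{i,r}` with `r < k_i`, as a type. -/
abbrev VarIn (k : ZMod n → ℕ) : Type := {v : Var n // v.2 < k v.1}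

/-- The numbers of elements of `T` of each colour. -/
def colourCount (col : ι → ZMod n) (T : Finset ι) (i : ZMod n) : ℕ := (T.filter (col · = i)).card

/-- A colour-preserving enumeration of `T` by the variables `x_{i,r}` with `r < k_i`. -/
structure ColEnum (col : ι → ZMod n) (T : Finset ι) (k : ZMod n → ℕ) where
  /-- The underlying bijection. -/
  equiv : VarIn k ≃ {t // t ∈ T}
  col_eq : ∀ v, col (equiv v) = v.1.1

namespace ColEnum

variable {col : ι → ZMod n} {T : Finset ι} {k l : ZMod n → ℕ} {x : ι → L}

theorem col_symm (e : ColEnum col T k) (t : {t // t ∈ T}) : (e.equiv.symm t).1.1 = col t := by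
  rw [← e.col_eq, Equiv.apply_symm_apply]

/-- The point with coordinates `x`. -/
def point (e : ColEnum col T k) (x : ι → L) (v : Var n) : L :=
  if h : v.2 < k v.1 then x (e.equiv ⟨v, h⟩) else 0

theorem point_of_lt (e : ColEnum col T k) (x : ι → L) (v : VarIn k) :
    e.point x v.1 = x (e.equiv v) := dif_pos v.2

theorem generic (e : ColEnum col T k) (hx : Set.InjOn x T) (h0 : ∀ t ∈ T, x t ≠ 0) :
    Generic k (e.point x) := by
  refine ⟨fun u hu v hv huv => ?_, fun v hv => ?_⟩
  · rw [e.point_of_lt x ⟨u, hu⟩, e.point_of_lt x ⟨v, hv⟩] at huv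
    have := e.equiv.injective (Subtype.ext (hx (e.equiv ⟨u, hu⟩).2 (e.equiv ⟨v, hv⟩).2 huv))
    exact congrArg Subtype.val this
  · rw [e.point_of_lt x ⟨v, hv⟩]
    exact h0 _ (e.equiv ⟨v, hv⟩).2

theorem colourCount_eq (e : ColEnum col T k) : colourCount col T = k := by
  funext i
  rw [← Finset.card_range (k i)]
  symm
  refine Finset.card_bij (fun r hr => (e.equiv ⟨⟨i, r⟩, Finset.mem_range.1 hr⟩).1) ?_ ?_ ?_
  · intro r hr
    rw [Finset.mem_filter]
    exact ⟨(e.equiv _).2, e.col_eq _⟩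
  · intro r hr s hs h
    have := e.equiv.injective (Subtype.ext h)
    simpa using this
  · intro t ht
    obtain ⟨ht, hc⟩ := Finset.mem_filter.1 ht
    have h1 := e.col_symm ⟨t, ht⟩
    have h2 := (e.equiv.symm ⟨t, ht⟩).2
    have h3 : (e.equiv.symm ⟨t, ht⟩).1 = ⟨i, (e.equiv.symm ⟨t, ht⟩).1.2⟩ :=
      Sigma.ext (h1.trans hc) (by simp)
    have h4 : (e.equiv.symm ⟨t, ht⟩).1.2 < k i := by
      have h5 : k (e.equiv.symm ⟨t, ht⟩).1.1 = k i := by rw [h1]; exact congrArg k hc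
      rw [← h5]; exact h2
    refine ⟨_, Finset.mem_range.2 h4, ?_⟩
    have : (⟨⟨i, (e.equiv.symm ⟨t, ht⟩).1.2⟩, h4⟩ : VarIn k) = e.equiv.symm ⟨t, ht⟩ :=
      Subtype.ext h3.symm
    rw [this, Equiv.apply_symm_apply]

theorem exists_enum (col : ι → ZMod n) (T : Finset ι) :
    Nonempty (ColEnum col T (colourCount col T)) := by
  let f : VarIn (colourCount col T) → {t // t ∈ T} := fun v =>
    ⟨((T.filter (col · = v.1.1)).equivFin.symm ⟨v.1.2, v.2⟩).1,
      Finset.mem_of_mem_filter _ (((T.filter (col · = v.1.1)).equivFin.symm ⟨v.1.2, v.2⟩).2)⟩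
  have hf : ∀ v, col (f v) = v.1.1 := fun v =>
    (Finset.mem_filter.1 (((T.filter (col · = v.1.1)).equivFin.symm ⟨v.1.2, v.2⟩).2)).2
  have hb : Function.Bijective f := by
    constructor
    · rintro ⟨⟨i, r⟩, hr⟩ ⟨⟨j, s⟩, hs⟩ h
      have hij : i = j := by
        have := congrArg (fun t => col t.1) h
        simpa only [hf] using this
      subst hij
      have h' := congrArg Subtype.val h
      have := (T.filter (col · = i)).equivFin.symm.injective (Subtype.ext h')
      have := congrArg Fin.val this
      simp only at this
      subst this
      rfl
    · rintro ⟨t, ht⟩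
      have hm : t ∈ T.filter (col · = col t) := Finset.mem_filter.2 ⟨ht, rfl⟩
      refine ⟨⟨⟨col t, ((T.filter (col · = col t)).equivFin ⟨t, hm⟩ : ℕ)⟩, Fin.is_lt _⟩, ?_⟩
      apply Subtype.ext
      simp only [f]
      rw [Equiv.symm_apply_apply]
  exact ⟨⟨Equiv.ofBijective f hb, hf⟩⟩

theorem exists_enum_of_eq (h : colourCount col T = k) : Nonempty (ColEnum col T k) :=
  h ▸ exists_enum col T

theorem permVar_lt_iff (σ : SymGroup k) (v : Var n) :
    (permVar k σ v).2 < k (permVar k σ v).1 ↔ v.2 < k v.1 := by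
  have := permVar_mem_block k σ v
  simpa [mem_block] using this

theorem exists_perm (e e' : ColEnum col T k) : ∃ σ : SymGroup k, ∀ v : VarIn k,
    ∃ h, e'.equiv v = e.equiv ⟨permVar k σ v.1, h⟩ := by
  let τ : Equiv.Perm (VarIn k) := e'.equiv.trans e.equiv.symm
  have h1 : ∀ v : VarIn k, (τ v).1.1 = v.1.1 := by
    intro v
    simp only [τ, Equiv.trans_apply]
    rw [e.col_symm, e'.col_eq]
  obtain ⟨σ, hσ⟩ := exists_permVar k (Equiv.Perm.ofSubtype τ) (by
    intro v
    by_cases hv : v.2 < k v.1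
    · rw [Equiv.Perm.ofSubtype_apply_of_mem τ hv]; exact h1 ⟨v, hv⟩
    · rw [Equiv.Perm.ofSubtype_apply_of_not_mem τ hv]) (by
    intro v hv
    exact Equiv.Perm.ofSubtype_apply_of_not_mem τ (not_lt.2 hv))
  refine ⟨σ, fun v => ?_⟩
  have h2 : permVar k σ v.1 = (τ v).1 := by
    rw [hσ]; exact Equiv.Perm.ofSubtype_apply_of_mem τ v.2
  refine ⟨by rw [h2]; exact (τ v).2, ?_⟩
  have h3 : (⟨permVar k σ v.1, by rw [h2]; exact (τ v).2⟩ : VarIn k) = τ v := Subtype.ext h2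
  rw [h3]
  simp [τ]

variable [Fact (3 ≤ n)]

theorem evalRat_point_eq (e e' : ColEnum col T k) (hx : Set.InjOn x T) (h0 : ∀ t ∈ T, x t ≠ 0)
    {F : RatFun (Var n)} (hF : F ∈ shuffleComp k) :
    evalRat (e.point x) F = evalRat (e'.point x) F := by
  obtain ⟨σ, hσ⟩ := exists_perm e e'
  rw [← evalRat_perm hF (e.generic hx h0) σ]
  symm
  refine evalRat_congr hF (e'.generic hx h0) fun v hv => ?_
  obtain ⟨h, he⟩ := hσ ⟨v, hv⟩
  rw [e'.point_of_lt x ⟨v, hv⟩, he, Function.comp_apply, e.point_of_lt x ⟨_, h⟩]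

/-- Enumerations composed with permutations. -/
def perm (e : ColEnum col T k) (σ : SymGroup k) : ColEnum col T k where
  equiv := (Equiv.subtypeEquiv (permVar k σ) (fun v => (permVar_lt_iff σ v).symm)).trans e.equiv
  col_eq v := e.col_eq ⟨permVar k σ v.1, (permVar_lt_iff σ v.1).2 v.2⟩

theorem perm_point (e : ColEnum col T k) (σ : SymGroup k) (v : VarIn k) :
    (e.perm σ).point x v.1 = e.point x (permVar k σ v.1) := by
  rw [point_of_lt]
  exact (e.point_of_lt x ⟨permVar k σ v.1, permVar_mem k σ v.2⟩).symm

/-- The elements enumerated by the variables `x_{i,r}` with `r < k_i`. -/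
def head (k : ZMod n → ℕ) (e : ColEnum col T (k + l)) : Finset ι :=
  T.attach.filter (fun t => (e.equiv.symm t).1.2 < k (col t)) |>.map (Function.Embedding.subtype _)

theorem mem_head (e : ColEnum col T (k + l)) (t : {t // t ∈ T}) :
    t.1 ∈ e.head k ↔ (e.equiv.symm t).1.2 < k (col t) := by
  simp [head]

theorem equiv_mem_head (e : ColEnum col T (k + l)) (v : VarIn (k + l)) :
    (e.equiv v).1 ∈ e.head k ↔ v.1.2 < k v.1.1 := by
  rw [mem_head, Equiv.symm_apply_apply, e.col_eq]

theorem head_subset (e : ColEnum col T (k + l)) : e.head k ⊆ T := by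
  intro t ht
  simp only [head, Finset.mem_map, Finset.mem_filter] at ht
  obtain ⟨t, -, rfl⟩ := ht
  exact t.2

/-- The enumeration of the head. -/
def headEnum (e : ColEnum col T (k + l)) : ColEnum col (e.head k) k where
  equiv := Equiv.ofBijective (fun v => ⟨(e.equiv ⟨v.1, lt_of_lt_of_le v.2 (Nat.le_add_right _ _)⟩).1,
      (e.equiv_mem_head _).2 v.2⟩) (by
    constructor
    · intro u v h
      have h' := congrArg Subtype.val h
      have := e.equiv.injective (Subtype.ext h')
      exact Subtype.ext (by simpa using this)
    · rintro ⟨t, ht⟩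
      have ht' := e.head_subset ht
      have h1 := (e.mem_head ⟨t, ht'⟩).1 ht
      refine ⟨⟨(e.equiv.symm ⟨t, ht'⟩).1, by rw [e.col_symm]; exact h1⟩, ?_⟩
      apply Subtype.ext
      simp)
  col_eq v := e.col_eq _

theorem headEnum_point (e : ColEnum col T (k + l)) {v : Var n} (hv : v.2 < k v.1) :
    e.headEnum.point x v = e.point x v := by
  rw [point_of_lt e.headEnum x ⟨v, hv⟩,
    point_of_lt e x ⟨v, lt_of_lt_of_le hv (Nat.le_add_right _ _)⟩]
  rfl

/-- The enumeration of the complement of the head. -/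
def tailEnum (e : ColEnum col T (k + l)) : ColEnum col (T \ e.head k) l where
  equiv := Equiv.ofBijective (fun v => ⟨(e.equiv ⟨shiftVar k v.1, Nat.add_lt_add_left v.2 _⟩).1,
      Finset.mem_sdiff.2 ⟨(e.equiv _).2, by
        rw [equiv_mem_head]; simp [shiftVar]⟩⟩) (by
    constructor
    · intro u v h
      have h' := congrArg Subtype.val h
      have := e.equiv.injective (Subtype.ext h')
      exact Subtype.ext (shiftVar_injective k (congrArg (fun w : VarIn (k + l) => w.1) this))
    · rintro ⟨t, ht⟩
      obtain ⟨ht', hn⟩ := Finset.mem_sdiff.1 ht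
      rw [e.mem_head ⟨t, ht'⟩, ← e.col_symm, not_lt] at hn
      have h2 := (e.equiv.symm ⟨t, ht'⟩).2
      have h3 : shiftVar k ⟨(e.equiv.symm ⟨t, ht'⟩).1.1, (e.equiv.symm ⟨t, ht'⟩).1.2
          - k (e.equiv.symm ⟨t, ht'⟩).1.1⟩ = (e.equiv.symm ⟨t, ht'⟩).1 := by
        refine Sigma.ext rfl (heq_of_eq ?_)
        simp only [shiftVar]
        omega
      refine ⟨⟨⟨(e.equiv.symm ⟨t, ht'⟩).1.1, (e.equiv.symm ⟨t, ht'⟩).1.2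
          - k (e.equiv.symm ⟨t, ht'⟩).1.1⟩, ?_⟩, ?_⟩
      · simp only [Pi.add_apply] at h2
        simp only
        omega
      · apply Subtype.ext
        simp only [h3]
        simp)
  col_eq v := e.col_eq _

theorem tailEnum_point (e : ColEnum col T (k + l)) {v : Var n} (hv : v.2 < l v.1) :
    e.tailEnum.point x v = e.point x (shiftVar k v) := by
  rw [point_of_lt e.tailEnum x ⟨v, hv⟩,
    point_of_lt e x ⟨shiftVar k v, Nat.add_lt_add_left hv _⟩]
  rfl

theorem exists_head_eq {A : Finset ι} (hA : A ⊆ T) (e : ColEnum col T (k + l))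
    (hk : colourCount col A = k) : ∃ σ, (e.perm σ).head k = A := by
  classical
  have hT := e.colourCount_eq
  have hl : colourCount col (T \ A) = l := by
    funext i
    have h1 := congrFun hT i
    have h2 := congrFun hk i
    simp only [Pi.add_apply, colourCount] at h1 h2 ⊢
    rw [← Finset.sdiff_union_of_subset hA, Finset.filter_union, Finset.card_union_of_disjoint] at h1
    · omega
    · exact Finset.disjoint_filter_filter (Finset.sdiff_disjoint)
  obtain ⟨a⟩ := exists_enum_of_eq hk
  obtain ⟨b⟩ := exists_enum_of_eq hl
  let f : VarIn (k + l) → {t // t ∈ T} := fun v =>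
    if h : v.1.2 < k v.1.1 then ⟨(a.equiv ⟨v.1, h⟩).1, hA (a.equiv ⟨v.1, h⟩).2⟩
    else ⟨(b.equiv ⟨⟨v.1.1, v.1.2 - k v.1.1⟩, by
      have := v.2; simp only [Pi.add_apply] at this; simp only; omega⟩).1,
      (Finset.mem_sdiff.1 (b.equiv _).2).1⟩
  have hf1 : ∀ v (h : v.1.2 < k v.1.1), (f v).1 = (a.equiv ⟨v.1, h⟩).1 := fun v h => by
    simp only [f, dif_pos h]
  have hf2 : ∀ (v : VarIn l), (f ⟨shiftVar k v.1, Nat.add_lt_add_left v.2 _⟩).1 = (b.equiv v).1 := by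
    intro v
    have h : ¬ (shiftVar k v.1).2 < k (shiftVar k v.1).1 := by simp [shiftVar]
    simp only [f, dif_neg h]
    congr 2
    apply Subtype.ext
    refine Sigma.ext rfl (heq_of_eq ?_)
    simp [shiftVar]
  have hf2' : ∀ v : VarIn (k + l), ¬ v.1.2 < k v.1.1 →
      ∃ u : VarIn l, v = ⟨shiftVar k u.1, Nat.add_lt_add_left u.2 _⟩ := by
    intro v hv
    have := v.2
    simp only [Pi.add_apply] at this
    refine ⟨⟨⟨v.1.1, v.1.2 - k v.1.1⟩, by simp only; omega⟩, Subtype.ext ?_⟩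
    refine Sigma.ext rfl (heq_of_eq ?_)
    simp only [shiftVar]
    omega
  have hfA : ∀ v, (f v).1 ∈ A ↔ v.1.2 < k v.1.1 := by
    intro v
    by_cases h : v.1.2 < k v.1.1
    · simp only [h, iff_true, hf1 v h]; exact (a.equiv _).2
    · obtain ⟨u, rfl⟩ := hf2' v h
      simp only [h, iff_false, hf2 u]
      exact (Finset.mem_sdiff.1 (b.equiv _).2).2
  have hb : Function.Bijective f := by
    constructor
    · intro u v huv
      have huv1 := congrArg Subtype.val huv
      have hi : u.1.2 < k u.1.1 ↔ v.1.2 < k v.1.1 := by rw [← hfA, ← hfA, huv]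
      by_cases hu : u.1.2 < k u.1.1
      · rw [hf1 u hu, hf1 v (hi.1 hu)] at huv1
        have := a.equiv.injective (Subtype.ext huv1)
        exact Subtype.ext (by simpa using this)
      · obtain ⟨u', rfl⟩ := hf2' u hu
        obtain ⟨v', rfl⟩ := hf2' v (fun h => hu (hi.2 h))
        rw [hf2, hf2] at huv1
        have := b.equiv.injective (Subtype.ext huv1)
        rw [this]
    · rintro ⟨t, ht⟩
      by_cases htA : t ∈ A
      · refine ⟨⟨(a.equiv.symm ⟨t, htA⟩).1, lt_of_lt_of_le (a.equiv.symm ⟨t, htA⟩).2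
          (Nat.le_add_right _ _)⟩, Subtype.ext ?_⟩
        rw [hf1 _ (a.equiv.symm ⟨t, htA⟩).2]
        simp
      · have hts : t ∈ T \ A := Finset.mem_sdiff.2 ⟨ht, htA⟩
        refine ⟨⟨shiftVar k (b.equiv.symm ⟨t, hts⟩).1,
          Nat.add_lt_add_left (b.equiv.symm ⟨t, hts⟩).2 _⟩, Subtype.ext ?_⟩
        rw [hf2]
        simp
  let e' : ColEnum col T (k + l) := ⟨Equiv.ofBijective f hb, by
    intro v
    change col (f v).1 = _
    by_cases h : v.1.2 < k v.1.1
    · rw [hf1 v h]; exact a.col_eq _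
    · obtain ⟨u, rfl⟩ := hf2' v h
      rw [hf2]; exact b.col_eq _⟩
  obtain ⟨σ, hσ⟩ := exists_perm e e'
  refine ⟨σ, ?_⟩
  have h1 : ∀ v, (e.perm σ).equiv v = f v := by
    intro v
    obtain ⟨h, h'⟩ := hσ v
    exact h'.symm
  ext t
  constructor
  · intro ht
    have htT := (e.perm σ).head_subset ht
    obtain ⟨v, hv⟩ := (e.perm σ).equiv.surjective ⟨t, htT⟩
    have h2 : ((e.perm σ).equiv v).1 = t := congrArg Subtype.val hv
    rw [← h2, equiv_mem_head] at ht
    rw [← h2, h1]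
    exact (hfA v).2 ht
  · intro ht
    obtain ⟨v, hv⟩ := (e.perm σ).equiv.surjective ⟨t, hA ht⟩
    have h2 : ((e.perm σ).equiv v).1 = t := congrArg Subtype.val hv
    rw [← h2, h1, hfA] at ht
    rw [← h2, equiv_mem_head]
    exact ht

theorem perm_equiv_mk (e : ColEnum col T (k + l)) (σ : SymGroup (k + l)) (i : ZMod n)
    (r : Fin ((k + l) i)) :
    (e.perm σ).equiv ⟨⟨i, r⟩, r.2⟩ = e.equiv ⟨⟨i, σ i r⟩, (σ i r).2⟩ := by
  refine congrArg e.equiv (Subtype.ext ?_)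
  exact permVar_lt (k + l) σ i r

theorem head_perm_eq_iff (e : ColEnum col T (k + l)) (σ τ : SymGroup (k + l)) :
    (e.perm σ).head k = (e.perm τ).head k ↔
      ∀ i (r : Fin ((k + l) i)), ((σ i)⁻¹ (τ i r) : ℕ) < k i ↔ (r : ℕ) < k i := by
  have key : ∀ (σ : SymGroup (k + l)) i (r : Fin ((k + l) i)),
      (e.equiv ⟨⟨i, σ i r⟩, (σ i r).2⟩).1 ∈ (e.perm σ).head k ↔ (r : ℕ) < k i := by
    intro σ i r
    rw [← perm_equiv_mk, equiv_mem_head]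
  constructor
  · intro h i r
    rw [← key τ i r, ← h, ← key σ i ((σ i)⁻¹ (τ i r))]
    simp
  · intro h
    ext t
    by_cases ht : t ∈ T
    swap
    · exact ⟨fun h => absurd (head_subset _ h) ht, fun h => absurd (head_subset _ h) ht⟩
    obtain ⟨⟨⟨i, r⟩, hr⟩, hv⟩ := (e.perm τ).equiv.surjective ⟨t, ht⟩
    have h2 := congrArg Subtype.val hv
    simp only at h2
    rw [perm_equiv_mk e τ i ⟨r, hr⟩] at h2
    rw [← h2, key τ i ⟨r, hr⟩, ← h i ⟨r, hr⟩, ← key σ i]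
    simp

theorem card_fiber (e : ColEnum col T (k + l)) (τ : SymGroup (k + l)) :
    (Finset.univ.filter fun σ => (e.perm σ).head k = (e.perm τ).head k).card
      = multiFactorial k * multiFactorial l := by
  classical
  have h1 : ∀ σ : SymGroup (k + l), ((e.perm σ).head k = (e.perm τ).head k) ↔
      ∀ i, (fun r : Fin ((k + l) i) => decide ((r : ℕ) < k i)) ∘ ((σ i)⁻¹ * τ i)
        = fun r : Fin ((k + l) i) => decide ((r : ℕ) < k i) := by
    intro σ
    rw [head_perm_eq_iff]
    refine forall_congr' fun i => ?_
    rw [funext_iff]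
    refine forall_congr' fun r => ?_
    simp
  rw [← Fintype.card_subtype]
  have e1 : {σ : SymGroup (k + l) // (e.perm σ).head k = (e.perm τ).head k} ≃
      {h : SymGroup (k + l) // ∀ i, (fun r : Fin ((k + l) i) => decide ((r : ℕ) < k i)) ∘ (h i)
        = fun r : Fin ((k + l) i) => decide ((r : ℕ) < k i)} :=
    Equiv.subtypeEquiv ((Equiv.inv _).trans (Equiv.mulRight τ)) h1
  rw [Fintype.card_congr (e1.trans (Equiv.subtypePiEquivPi (p := fun i (h : Equiv.Perm (Fin ((k + l) i))) =>
    (fun r : Fin ((k + l) i) => decide ((r : ℕ) < k i)) ∘ h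
      = fun r : Fin ((k + l) i) => decide ((r : ℕ) < k i)))), Fintype.card_pi]
  unfold multiFactorial
  rw [← Finset.prod_mul_distrib]
  refine Finset.prod_congr rfl fun i _ => ?_
  rw [DomMulAct.stabilizer_card, Fintype.prod_bool]
  congr 2
  · simp only [decide_eq_true_eq]
    rw [Fintype.card_subtype]
    have : Finset.univ.filter (fun r : Fin ((k + l) i) => (r : ℕ) < k i)
        = Finset.univ.map (Fin.castLEEmb (Nat.le_add_right (k i) (l i))) := by
      ext r
      simp only [Finset.mem_filter, Finset.mem_univ, true_and, Finset.mem_map]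
      constructor
      · intro h; exact ⟨⟨r, h⟩, rfl⟩
      · rintro ⟨s, rfl⟩; exact s.2
    rw [this, Finset.card_map, Finset.card_univ, Fintype.card_fin]
  · simp only [decide_eq_false_iff_not]
    rw [Fintype.card_subtype]
    have : Finset.univ.filter (fun r : Fin ((k + l) i) => ¬ (r : ℕ) < k i)
        = Finset.univ.map (Fin.natAddEmb (k i) : Fin (l i) ↪ Fin (k i + l i)) := by
      ext r
      simp only [Finset.mem_filter, Finset.mem_univ, true_and, Finset.mem_map]
      constructor
      · intro h
        have := r.2
        simp only [Pi.add_apply] at this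
        refine ⟨⟨r - k i, by omega⟩, Fin.ext ?_⟩
        change k i + (r - k i) = (r : ℕ)
        omega
      · rintro ⟨s, rfl⟩; simp
    rw [this, Finset.card_map, Finset.card_univ, Fintype.card_fin]

end ColEnum

end Coloured

section ValueAt

variable {n : ℕ} [NeZero n] [Fact (3 ≤ n)] {q d : ℂˣ} {L : Type} [Field L] [Algebra ℂ L]
  {ι : Type} [DecidableEq ι]

/-- The value of an element of the shuffle algebra at a finite set of coloured points. -/
def valueAt (col : ι → ZMod n) (x : ι → L) (T : Finset ι) (E : Shuffle (n := n) q d) : L :=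
  evalRat ((Classical.choice (ColEnum.exists_enum col T)).point x) (E (colourCount col T)).val

variable {col : ι → ZMod n} {x : ι → L} {T : Finset ι}

theorem valueAt_eq {k : ZMod n → ℕ} (e : ColEnum col T k) (hx : Set.InjOn x T)
    (h0 : ∀ t ∈ T, x t ≠ 0) (E : Shuffle (n := n) q d) :
    valueAt col x T E = evalRat (e.point x) (E k).val := by
  obtain rfl := e.colourCount_eq
  exact ColEnum.evalRat_point_eq _ _ hx h0 (E _).2

theorem ShuffleComp.val_mem {k : ZMod n → ℕ} (F : ShuffleComp q d k) : F.val ∈ shuffleComp k := F.2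

theorem evalRat_add {k : ZMod n → ℕ} {p : Var n → L} (h : Generic k p) {F G : RatFun (Var n)}
    (hF : F ∈ shuffleComp k) (hG : G ∈ shuffleComp k) :
    evalRat p (F + G) = evalRat p F + evalRat p G :=
  ((hasEval_evalRat hF h).add (hasEval_evalRat hG h)).evalRat_eq

theorem evalRat_smul {k : ZMod n → ℕ} {p : Var n → L} (h : Generic k p) {F : RatFun (Var n)}
    (hF : F ∈ shuffleComp k) (c : ℂ) : evalRat p (c • F) = c • evalRat p F :=
  ((hasEval_evalRat hF h).smul c).evalRat_eq

theorem valueAt_add (hx : Set.InjOn x T) (h0 : ∀ t ∈ T, x t ≠ 0) (E F : Shuffle (n := n) q d) :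
    valueAt col x T (E + F) = valueAt col x T E + valueAt col x T F :=
  evalRat_add (ColEnum.generic _ hx h0) (E _).2 (F _).2

theorem valueAt_smul (hx : Set.InjOn x T) (h0 : ∀ t ∈ T, x t ≠ 0) (c : ℂ)
    (E : Shuffle (n := n) q d) : valueAt col x T (c • E) = c • valueAt col x T E :=
  evalRat_smul (ColEnum.generic _ hx h0) (E _).2 c

theorem evalRat_zero {X : Type} (p : X → L) : evalRat p 0 = 0 := (HasEval.zero p).evalRat_eq

theorem valueAt_zero : valueAt col x T (0 : Shuffle (n := n) q d) = 0 := evalRat_zero _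

theorem valueAt_of_ne {k : ZMod n → ℕ} (h : colourCount col T ≠ k) (F : ShuffleComp q d k) :
    valueAt col x T (DirectSum.of (ShuffleComp q d) k F) = 0 := by
  unfold valueAt
  rw [DirectSum.of_eq_of_ne _ _ _ h]
  exact evalRat_zero _

theorem valueAt_of {k : ZMod n → ℕ} (e : ColEnum col T k) (hx : Set.InjOn x T)
    (h0 : ∀ t ∈ T, x t ≠ 0) (F : ShuffleComp q d k) :
    valueAt col x T (DirectSum.of (ShuffleComp q d) k F) = evalRat (e.point x) F.val := by
  rw [valueAt_eq e hx h0, DirectSum.of_eq_same]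

/-- The product of the factors `ζ` over the pairs in `A × B`. -/
def zetaCross (q d : ℂˣ) (col : ι → ZMod n) (x : ι → L) (A B : Finset ι) : L :=
  ∏ a ∈ A, ∏ b ∈ B, zeta q d (col a) (col b) (x a) (x b)

theorem prod_head {M : Type*} [CommMonoid M] {k l : ZMod n → ℕ} (e : ColEnum col T (k + l))
    (f : ZMod n → L → M) :
    ∏ u ∈ block 0 k, f u.1 (e.point x u) = ∏ a ∈ e.head k, f (col a) (x a) := by
  refine Finset.prod_bij (fun u hu => (e.headEnum.equiv ⟨u, ?_⟩).1) ?_ ?_ ?_ ?_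
  · simpa [mem_block] using hu
  · intro u hu; exact (e.headEnum.equiv _).2
  · intro u hu v hv h
    have := e.headEnum.equiv.injective (Subtype.ext h)
    simpa using this
  · intro a ha
    refine ⟨(e.headEnum.equiv.symm ⟨a, ha⟩).1, ?_, by simp⟩
    have := (e.headEnum.equiv.symm ⟨a, ha⟩).2
    simpa [mem_block] using this
  · intro u hu
    have hu' : u.2 < k u.1 := by simpa [mem_block] using hu
    rw [e.headEnum.col_eq, ← e.headEnum_point hu', e.headEnum.point_of_lt x ⟨u, hu'⟩]

theorem prod_tail {M : Type*} [CommMonoid M] {k l : ZMod n → ℕ} (e : ColEnum col T (k + l))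
    (f : ZMod n → L → M) :
    ∏ u ∈ block k l, f u.1 (e.point x u) = ∏ a ∈ T \ e.head k, f (col a) (x a) := by
  symm
  refine Finset.prod_bij (fun a ha => shiftVar k (e.tailEnum.equiv.symm ⟨a, ha⟩).1) ?_ ?_ ?_ ?_
  · intro a ha
    have := (e.tailEnum.equiv.symm ⟨a, ha⟩).2
    simp only [mem_block, shiftVar]
    omega
  · intro a ha b hb h
    have := e.tailEnum.equiv.symm.injective (Subtype.ext (shiftVar_injective k h))
    exact congrArg Subtype.val this
  · intro v hv
    rw [mem_block] at hv
    have hs : shiftVar k ⟨v.1, v.2 - k v.1⟩ = v := by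
      refine Sigma.ext rfl (heq_of_eq ?_)
      simp only [shiftVar]
      omega
    have hl : (⟨v.1, v.2 - k v.1⟩ : Var n).2 < l (⟨v.1, v.2 - k v.1⟩ : Var n).1 := by
      simp only; omega
    refine ⟨(e.tailEnum.equiv ⟨_, hl⟩).1, (e.tailEnum.equiv ⟨_, hl⟩).2, ?_⟩
    simp [hs]
  · intro a ha
    rw [← e.tailEnum_point (e.tailEnum.equiv.symm ⟨a, ha⟩).2,
      e.tailEnum.point_of_lt x (e.tailEnum.equiv.symm ⟨a, ha⟩), Equiv.apply_symm_apply]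
    have := e.tailEnum.col_symm ⟨a, ha⟩
    change f (col a) (x a) = f (e.tailEnum.equiv.symm ⟨a, ha⟩).1.1 (x a)
    rw [this]

theorem evalRat_star (hx : Set.InjOn x T) (h0 : ∀ t ∈ T, x t ≠ 0) {k l : ZMod n → ℕ}
    (e : ColEnum col T (k + l)) (F : ShuffleComp q d k) (G : ShuffleComp q d l) :
    evalRat (e.point x) (star q d k l F.val G.val) =
      ∑ A ∈ T.powerset, valueAt col x A (DirectSum.of (ShuffleComp q d) k F) *
        valueAt col x (T \ A) (DirectSum.of (ShuffleComp q d) l G) *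
        zetaCross q d col x A (T \ A) := by
  classical
  set g : Finset ι → L := fun A => valueAt col x A (DirectSum.of (ShuffleComp q d) k F) *
        valueAt col x (T \ A) (DirectSum.of (ShuffleComp q d) l G) *
        zetaCross q d col x A (T \ A) with hg
  rw [(hasEval_star q d F.val_mem G.val_mem (e.generic hx h0)).evalRat_eq]
  have hterm : ∀ σ : SymGroup (k + l),
      evalRat (e.point x ∘ permVar (k + l) σ) F.val *
        evalRat (e.point x ∘ permVar (k + l) σ ∘ shiftVar k) G.val *
        ∏ u ∈ block 0 k, ∏ v ∈ block k l, zeta q d u.1 v.1 (e.point x (permVar (k + l) σ u))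
          (e.point x (permVar (k + l) σ v)) = g ((e.perm σ).head k) := by
    intro σ
    have hxA : Set.InjOn x ((e.perm σ).head k) := hx.mono (e.perm σ).head_subset
    have h0A : ∀ t ∈ (e.perm σ).head k, x t ≠ 0 := fun t ht => h0 t ((e.perm σ).head_subset ht)
    have hxB : Set.InjOn x (T \ (e.perm σ).head k : Finset ι) := hx.mono Finset.sdiff_subset
    have h0B : ∀ t ∈ T \ (e.perm σ).head k, x t ≠ 0 :=
      fun t ht => h0 t (Finset.sdiff_subset ht)
    simp only [hg]
    congr 1
    · congr 1
      · rw [valueAt_of (e.perm σ).headEnum hxA h0A]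
        symm
        refine evalRat_congr F.val_mem ((e.perm σ).headEnum.generic hxA h0A) fun v hv => ?_
        rw [(e.perm σ).headEnum_point hv]
        exact e.perm_point σ ⟨v, lt_of_lt_of_le hv (Nat.le_add_right _ _)⟩
      · rw [valueAt_of (e.perm σ).tailEnum hxB h0B]
        symm
        refine evalRat_congr G.val_mem ((e.perm σ).tailEnum.generic hxB h0B) fun v hv => ?_
        rw [(e.perm σ).tailEnum_point hv]
        exact e.perm_point σ ⟨shiftVar k v, Nat.add_lt_add_left hv _⟩
    · rw [zetaCross, ← prod_head (x := x) (e.perm σ) (fun i a => ∏ b ∈ T \ (e.perm σ).head k,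
        zeta q d i (col b) a (x b))]
      refine Finset.prod_congr rfl fun u hu => ?_
      rw [← prod_tail (x := x) (e.perm σ) (fun j b => zeta q d u.1 j ((e.perm σ).point x u) b)]
      refine Finset.prod_congr rfl fun v hv => ?_
      rw [mem_block] at hu hv
      simp only [Pi.zero_apply, zero_add] at hu
      rw [e.perm_point σ ⟨u, lt_of_lt_of_le hu.2 (Nat.le_add_right _ _)⟩,
        e.perm_point σ ⟨v, hv.2⟩]
  rw [Finset.sum_congr rfl fun σ _ => hterm σ]
  have hmaps : ∀ σ ∈ (Finset.univ : Finset (SymGroup (k + l))),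
      (e.perm σ).head k ∈ T.powerset.filter fun A => colourCount col A = k := fun σ _ =>
    Finset.mem_filter.2 ⟨Finset.mem_powerset.2 (e.perm σ).head_subset,
      (e.perm σ).headEnum.colourCount_eq⟩
  rw [← Finset.sum_fiberwise_of_maps_to hmaps]
  have hfib : ∀ A ∈ T.powerset.filter fun A => colourCount col A = k,
      (∑ σ with (e.perm σ).head k = A, g ((e.perm σ).head k))
        = ((multiFactorial k * multiFactorial l : ℕ) : ℂ) • g A := by
    intro A hA
    obtain ⟨hA, hk⟩ := Finset.mem_filter.1 hA
    obtain ⟨τ, rfl⟩ := ColEnum.exists_head_eq (Finset.mem_powerset.1 hA) e hk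
    rw [Finset.sum_congr rfl (g := fun _ => g ((e.perm τ).head k)), Finset.sum_const,
      e.card_fiber τ, Nat.cast_smul_eq_nsmul]
    intro σ hσ
    rw [(Finset.mem_filter.1 hσ).2]
  rw [Finset.sum_congr rfl hfib, ← Finset.smul_sum, smul_smul]
  have : ((multiFactorial k : ℂ) * (multiFactorial l : ℂ))⁻¹ *
      ((multiFactorial k * multiFactorial l : ℕ) : ℂ) = 1 := by
    push_cast
    exact inv_mul_cancel₀ (mul_ne_zero (multiFactorial_ne_zero k) (multiFactorial_ne_zero l))
  rw [this, one_smul, Finset.sum_filter]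
  refine Finset.sum_congr rfl fun A _ => ?_
  split_ifs with h
  · rfl
  · simp only [hg, valueAt_of_ne h, zero_mul]

theorem colourCount_add {A : Finset ι} (hA : A ⊆ T) :
    colourCount col A + colourCount col (T \ A) = colourCount col T := by
  funext i
  simp only [Pi.add_apply, colourCount]
  conv_rhs => rw [← Finset.sdiff_union_of_subset hA, Finset.filter_union,
    Finset.card_union_of_disjoint (Finset.disjoint_filter_filter Finset.sdiff_disjoint)]
  exact add_comm _ _

/-- The values of a shuffle product. -/
theorem valueAt_mul (hx : Set.InjOn x T) (h0 : ∀ t ∈ T, x t ≠ 0) (E F : Shuffle (n := n) q d) :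
    valueAt col x T (E * F) = ∑ A ∈ T.powerset, valueAt col x A E * valueAt col x (T \ A) F *
      zetaCross q d col x A (T \ A) := by
  have hxA : ∀ A ∈ T.powerset, Set.InjOn x A ∧ ∀ t ∈ A, x t ≠ 0 := fun A hA =>
    ⟨hx.mono (Finset.mem_powerset.1 hA), fun t ht => h0 t (Finset.mem_powerset.1 hA ht)⟩
  have hxB : ∀ A : Finset ι, Set.InjOn x (T \ A : Finset ι) ∧ ∀ t ∈ T \ A, x t ≠ 0 := fun A =>
    ⟨hx.mono Finset.sdiff_subset, fun t ht => h0 t (Finset.sdiff_subset ht)⟩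
  induction E using DirectSum.induction_on with
  | zero => simp [valueAt_zero]
  | add E E' hE hE' =>
    rw [add_mul, valueAt_add hx h0, hE, hE', ← Finset.sum_add_distrib]
    refine Finset.sum_congr rfl fun A hA => ?_
    rw [valueAt_add (hxA A hA).1 (hxA A hA).2]; ring
  | of k E =>
    induction F using DirectSum.induction_on with
    | zero => simp [valueAt_zero]
    | add F F' hF hF' =>
      rw [mul_add, valueAt_add hx h0, hF, hF', ← Finset.sum_add_distrib]
      refine Finset.sum_congr rfl fun A hA => ?_
      rw [valueAt_add (hxB A).1 (hxB A).2]; ring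
    | of l F =>
      rw [DirectSum.of_mul_of]
      by_cases h : colourCount col T = k + l
      · obtain ⟨e⟩ := ColEnum.exists_enum_of_eq h
        rw [valueAt_of e hx h0]
        exact evalRat_star hx h0 e E F
      · rw [valueAt_of_ne h]
        symm
        refine Finset.sum_eq_zero fun A hA => ?_
        by_cases hk : colourCount col A = k
        · have hl : colourCount col (T \ A) ≠ l := by
            rintro rfl
            apply h
            rw [← hk, colourCount_add (Finset.mem_powerset.1 hA)]
          rw [valueAt_of_ne hl]; ring
        · rw [valueAt_of_ne hk]; ring

/-- An element of the shuffle algebra is determined by its values. -/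
theorem shuffle_ext {E F : Shuffle (n := n) q d}
    (h : ∀ T : Finset (Var n), valueAt Sigma.fst rvar T E = valueAt Sigma.fst rvar T F) : E = F := by
  refine DFinsupp.ext fun k => Subtype.ext ?_
  let e : ColEnum (Sigma.fst : Var n → ZMod n) (block 0 k) k :=
    ⟨Equiv.subtypeEquivRight fun v => by simp [mem_block], fun v => rfl⟩
  have hx : Set.InjOn rvar ((block 0 k : Finset (Var n)) : Set (Var n)) := rvar_injective.injOn
  have h1 := h (block 0 k)
  rw [valueAt_eq e hx (fun t _ => rvar_ne_zero t), valueAt_eq e hx (fun t _ => rvar_ne_zero t)] at h1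
  have h2 : ∀ G : ShuffleComp q d k, evalRat (e.point rvar) G.val = G.val := by
    intro G
    rw [evalRat_congr G.val_mem (e.generic hx (fun t _ => rvar_ne_zero t)) (p' := rvar)]
    · exact (HasEval.self _).evalRat_eq
    · intro v hv
      rw [e.point_of_lt rvar ⟨v, hv⟩]
      rfl
  rw [h2, h2] at h1
  exact h1

end ValueAt

/-! difference operators -/

section DiffOpBasics

variable {n : ℕ} [NeZero n] {q d : ℂˣ} {a : ZMod n → ℕ}

theorem func_mul (x y : WField a) : func q a (x * y) = func q a x * func q a y := by
  refine Eq.trans ?_ (SkewMonoidAlgebra.single_mul_single (a₁ := (1 : ShiftGroup q a)) (a₂ := 1)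
    (b₁ := x) (b₂ := y)).symm
  rw [one_smul, one_mul]
  rfl

theorem func_add (x y : WField a) : func q a (x + y) = func q a x + func q a y :=
  SkewMonoidAlgebra.single_add _ _ _

theorem func_zero : func q a 0 = 0 := SkewMonoidAlgebra.single_zero _

theorem func_one : func q a 1 = 1 := rfl

theorem func_smul (c : ℂ) (x : WField a) : func q a (c • x) = c • func q a x :=
  (SkewMonoidAlgebra.smul_single c (1 : ShiftGroup q a) x).symm

variable (q a) in
/-- Multiplication operators, as an algebra homomorphism. -/
def funcHom : WField a →ₐ[ℂ] DiffOp q a where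
  toFun := func q a
  map_one' := func_one
  map_mul' := func_mul
  map_zero' := func_zero
  map_add' := func_add
  commutes' c := by
    rw [Algebra.algebraMap_eq_smul_one, func_smul, func_one, Algebra.algebraMap_eq_smul_one]

theorem func_sum {ι : Type*} (s : Finset ι) (f : ι → WField a) :
    func q a (∑ i ∈ s, f i) = ∑ i ∈ s, func q a (f i) := map_sum (funcHom q a) f s

theorem func_sub (x y : WField a) : func q a (x - y) = func q a x - func q a y :=
  map_sub (funcHom q a) x y

theorem Dmon_add (m m' : WVar a → ℤ) : Dmon q a (m + m') = Dmon q a m * Dmon q a m' := by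
  refine Eq.trans ?_ (SkewMonoidAlgebra.single_mul_single (a₁ := ShiftGroup.ofExp q m)
    (a₂ := ShiftGroup.ofExp q m') (b₁ := (1 : WField a)) (b₂ := (1 : WField a))).symm
  rw [smul_one, one_mul]
  rfl

theorem Dmon_zero : Dmon q a 0 = 1 := rfl

theorem Dmon_mul_func (m : WVar a → ℤ) (x : WField a) :
    Dmon q a m * func q a x = func q a (scaleHom q m x) * Dmon q a m := by
  refine (SkewMonoidAlgebra.single_mul_single (a₁ := ShiftGroup.ofExp q m)
    (a₂ := (1 : ShiftGroup q a)) (b₁ := 1) (b₂ := x)).trans ?_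
  refine Eq.trans ?_ (SkewMonoidAlgebra.single_mul_single (a₁ := (1 : ShiftGroup q a))
    (a₂ := ShiftGroup.ofExp q m) (b₁ := scaleHom q m x) (b₂ := 1)).symm
  rw [one_mul, mul_one, one_mul, smul_one, mul_one]
  rfl

/-- The operator `c ∏ D_{i,r}^{m_{i,r}}`. -/
def term (q : ℂˣ) (m : WVar a → ℤ) (c : WField a) : DiffOp q a := func q a c * Dmon q a m

theorem term_mul_term (m m' : WVar a → ℤ) (c c' : WField a) :
    term q m c * term q m' c' = term q (m + m') (c * scaleHom q m c') := by
  unfold term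
  rw [mul_assoc, ← mul_assoc (Dmon q a m), Dmon_mul_func, func_mul, Dmon_add]
  simp only [mul_assoc]

theorem term_add (m : WVar a → ℤ) (c c' : WField a) :
    term q m (c + c') = term q m c + term q m c' := by
  unfold term; rw [func_add, add_mul]

theorem term_zero (m : WVar a → ℤ) : term q m (0 : WField a) = 0 := by
  unfold term; rw [func_zero, zero_mul]

theorem term_smul (m : WVar a → ℤ) (s : ℂ) (c : WField a) :
    term q m (s • c) = s • term q m c := by
  unfold term; rw [func_smul, smul_mul_assoc]

theorem term_sum {ι : Type*} (m : WVar a → ℤ) (s : Finset ι) (f : ι → WField a) :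
    term q m (∑ i ∈ s, f i) = ∑ i ∈ s, term q m (f i) := by
  unfold term; rw [func_sum, Finset.sum_mul]

theorem term_sub (m : WVar a → ℤ) (c c' : WField a) :
    term q m (c - c') = term q m c - term q m c' := by
  unfold term; rw [func_sub, sub_mul]

theorem func_eq_term (c : WField a) : func q a c = term q 0 c := by
  unfold term; rw [Dmon_zero, mul_one]

theorem func_mul_term (c c' : WField a) (m : WVar a → ℤ) :
    func q a c * term q m c' = term q m (c * c') := by
  unfold term; rw [func_mul, mul_assoc]

theorem term_eq_single (m : WVar a → ℤ) (c : WField a) :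
    term q m c = (SkewMonoidAlgebra.single (ShiftGroup.ofExp q m) c :
      SkewMonoidAlgebra (WField a) (ShiftGroup q a)) := by
  refine (SkewMonoidAlgebra.single_mul_single (a₁ := (1 : ShiftGroup q a))
    (a₂ := ShiftGroup.ofExp q m) (b₁ := c) (b₂ := 1)).trans ?_
  rw [one_mul, smul_one, mul_one]

end DiffOpBasics

/-! chains of points -/

section Points

variable {n : ℕ} [NeZero n] {a : ZMod n → ℕ}

/-- The positions `(i, r, p)` of points: `p` is the position in the chain of `w_{i,r}`. -/
abbrev Pt (a : ZMod n → ℕ) : Type := (_ : WVar a) × ℕ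

/-- The colour of a point. -/
def ptCol (t : Pt a) : ZMod n := t.1.1

/-- The points of the chains of lengths `m`. -/
def pts (m : ∀ i, Fin (a i) → ℕ) : Finset (Pt a) :=
  Finset.univ.sigma fun v => Finset.range (m v.1 v.2)

theorem mem_pts {m : ∀ i, Fin (a i) → ℕ} {t : Pt a} : t ∈ pts m ↔ t.2 < m t.1.1 t.1.2 := by
  simp [pts]

theorem prod_pts {M : Type*} [CommMonoid M] (m : ∀ i, Fin (a i) → ℕ) (g : Pt a → M) :
    ∏ t ∈ pts m, g t = ∏ i, ∏ r, ∏ p ∈ Finset.range (m i r), g ⟨⟨i, r⟩, p⟩ := by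
  unfold pts
  rw [Finset.prod_sigma, Fintype.prod_sigma]

theorem colourCount_pts (m : ∀ i, Fin (a i) → ℕ) (i : ZMod n) :
    colourCount ptCol (pts m) i = ∑ r, m i r := by
  unfold colourCount pts
  rw [Finset.card_filter, Finset.sum_sigma, Fintype.sum_sigma, Finset.sum_eq_single i]
  · refine Finset.sum_congr rfl fun r _ => ?_
    simp [ptCol]
  · intro j _ hj
    simp [ptCol, hj]
  · simp

theorem mem_splittings {k : ZMod n → ℕ} {m : ∀ i, Fin (a i) → ℕ} :
    m ∈ splittings a k ↔ colourCount ptCol (pts m) = k := by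
  unfold splittings
  rw [Fintype.mem_piFinset, funext_iff]
  refine forall_congr' fun i => ?_
  rw [Finset.mem_piAntidiag, colourCount_pts]
  simp

theorem pts_injective : Function.Injective (pts (a := a)) := by
  intro m m' h
  funext i r
  have h1 : ∀ p, p < m i r ↔ p < m' i r := fun p => by
    have := congrArg ((⟨⟨i, r⟩, p⟩ : Pt a) ∈ ·) h
    simpa [mem_pts] using this
  exact le_antisymm (le_of_not_gt fun h' => lt_irrefl _ ((h1 _).1 h'))
    (le_of_not_gt fun h' => lt_irrefl _ ((h1 _).2 h'))

/-- The translation of the points along the chains. -/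
def shiftPt (m : ∀ i, Fin (a i) → ℕ) : Pt a ↪ Pt a where
  toFun t := ⟨t.1, m t.1.1 t.1.2 + t.2⟩
  inj' := by
    rintro ⟨v, p⟩ ⟨v', p'⟩ h
    obtain ⟨rfl, h⟩ := Sigma.mk.inj_iff.1 h
    simpa using h

theorem shiftPt_fst (m : ∀ i, Fin (a i) → ℕ) (t : Pt a) : (shiftPt m t).1 = t.1 := rfl

theorem shiftPt_snd (m : ∀ i, Fin (a i) → ℕ) (t : Pt a) :
    (shiftPt m t).2 = m t.1.1 t.1.2 + t.2 := rfl

theorem pts_subset_add (m m' : ∀ i, Fin (a i) → ℕ) : pts m ⊆ pts (m + m') := fun t ht => by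
  rw [mem_pts] at ht ⊢
  exact lt_of_lt_of_le ht (Nat.le_add_right _ _)

theorem pts_add_sdiff (m m' : ∀ i, Fin (a i) → ℕ) :
    pts (m + m') \ pts m = (pts m').map (shiftPt m) := by
  ext t
  simp only [Finset.mem_sdiff, mem_pts, Finset.mem_map, Pi.add_apply, not_lt]
  constructor
  · rintro ⟨h1, h2⟩
    refine ⟨⟨t.1, t.2 - m t.1.1 t.1.2⟩, by simp only; omega, ?_⟩
    refine Sigma.ext rfl (heq_of_eq ?_)
    rw [shiftPt_snd]
    simp only
    omega
  · rintro ⟨u, hu, rfl⟩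
    rw [shiftPt_snd, shiftPt_fst]
    omega

theorem eq_range_of_closed (S : Finset ℕ) (h : ∀ p, p + 1 ∈ S → p ∈ S) :
    S = Finset.range S.card := by
  refine Finset.eq_of_subset_of_card_le (fun p hp => ?_) (by simp)
  have : ∀ j, ∀ p ∈ S, j ≤ p → p - j ∈ S := by
    intro j
    induction j with
    | zero => intro p hp _; simpa using hp
    | succ j ih =>
      intro p hp hj
      apply h
      have := ih p hp (by omega)
      rwa [show p - (j + 1) + 1 = p - j by omega]
  have hsub : Finset.range (p + 1) ⊆ S := by
    intro j hj
    rw [Finset.mem_range] at hj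
    have := this (p - j) p hp (by omega)
    rwa [show p - (p - j) = j by omega] at this
  have := Finset.card_le_card hsub
  rw [Finset.card_range] at this
  exact Finset.mem_range.2 (by omega)

theorem exists_eq_pts (A : Finset (Pt a)) (h : ∀ v p, (⟨v, p + 1⟩ : Pt a) ∈ A → ⟨v, p⟩ ∈ A) :
    ∃ m, A = pts m := by
  classical
  let S : WVar a → Finset ℕ := fun v => (A.filter (fun t => t.1 = v)).image (fun t => t.2)
  have hS : ∀ v p, p ∈ S v ↔ (⟨v, p⟩ : Pt a) ∈ A := by
    intro v p
    simp only [S, Finset.mem_image, Finset.mem_filter]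
    constructor
    · rintro ⟨⟨v', p'⟩, ⟨h1, rfl⟩, rfl⟩; exact h1
    · intro h; exact ⟨⟨v, p⟩, ⟨h, rfl⟩, rfl⟩
  refine ⟨fun i r => (S ⟨i, r⟩).card, ?_⟩
  ext ⟨v, p⟩
  rw [mem_pts, ← hS, eq_range_of_closed (S v) (fun p hp => (hS v p).2 (h v p ((hS v _).1 hp))),
    Finset.mem_range, Finset.card_range]

/-- The families bounded by `m`. -/
def box (m : ∀ i, Fin (a i) → ℕ) : Finset (∀ i, Fin (a i) → ℕ) :=
  Fintype.piFinset fun i => Fintype.piFinset fun r => Finset.range (m i r + 1)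

theorem mem_box {m m' : ∀ i, Fin (a i) → ℕ} : m' ∈ box m ↔ ∀ i r, m' i r ≤ m i r := by
  simp [box, Fintype.mem_piFinset]

theorem pts_subset_pts {m m' : ∀ i, Fin (a i) → ℕ} : pts m' ⊆ pts m ↔ m' ∈ box m := by
  rw [mem_box]
  constructor
  · intro h i r
    by_contra hlt
    have := h (mem_pts.2 (not_le.1 hlt : (⟨⟨i, r⟩, m i r⟩ : Pt a).2 < _))
    rw [mem_pts] at this
    exact lt_irrefl _ this
  · intro h t ht
    rw [mem_pts] at ht ⊢
    exact lt_of_lt_of_le ht (h _ _)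

theorem sum_powerset_pts {M : Type*} [AddCommMonoid M] (m : ∀ i, Fin (a i) → ℕ)
    (g : Finset (Pt a) → M)
    (hg : ∀ A ⊆ pts m, ∀ v p, (⟨v, p + 1⟩ : Pt a) ∈ A → (⟨v, p⟩ : Pt a) ∉ A → g A = 0) :
    ∑ A ∈ (pts m).powerset, g A = ∑ m' ∈ box m, g (pts m') := by
  symm
  refine Finset.sum_of_injOn pts pts_injective.injOn ?_ ?_ fun _ _ => rfl
  · intro m' hm'
    exact Finset.mem_powerset.2 (pts_subset_pts.2 hm')
  · intro A hA hn
    rw [Finset.mem_powerset] at hA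
    by_contra h0
    obtain ⟨m', rfl⟩ := exists_eq_pts A (fun v p h => by
      by_contra hp
      exact h0 (hg A hA v p h hp))
    exact hn ⟨m', pts_subset_pts.1 hA, rfl⟩

/-- The list of the points of colour `i`. -/
def ptList (m : ∀ i, Fin (a i) → ℕ) (i : ZMod n) : List (Pt a) :=
  (List.finRange (a i)).flatMap fun r => (List.range (m i r)).map fun p => ⟨⟨i, r⟩, p⟩

theorem mem_ptList {m : ∀ i, Fin (a i) → ℕ} {i : ZMod n} {t : Pt a} :
    t ∈ ptList m i ↔ t ∈ pts m ∧ ptCol t = i := by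
  unfold ptList
  simp only [List.mem_flatMap, List.mem_finRange, true_and, List.mem_map, List.mem_range, mem_pts]
  constructor
  · rintro ⟨r, p, hp, rfl⟩
    exact ⟨hp, rfl⟩
  · obtain ⟨⟨j, r⟩, p⟩ := t
    rintro ⟨hp, rfl⟩
    exact ⟨r, p, hp, rfl⟩

theorem nodup_ptList (m : ∀ i, Fin (a i) → ℕ) (i : ZMod n) : (ptList m i).Nodup := by
  unfold ptList
  rw [List.nodup_flatMap]
  constructor
  · intro r _
    refine List.Nodup.map ?_ List.nodup_range
    intro p p' h
    simpa using h
  · refine (List.nodup_finRange _).imp ?_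
    intro r s hrs
    simp only [Function.onFun, List.disjoint_left, List.mem_map]
    rintro t ⟨p, _, rfl⟩ ⟨p', _, h⟩
    simp at h
    exact hrs h.1.symm

theorem length_ptList (m : ∀ i, Fin (a i) → ℕ) (i : ZMod n) :
    (ptList m i).length = ∑ r, m i r := by
  unfold ptList
  rw [List.length_flatMap]
  simp only [List.length_map, List.length_range]
  rw [← List.sum_ofFn, List.ofFn_eq_map]

theorem exists_enum_pointList {k : ZMod n → ℕ} (x : Pt a → WField a) {m : ∀ i, Fin (a i) → ℕ}
    (hm : m ∈ splittings a k) : ∃ e : ColEnum ptCol (pts m) k,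
      e.point x = pointList (fun i r p => x ⟨⟨i, r⟩, p⟩) m := by
  have hlen : ∀ i, (ptList m i).length = k i := by
    intro i
    rw [length_ptList, ← colourCount_pts, mem_splittings.1 hm]
  have hv : ∀ v : VarIn k, v.1.2 < (ptList m v.1.1).length := fun v => by rw [hlen]; exact v.2
  let f : VarIn k → {t // t ∈ pts m} := fun v =>
    ⟨(ptList m v.1.1)[v.1.2]'(hv v), (mem_ptList.1 (List.getElem_mem (hv v))).1⟩
  have hf : ∀ v, ptCol (f v).1 = v.1.1 := fun v => (mem_ptList.1 (List.getElem_mem (hv v))).2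
  have hb : Function.Bijective f := by
    constructor
    · rintro ⟨⟨i, r⟩, hr⟩ ⟨⟨j, s⟩, hs⟩ h
      have hij : i = j := by
        have := congrArg (fun t => ptCol t.1) h
        simpa only [hf] using this
      subst hij
      have h' := congrArg Subtype.val h
      have := (nodup_ptList m i).getElem_inj_iff.1 h'
      simp only at this
      subst this
      rfl
    · rintro ⟨t, ht⟩
      obtain ⟨r, hr, hrt⟩ := List.getElem_of_mem (mem_ptList.2 ⟨ht, rfl⟩ : t ∈ ptList m (ptCol t))
      refine ⟨⟨⟨ptCol t, r⟩, by rw [← hlen]; exact hr⟩, Subtype.ext hrt⟩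
  refine ⟨⟨Equiv.ofBijective f hb, hf⟩, ?_⟩
  funext v
  have hl : ((List.finRange (a v.1)).flatMap fun r => (List.range (m v.1 r)).map fun p =>
      x ⟨⟨v.1, r⟩, p⟩) = (ptList m v.1).map x := by
    unfold ptList
    rw [List.map_flatMap]
    simp only [List.map_map]
    rfl
  unfold pointList ColEnum.point
  rw [hl]
  split_ifs with h
  · rw [List.getD_eq_getElem _ _ (by rw [List.length_map, hlen]; exact h), List.getElem_map]
    rfl
  · rw [List.getD_eq_default _ _ (by rw [List.length_map, hlen]; exact not_lt.1 h)]

end Points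

section HatMul

variable {n : ℕ} [NeZero n] [Fact (3 ≤ n)] {q d : ℂˣ} {a : ZMod n → ℕ}
  {L L' : Type} [Field L] [Algebra ℂ L] [Field L'] [Algebra ℂ L'] {ι κ : Type} [DecidableEq ι]
  [DecidableEq κ]

theorem map_evalRat {X : Type} (τ : L →ₐ[ℂ] L') (p : X → L) (F : RatFun X) :
    τ (evalRat p F) = evalRat (τ ∘ p) F := by
  have h : ∀ P : MvPolynomial X ℂ, τ (MvPolynomial.aeval p P) = MvPolynomial.aeval (τ ∘ p) P := by
    intro P
    have : τ.comp (MvPolynomial.aeval p) = MvPolynomial.aeval (τ ∘ p) :=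
      MvPolynomial.algHom_ext fun v => by simp
    exact DFunLike.congr_fun this P
  unfold evalRat
  rw [map_div₀, h, h]

theorem map_valueAt (τ : L →ₐ[ℂ] L') (col : ι → ZMod n) (x : ι → L) (T : Finset ι)
    (E : Shuffle (n := n) q d) : τ (valueAt col x T E) = valueAt col (τ ∘ x) T E := by
  unfold valueAt
  rw [map_evalRat]
  congr 1
  funext v
  simp only [ColEnum.point, Function.comp_apply]
  split_ifs <;> simp

theorem valueAt_map (f : κ ↪ ι) (col : ι → ZMod n) (x : ι → L) (T : Finset κ)
    (hx : Set.InjOn x (T.map f)) (h0 : ∀ t ∈ T.map f, x t ≠ 0)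
    (E : Shuffle (n := n) q d) :
    valueAt col x (T.map f) E = valueAt (col ∘ f) (x ∘ f) T E := by
  obtain ⟨e⟩ := ColEnum.exists_enum (col ∘ f) T
  let g : {t // t ∈ T} ≃ {t // t ∈ T.map f} := Equiv.ofBijective
    (fun t => ⟨f t.1, Finset.mem_map_of_mem f t.2⟩) (by
      constructor
      · intro s t h
        exact Subtype.ext (f.injective (congrArg Subtype.val h))
      · rintro ⟨t, ht⟩
        obtain ⟨s, hs, rfl⟩ := Finset.mem_map.1 ht
        exact ⟨⟨s, hs⟩, rfl⟩)
  let e' : ColEnum col (T.map f) _ := ⟨e.equiv.trans g, e.col_eq⟩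
  rw [valueAt_eq e' hx h0, valueAt_eq e]
  · rfl
  · intro s hs t ht h
    exact f.injective (hx (Finset.mem_coe.2 (Finset.mem_map_of_mem f hs))
      (Finset.mem_coe.2 (Finset.mem_map_of_mem f ht)) h)
  · intro t ht
    exact h0 _ (Finset.mem_map_of_mem f ht)

/-- The exponents of the operator attached to `m`. -/
def expOf (s : ℤ) (m : ∀ i, Fin (a i) → ℕ) (v : WVar a) : ℤ := s * (m v.1 v.2 : ℤ)

theorem expOf_add (s : ℤ) (m m' : ∀ i, Fin (a i) → ℕ) :
    expOf s (m + m') = expOf s m + expOf s m' := by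
  funext v
  simp [expOf, mul_add]

/-- Multiplicativity of a sum over splittings, from the cocycle property of its coefficients. -/
theorem sum_splittings_mul (s : ℤ) (x : Pt a → WField a) (hx : Function.Injective x)
    (h0 : ∀ t, x t ≠ 0)
    (hs : ∀ m t, scaleHom q (expOf s m) (x t) = x (shiftPt m t))
    (C : (∀ i, Fin (a i) → ℕ) → WField a) (Z : Pt a → Pt a → WField a)
    (hZ : ∀ v p, Z ⟨v, p + 1⟩ ⟨v, p⟩ = 0)
    (hC : ∀ m m', C (m + m') * ∏ t ∈ pts m, ∏ t' ∈ pts m', Z t (shiftPt m t') =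
      C m * scaleHom q (expOf s m) (C m'))
    {k l : ZMod n → ℕ} {E F P : Shuffle (n := n) q d}
    (hE : ∀ T, colourCount ptCol T ≠ k → valueAt ptCol x T E = 0)
    (hF : ∀ T, colourCount ptCol T ≠ l → valueAt ptCol x T F = 0)
    (hP : ∀ m : ∀ i, Fin (a i) → ℕ, valueAt ptCol x (pts m) P = ∑ A ∈ (pts m).powerset,
      valueAt ptCol x A E * valueAt ptCol x (pts m \ A) F * ∏ t ∈ A, ∏ t' ∈ pts m \ A, Z t t') :
    ∑ m ∈ splittings a (k + l), term q (expOf s m) (C m * valueAt ptCol x (pts m) P) =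
      (∑ m ∈ splittings a k, term q (expOf s m) (C m * valueAt ptCol x (pts m) E)) *
      ∑ m ∈ splittings a l, term q (expOf s m) (C m * valueAt ptCol x (pts m) F) := by
  set h : (∀ i, Fin (a i) → ℕ) → (∀ i, Fin (a i) → ℕ) → DiffOp q a := fun m m' =>
    term q (expOf s m) (C m * (valueAt ptCol x (pts m') E * valueAt ptCol x (pts m \ pts m') F *
      ∏ t ∈ pts m', ∏ t' ∈ pts m \ pts m', Z t t')) with hh
  have e1 : ∀ m, term q (expOf s m) (C m * valueAt ptCol x (pts m) P) = ∑ m' ∈ box m, h m m' := by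
    intro m
    rw [hP, sum_powerset_pts, Finset.mul_sum, term_sum]
    intro A hA v p h1 h2
    have h3 : (⟨v, p⟩ : Pt a) ∈ pts m \ A := by
      refine Finset.mem_sdiff.2 ⟨?_, h2⟩
      have := hA h1
      rw [mem_pts] at this ⊢
      simp only at this ⊢
      omega
    rw [Finset.prod_eq_zero h1 (Finset.prod_eq_zero h3 (hZ v p)), mul_zero]
  have e2 : ∀ m m', term q (expOf s m) (C m * valueAt ptCol x (pts m) E) *
      term q (expOf s m') (C m' * valueAt ptCol x (pts m') F) = h (m + m') m := by
    intro m m'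
    rw [term_mul_term, hh]
    simp only
    rw [expOf_add, map_mul, map_valueAt, pts_add_sdiff,
      valueAt_map (shiftPt m) ptCol x (pts m') hx.injOn (fun t _ => h0 t)]
    have h1 : (scaleHom q (expOf s m) : WField a →ₐ[ℂ] WField a) ∘ x = x ∘ shiftPt m :=
      funext fun t => hs m t
    have h2 : ptCol (a := a) ∘ shiftPt m = ptCol := rfl
    rw [h1, h2]
    congr 1
    simp only [Finset.prod_map]
    linear_combination (-valueAt ptCol x (pts m) E * valueAt ptCol (x ∘ shiftPt m) (pts m') F) * hC m m'
  rw [Finset.sum_congr rfl fun m _ => e1 m, Finset.sum_mul_sum]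
  simp only [e2]
  rw [Finset.sum_sigma', ← Finset.sum_product']
  symm
  refine Finset.sum_of_injOn (fun mm => ⟨mm.1 + mm.2, mm.1⟩) ?_ ?_ ?_ ?_
  · rintro ⟨m, m'⟩ _ ⟨u, u'⟩ _ heq
    simp only [Sigma.mk.injEq, heq_eq_eq] at heq
    obtain ⟨h1, rfl⟩ := heq
    rw [add_left_cancel h1]
  · rintro ⟨m, m'⟩ hm
    simp only [Finset.coe_product, Set.mem_prod, Finset.mem_coe] at hm
    simp only [Finset.coe_sigma, Set.mem_sigma_iff, Finset.mem_coe]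
    rw [mem_splittings, mem_splittings] at hm
    rw [mem_splittings, mem_box]
    refine ⟨?_, fun i r => Nat.le_add_right _ _⟩
    rw [← hm.1, ← hm.2]
    funext i
    simp only [Pi.add_apply, colourCount_pts, Finset.sum_add_distrib]
  · rintro ⟨m, m'⟩ hm hn
    simp only [Finset.mem_sigma, mem_splittings] at hm
    obtain ⟨hm, hb⟩ := hm
    simp only [hh]
    by_cases hk : colourCount ptCol (pts m') = k
    · have hl : colourCount ptCol (pts m \ pts m') ≠ l := by
        intro hl
        apply hn
        refine ⟨⟨m', m - m'⟩, ?_, ?_⟩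
        · simp only [Finset.coe_product, Set.mem_prod, Finset.mem_coe, mem_splittings]
          refine ⟨hk, ?_⟩
          rw [← hl]
          have hmm : m = m' + (m - m') := by
            funext i r
            have := mem_box.1 hb i r
            simp only [Pi.add_apply, Pi.sub_apply]
            omega
          conv_rhs => rw [hmm, pts_add_sdiff]
          funext i
          unfold colourCount
          rw [Finset.filter_map, Finset.card_map]
          rfl
        · simp only [Sigma.mk.injEq, heq_eq_eq, and_true]
          funext i r
          have := mem_box.1 hb i r
          simp only [Pi.add_apply, Pi.sub_apply]
          omega
      rw [hF _ hl, mul_zero, zero_mul, mul_zero, term_zero]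
    · rw [hE _ hk, zero_mul, zero_mul, mul_zero, term_zero]
  · rintro ⟨m, m'⟩ _
    rfl

theorem cocycle_of_pairs (τ : WField a →+* WField a) (m m' : ∀ i, Fin (a i) → ℕ)
    (Y : Pt a → WField a) (K Z : Pt a → Pt a → WField a)
    (hK : ∀ t t', τ (K t t') = K (shiftPt m t) (shiftPt m t'))
    (hY : ∀ t, τ (Y t) = Y (shiftPt m t) * ∏ u ∈ pts m,
      (K u (shiftPt m t) * K (shiftPt m t) u * Z u (shiftPt m t))) :
    ((∏ t ∈ pts (m + m'), Y t) * ∏ t ∈ pts (m + m'), ∏ t' ∈ pts (m + m'), K t t') *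
      ∏ t ∈ pts m, ∏ t' ∈ pts m', Z t (shiftPt m t') =
    ((∏ t ∈ pts m, Y t) * ∏ t ∈ pts m, ∏ t' ∈ pts m, K t t') *
      τ ((∏ t ∈ pts m', Y t) * ∏ t ∈ pts m', ∏ t' ∈ pts m', K t t') := by
  have hsplit : ∀ g : Pt a → WField a, ∏ t ∈ pts (m + m'), g t =
      (∏ t ∈ pts m, g t) * ∏ t ∈ pts m', g (shiftPt m t) := by
    intro g
    rw [← Finset.prod_sdiff (pts_subset_add m m'), pts_add_sdiff, Finset.prod_map, mul_comm]
  simp only [hsplit, map_mul, map_prod, hK, hY, Finset.prod_mul_distrib]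
  rw [Finset.prod_comm (s := pts m') (t := pts m) (f := fun t u => K u (shiftPt m t)),
    Finset.prod_comm (s := pts m') (t := pts m) (f := fun t u => Z u (shiftPt m t))]
  ring

end HatMul

/-! the two halves -/

section Arrows

variable {n : ℕ} [NeZero n] [Fact (3 ≤ n)]

theorem add_two_ne (i : ZMod n) : i + 1 + 1 ≠ i := by
  intro h
  have h2 : ((2 : ℕ) : ZMod n) = 0 := by
    have : i + ((2 : ℕ) : ZMod n) = i + 0 := by
      rw [add_zero]; push_cast; rw [← one_add_one_eq_two, ← add_assoc]; exact h
    exact add_left_cancel this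
  rw [ZMod.natCast_eq_zero_iff] at h2
  have := Nat.le_of_dvd (by norm_num) h2
  have h3 : 3 ≤ n := Fact.out
  omega

theorem sub_one_ne (i : ZMod n) : i - 1 ≠ i := fun h => add_one_ne (i - 1) (by
  rw [sub_add_cancel]; exact h.symm)

theorem add_one_ne_sub_one (i : ZMod n) : i + 1 ≠ i - 1 := fun h => add_two_ne i (by
  rw [h, sub_add_cancel])

/-- The orientation is described from the head side (`true`) or from the tail side (`false`). -/
def arrowsOf (ε : Bool) (o : ZMod n → Bool) (i : ZMod n) : Finset (ZMod n) :=
  if ε then arrowsInto o i else arrowsFrom o i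

theorem mem_arrowsInto {o : ZMod n → Bool} {i j : ZMod n} : j ∈ arrowsInto o i ↔
    (i = j + 1 ∧ o j = true) ∨ (j = i + 1 ∧ o i = false) := by simp [arrowsInto]

theorem mem_arrowsFrom {o : ZMod n → Bool} {i j : ZMod n} :
    j ∈ arrowsFrom o i ↔ i ∈ arrowsInto o j := by simp [arrowsFrom]

theorem adj_symm {i j : ZMod n} (h : j = i + 1 ∨ j = i - 1) : i = j + 1 ∨ i = j - 1 := by
  rcases h with rfl | rfl
  · right; ring
  · left; ring

theorem adj_of_mem_arrowsInto {o : ZMod n → Bool} {i j : ZMod n} (h : j ∈ arrowsInto o i) :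
    j = i + 1 ∨ j = i - 1 := by
  rcases mem_arrowsInto.1 h with ⟨rfl, -⟩ | ⟨rfl, -⟩
  · right; ring
  · left; rfl

theorem arrowsInto_xor {o : ZMod n → Bool} {i j : ZMod n} (h : j = i + 1 ∨ j = i - 1) :
    j ∈ arrowsInto o i ↔ i ∉ arrowsInto o j := by
  rw [mem_arrowsInto, mem_arrowsInto]
  have h1 := add_two_ne i
  have h2 := add_two_ne j
  rcases h with rfl | rfl
  · cases o i <;> simp [h1.symm]
  · have h3 : i - 1 ≠ i + 1 := (add_one_ne_sub_one i).symm
    cases o (i - 1) <;> simp [h3]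

theorem adj_of_mem_arrowsOf {ε : Bool} {o : ZMod n → Bool} {i j : ZMod n}
    (h : j ∈ arrowsOf ε o i) : j = i + 1 ∨ j = i - 1 := by
  cases ε
  · exact adj_symm (adj_of_mem_arrowsInto (mem_arrowsFrom.1 h))
  · exact adj_of_mem_arrowsInto h

theorem arrowsOf_xor {ε : Bool} {o : ZMod n → Bool} {i j : ZMod n} (h : j = i + 1 ∨ j = i - 1) :
    j ∈ arrowsOf ε o i ↔ i ∉ arrowsOf ε o j := by
  cases ε
  · change j ∈ arrowsFrom o i ↔ i ∉ arrowsFrom o j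
    rw [mem_arrowsFrom, mem_arrowsFrom]
    have := arrowsInto_xor (o := o) h
    tauto
  · exact arrowsInto_xor h

theorem ne_of_adj {i j : ZMod n} (h : j = i + 1 ∨ j = i - 1) : j ≠ i := by
  rcases h with rfl | rfl
  · exact add_one_ne i
  · exact sub_one_ne i

theorem mMat_adj {i j : ZMod n} (h : j = i + 1 ∨ j = i - 1) : mMat j i = -mMat i j := by
  have h3 := add_one_ne_sub_one i
  rcases h with rfl | rfl
  · have : i ≠ i + 1 + 1 := (add_two_ne i).symm
    simp [mMat, this]
  · simp [mMat, h3.symm]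

end Arrows

section Constants

variable {n : ℕ} [NeZero n] {a : ZMod n → ℕ}

theorem cst_mul (x y : ℂ) : cst a (x * y) = cst a x * cst a y := map_mul _ _ _

theorem cst_one : cst a 1 = 1 := map_one _

theorem cst_inv (x : ℂ) : cst a x⁻¹ = (cst a x)⁻¹ := map_inv₀ _ _

theorem cst_pow (x : ℂ) (e : ℕ) : cst a (x ^ e) = cst a x ^ e := map_pow _ _ _

theorem cst_zpow (x : ℂ) (e : ℤ) : cst a (x ^ e) = cst a x ^ e := map_zpow₀ _ _ _

theorem cst_ne_zero {x : ℂ} (h : x ≠ 0) : cst a x ≠ 0 := by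
  unfold cst
  rwa [Ne, FaithfulSMul.algebraMap_eq_zero_iff]

theorem smul_eq_cst_mul (c : ℂ) (x : WField a) : c • x = cst a c * x := Algebra.smul_def _ _

theorem wv_ne_zero (i : ZMod n) (r : Fin (a i)) : wv i r ≠ 0 := pow_ne_zero _ (rvar_ne_zero _)

theorem sqrtW_ne_zero (i : ZMod n) (r : Fin (a i)) : sqrtW i r ≠ 0 := rvar_ne_zero _

theorem cst_mul_wv_inj {c c' : ℂ} (hc : c ≠ 0) {v v' : WVar a}
    (h : cst a c * wv v.1 v.2 = cst a c' * wv v'.1 v'.2) : v = v' ∧ c = c' := by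
  have h1 : (MvPolynomial.C c * MvPolynomial.X v ^ 2 : MvPolynomial (WVar a) ℂ)
      = MvPolynomial.C c' * MvPolynomial.X v' ^ 2 := by
    apply IsFractionRing.injective (MvPolynomial (WVar a) ℂ) (RatFun (WVar a))
    rw [map_mul, map_mul, map_pow, map_pow]
    exact h
  have h2 := congrArg (MvPolynomial.coeff (Finsupp.single v 2)) h1
  rw [MvPolynomial.coeff_C_mul, MvPolynomial.coeff_C_mul, MvPolynomial.coeff_X_pow,
    MvPolynomial.coeff_X_pow, if_pos rfl, mul_one] at h2
  by_cases hv : v' = v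
  · subst hv
    rw [if_pos rfl, mul_one] at h2
    exact ⟨rfl, h2⟩
  · rw [if_neg, mul_zero] at h2
    · exact absurd h2 hc
    · intro h3
      rw [Finsupp.single_eq_single_iff] at h3
      rcases h3 with h3 | h3
      · exact hv h3.1
      · omega

theorem scaleHom_sqrtW (q : ℂˣ) (m : WVar a → ℤ) (i : ZMod n) (r : Fin (a i)) :
    scaleHom q m (sqrtW i r) = cst a ((q : ℂ) ^ m ⟨i, r⟩) * sqrtW i r := by
  unfold sqrtW
  rw [scaleHom_rvar, smul_eq_cst_mul]

theorem scaleHom_wv (q : ℂˣ) (m : WVar a → ℤ) (i : ZMod n) (r : Fin (a i)) :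
    scaleHom q m (wv i r) = cst a ((q : ℂ) ^ (2 * m ⟨i, r⟩)) * wv i r := by
  unfold wv
  rw [map_pow, scaleHom_sqrtW, mul_pow, ← cst_pow, ← zpow_natCast, ← zpow_mul, mul_comm (2 : ℤ)]
  rfl

theorem scaleHom_cst (q : ℂˣ) (m : WVar a → ℤ) (c : ℂ) : scaleHom q m (cst a c) = cst a c :=
  AlgHom.commutes _ c

end Constants

section Halves

variable {n : ℕ} [NeZero n] [Fact (3 ≤ n)] {q d : ℂˣ} {a : ZMod n → ℕ}

/-- The sign of the exponents of the operators in the positive (`true`) or negative half. -/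
def halfSign (ε : Bool) : ℤ := if ε then -1 else 1

/-- `q` for the positive half, `q⁻¹` for the negative one. -/
def halfQ (ε : Bool) (q : ℂˣ) : ℂˣ := if ε then q else q⁻¹

/-- The base points of the chains, relative to the `w_{i,r}`. -/
def halfBase (ε : Bool) (q : ℂˣ) : ℂˣ := if ε then 1 else q ^ 2

/-- The coordinates of the points of the chains. -/
def halfPt (ε : Bool) (q : ℂˣ) (t : Pt a) : WField a :=
  if ε then ptPlus q t.1.1 t.1.2 t.2 else ptMinus q t.1.1 t.1.2 t.2

theorem halfPt_eq (ε : Bool) (q : ℂˣ) (t : Pt a) : halfPt ε q t =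
    cst a ((halfQ ε q : ℂ) ^ (-2 * (t.2 : ℤ)) * (halfBase ε q : ℂ)) * wv t.1.1 t.1.2 := by
  cases ε
  · simp only [halfPt, halfQ, halfBase, ptMinus, Bool.false_eq_true, if_false]
    congr 2
    rw [Units.val_inv_eq_inv_val, inv_zpow', Units.val_pow_eq_pow_val, ← zpow_natCast,
      ← zpow_add₀ q.ne_zero]
    congr 1
    push_cast; ring
  · simp [halfPt, halfQ, halfBase, ptPlus]

theorem halfQ_zpow_sign (ε : Bool) (q : ℂˣ) (e : ℤ) :
    (q : ℂ) ^ (halfSign ε * e) = (halfQ ε q : ℂ) ^ (-e) := by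
  cases ε <;> simp [halfQ, halfSign]

theorem halfPt_succ (ε : Bool) (q : ℂˣ) (v : WVar a) (p : ℕ) : halfPt ε q ⟨v, p + 1⟩ =
    cst a ((halfQ ε q : ℂ) ^ (-2 : ℤ)) * halfPt ε q ⟨v, p⟩ := by
  rw [halfPt_eq, halfPt_eq, ← mul_assoc, ← cst_mul, ← mul_assoc, ← zpow_add₀ (Units.ne_zero _)]
  congr 4
  push_cast; ring

theorem scaleHom_halfPt (ε : Bool) (m : ∀ i, Fin (a i) → ℕ) (t : Pt a) :
    scaleHom q (expOf (halfSign ε) m) (halfPt ε q t) = halfPt ε q (shiftPt m t) := by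
  rw [halfPt_eq, halfPt_eq, map_mul, scaleHom_cst, scaleHom_wv, ← mul_assoc, ← cst_mul]
  congr 2
  rw [shiftPt_snd, expOf,
    show 2 * (halfSign ε * (m t.1.1 t.1.2 : ℤ)) = halfSign ε * (2 * (m t.1.1 t.1.2 : ℤ)) by ring,
    halfQ_zpow_sign, mul_right_comm, ← zpow_add₀ (Units.ne_zero _)]
  congr 2
  push_cast; ring

theorem pow_ne_one_of_halfQ (hq : ∀ m : ℕ, 0 < m → q ^ m ≠ 1) (ε : Bool) (m : ℕ) (hm : 0 < m) :
    halfQ ε q ^ m ≠ 1 := by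
  cases ε
  · simp only [halfQ, Bool.false_eq_true, if_false, inv_pow, ne_eq, inv_eq_one]
    exact hq m hm
  · exact hq m hm

theorem units_zpow_inj {Q : ℂˣ} (hQ : ∀ m : ℕ, 0 < m → Q ^ m ≠ 1) {e f : ℤ}
    (h : (Q : ℂ) ^ e = (Q : ℂ) ^ f) : e = f := by
  have h' : Q ^ e = Q ^ f := by
    apply Units.ext
    push_cast
    exact h
  have h1 : ∀ m : ℤ, Q ^ m = 1 → m = 0 := by
    intro m hm
    by_contra h0
    rcases lt_or_gt_of_ne h0 with h0 | h0
    · refine hQ (-m).toNat (by omega) ?_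
      rw [← zpow_natCast, Int.toNat_of_nonneg (by omega), zpow_neg, hm, inv_one]
    · refine hQ m.toNat (by omega) ?_
      rw [← zpow_natCast, Int.toNat_of_nonneg (by omega), hm]
  have := h1 (e - f) (by rw [zpow_sub, h', mul_inv_cancel])
  omega

theorem halfPt_ne_zero (ε : Bool) (q : ℂˣ) (t : Pt a) : halfPt ε q t ≠ 0 := by
  rw [halfPt_eq]
  exact mul_ne_zero (cst_ne_zero (mul_ne_zero (zpow_ne_zero _ (Units.ne_zero _)) (Units.ne_zero _)))
    (wv_ne_zero _ _)

theorem halfPt_injective (hq : ∀ m : ℕ, 0 < m → q ^ m ≠ 1) (ε : Bool) :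
    Function.Injective (halfPt (a := a) ε q) := by
  rintro ⟨v, p⟩ ⟨v', p'⟩ h
  rw [halfPt_eq, halfPt_eq] at h
  obtain ⟨rfl, h⟩ := cst_mul_wv_inj
    (mul_ne_zero (zpow_ne_zero _ (Units.ne_zero _)) (Units.ne_zero _)) h
  have := units_zpow_inj (pow_ne_one_of_halfQ hq ε) (mul_right_cancel₀ (Units.ne_zero _) h)
  have h2 : p = p' := by simp only at this; omega
  rw [h2]

theorem halfPt_sub_ne_zero (ε : Bool) {t t' : Pt a} (h : t.1 ≠ t'.1) (c : ℂ) :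
    halfPt ε q t - cst a c * halfPt ε q t' ≠ 0 := by
  rw [sub_ne_zero, halfPt_eq, halfPt_eq, ← mul_assoc, ← cst_mul]
  intro h'
  exact h (cst_mul_wv_inj (mul_ne_zero (zpow_ne_zero _ (Units.ne_zero _)) (Units.ne_zero _)) h').1

/-- The kernel `ζ(x_t / x_t')`, with the arguments exchanged for the negative half. -/
def halfZ (ε : Bool) (q d : ℂˣ) (t t' : Pt a) : WField a :=
  if ε then zeta q d (ptCol t) (ptCol t') (halfPt ε q t) (halfPt ε q t')
  else zeta q d (ptCol t') (ptCol t) (halfPt ε q t') (halfPt ε q t)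

theorem zeta_same {L : Type} [Field L] [Algebra ℂ L] (i : ZMod n) (z w : L) :
    zeta q d i i z w = (z - ((q : ℂ) ^ (-2 : ℤ)) • w) / (z - w) := by simp [zeta]

theorem zeta_succ {L : Type} [Field L] [Algebra ℂ L] (i : ZMod n) (z w : L) :
    zeta q d i (i + 1) z w = ((d : ℂ)⁻¹ • z - (q : ℂ) • w) / (z - w) := by
  rw [zeta, if_neg (add_one_ne i), if_pos rfl]

theorem zeta_pred {L : Type} [Field L] [Algebra ℂ L] (i : ZMod n) (z w : L) :
    zeta q d i (i - 1) z w = (z - ((q : ℂ) * (d : ℂ)⁻¹) • w) / (z - w) := by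
  rw [zeta, if_neg (sub_one_ne i), if_neg (add_one_ne_sub_one i).symm, if_pos rfl]

theorem zeta_far {L : Type} [Field L] [Algebra ℂ L] {i j : ZMod n} (h : j ≠ i) (h1 : j ≠ i + 1)
    (h2 : j ≠ i - 1) (z w : L) : zeta q d i j z w = 1 := by
  rw [zeta, if_neg h, if_neg h1, if_neg h2]

theorem halfZ_chain (ε : Bool) (v : WVar a) (p : ℕ) :
    halfZ ε q d ⟨v, p + 1⟩ ⟨v, p⟩ = 0 := by
  unfold halfZ
  rw [halfPt_succ]
  cases ε
  · simp only [ptCol, Bool.false_eq_true, if_false, halfQ]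
    rw [zeta_same, smul_eq_cst_mul, ← mul_assoc, ← cst_mul]
    simp [cst_one]
  · simp [ptCol, zeta_same, smul_eq_cst_mul, halfQ]

theorem halfZ_ne_zero_of_lt (hq : ∀ m : ℕ, 0 < m → q ^ m ≠ 1) (ε : Bool) (v : WVar a) {p p' : ℕ}
    (h : p < p') : halfZ ε q d ⟨v, p⟩ ⟨v, p'⟩ ≠ 0 := by
  have hinj := halfPt_injective (a := a) hq ε
  have hne : halfPt ε q ⟨v, p⟩ ≠ halfPt ε q ⟨v, p'⟩ := fun h' => by
    have := hinj h'
    simp at this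
    omega
  have hnum : halfPt ε q ⟨v, p⟩ - cst a ((q : ℂ) ^ (2 * halfSign ε)) * halfPt ε q ⟨v, p'⟩ ≠ 0 := by
    rw [sub_ne_zero, mul_comm (2 : ℤ), halfQ_zpow_sign, halfPt_eq, halfPt_eq, ← mul_assoc,
      ← cst_mul]
    intro h'
    have h1 := (cst_mul_wv_inj (mul_ne_zero (zpow_ne_zero _ (Units.ne_zero _)) (Units.ne_zero _)) h').2
    rw [← mul_assoc] at h1
    have h2 := mul_right_cancel₀ (Units.ne_zero _) h1
    rw [← zpow_add₀ (Units.ne_zero _)] at h2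
    have := units_zpow_inj (pow_ne_one_of_halfQ hq ε) h2
    simp only at this
    omega
  unfold halfZ
  cases ε
  · simp only [ptCol, Bool.false_eq_true, if_false]
    rw [zeta_same, smul_eq_cst_mul]
    refine div_ne_zero ?_ (sub_ne_zero.2 hne.symm)
    intro h0
    apply hnum
    change halfPt false q ⟨v, p⟩ - cst a ((q : ℂ) ^ (2 : ℤ)) * halfPt false q ⟨v, p'⟩ = 0
    have h2 : cst a ((q : ℂ) ^ (2 : ℤ)) * cst a ((q : ℂ) ^ (-2 : ℤ)) = 1 := by
      rw [← cst_mul, ← zpow_add₀ q.ne_zero]; simp [cst_one]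
    linear_combination (-cst a ((q : ℂ) ^ (2 : ℤ))) * h0 - halfPt false q ⟨v, p⟩ * h2
  · simp only [ptCol, if_true]
    rw [zeta_same, smul_eq_cst_mul]
    exact div_ne_zero hnum (sub_ne_zero.2 hne)

theorem zeta_ne_zero {i j : ZMod n} (ε : Bool) {t t' : Pt a} (h : t.1 ≠ t'.1) :
    zeta q d i j (halfPt ε q t) (halfPt ε q t') ≠ 0 := by
  have h0 : halfPt ε q t - halfPt ε q t' ≠ 0 := by
    have := halfPt_sub_ne_zero (q := q) ε h 1
    rwa [cst_one, one_mul] at this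
  unfold zeta
  simp only [smul_eq_cst_mul]
  have hd : (d : ℂ) ≠ 0 := d.ne_zero
  split_ifs
  · exact div_ne_zero (halfPt_sub_ne_zero ε h _) h0
  · refine div_ne_zero ?_ h0
    have := halfPt_sub_ne_zero (q := q) ε h (d * q : ℂ)
    intro h1
    apply this
    have h2 : cst a (d : ℂ) * cst a (d : ℂ)⁻¹ = 1 := by
      rw [← cst_mul, mul_inv_cancel₀ hd, cst_one]
    rw [cst_mul]
    linear_combination cst a (d : ℂ) * h1 - halfPt ε q t * h2
  · exact div_ne_zero (halfPt_sub_ne_zero ε h _) h0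
  · exact one_ne_zero

theorem halfZ_ne_zero (ε : Bool) {t t' : Pt a} (h : t.1 ≠ t'.1) : halfZ ε q d t t' ≠ 0 := by
  unfold halfZ
  split_ifs
  · exact zeta_ne_zero ε h
  · exact zeta_ne_zero ε h.symm

theorem halfZ_far (ε : Bool) {t t' : Pt a} (h : ptCol t' ≠ ptCol t) (h1 : ptCol t' ≠ ptCol t + 1)
    (h2 : ptCol t' ≠ ptCol t - 1) : halfZ ε q d t t' = 1 := by
  unfold halfZ
  split_ifs
  · exact zeta_far h h1 h2 _ _
  · refine zeta_far h.symm ?_ ?_ _ _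
    · intro h3; apply h2; rw [h3]; ring
    · intro h3; apply h1; rw [h3]; ring

/-- The normalization of the pairs of points in different chains of the same colour. -/
def halfNorm (ε : Bool) (q : ℂˣ) : ℂ := if ε then 1 else (q : ℂ)⁻¹

theorem halfZ_same (ε : Bool) {t t' : Pt a} (h : t.1 ≠ t'.1) (hc : ptCol t' = ptCol t) :
    cst a (halfNorm ε q) ^ 2 * (halfZ ε q d t t')⁻¹ = (halfPt ε q t - halfPt ε q t') /
      (halfPt ε q t - cst a ((halfQ ε q : ℂ) ^ (-2 : ℤ)) * halfPt ε q t') := by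
  have hz := halfZ_ne_zero (d := d) (q := q) ε h
  have hd : halfPt ε q t - cst a ((halfQ ε q : ℂ) ^ (-2 : ℤ)) * halfPt ε q t' ≠ 0 :=
    halfPt_sub_ne_zero ε h _
  have h0 : halfPt ε q t - halfPt ε q t' ≠ 0 := by
    have := halfPt_sub_ne_zero (q := q) ε h 1
    rwa [cst_one, one_mul] at this
  have h0' : halfPt ε q t' - halfPt ε q t ≠ 0 := by
    rw [← neg_sub]; exact neg_ne_zero.2 h0
  rw [← div_eq_mul_inv, div_eq_div_iff hz hd]
  unfold halfZ halfNorm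
  rw [hc]
  cases ε
  · simp only [Bool.false_eq_true, if_false, halfQ] at *
    rw [zeta_same, smul_eq_cst_mul, mul_div_assoc', eq_div_iff h0']
    have e2 : cst a (((q⁻¹ : ℂˣ) : ℂ) ^ (-2 : ℤ)) = cst a (q : ℂ) ^ 2 := by
      rw [Units.val_inv_eq_inv_val, inv_zpow', ← cst_pow]; rfl
    have e3 : cst a ((q : ℂ) ^ (-2 : ℤ)) = cst a (q : ℂ)⁻¹ ^ 2 := by
      rw [← cst_pow, inv_pow, zpow_neg]; rfl
    have e4 : cst a (q : ℂ)⁻¹ * cst a (q : ℂ) = 1 := by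
      rw [← cst_mul, inv_mul_cancel₀ q.ne_zero, cst_one]
    rw [e2, e3]
    linear_combination (halfPt false q t - halfPt false q t') * halfPt false q t' *
      (1 + cst a (q : ℂ)⁻¹ * cst a (q : ℂ)) * e4
  · simp only [if_true, halfQ] at *
    rw [zeta_same, smul_eq_cst_mul, cst_one, one_pow, one_mul, mul_div_cancel₀ _ h0]

theorem zeta_ratio {i j : ZMod n} (h : j = i + 1 ∨ j = i - 1) (x y : WField a)
    (hxy : x - y ≠ 0) :
    zeta q d j i y x * (x - cst a ((q : ℂ) * (d : ℂ) ^ (-mMat i j)) * y) =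
    zeta q d i j x y * (cst a (q : ℂ) * (x - cst a ((q : ℂ)⁻¹ * (d : ℂ) ^ (-mMat i j)) * y)) := by
  have hyx : y - x ≠ 0 := by rw [← neg_sub]; exact neg_ne_zero.2 hxy
  have e4 : cst a (q : ℂ)⁻¹ * cst a (q : ℂ) = 1 := by
      rw [← cst_mul, inv_mul_cancel₀ q.ne_zero, cst_one]
  have e5 : cst a (d : ℂ)⁻¹ * cst a (d : ℂ) = 1 := by
      rw [← cst_mul, inv_mul_cancel₀ d.ne_zero, cst_one]
  rcases h with rfl | rfl
  · have hm : mMat i (i + 1) = -1 := by simp [mMat]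
    have e : zeta q d (i + 1) i y x = zeta q d (i + 1) (i + 1 - 1) y x := by
      rw [add_sub_cancel_right]
    rw [hm, e, zeta_pred, zeta_succ]
    simp only [smul_eq_cst_mul, neg_neg, zpow_one, cst_mul]
    generalize cst a (q : ℂ) = Q at *
    generalize cst a (q : ℂ)⁻¹ = Q' at *
    generalize cst a (d : ℂ) = D at *
    generalize cst a (d : ℂ)⁻¹ = D' at *
    rw [div_mul_eq_mul_div, div_mul_eq_mul_div, div_eq_div_iff hyx hxy]
    linear_combination (y - x) * (D' * x - Q * y) * D * y * e4 - (y - x) * x * y * (Q ^ 2 - 1) * e5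
  · have hm : mMat i (i - 1) = 1 := by simp [mMat, (add_one_ne_sub_one i).symm]
    have e : zeta q d (i - 1) i y x = zeta q d (i - 1) (i - 1 + 1) y x := by
      rw [sub_add_cancel]
    rw [hm, e, zeta_pred, zeta_succ]
    simp only [smul_eq_cst_mul, zpow_neg, zpow_one, cst_mul]
    generalize cst a (q : ℂ) = Q at *
    generalize cst a (q : ℂ)⁻¹ = Q' at *
    generalize cst a (d : ℂ)⁻¹ = D' at *
    rw [div_mul_eq_mul_div, div_mul_eq_mul_div, div_eq_div_iff hyx hxy]
    linear_combination (y - x) * (x - Q * D' * y) * D' * y * e4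

end Halves

/-! coefficients as products over pairs of points -/

section HalfCoeff

variable {n : ℕ} [NeZero n] [Fact (3 ≤ n)] (q d : ℂˣ) {a : ZMod n → ℕ} {N : ZMod n → ℕ}
  (z : ∀ i, Fin (N i) → ℂˣ) (o : ZMod n → Bool)

/-- The weight of a pair of points of the same colour. -/
def halfW (ε : Bool) (q : ℂˣ) : ℂ := if ε then (q : ℂ)⁻¹ else 1

/-- The factor attached to a pair of points. -/
def halfK (ε : Bool) (t t' : Pt a) : WField a :=
  (if ptCol t' = ptCol t then cst a (halfW ε q) else 1) *
  (if t.1 = t'.1 ∧ t.2 < t'.2 then (halfZ ε q d t t')⁻¹ else 1) *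
  (if ptCol t' = ptCol t ∧ t'.1 ≠ t.1 then cst a (halfNorm ε q) * (halfZ ε q d t t')⁻¹ else 1) *
  (if ptCol t' ∈ arrowsOf ε o (ptCol t) then (halfZ ε q d t t')⁻¹ else 1)

/-- The factor attached to a point. -/
def halfY (ε : Bool) (t : Pt a) : WField a :=
  if ε then cst a (q : ℂ) * Yfun q d z o t.1.1 t.1.2 (halfPt true q t)
  else YfunMinus q d o t.1.1 t.1.2 (halfPt false q t)

/-- The coefficient attached to `m`. -/
def halfC (ε : Bool) (m : ∀ i, Fin (a i) → ℕ) : WField a :=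
  (∏ t ∈ pts m, halfY q d z o ε t) * ∏ t ∈ pts m, ∏ t' ∈ pts m, halfK q d o ε t t'

theorem prod_pts_pts {M : Type*} [CommMonoid M] (m : ∀ i, Fin (a i) → ℕ) (g : Pt a → Pt a → M) :
    ∏ t ∈ pts m, ∏ t' ∈ pts m, g t t' = ∏ i, ∏ j, ∏ r₁, ∏ r₂, ∏ p₁ ∈ Finset.range (m i r₁),
      ∏ p₂ ∈ Finset.range (m j r₂), g ⟨⟨i, r₁⟩, p₁⟩ ⟨⟨j, r₂⟩, p₂⟩ := by
  simp only [prod_pts]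
  refine Finset.prod_congr rfl fun i _ => ?_
  rw [Finset.prod_comm]
  simp only [Finset.prod_comm (s := Finset.range _) (t := Finset.univ)]

theorem prod_chain_pairs {M : Type*} [CommMonoid M] (m : ∀ i, Fin (a i) → ℕ) (g : Pt a → Pt a → M) :
    (∏ t ∈ pts m, ∏ t' ∈ pts m, if t.1 = t'.1 ∧ t.2 < t'.2 then g t t' else 1) =
      ∏ i, ∏ r, ∏ p₂ ∈ Finset.range (m i r), ∏ p₁ ∈ Finset.range p₂,
        g ⟨⟨i, r⟩, p₁⟩ ⟨⟨i, r⟩, p₂⟩ := by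
  rw [Finset.prod_comm, prod_pts]
  refine Finset.prod_congr rfl fun i _ => Finset.prod_congr rfl fun r _ =>
    Finset.prod_congr rfl fun p₂ hp => ?_
  rw [Finset.mem_range] at hp
  rw [← Finset.prod_filter]
  symm
  refine Finset.prod_bij (fun p₁ _ => ⟨⟨i, r⟩, p₁⟩) ?_ ?_ ?_ ?_
  · intro p₁ h
    rw [Finset.mem_range] at h
    simp only [Finset.mem_filter, mem_pts, true_and]
    omega
  · intro p _ p' _ h
    simpa using h
  · rintro ⟨v, p⟩ h
    simp only [Finset.mem_filter, mem_pts] at h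
    obtain ⟨h1, rfl, h3⟩ := h
    exact ⟨p, Finset.mem_range.2 h3, rfl⟩
  · intro _ _; rfl

theorem prod_same_colour {M : Type*} [CommMonoid M] (m : ∀ i, Fin (a i) → ℕ) (g : Pt a → Pt a → M) :
    (∏ t ∈ pts m, ∏ t' ∈ pts m, if ptCol t' = ptCol t ∧ t'.1 ≠ t.1 then g t t' else 1) =
      ∏ i, ∏ r₁, ∏ r₂ ∈ Finset.univ.erase r₁, ∏ p₁ ∈ Finset.range (m i r₁),
        ∏ p₂ ∈ Finset.range (m i r₂), g ⟨⟨i, r₁⟩, p₁⟩ ⟨⟨i, r₂⟩, p₂⟩ := by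
  rw [prod_pts_pts]
  refine Finset.prod_congr rfl fun i _ => ?_
  rw [Finset.prod_eq_single i]
  · refine Finset.prod_congr rfl fun r₁ _ => ?_
    rw [← Finset.mul_prod_erase Finset.univ _ (Finset.mem_univ r₁)]
    simp only [ptCol, ne_eq, not_true_eq_false, and_false, if_false, Finset.prod_const_one, one_mul]
    refine Finset.prod_congr rfl fun r₂ hr => ?_
    have hr' := Finset.ne_of_mem_erase hr
    simp [hr']
  · intro j _ hj
    simp [ptCol, hj]
  · simp

theorem prod_arrow_pairs {M : Type*} [CommMonoid M] (ε : Bool) (m : ∀ i, Fin (a i) → ℕ)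
    (g : Pt a → Pt a → M) :
    (∏ t ∈ pts m, ∏ t' ∈ pts m, if ptCol t' ∈ arrowsOf ε o (ptCol t) then g t t' else 1) =
      ∏ i, ∏ j ∈ arrowsOf ε o i, ∏ r₁, ∏ r₂, ∏ p₁ ∈ Finset.range (m i r₁),
        ∏ p₂ ∈ Finset.range (m j r₂), g ⟨⟨i, r₁⟩, p₁⟩ ⟨⟨j, r₂⟩, p₂⟩ := by
  rw [prod_pts_pts]
  refine Finset.prod_congr rfl fun i _ => ?_
  rw [← Finset.prod_subset (Finset.subset_univ (arrowsOf ε o i))]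
  · refine Finset.prod_congr rfl fun j hj => ?_
    simp only [ptCol, hj, if_true]
  · intro j _ hj
    simp [ptCol, hj]

theorem prod_colour_const {M : Type*} [CommMonoid M] (m : ∀ i, Fin (a i) → ℕ) (c : M) :
    (∏ t ∈ pts m, ∏ t' ∈ pts m, if ptCol t' = ptCol t then c else 1) =
      ∏ i, c ^ (colourCount ptCol (pts m) i ^ 2) := by
  have h1 : ∀ t : Pt a, (∏ t' ∈ pts m, if ptCol t' = ptCol t then c else 1) =
      c ^ colourCount ptCol (pts m) (ptCol t) := by
    intro t
    rw [Finset.prod_ite, Finset.prod_const, Finset.prod_const_one, mul_one]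
    rfl
  simp only [h1]
  rw [← Finset.prod_fiberwise (pts m) ptCol]
  refine Finset.prod_congr rfl fun i _ => ?_
  rw [Finset.prod_congr rfl (g := fun _ => c ^ colourCount ptCol (pts m) i), Finset.prod_const,
    ← pow_mul, sq]
  · rfl
  · intro t ht
    rw [(Finset.mem_filter.1 ht).2]

theorem halfC_eq (ε : Bool) (m : ∀ i, Fin (a i) → ℕ) : halfC q d z o ε m =
    (∏ i, ∏ r, ∏ p ∈ Finset.range (m i r), halfY q d z o ε ⟨⟨i, r⟩, p⟩) *
    ((∏ i, cst a (halfW ε q) ^ (colourCount ptCol (pts m) i ^ 2)) *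
    (∏ i, ∏ r, ∏ p₂ ∈ Finset.range (m i r), ∏ p₁ ∈ Finset.range p₂,
        (halfZ ε q d (⟨⟨i, r⟩, p₁⟩ : Pt a) ⟨⟨i, r⟩, p₂⟩)⁻¹) *
    (∏ i, ∏ r₁, ∏ r₂ ∈ Finset.univ.erase r₁, ∏ p₁ ∈ Finset.range (m i r₁),
        ∏ p₂ ∈ Finset.range (m i r₂), (cst a (halfNorm ε q) *
          (halfZ ε q d (⟨⟨i, r₁⟩, p₁⟩ : Pt a) ⟨⟨i, r₂⟩, p₂⟩)⁻¹)) *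
    (∏ i, ∏ j ∈ arrowsOf ε o i, ∏ r₁, ∏ r₂, ∏ p₁ ∈ Finset.range (m i r₁),
        ∏ p₂ ∈ Finset.range (m j r₂),
          (halfZ ε q d (⟨⟨i, r₁⟩, p₁⟩ : Pt a) ⟨⟨j, r₂⟩, p₂⟩)⁻¹)) := by
  unfold halfC halfK
  rw [prod_pts]
  congr 1
  simp only [Finset.prod_mul_distrib]
  rw [prod_colour_const, prod_chain_pairs, prod_same_colour m
      (fun t t' => cst a (halfNorm ε q) * (halfZ ε q d t t')⁻¹), prod_arrow_pairs]
  simp only [Finset.prod_mul_distrib]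

theorem coeffPlus_eq {k : ZMod n → ℕ} {m : ∀ i, Fin (a i) → ℕ} (hm : m ∈ splittings a k)
    (E : RatFun (Var n)) :
    ((q : ℂ) ^ (∑ i, ((k i : ℤ) - (k i : ℤ) ^ 2))) • coeffPlus q d a z o m E =
      halfC q d z o true m * evalRat (pointList (ptPlus q) m) E := by
  rw [halfC_eq, mem_splittings.1 hm]
  have hk : ∀ i, ∑ r, m i r = k i := fun i => by
    rw [← colourCount_pts, mem_splittings.1 hm]
  have h1 : ∀ i r p, halfY q d z o true (⟨⟨i, r⟩, p⟩ : Pt a) =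
      cst a (q : ℂ) * Yfun q d z o i r (ptPlus q i r p) := fun i r p => rfl
  simp only [h1, Finset.prod_mul_distrib, Finset.prod_const, Finset.card_range,
    Finset.prod_pow_eq_pow_sum, hk]
  rw [smul_eq_cst_mul]
  have h2 : cst a ((q : ℂ) ^ (∑ i, ((k i : ℤ) - (k i : ℤ) ^ 2))) =
      cst a (q : ℂ) ^ (∑ i, k i) * cst a (halfW true q) ^ (∑ i, k i ^ 2) := by
    simp only [halfW, if_true]
    rw [← cst_pow, ← cst_pow, ← cst_mul, inv_pow, ← zpow_natCast, ← zpow_natCast, ← zpow_neg,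
      ← zpow_add₀ q.ne_zero]
    congr 2
    push_cast
    rw [Finset.sum_sub_distrib, sub_eq_add_neg]
  rw [h2]
  simp only [coeffPlus, halfZ, halfNorm, if_true, cst_one, one_pow,
    Finset.prod_const_one, arrowsOf, halfPt, ptCol]
  ring

theorem coeffMinus_eq {m : ∀ i, Fin (a i) → ℕ} (F : RatFun (Var n)) :
    coeffMinus q d a o m F =
      halfC q d z o false m * evalRat (pointList (ptMinus q) m) F := by
  rw [halfC_eq]
  have h1 : ∀ i r p, halfY q d z o false (⟨⟨i, r⟩, p⟩ : Pt a) =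
      YfunMinus q d o i r (ptMinus q i r p) := fun i r p => rfl
  simp only [h1, coeffMinus, halfZ, halfNorm, halfW, cst_one, one_mul, Finset.prod_const_one,
    arrowsOf, halfPt, ptCol, one_pow, Bool.false_eq_true, if_false]
  ring

/-- The factor of `halfY` attached to a chain. -/
def halfYat (ε : Bool) (v : WVar a) (t : Pt a) : WField a :=
  if v.1 = t.1.1 then (if ε then wv v.1 v.2 else 1) *
    (if v = t.1 then 1 else (1 - halfPt ε q ⟨v, 0⟩ / halfPt ε q t)⁻¹)
  else if v.1 ∈ arrowsOf ε o t.1.1 then (sqrtW v.1 v.2)⁻¹ *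
    (1 - cst a ((halfQ ε q : ℂ) * (d : ℂ) ^ (-mMat t.1.1 v.1)) * halfPt ε q ⟨v, 0⟩ / halfPt ε q t)
  else 1

variable (a) in
/-- The factor of `halfY` depending only on the point. -/
def halfYbase (ε : Bool) (i : ZMod n) (x : WField a) : WField a :=
  if ε then cst a ((q : ℂ) / ((q : ℂ) - (q : ℂ)⁻¹)) * Zf q a z i x else cst a (1 / (1 - (q : ℂ) ^ 2))

theorem prod_adjacent {M : Type*} [CommMonoid M] (ε : Bool) (i : ZMod n) (f : ZMod n → M)
    (h : ∀ j, j ≠ i → j ∉ arrowsOf ε o i → f j = 1) : ∏ j, f j = f i * ∏ j ∈ arrowsOf ε o i, f j := by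
  have hi : i ∉ arrowsOf ε o i := fun h => ne_of_adj (adj_of_mem_arrowsOf h) rfl
  rw [← Finset.prod_insert hi]
  symm
  refine Finset.prod_subset (Finset.subset_univ _) fun j _ hj => ?_
  rw [Finset.mem_insert, not_or] at hj
  exact h j hj.1 hj.2

theorem halfY_eq (ε : Bool) (t : Pt a) : halfY q d z o ε t =
    halfYbase q a z ε t.1.1 (halfPt ε q t) * ∏ v, halfYat q d o ε v t := by
  obtain ⟨⟨i, r⟩, p⟩ := t
  have hx : halfPt ε q (⟨⟨i, r⟩, p⟩ : Pt a) ≠ 0 := halfPt_ne_zero _ _ _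
  rw [Fintype.prod_sigma, prod_adjacent o ε i]
  swap
  · intro j hj hj'
    refine Finset.prod_eq_one fun s _ => ?_
    simp [halfYat, hj, hj']
  have h1 : ∀ s, halfYat q d o ε (⟨i, s⟩ : WVar a) ⟨⟨i, r⟩, p⟩ = (if ε then wv i s else 1) *
    (if s = r then 1 else (1 - halfPt ε q ⟨⟨i, s⟩, 0⟩ / halfPt ε q ⟨⟨i, r⟩, p⟩)⁻¹) := by
    intro s
    simp [halfYat]
  have h2 : ∀ j ∈ arrowsOf ε o i, ∀ s, halfYat q d o ε (⟨j, s⟩ : WVar a) ⟨⟨i, r⟩, p⟩ =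
      (sqrtW j s)⁻¹ * (1 - cst a ((halfQ ε q : ℂ) * (d : ℂ) ^ (-mMat i j)) *
        halfPt ε q ⟨⟨j, s⟩, 0⟩ / halfPt ε q ⟨⟨i, r⟩, p⟩) := by
    intro j hj s
    have := ne_of_adj (adj_of_mem_arrowsOf hj)
    simp [halfYat, hj, this]
  rw [Finset.prod_congr rfl fun s _ => h1 s, Finset.prod_congr rfl fun j hj =>
    Finset.prod_congr rfl fun s _ => h2 j hj s]
  simp only [Finset.prod_mul_distrib]
  rw [← Finset.mul_prod_erase Finset.univ
    (fun s => if s = r then 1 else (1 - halfPt ε q ⟨⟨i, s⟩, 0⟩ / halfPt ε q ⟨⟨i, r⟩, p⟩)⁻¹)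
    (Finset.mem_univ r), if_pos rfl, one_mul]
  rw [Finset.prod_congr (s₂ := Finset.univ.erase r) rfl (g := fun s =>
    (1 - halfPt ε q ⟨⟨i, s⟩, 0⟩ / halfPt ε q ⟨⟨i, r⟩, p⟩)⁻¹) fun s hs => by
      rw [if_neg (Finset.ne_of_mem_erase hs)]]
  rw [Finset.prod_inv_distrib]
  have hq0 := cst_ne_zero (a := a) q.ne_zero
  have hd0 := cst_ne_zero (a := a) d.ne_zero
  cases ε
  · simp only [halfY, YfunMinus, halfYbase, arrowsOf, Bool.false_eq_true, if_false,
      Finset.prod_const_one, Wtw, Wf, Wr, Algebra.algebraMap_self, RingHom.id_apply]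
    have e1 : ∀ (j : ZMod n) (s : Fin (a j)), wv j s / (cst a ((q : ℂ)⁻¹ * (d : ℂ) ^ mMat i j) *
        halfPt false q ⟨⟨i, r⟩, p⟩) = cst a (((halfQ false q : ℂˣ) : ℂ) * (d : ℂ) ^ (-mMat i j)) *
        halfPt false q ⟨⟨j, s⟩, 0⟩ / halfPt false q ⟨⟨i, r⟩, p⟩ := by
      intro j s
      simp only [halfPt_eq false q ⟨⟨j, s⟩, 0⟩, cst_mul, cst_zpow, zpow_neg, halfQ, halfBase,
        Bool.false_eq_true, if_false, Units.val_inv_eq_inv_val, cst_inv, Units.val_pow_eq_pow_val,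
        cst_pow]
      simp only [Nat.cast_zero, mul_zero, zpow_zero, one_mul]
      have := zpow_ne_zero (mMat i j) hd0
      field_simp
    have e2 : ∀ (s : Fin (a i)), wv i s / (cst a ((q : ℂ) ^ (-2 : ℤ)) *
        halfPt false q ⟨⟨i, r⟩, p⟩) =
        halfPt false q ⟨⟨i, s⟩, 0⟩ / halfPt false q ⟨⟨i, r⟩, p⟩ := by
      intro s
      simp only [halfPt_eq false q ⟨⟨i, s⟩, 0⟩, cst_mul, cst_zpow, zpow_neg, halfQ, halfBase,
        Bool.false_eq_true, if_false, Units.val_inv_eq_inv_val, cst_inv, Units.val_pow_eq_pow_val,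
        cst_pow, cst_zpow, zpow_neg]
      simp only [Nat.cast_zero, mul_zero, zpow_ofNat]
      field_simp
    simp only [e1, e2]
    ring
  · simp only [halfY, Yfun, halfYbase, arrowsOf, if_true, Wtw, Wf, Wr, Algebra.algebraMap_self,
      RingHom.id_apply]
    have e1 : ∀ (j : ZMod n) (s : Fin (a j)), wv j s / (cst a ((q : ℂ)⁻¹ * (d : ℂ) ^ mMat i j) *
        halfPt true q ⟨⟨i, r⟩, p⟩) = cst a (((halfQ true q : ℂˣ) : ℂ) * (d : ℂ) ^ (-mMat i j)) *
        halfPt true q ⟨⟨j, s⟩, 0⟩ / halfPt true q ⟨⟨i, r⟩, p⟩ := by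
      intro j s
      simp only [halfPt_eq true q ⟨⟨j, s⟩, 0⟩, cst_mul, cst_zpow, zpow_neg, halfQ, halfBase,
        if_true, cst_inv, Units.val_one, cst_one]
      simp only [Nat.cast_zero, mul_zero, zpow_zero, one_mul, mul_one]
      have := zpow_ne_zero (mMat i j) hd0
      field_simp
    have e2 : ∀ (s : Fin (a i)), wv i s = halfPt true q ⟨⟨i, s⟩, 0⟩ := by
      intro s
      simp [halfPt_eq true q ⟨⟨i, s⟩, 0⟩, halfBase, cst_one]
    have e3 : cst a ((q : ℂ) / ((q : ℂ) - (q : ℂ)⁻¹)) = cst a (q : ℂ) * cst a (1 / ((q : ℂ) - (q : ℂ)⁻¹)) := by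
      rw [← cst_mul, mul_one_div]
    simp only [e1, e3]
    rw [show (∏ s ∈ Finset.univ.erase r, (1 - wv i s / halfPt true q ⟨⟨i, r⟩, p⟩)) =
      ∏ s ∈ Finset.univ.erase r, (1 - halfPt true q ⟨⟨i, s⟩, 0⟩ / halfPt true q ⟨⟨i, r⟩, p⟩) from
      Finset.prod_congr rfl fun s _ => by rw [e2]]
    ring


theorem prod_telescope {K : Type*} [Field K] (f : ℕ → K) (h : ∀ p, f p ≠ 0) (m : ℕ) :
    ∏ p ∈ Finset.range m, f (p + 1) / f p = f m / f 0 := by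
  induction m with
  | zero => simp [h]
  | succ m ih =>
    have := h m
    have := h 0
    rw [Finset.prod_range_succ, ih]
    field_simp

variable {q d o} in
theorem halfK_same_chain {ε : Bool} {u b : Pt a} (h : u.1 = b.1) (hlt : u.2 < b.2) :
    halfK q d o ε u b * halfK q d o ε b u = cst a (halfW ε q) ^ 2 * (halfZ ε q d u b)⁻¹ := by
  have hc : ptCol b = ptCol u := congrArg Sigma.fst h.symm
  have hn : ptCol u ∉ arrowsOf ε o (ptCol u) := fun h => ne_of_adj (adj_of_mem_arrowsOf h) rfl
  have h3 : ¬ (b.2 < u.2) := by omega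
  simp [halfK, hc, hn, h, hlt, h3]
  ring

variable {q d o} in
theorem halfK_same_colour {ε : Bool} {u b : Pt a} (h : u.1 ≠ b.1) (hc : ptCol u = ptCol b) :
    halfK q d o ε u b * halfK q d o ε b u = cst a (halfW ε q) ^ 2 * cst a (halfNorm ε q) ^ 2 *
      (halfZ ε q d u b)⁻¹ * (halfZ ε q d b u)⁻¹ := by
  have hn : ptCol b ∉ arrowsOf ε o (ptCol b) := fun h => ne_of_adj (adj_of_mem_arrowsOf h) rfl
  simp [halfK, hc, hn, h, h.symm]
  ring

variable {q d o} in
theorem halfK_arrow {ε : Bool} {u b : Pt a} (h : ptCol u ∈ arrowsOf ε o (ptCol b)) :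
    halfK q d o ε u b = 1 ∧ halfK q d o ε b u = (halfZ ε q d b u)⁻¹ := by
  have hadj := adj_of_mem_arrowsOf h
  have hc := ne_of_adj hadj
  have hv : u.1 ≠ b.1 := fun h => hc (congrArg Sigma.fst h)
  have hx := (arrowsOf_xor hadj).1 h
  constructor
  · simp [halfK, hc.symm, hv, hx]
  · simp [halfK, hc, hv.symm, h]

variable {q d o} in
theorem halfK_far {ε : Bool} {u b : Pt a} (hc : ptCol u ≠ ptCol b)
    (h : ptCol u ∉ arrowsOf ε o (ptCol b)) (h' : ptCol b ∉ arrowsOf ε o (ptCol u)) :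
    halfK q d o ε u b = 1 ∧ halfK q d o ε b u = 1 ∧ halfZ ε q d u b = 1 := by
  have hv : u.1 ≠ b.1 := fun h => hc (congrArg Sigma.fst h)
  refine ⟨by simp [halfK, hc.symm, hv, h'], by simp [halfK, hc, hv.symm, h], ?_⟩
  have hadj : ¬ (ptCol b = ptCol u + 1 ∨ ptCol b = ptCol u - 1) := by
    intro hadj
    exact h' ((arrowsOf_xor hadj).2 h)
  rw [not_or] at hadj
  exact halfZ_far ε hc.symm hadj.1 hadj.2

variable {q d} in
theorem halfZ_ratio (ε : Bool) {u b : Pt a} (h : ptCol u = ptCol b + 1 ∨ ptCol u = ptCol b - 1) :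
    halfZ ε q d u b * (halfZ ε q d b u)⁻¹ = cst a (halfQ ε q : ℂ) *
      ((halfPt ε q b - cst a ((halfQ ε q : ℂ)⁻¹ * (d : ℂ) ^ (-mMat (ptCol b) (ptCol u))) *
          halfPt ε q u) /
        (halfPt ε q b - cst a ((halfQ ε q : ℂ) * (d : ℂ) ^ (-mMat (ptCol b) (ptCol u))) *
          halfPt ε q u)) := by
  have hv : b.1 ≠ u.1 := fun h' => ne_of_adj h (congrArg Sigma.fst h').symm
  have hz : halfZ ε q d b u ≠ 0 := halfZ_ne_zero ε hv
  have hd := halfPt_sub_ne_zero (q := q) ε hv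
    ((halfQ ε q : ℂ) * (d : ℂ) ^ (-mMat (ptCol b) (ptCol u)))
  have hxy : halfPt ε q b - halfPt ε q u ≠ 0 := by
    have := halfPt_sub_ne_zero (q := q) ε hv 1
    rwa [cst_one, one_mul] at this
  have key := zeta_ratio (q := q) (d := d) h (halfPt ε q b) (halfPt ε q u) hxy
  rw [← mul_div_assoc, ← div_eq_mul_inv, div_eq_div_iff hz hd]
  cases ε
  · simp only [halfZ, halfQ, Bool.false_eq_true, if_false, Units.val_inv_eq_inv_val, inv_inv] at *
    have e4 : cst a (q : ℂ)⁻¹ * cst a (q : ℂ) = 1 := by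
      rw [← cst_mul, inv_mul_cancel₀ q.ne_zero, cst_one]
    linear_combination (-cst a (q : ℂ)⁻¹) * key - zeta q d (ptCol b) (ptCol u) (halfPt false q b)
      (halfPt false q u) * (halfPt false q b - cst a ((q : ℂ)⁻¹ *
        (d : ℂ) ^ (-mMat (ptCol b) (ptCol u))) * halfPt false q u) * e4
  · simp only [halfZ, halfQ, if_true] at *
    linear_combination key

variable {q d o} in
theorem halfYat_shift (hq : ∀ m : ℕ, 0 < m → q ^ m ≠ 1) (ε : Bool) (m : ∀ i, Fin (a i) → ℕ) (v : WVar a) (t : Pt a) :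
    scaleHom q (expOf (halfSign ε) m) (halfYat q d o ε v t) = halfYat q d o ε v (shiftPt m t) *
      ∏ p ∈ Finset.range (m v.1 v.2), (halfK q d o ε ⟨v, p⟩ (shiftPt m t) *
        halfK q d o ε (shiftPt m t) ⟨v, p⟩ * halfZ ε q d ⟨v, p⟩ (shiftPt m t)) := by
  set b := shiftPt m t with hb
  have hb1 : b.1 = t.1 := rfl
  have hw : scaleHom q (expOf (halfSign ε) m) (if ε then wv v.1 v.2 else 1) =
      (if ε then wv v.1 v.2 else 1) * (cst a (halfW ε q) ^ 2) ^ (m v.1 v.2) := by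
    cases ε
    · simp [halfW, cst_one]
    · simp only [halfW, if_true, halfSign]
      rw [scaleHom_wv, mul_comm, ← pow_mul, ← cst_pow, inv_pow, ← zpow_natCast, ← zpow_neg]
      congr 3
      unfold expOf
      push_cast; ring
  have hxv : scaleHom q (expOf (halfSign ε) m) (halfPt ε q (⟨v, 0⟩ : Pt a)) =
      halfPt ε q ⟨v, m v.1 v.2⟩ := scaleHom_halfPt ε m ⟨v, 0⟩
  have hxt : scaleHom q (expOf (halfSign ε) m) (halfPt ε q t) = halfPt ε q b := scaleHom_halfPt ε m t
  have hb0 := halfPt_ne_zero ε q b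
  by_cases hv : v = t.1
  · have hpair : ∀ p ∈ Finset.range (m v.1 v.2), halfK q d o ε ⟨v, p⟩ b * halfK q d o ε b ⟨v, p⟩ *
        halfZ ε q d ⟨v, p⟩ b = cst a (halfW ε q) ^ 2 := by
      intro p hp
      have hlt : p < b.2 := by
        rw [Finset.mem_range] at hp
        rw [hb, shiftPt_snd, ← hv]
        omega
      rw [halfK_same_chain hv hlt, mul_assoc, inv_mul_cancel₀, mul_one]
      have := halfZ_ne_zero_of_lt (d := d) hq ε v hlt
      have hbv : b = ⟨v, b.2⟩ := Sigma.ext (hb1.trans hv.symm) HEq.rfl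
      rwa [hbv]
    rw [Finset.prod_congr rfl hpair, Finset.prod_const, Finset.card_range]
    simp only [halfYat, hb1, hv, if_true, mul_one]
    exact hw
  by_cases hc : v.1 = t.1.1
  · have hpair : ∀ p ∈ Finset.range (m v.1 v.2), halfK q d o ε ⟨v, p⟩ b * halfK q d o ε b ⟨v, p⟩ *
        halfZ ε q d ⟨v, p⟩ b = cst a (halfW ε q) ^ 2 *
        ((halfPt ε q b - halfPt ε q ⟨v, p + 1⟩)⁻¹ / (halfPt ε q b - halfPt ε q ⟨v, p⟩)⁻¹) := by
      intro p hp
      have hz := halfZ_ne_zero (d := d) (q := q) ε (t := ⟨v, p⟩) (t' := b) hv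
      rw [halfK_same_colour (b := b) (u := ⟨v, p⟩) hv hc]
      have := halfZ_same (d := d) (q := q) ε (t := b) (t' := ⟨v, p⟩) (Ne.symm hv) hc
      rw [← halfPt_succ] at this
      have e : ∀ x y : WField a, x⁻¹ / y⁻¹ = y / x := fun x y => by
        rw [div_inv_eq_mul, mul_comm, div_eq_mul_inv]
      rw [e, ← this]
      field_simp
    have hne : ∀ p, (halfPt ε q b - halfPt ε q ⟨v, p⟩)⁻¹ ≠ 0 := fun p => by
      have := halfPt_sub_ne_zero (q := q) ε (t := b) (t' := ⟨v, p⟩) (Ne.symm hv) 1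
      rw [cst_one, one_mul] at this
      exact inv_ne_zero this
    have hne' : ∀ p, halfPt ε q b - halfPt ε q ⟨v, p⟩ ≠ 0 := fun p h => hne p (by rw [h, inv_zero])
    rw [Finset.prod_congr rfl hpair, Finset.prod_mul_distrib, Finset.prod_const, Finset.card_range,
      prod_telescope _ hne]
    simp only [halfYat, hb1, hc, hv, if_true, if_false]
    rw [map_mul, map_inv₀, map_sub, map_div₀, map_one, hxv, hxt]
    rw [hw]
    have h1 := hne' 0
    have h2 := hne' (m v.1 v.2)
    have e1 : 1 - halfPt ε q ⟨v, m v.1 v.2⟩ / halfPt ε q b =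
      (halfPt ε q b - halfPt ε q ⟨v, m v.1 v.2⟩) / halfPt ε q b := by field_simp
    have e2 : 1 - halfPt ε q ⟨v, 0⟩ / halfPt ε q b =
      (halfPt ε q b - halfPt ε q ⟨v, 0⟩) / halfPt ε q b := by field_simp
    rw [e1, e2]
    field_simp
  by_cases har : v.1 ∈ arrowsOf ε o t.1.1
  · have hadj := adj_of_mem_arrowsOf har
    set c : ℂ := (halfQ ε q : ℂ) * (d : ℂ) ^ (-mMat t.1.1 v.1) with hcdef
    have hpair : ∀ p ∈ Finset.range (m v.1 v.2), halfK q d o ε ⟨v, p⟩ b * halfK q d o ε b ⟨v, p⟩ *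
        halfZ ε q d ⟨v, p⟩ b = cst a (halfQ ε q : ℂ) *
        ((halfPt ε q b - cst a c * halfPt ε q ⟨v, p + 1⟩) /
          (halfPt ε q b - cst a c * halfPt ε q ⟨v, p⟩)) := by
      intro p hp
      obtain ⟨h1, h2⟩ := halfK_arrow (q := q) (d := d) (u := ⟨v, p⟩) (b := b) har
      have := halfZ_ratio (q := q) (d := d) ε (u := ⟨v, p⟩) (b := b) hadj
      rw [h1, h2, one_mul, mul_comm, this]
      have e : cst a ((halfQ ε q : ℂ)⁻¹ * (d : ℂ) ^ (-mMat (ptCol b) (ptCol (⟨v, p⟩ : Pt a)))) =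
          cst a c * cst a ((halfQ ε q : ℂ) ^ (-2 : ℤ)) := by
        rw [← cst_mul, hcdef]
        congr 1
        rw [mul_right_comm]
        congr 1
        rw [zpow_neg]
        have := (halfQ ε q).ne_zero
        field_simp
      rw [halfPt_succ, e, mul_assoc]
      rfl
    have hne : ∀ p, halfPt ε q b - cst a c * halfPt ε q ⟨v, p⟩ ≠ 0 := fun p =>
      halfPt_sub_ne_zero (q := q) ε (t := b) (t' := ⟨v, p⟩) (Ne.symm hv) c
    rw [Finset.prod_congr rfl hpair, Finset.prod_mul_distrib, Finset.prod_const, Finset.card_range,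
      prod_telescope _ hne]
    simp only [halfYat, hb1, hc, har, if_true, if_false]
    rw [map_mul, map_inv₀, map_sub, map_div₀, map_one, map_mul, hxv, hxt, scaleHom_sqrtW,
      scaleHom_cst]
    have h1 := hne 0
    have h2 := hne (m v.1 v.2)
    have e1 : 1 - cst a c * halfPt ε q ⟨v, m v.1 v.2⟩ / halfPt ε q b =
      (halfPt ε q b - cst a c * halfPt ε q ⟨v, m v.1 v.2⟩) / halfPt ε q b := by field_simp
    have e2 : 1 - cst a c * halfPt ε q ⟨v, 0⟩ / halfPt ε q b =
      (halfPt ε q b - cst a c * halfPt ε q ⟨v, 0⟩) / halfPt ε q b := by field_simp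
    have e3 : (cst a ((q : ℂ) ^ expOf (halfSign ε) m ⟨v.1, v.2⟩))⁻¹ =
        cst a (halfQ ε q : ℂ) ^ (m v.1 v.2) := by
      rw [expOf, halfQ_zpow_sign, ← cst_inv, ← zpow_neg, neg_neg, zpow_natCast, cst_pow]
    rw [← hcdef, e1, e2, mul_inv, e3]
    field_simp
  · have hpair : ∀ p ∈ Finset.range (m v.1 v.2), halfK q d o ε ⟨v, p⟩ b * halfK q d o ε b ⟨v, p⟩ *
        halfZ ε q d ⟨v, p⟩ b = 1 := by
      intro p hp
      by_cases har' : t.1.1 ∈ arrowsOf ε o v.1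
      · obtain ⟨h1, h2⟩ := halfK_arrow (q := q) (d := d) (u := b) (b := ⟨v, p⟩) har'
        rw [h1, h2, mul_one, inv_mul_cancel₀]
        exact halfZ_ne_zero ε hv
      · obtain ⟨h1, h2, h3⟩ := halfK_far (q := q) (d := d) (u := ⟨v, p⟩) (b := b) hc har har'
        rw [h1, h2, h3, one_mul, one_mul]
    rw [Finset.prod_congr rfl hpair, Finset.prod_const_one]
    simp [halfYat, hb1, hc, har]


variable {q d o z} in
theorem halfY_shift (hq : ∀ m : ℕ, 0 < m → q ^ m ≠ 1) (ε : Bool) (m : ∀ i, Fin (a i) → ℕ)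
    (t : Pt a) : scaleHom q (expOf (halfSign ε) m) (halfY q d z o ε t) =
      halfY q d z o ε (shiftPt m t) * ∏ u ∈ pts m, (halfK q d o ε u (shiftPt m t) *
        halfK q d o ε (shiftPt m t) u * halfZ ε q d u (shiftPt m t)) := by
  have hx := scaleHom_halfPt (q := q) ε m t
  have h1 : scaleHom q (expOf (halfSign ε) m) (halfYbase q a z ε t.1.1 (halfPt ε q t)) =
      halfYbase q a z ε t.1.1 (halfPt ε q (shiftPt m t)) := by
    unfold halfYbase
    split_ifs
    · simp only [Zf, map_mul, map_prod, map_sub, map_div₀, map_one, hx, scaleHom_cst,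
        Algebra.algebraMap_self, RingHom.id_apply]
    · rw [scaleHom_cst]
  rw [halfY_eq, halfY_eq, map_mul, map_prod, h1, Finset.prod_congr rfl fun v _ =>
    halfYat_shift hq ε m v t, Finset.prod_mul_distrib, mul_assoc]
  congr 2
  unfold pts
  rw [Finset.prod_sigma]

variable {q d o} in
theorem halfK_shift (ε : Bool) (m : ∀ i, Fin (a i) → ℕ) (t t' : Pt a) :
    scaleHom q (expOf (halfSign ε) m) (halfK q d o ε t t') =
      halfK q d o ε (shiftPt m t) (shiftPt m t') := by
  have hZ : scaleHom q (expOf (halfSign ε) m) (halfZ ε q d t t') =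
      halfZ ε q d (shiftPt m t) (shiftPt m t') := by
    unfold halfZ
    split_ifs
    · rw [map_zeta, scaleHom_halfPt, scaleHom_halfPt]; rfl
    · rw [map_zeta, scaleHom_halfPt, scaleHom_halfPt]; rfl
  have hlt : t.1 = t'.1 ∧ t.2 < t'.2 ↔
      (shiftPt m t).1 = (shiftPt m t').1 ∧ (shiftPt m t).2 < (shiftPt m t').2 := by
    rw [shiftPt_fst, shiftPt_fst, shiftPt_snd, shiftPt_snd]
    refine and_congr_right fun h => ?_
    rw [h]
    omega
  have hp : ∀ t : Pt a, ptCol (shiftPt m t) = ptCol t := fun _ => rfl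
  unfold halfK
  rw [map_mul, map_mul, map_mul]
  simp only [apply_ite (scaleHom q (expOf (halfSign ε) m)), map_one, map_inv₀, map_mul, hZ,
    scaleHom_cst, hlt, hp, shiftPt_fst]
  congr!

variable {q d o z} in
theorem halfC_add (hq : ∀ m : ℕ, 0 < m → q ^ m ≠ 1) (ε : Bool) (m m' : ∀ i, Fin (a i) → ℕ) :
    halfC q d z o ε (m + m') * ∏ t ∈ pts m, ∏ t' ∈ pts m', halfZ ε q d t (shiftPt m t') =
      halfC q d z o ε m * scaleHom q (expOf (halfSign ε) m) (halfC q d z o ε m') :=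
  cocycle_of_pairs (scaleHom q (expOf (halfSign ε) m) : WField a →+* WField a) m m' _ _ _
    (fun t t' => halfK_shift ε m t t') (fun t => halfY_shift hq ε m t)

end HalfCoeff

/-! the maps from the shuffle algebra to difference operators -/

section Hat

variable {n : ℕ} [NeZero n] [Fact (3 ≤ n)] {q d : ℂˣ} {a : ZMod n → ℕ} {N : ZMod n → ℕ}
  (z : ∀ i, Fin (N i) → ℂˣ) (o : ZMod n → Bool)

variable (q d) in
/-- The coefficient of the operator attached to `m` in the image of `E`. -/
def halfCoeff (ε : Bool) (m : ∀ i, Fin (a i) → ℕ) (E : Shuffle (n := n) q d) : WField a :=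
  halfC q d z o ε m * valueAt ptCol (halfPt ε q) (pts m) E

/-- The map of the positive (`true`) or negative half. -/
def hat (hq : ∀ m : ℕ, 0 < m → q ^ m ≠ 1) (ε : Bool) : Shuffle (n := n) q d →ₗ[ℂ] DiffOp q a :=
  DirectSum.toModule ℂ _ _ fun k =>
    { toFun := fun F => ∑ m ∈ splittings a k, term q (expOf (halfSign ε) m)
        (halfCoeff q d z o ε m (DirectSum.of (ShuffleComp q d) k F))
      map_add' := fun F G => by
        simp only [halfCoeff, map_add, valueAt_add (halfPt_injective hq ε).injOn
          (fun t _ => halfPt_ne_zero ε q t), mul_add, term_add, Finset.sum_add_distrib]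
      map_smul' := fun c F => by
        have h : DirectSum.of (ShuffleComp q d) k (c • F) = c • DirectSum.of (ShuffleComp q d) k F :=
          (DirectSum.lof ℂ (ZMod n → ℕ) (ShuffleComp q d) k).map_smul c F
        simp only [halfCoeff, h, valueAt_smul (halfPt_injective hq ε).injOn
          (fun t _ => halfPt_ne_zero ε q t), mul_smul_comm, term_smul, Finset.smul_sum,
          RingHom.id_apply] }

variable (hq : ∀ m : ℕ, 0 < m → q ^ m ≠ 1)

theorem hat_of (ε : Bool) (k : ZMod n → ℕ) (F : ShuffleComp q d k) :
    hat (a := a) z o hq ε (DirectSum.of (ShuffleComp q d) k F) = ∑ m ∈ splittings a k,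
      term q (expOf (halfSign ε) m)
        (halfCoeff q d z o ε m (DirectSum.of (ShuffleComp q d) k F)) :=
  DirectSum.toModule_lof ℂ k F

theorem hat_true_of (k : ZMod n → ℕ) (E : ShuffleComp q d k) :
    hat (a := a) z o hq true (DirectSum.of (ShuffleComp q d) k E) = hatPlus q d a z o k E.val := by
  rw [hat_of]
  unfold hatPlus
  rw [Finset.smul_sum]
  refine Finset.sum_congr rfl fun m hm => ?_
  obtain ⟨e, he⟩ := exists_enum_pointList (halfPt true q) hm
  rw [← smul_mul_assoc, ← func_smul, coeffPlus_eq q d z o hm]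
  unfold halfCoeff
  rw [valueAt_of e (halfPt_injective hq true).injOn (fun t _ => halfPt_ne_zero true q t), he]
  unfold term
  have h1 : expOf (halfSign true) m = fun v => -(m v.1 v.2 : ℤ) := by
    funext v; simp [expOf, halfSign]
  rw [h1]
  rfl

theorem hat_false_of (k : ZMod n → ℕ) (F : ShuffleComp q d k) :
    hat (a := a) z o hq false (DirectSum.of (ShuffleComp q d) k F) = hatMinus q d a o k F.val := by
  rw [hat_of]
  unfold hatMinus
  refine Finset.sum_congr rfl fun m hm => ?_
  obtain ⟨e, he⟩ := exists_enum_pointList (halfPt false q) hm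
  rw [coeffMinus_eq q d z o]
  unfold halfCoeff
  rw [valueAt_of e (halfPt_injective hq false).injOn (fun t _ => halfPt_ne_zero false q t), he]
  unfold term
  have h1 : expOf (halfSign false) m = fun v => (m v.1 v.2 : ℤ) := by
    funext v; simp [expOf, halfSign]
  rw [h1]
  rfl

theorem hat_true_mul (E F : Shuffle (n := n) q d) :
    hat (a := a) z o hq true (E * F) = hat z o hq true E * hat z o hq true F := by
  have hx := halfPt_injective (a := a) hq true
  have h0 := fun t : Pt a => halfPt_ne_zero true q t
  induction E using DirectSum.induction_on with
  | zero => simp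
  | add E E' hE hE' => rw [add_mul, map_add, hE, hE', map_add, add_mul]
  | of k E =>
    induction F using DirectSum.induction_on with
    | zero => simp
    | add F F' hF hF' => rw [mul_add, map_add, hF, hF', map_add, mul_add]
    | of l F =>
      rw [DirectSum.of_mul_of, hat_of, hat_of, hat_of]
      refine sum_splittings_mul (halfSign true) (halfPt true q) hx h0
        (fun m t => scaleHom_halfPt true m t) _ (halfZ true q d) (fun v p => halfZ_chain true v p)
        (fun m m' => halfC_add hq true m m')
        (fun T hT => valueAt_of_ne hT _) (fun T hT => valueAt_of_ne hT _) fun m => ?_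
      rw [← DirectSum.of_mul_of, valueAt_mul hx.injOn fun t _ => h0 t]
      rfl

theorem hat_false_mul (E F : Shuffle (n := n) q d) :
    hat (a := a) z o hq false (E * F) = hat z o hq false F * hat z o hq false E := by
  have hx := halfPt_injective (a := a) hq false
  have h0 := fun t : Pt a => halfPt_ne_zero false q t
  induction E using DirectSum.induction_on with
  | zero => simp
  | add E E' hE hE' => rw [add_mul, map_add, hE, hE', map_add, mul_add]
  | of k E =>
    induction F using DirectSum.induction_on with
    | zero => simp
    | add F F' hF hF' => rw [mul_add, map_add, hF, hF', map_add, add_mul]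
    | of l F =>
      rw [DirectSum.of_mul_of, hat_of, hat_of, hat_of, ← DirectSum.of_mul_of, add_comm k l]
      refine sum_splittings_mul (halfSign false) (halfPt false q) hx h0
        (fun m t => scaleHom_halfPt false m t) _ (halfZ false q d) (fun v p => halfZ_chain false v p)
        (fun m m' => halfC_add hq false m m')
        (fun T hT => valueAt_of_ne hT _) (fun T hT => valueAt_of_ne hT _) fun m => ?_
      rw [valueAt_mul hx.injOn fun t _ => h0 t]
      refine Finset.sum_bij' (fun A _ => pts m \ A) (fun A _ => pts m \ A) ?_ ?_ ?_ ?_ ?_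
      · intro A _; exact Finset.mem_powerset.2 Finset.sdiff_subset
      · intro A _; exact Finset.mem_powerset.2 Finset.sdiff_subset
      · intro A hA; exact Finset.sdiff_sdiff_eq_self (Finset.mem_powerset.1 hA)
      · intro A hA; exact Finset.sdiff_sdiff_eq_self (Finset.mem_powerset.1 hA)
      · intro A hA
        rw [Finset.sdiff_sdiff_eq_self (Finset.mem_powerset.1 hA)]
        unfold zetaCross
        rw [Finset.prod_comm, mul_comm (valueAt _ _ A _)]
        rfl

theorem hat_one (ε : Bool) : hat (a := a) z o hq ε (1 : Shuffle (n := n) q d) = 1 := by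
  have h1 : (1 : Shuffle (n := n) q d) = DirectSum.of (ShuffleComp q d) 0
      (.mk (algebraMap ℂ _ 1) (algebraMap_mem_shuffleComp 1)) := rfl
  have h2 : splittings a 0 = {0} := by
    ext m
    rw [mem_splittings, Finset.mem_singleton, funext_iff]
    simp only [colourCount_pts, Pi.zero_apply, Finset.sum_eq_zero_iff, Finset.mem_univ, true_imp_iff]
    constructor
    · intro h; funext i r; exact h i r
    · rintro rfl i r; rfl
  have h3 : pts (0 : ∀ i, Fin (a i) → ℕ) = ∅ := by
    ext t; simp [mem_pts]
  have h4 : expOf (halfSign ε) (0 : ∀ i, Fin (a i) → ℕ) = 0 := by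
    funext v; simp [expOf]
  rw [h1, hat_of, h2, Finset.sum_singleton, h4]
  unfold halfCoeff halfC valueAt
  rw [h3]
  have h5 : colourCount (ptCol (a := a)) ∅ = 0 := by
    funext i; simp [colourCount]
  obtain ⟨e⟩ := ColEnum.exists_enum_of_eq h5
  have h6 : evalRat (e.point (halfPt (a := a) ε q)) (DirectSum.of (ShuffleComp q d) 0
      (.mk (algebraMap ℂ _ 1) (algebraMap_mem_shuffleComp 1)) 0).val = 1 := by
    rw [DirectSum.of_eq_same]
    have := (HasEval.const (e.point (halfPt (a := a) ε q)) 1).evalRat_eq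
    rwa [map_one (algebraMap ℂ (WField a))] at this
  have h7 := valueAt_of e (x := halfPt (a := a) ε q) (q := q) (d := d) (by simp) (by simp)
    (.mk (algebraMap ℂ _ 1) (algebraMap_mem_shuffleComp 1))
  rw [DirectSum.of_eq_same] at h6
  unfold valueAt at h7
  rw [h7, h6]
  simp [term, func_one, Dmon_zero]

end Hat

/-! membership in the localized algebras -/

section Membership

variable {n : ℕ} [NeZero n] {q d : ℂˣ} {a : ZMod n → ℕ}

variable (q a) in
/-- The functions in the algebra of difference operators. -/
def fnAlg : Subalgebra ℂ (WField a) := (diffAlg q a).comap (funcHom q a)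

variable (q d a) in
/-- The functions in the localized algebra of difference operators. -/
def fnAlgLoc : Subalgebra ℂ (WField a) := (diffAlgLoc q d a).comap (funcHom q a)

theorem diffAlg_le : diffAlg q a ≤ diffAlgLoc q d a :=
  Algebra.adjoin_mono Set.subset_union_left

theorem fnAlg_le : fnAlg q a ≤ fnAlgLoc q d a := fun _ hx => diffAlg_le hx

theorem sqrtW_mem (i : ZMod n) (r : Fin (a i)) : sqrtW i r ∈ fnAlg q a :=
  Algebra.subset_adjoin (Or.inl ⟨i, r, Or.inl rfl⟩)

theorem sqrtW_inv_mem (i : ZMod n) (r : Fin (a i)) : (sqrtW i r)⁻¹ ∈ fnAlg q a :=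
  Algebra.subset_adjoin (Or.inl ⟨i, r, Or.inr (Or.inl rfl)⟩)

theorem wv_mem (i : ZMod n) (r : Fin (a i)) : wv i r ∈ fnAlg q a := pow_mem (sqrtW_mem i r) 2

theorem wv_inv_mem (i : ZMod n) (r : Fin (a i)) : (wv i r)⁻¹ ∈ fnAlg q a := by
  unfold wv
  rw [← inv_pow]
  exact pow_mem (sqrtW_inv_mem i r) 2

theorem cst_mem (S : Subalgebra ℂ (WField a)) (c : ℂ) : cst a c ∈ S := S.algebraMap_mem c

theorem wv_sub_inv_mem {i : ZMod n} {r s : Fin (a i)} (h : r ≠ s) (e : ℤ) :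
    (wv i r - cst a ((q : ℂ) ^ e) * wv i s)⁻¹ ∈ fnAlg q a := by
  rw [← smul_eq_cst_mul]
  exact Algebra.subset_adjoin (Or.inr ⟨i, r, s, e, h, rfl⟩)

theorem wv_sub_inv_mem_loc (i : ZMod n) (r : Fin (a i)) (s : Fin (a (i + 1))) (e : ℤ) :
    (wv i r - cst a ((q : ℂ) ^ e * (d : ℂ)) * wv (i + 1) s)⁻¹ ∈ fnAlgLoc q d a := by
  rw [← smul_eq_cst_mul]
  exact Algebra.subset_adjoin (Or.inr ⟨i, r, s, e, rfl⟩)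

theorem Dmon_single_mem (v : WVar a) (e : ℤ) : Dmon q a (Pi.single v e) ∈ diffAlg q a := by
  have h1 : Dmon q a (Pi.single v 1) ∈ diffAlg q a :=
    Algebra.subset_adjoin (Or.inl ⟨v.1, v.2, Or.inr (Or.inr (Or.inl rfl))⟩)
  have h2 : Dmon q a (Pi.single v (-1)) ∈ diffAlg q a :=
    Algebra.subset_adjoin (Or.inl ⟨v.1, v.2, Or.inr (Or.inr (Or.inr rfl))⟩)
  induction e using Int.induction_on with
  | zero => rw [Pi.single_zero, Dmon_zero]; exact one_mem _
  | succ k ih => rw [Pi.single_add, Dmon_add]; exact mul_mem ih h1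
  | pred k ih => rw [sub_eq_add_neg, Pi.single_add, Dmon_add]; exact mul_mem ih h2

theorem Dmon_mem (m : WVar a → ℤ) : Dmon q a m ∈ diffAlg q a := by
  classical
  have h : ∀ s : Finset (WVar a), Dmon q a (∑ v ∈ s, Pi.single v (m v)) ∈ diffAlg q a := by
    intro s
    induction s using Finset.induction_on with
    | empty => rw [Finset.sum_empty, Dmon_zero]; exact one_mem _
    | insert v s hv ih =>
      rw [Finset.sum_insert hv, Dmon_add]
      exact mul_mem (Dmon_single_mem v _) ih
  have := h Finset.univ
  rwa [Finset.univ_sum_single] at this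

theorem term_mem {m : WVar a → ℤ} {c : WField a} (h : c ∈ fnAlg q a) : term q m c ∈ diffAlg q a :=
  mul_mem h (Dmon_mem m)

theorem term_mem_loc {m : WVar a → ℤ} {c : WField a} (h : c ∈ fnAlgLoc q d a) :
    term q m c ∈ diffAlgLoc q d a := mul_mem h (diffAlg_le (Dmon_mem m))

variable (q) in
/-- The exponent of `q` in a coordinate. -/
def halfExp (ε : Bool) (t : Pt a) : ℤ := if ε then -2 * (t.2 : ℤ) else 2 * ((t.2 : ℤ) + 1)

theorem halfPt_eq_zpow (ε : Bool) (t : Pt a) :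
    halfPt ε q t = cst a ((q : ℂ) ^ halfExp ε t) * wv t.1.1 t.1.2 := by
  cases ε <;> rfl

theorem halfPt_mem (ε : Bool) (t : Pt a) : halfPt ε q t ∈ fnAlg q a := by
  rw [halfPt_eq_zpow]
  exact mul_mem (cst_mem _ _) (wv_mem _ _)

theorem halfPt_inv_mem (ε : Bool) (t : Pt a) : (halfPt ε q t)⁻¹ ∈ fnAlg q a := by
  rw [halfPt_eq_zpow, mul_inv, ← cst_inv]
  exact mul_mem (cst_mem _ _) (wv_inv_mem _ _)

theorem halfPt_sub_inv_mem (ε : Bool) {t t' : Pt a} (hc : ptCol t' = ptCol t) (e : ℤ) :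
    (halfPt ε q t - cst a ((q : ℂ) ^ e) * halfPt ε q t')⁻¹ ∈ fnAlg q a := by
  obtain ⟨⟨i, r⟩, p⟩ := t
  obtain ⟨⟨j, s⟩, p'⟩ := t'
  obtain rfl : j = i := hc
  rw [halfPt_eq_zpow, halfPt_eq_zpow]
  simp only
  set f := halfExp ε (⟨⟨j, r⟩, p⟩ : Pt a)
  set g := halfExp ε (⟨⟨j, s⟩, p'⟩ : Pt a)
  by_cases h : r = s
  · subst h
    have : cst a ((q : ℂ) ^ f) * wv j r - cst a ((q : ℂ) ^ e) * (cst a ((q : ℂ) ^ g) * wv j r) =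
      cst a ((q : ℂ) ^ f - (q : ℂ) ^ e * (q : ℂ) ^ g) * wv j r := by
      rw [show cst a ((q : ℂ) ^ f - (q : ℂ) ^ e * (q : ℂ) ^ g) = cst a ((q : ℂ) ^ f) -
        cst a ((q : ℂ) ^ e * (q : ℂ) ^ g) from map_sub _ _ _, cst_mul]
      ring
    rw [this, mul_inv, ← cst_inv]
    exact mul_mem (cst_mem _ _) (wv_inv_mem _ _)
  · have : cst a ((q : ℂ) ^ f) * wv j r - cst a ((q : ℂ) ^ e) * (cst a ((q : ℂ) ^ g) * wv j s) =
      cst a ((q : ℂ) ^ f) * (wv j r - cst a ((q : ℂ) ^ (e + g - f)) * wv j s) := by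
      have h1 : cst a ((q : ℂ) ^ f) * cst a ((q : ℂ) ^ (e + g - f)) =
          cst a ((q : ℂ) ^ e) * cst a ((q : ℂ) ^ g) := by
        rw [← cst_mul, ← cst_mul, ← zpow_add₀ q.ne_zero, ← zpow_add₀ q.ne_zero]
        congr 2; ring
      linear_combination wv j s * h1
    rw [this, mul_inv, ← cst_inv]
    exact mul_mem (cst_mem _ _) (wv_sub_inv_mem h _)

theorem mem_div {S : Subalgebra ℂ (WField a)} {x y : WField a} (hx : x ∈ S) (hy : y⁻¹ ∈ S) :
    x / y ∈ S := by
  rw [div_eq_mul_inv]; exact mul_mem hx hy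

variable [Fact (3 ≤ n)]

theorem halfZ_inv_mem (ε : Bool) {t t' : Pt a} (hc : ptCol t' = ptCol t) :
    (halfZ ε q d t t')⁻¹ ∈ fnAlg q a := by
  have key : ∀ t t' : Pt a, ptCol t' = ptCol t →
      (zeta q d (ptCol t) (ptCol t') (halfPt ε q t) (halfPt ε q t'))⁻¹ ∈ fnAlg q a := by
    intro t t' hc
    rw [hc, zeta_same, smul_eq_cst_mul, inv_div]
    exact mem_div (sub_mem (halfPt_mem _ _) (halfPt_mem _ _)) (halfPt_sub_inv_mem ε hc _)
  unfold halfZ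
  split_ifs
  · exact key t t' hc
  · exact key t' t hc.symm

/-- The constant in the pole `x_t = κ x_t'` of an arrow. -/
def poleCst (ε : Bool) (q d : ℂˣ) (i j : ZMod n) : ℂ := (halfQ ε q : ℂ) * (d : ℂ) ^ (-mMat i j)

theorem halfZ_arrow (ε : Bool) {t t' : Pt a}
    (h : ptCol t' = ptCol t + 1 ∨ ptCol t' = ptCol t - 1) : ∃ c : ℂ, (halfZ ε q d t t')⁻¹ =
      cst a c * ((halfPt ε q t - halfPt ε q t') *
        (halfPt ε q t - cst a (poleCst ε q d (ptCol t) (ptCol t')) * halfPt ε q t')⁻¹) := by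
  have hv : t.1 ≠ t'.1 := fun h' => ne_of_adj h (congrArg Sigma.fst h').symm
  have h0 : halfPt ε q t - halfPt ε q t' ≠ 0 := by
    have := halfPt_sub_ne_zero (q := q) ε hv 1
    rwa [cst_one, one_mul] at this
  have h1 := halfPt_sub_ne_zero (q := q) ε hv (poleCst ε q d (ptCol t) (ptCol t'))
  have hZ : ∀ u : ℂ, u ≠ 0 → halfZ ε q d t t' * (halfPt ε q t - halfPt ε q t') = cst a u *
      (halfPt ε q t - cst a (poleCst ε q d (ptCol t) (ptCol t')) * halfPt ε q t') →
      (halfZ ε q d t t')⁻¹ = cst a u⁻¹ * ((halfPt ε q t - halfPt ε q t') *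
        (halfPt ε q t - cst a (poleCst ε q d (ptCol t) (ptCol t')) * halfPt ε q t')⁻¹) := by
    intro u hu h
    rw [eq_div_of_mul_eq h0 h, cst_inv, inv_div, div_eq_mul_inv, mul_inv]
    ring
  have e4 : cst a (q : ℂ)⁻¹ * cst a (q : ℂ) = 1 := by
      rw [← cst_mul, inv_mul_cancel₀ q.ne_zero, cst_one]
  have e5 : cst a (d : ℂ)⁻¹ * cst a (d : ℂ) = 1 := by
      rw [← cst_mul, inv_mul_cancel₀ d.ne_zero, cst_one]
  have h0' : halfPt ε q t' - halfPt ε q t ≠ 0 := by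
    rw [← neg_sub]; exact neg_ne_zero.2 h0
  rcases h with h | h
  · have hm : mMat (ptCol t) (ptCol t') = -1 := by rw [h]; simp [mMat]
    cases ε
    · refine ⟨_, hZ (q * (d : ℂ)⁻¹) (by simp) ?_⟩
      have h' : ptCol t = ptCol t' - 1 := by rw [h]; ring
      have hz : halfZ false q d t t' = zeta q d (ptCol t') (ptCol t' - 1) (halfPt false q t')
        (halfPt false q t) := by rw [← h']; rfl
      rw [hz, zeta_pred, poleCst, hm]
      simp only [smul_eq_cst_mul, neg_neg, zpow_one, cst_mul, halfQ, Bool.false_eq_true, if_false,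
        Units.val_inv_eq_inv_val]
      rw [div_mul_eq_mul_div, div_eq_iff h0']
      linear_combination (halfPt false q t' - halfPt false q t) * (halfPt false q t' *
        (cst a (q : ℂ)⁻¹ * cst a (q : ℂ)) * e5 + halfPt false q t' * e4)
    · refine ⟨_, hZ (d : ℂ)⁻¹ (by simp) ?_⟩
      have hz : halfZ true q d t t' = zeta q d (ptCol t) (ptCol t + 1) (halfPt true q t)
        (halfPt true q t') := by rw [← h]; rfl
      rw [hz, zeta_succ, poleCst, hm, div_mul_cancel₀ _ h0]
      simp only [smul_eq_cst_mul, neg_neg, zpow_one, cst_mul, halfQ, if_true]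
      linear_combination (-cst a (q : ℂ) * halfPt true q t') * (-e5)
  · have hm : mMat (ptCol t) (ptCol t') = 1 := by
      rw [h]; simp [mMat, (add_one_ne_sub_one (ptCol t)).symm]
    cases ε
    · refine ⟨_, hZ (q : ℂ) (by simp) ?_⟩
      have h' : ptCol t = ptCol t' + 1 := by rw [h]; ring
      have hz : halfZ false q d t t' = zeta q d (ptCol t') (ptCol t' + 1) (halfPt false q t')
        (halfPt false q t) := by rw [← h']; rfl
      rw [hz, zeta_succ, poleCst, hm]
      simp only [smul_eq_cst_mul, zpow_neg, zpow_one, cst_mul, halfQ, Bool.false_eq_true, if_false,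
        Units.val_inv_eq_inv_val]
      rw [div_mul_eq_mul_div, div_eq_iff h0']
      linear_combination (halfPt false q t' - halfPt false q t) * halfPt false q t' *
        (cst a (d : ℂ)⁻¹) * e4
    · refine ⟨_, hZ 1 one_ne_zero ?_⟩
      have hz : halfZ true q d t t' = zeta q d (ptCol t) (ptCol t - 1) (halfPt true q t)
        (halfPt true q t') := by rw [← h]; rfl
      rw [hz, zeta_pred, poleCst, hm, div_mul_cancel₀ _ h0]
      simp only [smul_eq_cst_mul, zpow_neg, zpow_one, halfQ, if_true, cst_one, one_mul]

theorem pole_inv_mem_loc (ε : Bool) {t t' : Pt a}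
    (h : ptCol t' = ptCol t + 1 ∨ ptCol t' = ptCol t - 1) :
    (halfPt ε q t - cst a (poleCst ε q d (ptCol t) (ptCol t')) * halfPt ε q t')⁻¹ ∈
      fnAlgLoc q d a := by
  obtain ⟨⟨i, r⟩, p⟩ := t
  obtain ⟨⟨j, s⟩, p'⟩ := t'
  have hQ : ∃ f : ℤ, (halfQ ε q : ℂ) = (q : ℂ) ^ f := by
    cases ε
    · exact ⟨-1, by simp [halfQ]⟩
    · exact ⟨1, by simp [halfQ]⟩
  obtain ⟨g, hg⟩ := hQ
  rw [halfPt_eq_zpow, halfPt_eq_zpow, poleCst, hg]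
  simp only [ptCol] at h ⊢
  set e := halfExp ε (⟨⟨i, r⟩, p⟩ : Pt a)
  set f := halfExp ε (⟨⟨j, s⟩, p'⟩ : Pt a)
  rcases h with rfl | h
  · have hm : mMat i (i + 1) = -1 := by simp [mMat]
    rw [hm, neg_neg, zpow_one]
    have : cst a ((q : ℂ) ^ e) * wv i r - cst a ((q : ℂ) ^ g * d) *
        (cst a ((q : ℂ) ^ f) * wv (i + 1) s) = cst a ((q : ℂ) ^ e) *
        (wv i r - cst a ((q : ℂ) ^ (g + f - e) * (d : ℂ)) * wv (i + 1) s) := by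
      have h1 : cst a ((q : ℂ) ^ e) * cst a ((q : ℂ) ^ (g + f - e) * (d : ℂ)) =
          cst a ((q : ℂ) ^ g * d) * cst a ((q : ℂ) ^ f) := by
        rw [← cst_mul, ← cst_mul, ← mul_assoc, ← zpow_add₀ q.ne_zero, mul_right_comm,
          ← zpow_add₀ q.ne_zero]
        congr 3; ring
      linear_combination wv (i + 1) s * h1
    rw [this, mul_inv, ← cst_inv]
    exact mul_mem (cst_mem _ _) (wv_sub_inv_mem_loc i r s _)
  · obtain rfl : i = j + 1 := by rw [h]; ring
    have hm : mMat (j + 1) j = 1 := by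
      have h2 : j ≠ j + 1 + 1 := (add_two_ne j).symm
      simp [mMat, h2]
    rw [hm, zpow_neg, zpow_one]
    have : cst a ((q : ℂ) ^ e) * wv (j + 1) r - cst a ((q : ℂ) ^ g * (d : ℂ)⁻¹) *
        (cst a ((q : ℂ) ^ f) * wv j s) = -cst a ((q : ℂ) ^ g * (d : ℂ)⁻¹ * (q : ℂ) ^ f) *
        (wv j s - cst a ((q : ℂ) ^ (e - g - f) * (d : ℂ)) * wv (j + 1) r) := by
      have h1 : cst a ((q : ℂ) ^ g * (d : ℂ)⁻¹ * (q : ℂ) ^ f) *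
          cst a ((q : ℂ) ^ (e - g - f) * (d : ℂ)) = cst a ((q : ℂ) ^ e) := by
        rw [← cst_mul]
        congr 1
        have hd := d.ne_zero
        have h3 : (q : ℂ) ^ g * (q : ℂ) ^ f * (q : ℂ) ^ (e - g - f) = (q : ℂ) ^ e := by
          rw [← zpow_add₀ q.ne_zero, ← zpow_add₀ q.ne_zero]
          congr 1; ring
        rw [← h3]
        field_simp
      have h2 : cst a ((q : ℂ) ^ g * (d : ℂ)⁻¹ * (q : ℂ) ^ f) =
        cst a ((q : ℂ) ^ g * (d : ℂ)⁻¹) * cst a ((q : ℂ) ^ f) := cst_mul _ _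
      linear_combination (-wv (j + 1) r) * h1 + wv j s * h2
    rw [this, mul_inv, inv_neg, ← cst_inv]
    exact mul_mem (neg_mem (cst_mem _ _)) (wv_sub_inv_mem_loc j s r _)

end Membership

/-! the poles of the coefficients -/

section Poles

variable {n : ℕ} [NeZero n] [Fact (3 ≤ n)] {q d : ℂˣ} {a : ZMod n → ℕ} {N : ZMod n → ℕ}
  (z : ∀ i, Fin (N i) → ℂˣ) (o : ZMod n → Bool)

/-- `x` is the product of `y` and an element of `S`. -/
def MultipleOf {K : Type} [Field K] [Algebra ℂ K] (S : Subalgebra ℂ K) (x y : K) : Prop :=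
  ∃ s ∈ S, x = s * y

namespace MultipleOf

variable {K : Type} [Field K] [Algebra ℂ K] {S : Subalgebra ℂ K}

theorem of_mem {x : K} (h : x ∈ S) : MultipleOf S x 1 := ⟨x, h, (mul_one x).symm⟩

theorem refl (x : K) : MultipleOf S x x := ⟨1, one_mem S, (one_mul x).symm⟩

theorem mul {x y x' y' : K} (h : MultipleOf S x y) (h' : MultipleOf S x' y') :
    MultipleOf S (x * x') (y * y') := by
  obtain ⟨s, hs, rfl⟩ := h
  obtain ⟨s', hs', rfl⟩ := h'
  exact ⟨s * s', mul_mem hs hs', by ring⟩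

theorem trans {x y w : K} (h : MultipleOf S x y) (h' : MultipleOf S y w) : MultipleOf S x w := by
  obtain ⟨s, hs, rfl⟩ := h
  obtain ⟨s', hs', rfl⟩ := h'
  exact ⟨s * s', mul_mem hs hs', by ring⟩

theorem prod {ι : Type*} (T : Finset ι) {f g : ι → K} (h : ∀ i ∈ T, MultipleOf S (f i) (g i)) :
    MultipleOf S (∏ i ∈ T, f i) (∏ i ∈ T, g i) := by
  choose! s hs h using h
  exact ⟨∏ i ∈ T, s i, prod_mem hs, by rw [← Finset.prod_mul_distrib]; exact Finset.prod_congr rfl h⟩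

theorem mem {x y : K} (h : MultipleOf S x y) (hy : y ∈ S) : x ∈ S := by
  obtain ⟨s, hs, rfl⟩ := h
  exact mul_mem hs hy

end MultipleOf

/-- The possible pole of an arrow. -/
def poleTerm (ε : Bool) (q d : ℂˣ) (t t' : Pt a) : WField a :=
  halfPt ε q t - cst a (poleCst ε q d (ptCol t) (ptCol t')) * halfPt ε q t'

theorem not_mem_arrowsOf_self (ε : Bool) (i : ZMod n) : i ∉ arrowsOf ε o i := fun h =>
  ne_of_adj (adj_of_mem_arrowsOf h) rfl

theorem poleTerm_mem (ε : Bool) (t t' : Pt a) : poleTerm ε q d t t' ∈ fnAlg q a :=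
  sub_mem (halfPt_mem _ _) (mul_mem (cst_mem _ _) (halfPt_mem _ _))

variable (d) in
theorem halfYat_multiple (ε : Bool) (v : WVar a) (t : Pt a) :
    MultipleOf (fnAlg q a) (halfYat q d o ε v t)
      (if v.1 ∈ arrowsOf ε o (ptCol t) then poleTerm ε q d t ⟨v, 0⟩ else 1) := by
  have hx := halfPt_ne_zero ε q t
  unfold halfYat
  change MultipleOf _ _ (if v.1 ∈ arrowsOf ε o t.1.1 then _ else _)
  by_cases hc : v.1 = t.1.1
  · have h2 : v.1 ∉ arrowsOf ε o t.1.1 := by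
      rw [hc]; exact not_mem_arrowsOf_self o ε _
    rw [if_pos hc, if_neg h2]
    refine .of_mem (mul_mem ?_ ?_)
    · split_ifs
      · exact wv_mem _ _
      · exact one_mem _
    · split_ifs
      · exact one_mem _
      · have h1 : 1 - halfPt ε q (⟨v, 0⟩ : Pt a) / halfPt ε q t =
          (halfPt ε q t - cst a ((q : ℂ) ^ (0 : ℤ)) * halfPt ε q ⟨v, 0⟩) / halfPt ε q t := by
          rw [zpow_zero, cst_one, one_mul]
          field_simp
        rw [h1, inv_div]
        exact mem_div (halfPt_mem _ _) (halfPt_sub_inv_mem (t := t) (t' := ⟨v, 0⟩) ε hc 0)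
  · rw [if_neg hc]
    by_cases har : v.1 ∈ arrowsOf ε o t.1.1
    · rw [if_pos har, if_pos har]
      refine ⟨(sqrtW v.1 v.2)⁻¹ * (halfPt ε q t)⁻¹, mul_mem (sqrtW_inv_mem _ _) (halfPt_inv_mem _ _), ?_⟩
      unfold poleTerm poleCst ptCol
      simp only
      field_simp
    · rw [if_neg har, if_neg har]
      exact .refl 1

theorem halfYbase_mem (ε : Bool) (i : ZMod n) (t : Pt a) :
    halfYbase q a z ε i (halfPt ε q t) ∈ fnAlg q a := by
  unfold halfYbase
  split_ifs
  · refine mul_mem (cst_mem _ _) (prod_mem fun s _ => sub_mem (one_mem _) ?_)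
    exact mem_div (cst_mem _ _) (halfPt_inv_mem _ _)
  · exact cst_mem _ _

theorem halfK_multiple (ε : Bool) (t t' : Pt a) :
    MultipleOf (fnAlg q a) (halfK q d o ε t t')
      ((if ptCol t' ∈ arrowsOf ε o (ptCol t) then halfPt ε q t - halfPt ε q t' else 1) *
      (if ptCol t' ∈ arrowsOf ε o (ptCol t) then (poleTerm ε q d t t')⁻¹ else 1)) := by
  unfold halfK
  by_cases har : ptCol t' ∈ arrowsOf ε o (ptCol t)
  · have hadj := adj_of_mem_arrowsOf har
    have hc := ne_of_adj hadj
    have hv : t.1 ≠ t'.1 := fun h' => hc (congrArg Sigma.fst h').symm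
    obtain ⟨c, hZ⟩ := halfZ_arrow (q := q) (d := d) ε hadj
    simp only [har, hc, hv, if_true, if_false, false_and, one_mul]
    exact ⟨cst a c, cst_mem _ _, hZ⟩
  · simp only [har, if_false, mul_one]
    refine .of_mem (mul_mem (mul_mem ?_ ?_) ?_)
    · split_ifs
      · exact cst_mem _ _
      · exact one_mem _
    · split_ifs with h
      · exact halfZ_inv_mem ε (congrArg Sigma.fst h.1.symm)
      · exact one_mem _
    · split_ifs with h
      · exact mul_mem (cst_mem _ _) (halfZ_inv_mem ε h.1)
      · exact one_mem _

theorem ColEnum.prod_block {M : Type*} [CommMonoid M] {L : Type} [Field L] [Algebra ℂ L] {ι : Type}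
    [DecidableEq ι] {col : ι → ZMod n} {T : Finset ι} {x : ι → L} {k : ZMod n → ℕ}
    (e : ColEnum col T k) (f : ZMod n → L → M) :
    ∏ u ∈ block 0 k, f u.1 (e.point x u) = ∏ t ∈ T, f (col t) (x t) := by
  refine Finset.prod_bij (fun u hu => (e.equiv ⟨u, ?_⟩).1) ?_ ?_ ?_ ?_
  · simpa [mem_block] using hu
  · intro u hu; exact (e.equiv _).2
  · intro u hu v hv h
    exact congrArg Subtype.val (e.equiv.injective (Subtype.ext h))
  · intro t ht
    refine ⟨(e.equiv.symm ⟨t, ht⟩).1, ?_, ?_⟩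
    · have := (e.equiv.symm ⟨t, ht⟩).2
      simpa [mem_block] using this
    · simp
  · intro u hu
    have hu' : u.2 < k u.1 := by simpa [mem_block] using hu
    rw [e.col_eq, e.point_of_lt x ⟨u, hu'⟩]

theorem poleDenAt_point {L : Type} [Field L] [Algebra ℂ L] {ι : Type}
    [DecidableEq ι] {col : ι → ZMod n} {T : Finset ι} {x : ι → L} {k : ZMod n → ℕ}
    (e : ColEnum col T k) : poleDenAt k (e.point x) =
      ∏ t ∈ T, ∏ t' ∈ T, if col t' = col t + 1 then x t - x t' else 1 := by
  have h1 := (hasEval_poleDen k (e.point x)).evalRat_eq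
  rw [poleDen_eq] at h1
  have h2 : HasEval (e.point x) (∏ u ∈ block 0 k, ∏ v ∈ block 0 k, poleFactor u v)
      (∏ u ∈ block 0 k, ∏ v ∈ block 0 k,
        if v.1 = u.1 + 1 then e.point x u - e.point x v else 1) := by
    refine HasEval.prod _ fun u _ => HasEval.prod _ fun v _ => ?_
    unfold poleFactor
    split_ifs
    · exact (HasEval.var _ _).sub (HasEval.var _ _)
    · exact HasEval.one _
  rw [← h1, h2.evalRat_eq]
  rw [Finset.prod_congr rfl fun u _ => e.prod_block (x := x)
    (fun i y => if i = u.1 + 1 then e.point x u - y else 1)]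
  exact e.prod_block (fun i y => ∏ t' ∈ T, if col t' = i + 1 then y - x t' else 1)

theorem arrow_numerators (ε : Bool) (T : Finset (Pt a)) : MultipleOf (fnAlg q a)
    (∏ t ∈ T, ∏ t' ∈ T, if ptCol t' ∈ arrowsOf ε o (ptCol t) then
      halfPt ε q t - halfPt ε q t' else 1)
    (∏ t ∈ T, ∏ t' ∈ T, if ptCol t' = ptCol t + 1 then halfPt ε q t - halfPt ε q t' else 1) := by
  have h1 : ∀ t t' : Pt a, (if ptCol t' ∈ arrowsOf ε o (ptCol t) then
      halfPt ε q t - halfPt ε q t' else 1) =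
      (if ptCol t' ∈ arrowsOf ε o (ptCol t) ∧ ptCol t' = ptCol t + 1 then
        halfPt ε q t - halfPt ε q t' else 1) *
      (if ptCol t' ∈ arrowsOf ε o (ptCol t) ∧ ptCol t = ptCol t' + 1 then
        halfPt ε q t - halfPt ε q t' else 1) := by
    intro t t'
    by_cases har : ptCol t' ∈ arrowsOf ε o (ptCol t)
    · rcases adj_of_mem_arrowsOf har with h | h
      · have h2 : ptCol t ≠ ptCol t' + 1 := by rw [h]; exact (add_two_ne _).symm
        rw [if_pos har, if_pos ⟨har, h⟩, if_neg (fun h => h2 h.2), mul_one]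
      · have h2 : ptCol t' ≠ ptCol t + 1 := by rw [h]; exact (add_one_ne_sub_one _).symm
        have h3 : ptCol t = ptCol t' + 1 := by rw [h]; ring
        rw [if_pos har, if_neg (fun h => h2 h.2), if_pos ⟨har, h3⟩, one_mul]
    · simp [har]
  simp only [h1, Finset.prod_mul_distrib]
  rw [Finset.prod_comm (f := fun t t' => if ptCol t' ∈ arrowsOf ε o (ptCol t) ∧
    ptCol t = ptCol t' + 1 then halfPt ε q t - halfPt ε q t' else 1)]
  simp only [← Finset.prod_mul_distrib]
  refine .prod _ fun t _ => .prod _ fun t' _ => ?_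
  by_cases h : ptCol t' = ptCol t + 1
  · simp only [h, and_true, if_true]
    have hx := arrowsOf_xor (ε := ε) (o := o) (Or.inl h)
    rw [h] at hx
    by_cases har : ptCol t + 1 ∈ arrowsOf ε o (ptCol t)
    · rw [if_pos har, if_neg (hx.1 har), mul_one]
      exact .refl _
    · rw [if_neg har, if_pos (by by_contra h'; exact har (hx.2 h')), one_mul]
      exact ⟨-1, neg_mem (one_mem _), by ring⟩
  · simp only [h, and_false, if_false, mul_one]
    exact .refl _

theorem halfCoeff_factor (hq : ∀ m : ℕ, 0 < m → q ^ m ≠ 1) (ε : Bool) {k : ZMod n → ℕ}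
    {m : ∀ i, Fin (a i) → ℕ} (en : ColEnum ptCol (pts m) k) (F : ShuffleComp q d k)
    {e : ℕ} {P : MvPolynomial (Var n) ℂ}
    (hP : F.val * poleDen k * (∏ v ∈ block 0 k, rvar v) ^ e = algebraMap _ (RatFun (Var n)) P) :
    MultipleOf (fnAlg q a) (halfCoeff q d z o ε m (DirectSum.of (ShuffleComp q d) k F))
      ((∏ t ∈ pts m, ∏ v, if v.1 ∈ arrowsOf ε o (ptCol t) then poleTerm ε q d t ⟨v, 0⟩ else 1) *
        (∏ t ∈ pts m, ∏ t' ∈ pts m,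
          if ptCol t' ∈ arrowsOf ε o (ptCol t) then (poleTerm ε q d t t')⁻¹ else 1) *
        MvPolynomial.aeval (en.point (halfPt ε q)) P) := by
  have hx := (halfPt_injective (a := a) hq ε)
  have hgen := en.generic hx.injOn fun t _ => halfPt_ne_zero ε q t
  have h0 := hgen.poleDenAt_ne_zero
  unfold halfCoeff halfC
  rw [valueAt_of en hx.injOn fun t _ => halfPt_ne_zero ε q t,
    (hasEval_of_numerator hP hgen).evalRat_eq]
  have hY : MultipleOf (fnAlg q a) (∏ t ∈ pts m, halfY q d z o ε t) (∏ t ∈ pts m, ∏ v,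
      if v.1 ∈ arrowsOf ε o (ptCol t) then poleTerm ε q d t ⟨v, 0⟩ else 1) := by
    refine .prod _ fun t _ => ?_
    rw [halfY_eq]
    have := (MultipleOf.of_mem (halfYbase_mem (q := q) z ε t.1.1 t)).mul
      (MultipleOf.prod Finset.univ fun v _ => halfYat_multiple d o ε v t)
    rwa [one_mul] at this
  have hK : MultipleOf (fnAlg q a) (∏ t ∈ pts m, ∏ t' ∈ pts m, halfK q d o ε t t')
      (poleDenAt k (en.point (halfPt ε q)) * ∏ t ∈ pts m, ∏ t' ∈ pts m,
          if ptCol t' ∈ arrowsOf ε o (ptCol t) then (poleTerm ε q d t t')⁻¹ else 1) := by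
    have h1 := MultipleOf.prod (pts m) fun t _ => MultipleOf.prod (pts m) fun t' _ =>
      halfK_multiple (q := q) (d := d) o ε t t'
    simp only [Finset.prod_mul_distrib] at h1
    refine h1.trans (.mul ?_ (.refl _))
    rw [poleDenAt_point en]
    exact arrow_numerators o ε (pts m)
  have hM : MultipleOf (fnAlg q a) ((∏ v ∈ block 0 k, en.point (halfPt ε q) v) ^ e)⁻¹ 1 := by
    refine .of_mem ?_
    rw [← inv_pow, ← Finset.prod_inv_distrib]
    refine pow_mem ?_ e
    have := en.prod_block (x := halfPt ε q) (fun _ y => y⁻¹)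
    rw [this]
    exact prod_mem fun t _ => halfPt_inv_mem ε t
  obtain ⟨s1, hs1, e1⟩ := hY
  obtain ⟨s2, hs2, e2⟩ := hK
  obtain ⟨s3, hs3, e3⟩ := hM
  refine ⟨s1 * s2 * s3, mul_mem (mul_mem hs1 hs2) hs3, ?_⟩
  rw [e1, e2, div_eq_mul_inv, mul_inv, e3]
  field_simp

theorem aeval_mem {S : Subalgebra ℂ (WField a)} {X : Type} {p : X → WField a} (h : ∀ v, p v ∈ S)
    (P : MvPolynomial X ℂ) : MvPolynomial.aeval p P ∈ S := by
  induction P using MvPolynomial.induction_on with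
  | C c => rw [MvPolynomial.aeval_C]; exact S.algebraMap_mem c
  | add P Q hP hQ => rw [map_add]; exact add_mem hP hQ
  | mul_X P v hP => rw [map_mul, MvPolynomial.aeval_X]; exact mul_mem hP (h v)

theorem point_mem {S : Subalgebra ℂ (WField a)} {k : ZMod n → ℕ} {T : Finset (Pt a)}
    (en : ColEnum ptCol T k) {x : Pt a → WField a} (h : ∀ t, x t ∈ S) (v : Var n) :
    en.point x v ∈ S := by
  unfold ColEnum.point
  split_ifs
  · exact h _
  · exact zero_mem _

theorem hat_mem_loc (hq : ∀ m : ℕ, 0 < m → q ^ m ≠ 1) (ε : Bool) (E : Shuffle (n := n) q d) :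
    hat (a := a) z o hq ε E ∈ diffAlgLoc q d a := by
  induction E using DirectSum.induction_on with
  | zero => rw [map_zero]; exact zero_mem _
  | add E E' hE hE' => rw [map_add]; exact add_mem hE hE'
  | of k F =>
    rw [hat_of]
    refine sum_mem fun m hm => term_mem_loc ?_
    obtain ⟨en⟩ := ColEnum.exists_enum_of_eq (mem_splittings.1 hm)
    obtain ⟨e, P, -, hP⟩ := exists_numerator F.val_mem
    obtain ⟨s, hs, h⟩ := halfCoeff_factor z o hq ε en F hP
    rw [h]
    refine mul_mem (fnAlg_le hs) (mul_mem (mul_mem ?_ ?_) ?_)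
    · refine fnAlg_le (prod_mem fun t _ => prod_mem fun v _ => ?_)
      split_ifs
      · exact poleTerm_mem _ _ _
      · exact one_mem _
    · refine prod_mem fun t _ => prod_mem fun t' _ => ?_
      split_ifs with har
      · exact pole_inv_mem_loc ε (adj_of_mem_arrowsOf har)
      · exact one_mem _
    · exact fnAlg_le (aeval_mem (point_mem en fun t => halfPt_mem ε t) P)

end Poles

/-! divisibility by linear forms -/

section LinearForms

variable {X : Type} [DecidableEq X]

theorem sub_dvd_of_subst (v : X) (g P : MvPolynomial X ℂ)
    (hP : MvPolynomial.aeval (Function.update MvPolynomial.X v g) P = 0) :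
    (MvPolynomial.X v - g) ∣ P := by
  have key : ∀ Q : MvPolynomial X ℂ, (MvPolynomial.X v - g) ∣
      Q - MvPolynomial.aeval (Function.update MvPolynomial.X v g) Q := by
    intro Q
    induction Q using MvPolynomial.induction_on with
    | C a => simp
    | add p q hp hq =>
      rw [map_add, add_sub_add_comm]
      exact dvd_add hp hq
    | mul_X p w hp =>
      set f := MvPolynomial.aeval (R := ℂ) (Function.update MvPolynomial.X v g) with hf
      have : p * MvPolynomial.X w - f (p * MvPolynomial.X w) =
          (p - f p) * MvPolynomial.X w + f p * (MvPolynomial.X w - f (MvPolynomial.X w)) := by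
        rw [map_mul]; ring
      rw [this]
      refine dvd_add (hp.mul_right _) (Dvd.dvd.mul_left ?_ _)
      rw [hf, MvPolynomial.aeval_X]
      by_cases hu : w = v
      · subst hu; simp
      · simp [Function.update_of_ne hu]
  have := key P
  rwa [hP, sub_zero] at this

theorem prod_sub_dvd_of_subst {ι : Type} [DecidableEq ι] (t : Finset ι) (v : ι → X)
    (g : ι → MvPolynomial X ℂ)
    (hne : ∀ i ∈ t, ∀ j ∈ t, i ≠ j →
      MvPolynomial.aeval (Function.update MvPolynomial.X (v j) (g j)) (MvPolynomial.X (v i) - g i) ≠ 0)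
    (P : MvPolynomial X ℂ)
    (hP : ∀ i ∈ t, MvPolynomial.aeval (Function.update MvPolynomial.X (v i) (g i)) P = 0) :
    (∏ i ∈ t, (MvPolynomial.X (v i) - g i)) ∣ P := by
  induction t using Finset.induction_on with
  | empty => simp
  | insert a t ha ih =>
    obtain ⟨Q, rfl⟩ := ih
      (fun i hi j hj => hne i (Finset.mem_insert_of_mem hi) j (Finset.mem_insert_of_mem hj))
      (fun i hi => hP i (Finset.mem_insert_of_mem hi))
    rw [Finset.prod_insert ha, mul_comm]
    refine mul_dvd_mul_left _ (sub_dvd_of_subst _ _ _ ?_)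
    have h0 := hP a (Finset.mem_insert_self _ _)
    rw [map_mul, map_prod] at h0
    refine (mul_eq_zero.1 h0).resolve_left (Finset.prod_ne_zero_iff.2 fun i hi => ?_)
    exact hne i (Finset.mem_insert_of_mem hi) a (Finset.mem_insert_self _ _)
      (by rintro rfl; exact ha hi)

theorem C_mul_X_inj {c c' : ℂ} (hc : c ≠ 0) {v v' : X}
    (h : (MvPolynomial.C c * MvPolynomial.X v : MvPolynomial X ℂ) =
      MvPolynomial.C c' * MvPolynomial.X v') : v = v' ∧ c = c' := by
  have h2 := congrArg (MvPolynomial.coeff (Finsupp.single v 1)) h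
  rw [MvPolynomial.coeff_C_mul, MvPolynomial.coeff_C_mul, MvPolynomial.coeff_X,
    MvPolynomial.coeff_X, if_pos rfl, mul_one] at h2
  by_cases hv : v' = v
  · subst hv
    rw [if_pos rfl, mul_one] at h2
    exact ⟨rfl, h2⟩
  · rw [if_neg, mul_zero] at h2
    · exact absurd h2 hc
    · intro h3
      rw [Finsupp.single_eq_single_iff] at h3
      rcases h3 with h3 | h3
      · exact hv h3.1
      · omega

theorem prime_X_sub {v v' : X} (h : v ≠ v') (c : ℂ) :
    Prime (MvPolynomial.X v - MvPolynomial.C c * MvPolynomial.X v' : MvPolynomial X ℂ) := by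
  set g : MvPolynomial X ℂ := MvPolynomial.C c * MvPolynomial.X v' with hg
  set f := MvPolynomial.aeval (R := ℂ) (Function.update MvPolynomial.X v g) with hf
  have h0 : f (MvPolynomial.X v - g) = 0 := by
    rw [hg, hf]
    simp only [map_sub, map_mul, MvPolynomial.algHom_C, MvPolynomial.algebraMap_eq,
      MvPolynomial.aeval_X, Function.update_self, Function.update_of_ne h.symm, hg, sub_self]
  have hdvd : ∀ P, (MvPolynomial.X v - g) ∣ P ↔ f P = 0 := by
    intro P
    refine ⟨?_, sub_dvd_of_subst v g P⟩
    rintro ⟨Q, rfl⟩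
    rw [map_mul, h0, zero_mul]
  refine ⟨?_, ?_, ?_⟩
  · intro h1
    have : (MvPolynomial.C 1 * MvPolynomial.X v : MvPolynomial X ℂ) =
        MvPolynomial.C c * MvPolynomial.X v' := by
      rw [map_one, one_mul]; exact sub_eq_zero.1 h1
    exact h (C_mul_X_inj one_ne_zero this).1
  · intro h1
    have := (hdvd 1).1 (h1.dvd)
    rw [map_one] at this
    exact one_ne_zero this
  · intro P Q hPQ
    rw [hdvd, map_mul] at hPQ
    rw [hdvd, hdvd]
    exact mul_eq_zero.1 hPQ

theorem isRelPrime_linear {v v' u u' : X} {c c' e e' : ℂ} (hc : c ≠ 0) (hc' : c' ≠ 0) (he : e ≠ 0)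
    (hv : v ≠ v') (hu : u ≠ u') (h1 : ¬ (v = u ∧ v' = u')) (h2 : ¬ (v = u' ∧ v' = u)) :
    IsRelPrime (MvPolynomial.C c * MvPolynomial.X v - MvPolynomial.C c' * MvPolynomial.X v' :
      MvPolynomial X ℂ) (MvPolynomial.C e * MvPolynomial.X u - MvPolynomial.C e' * MvPolynomial.X u') := by
  have hf : (MvPolynomial.C c * MvPolynomial.X v - MvPolynomial.C c' * MvPolynomial.X v' :
      MvPolynomial X ℂ) = MvPolynomial.C c *
      (MvPolynomial.X v - MvPolynomial.C (c' / c) * MvPolynomial.X v') := by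
    rw [mul_sub, ← mul_assoc, ← map_mul, mul_div_cancel₀ _ hc]
  have hun : IsUnit (MvPolynomial.C c : MvPolynomial X ℂ) := (IsUnit.mk0 c hc).map _
  rw [hf, isRelPrime_mul_unit_left_left hun]
  refine ((prime_X_sub hv _).irreducible.isRelPrime_iff_not_dvd).2 ?_
  rintro ⟨Q, hQ⟩
  have h3 := congrArg (MvPolynomial.aeval (R := ℂ) (Function.update MvPolynomial.X v
    (MvPolynomial.C (c' / c) * MvPolynomial.X v'))) hQ
  have hcc : c' / c ≠ 0 := div_ne_zero hc' hc
  have hL : MvPolynomial.aeval (R := ℂ) (Function.update MvPolynomial.X v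
    (MvPolynomial.C (c' / c) * MvPolynomial.X v'))
    (MvPolynomial.X v - MvPolynomial.C (c' / c) * MvPolynomial.X v') = 0 := by
    simp [hv.symm, MvPolynomial.algebraMap_eq]
  rw [map_mul, hL, zero_mul] at h3
  simp only [map_sub, map_mul, MvPolynomial.algHom_C, MvPolynomial.algebraMap_eq,
    MvPolynomial.aeval_X] at h3
  by_cases huv : u = v
  · subst huv
    rw [Function.update_self, Function.update_of_ne hu.symm, ← mul_assoc, ← map_mul] at h3
    exact h1 ⟨rfl, (C_mul_X_inj (mul_ne_zero he hcc) (sub_eq_zero.1 h3)).1⟩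
  · rw [Function.update_of_ne huv] at h3
    by_cases huv' : u' = v
    · subst huv'
      rw [Function.update_self, ← mul_assoc, ← map_mul] at h3
      exact h2 ⟨rfl, (C_mul_X_inj he (sub_eq_zero.1 h3)).1.symm⟩
    · rw [Function.update_of_ne huv'] at h3
      exact hu (C_mul_X_inj he (sub_eq_zero.1 h3)).1

end LinearForms

/-! consequences of the wheel conditions -/

section Wheel

variable {n : ℕ} [NeZero n] [Fact (3 ≤ n)] {q d : ℂˣ}

/-- The wheel conditions for a homogeneous element. -/
def IsWheel (q d : ℂˣ) (k : ZMod n → ℕ) (F : RatFun (Var n)) : Prop :=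
  ∀ (i : ZMod n) (ε : ℤ), (ε = 1 ∨ ε = -1) → 2 ≤ k i → 1 ≤ k (i + ε) →
    evalRat (wheelPoint q d i ε) F = 0

/-- `q² ≠ 1`, `q d ≠ 1` and `q d⁻¹ ≠ 1`. -/
structure WheelGeneric (q d : ℂˣ) : Prop where
  sq : (q : ℂ) ^ 2 ≠ 1
  mul : (q : ℂ) * d ≠ 1
  div : (q : ℂ) * (d : ℂ)⁻¹ ≠ 1

theorem WheelGeneric.of_roots (hq : ∀ m : ℕ, 0 < m → q ^ m ≠ 1)
    (hqd : ∀ m : ℕ, 0 < m → (q * d) ^ m ≠ 1) (hqd' : ∀ m : ℕ, 0 < m → (q * d⁻¹) ^ m ≠ 1) :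
    WheelGeneric q d := by
  refine ⟨fun h => hq 2 two_pos (Units.ext ?_), fun h => hqd 1 one_pos (Units.ext ?_),
    fun h => hqd' 1 one_pos (Units.ext ?_)⟩
  · simpa using h
  · simpa using h
  · simpa using h

theorem WheelGeneric.zpow (h : WheelGeneric q d) {ε : ℤ} (hε : ε = 1 ∨ ε = -1) :
    (q : ℂ) * (d : ℂ) ^ (-ε) ≠ 1 ∧ (q : ℂ) * (d : ℂ) ^ ε ≠ 1 := by
  rcases hε with rfl | rfl
  · exact ⟨by simpa using h.div, by simpa using h.mul⟩
  · exact ⟨by simpa using h.mul, by simpa using h.div⟩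

/-- The coefficient of a coordinate of the wheel point. -/
def wheelCoeff (q d : ℂˣ) (i : ZMod n) (ε : ℤ) (v : Var n) : ℂ :=
  if v = ⟨i, 0⟩ then (q : ℂ) ^ 2 else if v = ⟨i + ε, 0⟩ then (q : ℂ) * (d : ℂ) ^ (-ε) else 1

/-- The variable in a coordinate of the wheel point. -/
def wheelVar (i : ZMod n) (ε : ℤ) (v : Var n) : Var n :=
  if v = ⟨i, 0⟩ then ⟨i, 1⟩ else if v = ⟨i + ε, 0⟩ then ⟨i, 1⟩ else v

theorem wheelPoint_eq (i : ZMod n) (ε : ℤ) (v : Var n) : wheelPoint q d i ε v =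
    algebraMap (MvPolynomial (Var n) ℂ) _
      (MvPolynomial.C (wheelCoeff q d i ε v) * MvPolynomial.X (wheelVar i ε v)) := by
  unfold wheelPoint wheelCoeff wheelVar xv
  have h : ∀ (c : ℂ) (w : Var n), c • rvar w = algebraMap (MvPolynomial (Var n) ℂ) (RatFun (Var n))
      (MvPolynomial.C c * MvPolynomial.X w) := by
    intro c w
    rw [map_mul, Algebra.smul_def]
    rfl
  split_ifs
  · exact h _ _
  · exact h _ _
  · rw [← h, one_smul]

theorem wheelCoeff_ne_zero (i : ZMod n) (ε : ℤ) (v : Var n) : wheelCoeff q d i ε v ≠ 0 := by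
  unfold wheelCoeff
  have := q.ne_zero
  have := zpow_ne_zero (-ε) d.ne_zero
  split_ifs <;> simp_all

theorem add_unit_ne (i : ZMod n) {ε : ℤ} (hε : ε = 1 ∨ ε = -1) : i + (ε : ZMod n) ≠ i := by
  rcases hε with rfl | rfl
  · simpa using add_one_ne i
  · have := sub_one_ne i
    rw [sub_eq_add_neg] at this
    simpa using this

theorem generic_wheelPoint (hw : WheelGeneric q d) (k : ZMod n → ℕ) (i : ZMod n) {ε : ℤ}
    (hε : ε = 1 ∨ ε = -1) : Generic k (wheelPoint q d i ε) := by
  have hinj := IsFractionRing.injective (MvPolynomial (Var n) ℂ) (RatFun (Var n))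
  obtain ⟨h1, h2⟩ := hw.zpow hε
  have hne := add_unit_ne i hε
  refine ⟨?_, ?_⟩
  · intro u _ v _ huv
    rw [wheelPoint_eq, wheelPoint_eq] at huv
    obtain ⟨e1, e2⟩ := C_mul_X_inj (wheelCoeff_ne_zero i ε u) (hinj huv)
    unfold wheelVar at e1
    unfold wheelCoeff at e2
    have h3 := hw.sq
    have hq0 := q.ne_zero
    have h4 : (q : ℂ) ^ 2 ≠ (q : ℂ) * (d : ℂ) ^ (-ε) := by
      intro h
      rw [sq] at h
      have h5 := mul_left_cancel₀ hq0 h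
      apply h2
      rw [h5, ← zpow_add₀ d.ne_zero]
      simp
    have h5 : (⟨i, 1⟩ : Var n) ≠ ⟨i, 0⟩ := by simp
    have h6 : (⟨i, 1⟩ : Var n) ≠ ⟨i + ε, 0⟩ := by
      intro h
      exact hne (congrArg Sigma.fst h).symm
    split_ifs at e1 e2 <;> simp_all
  · intro v _ h0
    rw [wheelPoint_eq, map_eq_zero_iff _ hinj] at h0
    simp [wheelCoeff_ne_zero] at h0

theorem rename_numerator {k : ZMod n → ℕ} {F : RatFun (Var n)} (hF : F ∈ shuffleComp k) {e : ℕ}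
    {P : MvPolynomial (Var n) ℂ}
    (hP : F * poleDen k * (∏ v ∈ block 0 k, rvar v) ^ e = algebraMap _ (RatFun (Var n)) P)
    (σ : SymGroup k) : MvPolynomial.rename (permVar k σ) P = P := by
  apply IsFractionRing.injective (MvPolynomial (Var n) ℂ) (RatFun (Var n))
  rw [← relabel_algebraMap _ (permVar k σ).injective, ← hP]
  change symAct k σ _ = _
  rw [map_mul, map_mul, map_pow, symAct_of_mem hF, symAct_poleDen, symAct_prod_rvar]

theorem wheel_vanish (hw : WheelGeneric q d) {k : ZMod n → ℕ} {F : RatFun (Var n)}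
    (hF : F ∈ shuffleComp k) (hW : IsWheel q d k F) {e : ℕ} {P : MvPolynomial (Var n) ℂ}
    (hP : F * poleDen k * (∏ v ∈ block 0 k, rvar v) ^ e = algebraMap _ (RatFun (Var n)) P)
    {B : Type} [CommRing B] [Algebra ℂ B] (r : Var n → B) (i : ZMod n) {ε : ℤ}
    (hε : ε = 1 ∨ ε = -1) {s t u : ℕ} (hst : s ≠ t) (hs : s < k i) (ht : t < k i)
    (hu : u < k (i + ε)) (h1 : r ⟨i, s⟩ = algebraMap ℂ B ((q : ℂ) ^ 2) * r ⟨i, t⟩)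
    (h2 : r ⟨i + ε, u⟩ = algebraMap ℂ B ((q : ℂ) * (d : ℂ) ^ (-ε)) * r ⟨i, t⟩) :
    MvPolynomial.aeval r P = 0 := by
  have hinj := IsFractionRing.injective (MvPolynomial (Var n) ℂ) (RatFun (Var n))
  have hne := add_unit_ne i hε
  have hk2 : 2 ≤ k i := by omega
  have hg := generic_wheelPoint hw k i hε
  have hv := hW i ε hε hk2 (by omega)
  rw [(hasEval_of_numerator hP hg).evalRat_eq, div_eq_zero_iff] at hv
  have hv := hv.resolve_right (mul_ne_zero hg.poleDenAt_ne_zero (hg.prod_ne_zero e))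
  set wp : Var n → MvPolynomial (Var n) ℂ := fun v =>
    MvPolynomial.C (wheelCoeff q d i ε v) * MvPolynomial.X (wheelVar i ε v) with hwp
  have hv' : MvPolynomial.aeval wp P = 0 := by
    apply hinj
    rw [map_zero, ← hv]
    have : (Algebra.algHom ℂ (MvPolynomial (Var n) ℂ) (RatFun (Var n))).comp
        (MvPolynomial.aeval wp) = MvPolynomial.aeval (wheelPoint q d i ε) :=
      MvPolynomial.algHom_ext fun v => by
        rw [AlgHom.comp_apply, MvPolynomial.aeval_X, MvPolynomial.aeval_X, wheelPoint_eq]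
        rfl
    exact DFunLike.congr_fun this P
  obtain ⟨σi, hσ0, hσ1⟩ : ∃ τ : Equiv.Perm (Fin (k i)), τ ⟨0, by omega⟩ = ⟨s, hs⟩ ∧
      τ ⟨1, by omega⟩ = ⟨t, ht⟩ := by
    set c : Fin (k i) := Equiv.swap ⟨0, by omega⟩ ⟨s, hs⟩ ⟨1, by omega⟩ with hc
    have hc0 : c ≠ ⟨s, hs⟩ := by
      intro h
      have h' : c = Equiv.swap ⟨0, by omega⟩ ⟨s, hs⟩ ⟨0, by omega⟩ := by
        rw [h, Equiv.swap_apply_left]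
      have := (Equiv.swap _ _).injective h'
      simp at this
    refine ⟨Equiv.swap c ⟨t, ht⟩ * Equiv.swap ⟨0, by omega⟩ ⟨s, hs⟩, ?_, ?_⟩
    · rw [Equiv.Perm.mul_apply, Equiv.swap_apply_left, Equiv.swap_apply_of_ne_of_ne hc0.symm]
      simpa using hst
    · rw [Equiv.Perm.mul_apply, ← hc, Equiv.swap_apply_left]
  set σ : SymGroup k := Function.update (Function.update 1 (i + (ε : ZMod n))
    (Equiv.swap ⟨0, by omega⟩ ⟨u, hu⟩)) i σi with hσ
  have e0 : permVar k σ ⟨i, 0⟩ = ⟨i, s⟩ := by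
    have := permVar_lt k σ i ⟨0, by omega⟩
    rw [this, hσ, Function.update_self, hσ0]
  have e1 : permVar k σ ⟨i, 1⟩ = ⟨i, t⟩ := by
    have := permVar_lt k σ i ⟨1, by omega⟩
    rw [this, hσ, Function.update_self, hσ1]
  have e2 : permVar k σ ⟨i + ε, 0⟩ = ⟨i + ε, u⟩ := by
    have := permVar_lt k σ (i + ε) ⟨0, by omega⟩
    rw [this, hσ, Function.update_of_ne hne, Function.update_self, Equiv.swap_apply_left]
  have h3 : MvPolynomial.aeval (r ∘ permVar k σ) P = MvPolynomial.aeval r P := by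
    rw [← MvPolynomial.aeval_rename, rename_numerator hF hP]
  rw [← h3]
  have h4 : (MvPolynomial.aeval (r ∘ permVar k σ)).comp (MvPolynomial.aeval wp) =
      MvPolynomial.aeval (R := ℂ) (r ∘ permVar k σ) := by
    refine MvPolynomial.algHom_ext fun v => ?_
    rw [AlgHom.comp_apply, MvPolynomial.aeval_X, MvPolynomial.aeval_X, hwp]
    simp only [map_mul, MvPolynomial.algHom_C, MvPolynomial.aeval_X, Function.comp_apply]
    unfold wheelCoeff wheelVar
    by_cases hv1 : v = ⟨i, 0⟩
    · rw [if_pos hv1, if_pos hv1, hv1, e0, e1, h1]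
    · rw [if_neg hv1, if_neg hv1]
      by_cases hv2 : v = ⟨i + ε, 0⟩
      · rw [if_pos hv2, if_pos hv2, hv2, e2, e1, h2]
      · rw [if_neg hv2, if_neg hv2, map_one, one_mul]
  rw [← h4, AlgHom.comp_apply, hv', map_zero]

end Wheel

/-! cancellation of the poles under the wheel conditions -/

section WheelPoles

variable {n : ℕ} [NeZero n] [Fact (3 ≤ n)] {q d : ℂˣ} {a : ZMod n → ℕ} {N : ZMod n → ℕ}
  (z : ∀ i, Fin (N i) → ℂˣ) (o : ZMod n → Bool)

/-- The point with coordinates `x`, in a commutative ring. -/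
def ColEnum.ringPoint {ι : Type} [DecidableEq ι] {col : ι → ZMod n} {T : Finset ι}
    {k : ZMod n → ℕ} (e : ColEnum col T k) {B : Type} [CommRing B] (x : ι → B) (v : Var n) : B :=
  if h : v.2 < k v.1 then x (e.equiv ⟨v, h⟩) else 0

theorem ColEnum.aeval_ringPoint {ι : Type} [DecidableEq ι] {col : ι → ZMod n} {T : Finset ι}
    {k : ZMod n → ℕ} (e : ColEnum col T k) {B B' : Type} [CommRing B] [Algebra ℂ B] [CommRing B']
    [Algebra ℂ B'] (x : ι → B) (f : B →ₐ[ℂ] B') (P : MvPolynomial (Var n) ℂ) :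
    f (MvPolynomial.aeval (e.ringPoint x) P) = MvPolynomial.aeval (e.ringPoint (f ∘ x)) P := by
  have : f.comp (MvPolynomial.aeval (e.ringPoint x)) =
      MvPolynomial.aeval (R := ℂ) (e.ringPoint (f ∘ x)) := by
    refine MvPolynomial.algHom_ext fun v => ?_
    rw [AlgHom.comp_apply, MvPolynomial.aeval_X, MvPolynomial.aeval_X]
    unfold ColEnum.ringPoint
    split_ifs
    · rfl
    · exact map_zero f
  exact DFunLike.congr_fun this P

/-- The scalar factor of a coordinate. -/
def ptCoef (ε : Bool) (q : ℂˣ) (t : Pt a) : ℂ := (q : ℂ) ^ halfExp ε t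

/-- The coordinates of the points as polynomials in the `w_{i,r}`. -/
def linPt (ε : Bool) (q : ℂˣ) (t : Pt a) : MvPolynomial (WVar a) ℂ :=
  MvPolynomial.C (ptCoef ε q t) * MvPolynomial.X t.1

theorem ptCoef_ne_zero (ε : Bool) (t : Pt a) : ptCoef ε q t ≠ 0 := zpow_ne_zero _ q.ne_zero

theorem poleCst_ne_zero (ε : Bool) (i j : ZMod n) : poleCst ε q d i j ≠ 0 :=
  mul_ne_zero (Units.ne_zero _) (zpow_ne_zero _ d.ne_zero)

theorem aeval_linPt (ε : Bool) (t : Pt a) :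
    MvPolynomial.aeval (fun v : WVar a => wv v.1 v.2) (linPt ε q t) = halfPt ε q t := by
  unfold linPt ptCoef
  rw [halfPt_eq_zpow, map_mul, MvPolynomial.algHom_C, MvPolynomial.aeval_X]
  rfl

/-- The pole of an arrow, as a polynomial in the `w_{i,r}`. -/
def linPole (ε : Bool) (q d : ℂˣ) (t t' : Pt a) : MvPolynomial (WVar a) ℂ :=
  linPt ε q t - MvPolynomial.C (poleCst ε q d (ptCol t) (ptCol t')) * linPt ε q t'

theorem aeval_linPole (ε : Bool) (t t' : Pt a) :
    MvPolynomial.aeval (fun v : WVar a => wv v.1 v.2) (linPole ε q d t t') = poleTerm ε q d t t' := by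
  unfold linPole poleTerm
  rw [map_sub, map_mul, aeval_linPt, aeval_linPt, MvPolynomial.algHom_C]
  rfl

theorem mMat_of_adj {i j : ZMod n} (h : j = i + 1 ∨ j = i - 1) :
    (mMat i j = 1 ∨ mMat i j = -1) ∧ i = j + (mMat i j : ZMod n) := by
  rcases h with rfl | rfl
  · have : mMat i (i + 1) = -1 := by simp [mMat]
    rw [this]
    exact ⟨Or.inr rfl, by push_cast; ring⟩
  · have : mMat i (i - 1) = 1 := by simp [mMat, (add_one_ne_sub_one i).symm]
    rw [this]
    exact ⟨Or.inl rfl, by push_cast; ring⟩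

variable {o} in
theorem wheel_vanish_chain (hw : WheelGeneric q d) (ε : Bool) {k : ZMod n → ℕ}
    {m : ∀ i, Fin (a i) → ℕ} (en : ColEnum ptCol (pts m) k) {F : RatFun (Var n)}
    (hF : F ∈ shuffleComp k) (hW : IsWheel q d k F) {e : ℕ} {P : MvPolynomial (Var n) ℂ}
    (hP : F * poleDen k * (∏ v ∈ block 0 k, rvar v) ^ e = algebraMap _ (RatFun (Var n)) P)
    {B : Type} [CommRing B] [Algebra ℂ B] (x : Pt a → B) {v0 v1 : WVar a}
    (har : v1.1 ∈ arrowsOf ε o v0.1) {p p' : ℕ} (hp : p < m v0.1 v0.2) (hp' : p' + 1 < m v1.1 v1.2)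
    (h1 : x ⟨v1, p'⟩ = algebraMap ℂ B ((halfQ ε q : ℂ) ^ 2) * x ⟨v1, p' + 1⟩)
    (h2 : x ⟨v0, p⟩ = algebraMap ℂ B (poleCst ε q d v0.1 v1.1) * x ⟨v1, p' + 1⟩) :
    MvPolynomial.aeval (en.ringPoint x) P = 0 := by
  obtain ⟨hε, hi⟩ := mMat_of_adj (adj_of_mem_arrowsOf har)
  have m0 : (⟨v0, p⟩ : Pt a) ∈ pts m := mem_pts.2 hp
  have m1 : (⟨v1, p'⟩ : Pt a) ∈ pts m := mem_pts.2 (by simp only; omega)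
  have m2 : (⟨v1, p' + 1⟩ : Pt a) ∈ pts m := mem_pts.2 hp'
  have key : ∀ (t : Pt a) (ht : t ∈ pts m), ∃ s, s < k (ptCol t) ∧
      en.ringPoint x ⟨ptCol t, s⟩ = x t ∧ ∃ h, en.equiv ⟨⟨ptCol t, s⟩, h⟩ = ⟨t, ht⟩ := by
    intro t ht
    have hc := en.col_symm ⟨t, ht⟩
    set w := en.equiv.symm ⟨t, ht⟩ with hwdef
    have hw1 : en.equiv w = ⟨t, ht⟩ := by rw [hwdef, Equiv.apply_symm_apply]
    obtain ⟨⟨i, s⟩, hs⟩ := w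
    simp only at hc hs
    subst hc
    refine ⟨s, hs, ?_, hs, hw1⟩
    unfold ColEnum.ringPoint
    rw [dif_pos hs, hw1]
  obtain ⟨s0, hs0, e0, -, -⟩ := key _ m0
  obtain ⟨s1, hs1, e1, hs1', f1⟩ := key _ m1
  obtain ⟨s2, hs2, e2, hs2', f2⟩ := key _ m2
  simp only [ptCol] at hs0 hs1 hs2 e0 e1 e2 f1 f2
  have h12 : s1 ≠ s2 := by
    rintro rfl
    have := congrArg Subtype.val (f1.symm.trans f2)
    simp at this
  have hs0' : s0 < k (v1.1 + (mMat v0.1 v1.1 : ZMod n)) := by rw [← hi]; exact hs0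
  have e0' : en.ringPoint x ⟨v1.1 + (mMat v0.1 v1.1 : ZMod n), s0⟩ = x ⟨v0, p⟩ := by
    rw [← hi]; exact e0
  cases ε
  · refine wheel_vanish hw hF hW hP (en.ringPoint x) v1.1 hε h12.symm hs2 hs1 hs0' ?_ ?_
    · rw [e1, e2, h1, ← mul_assoc, ← map_mul]
      simp [halfQ]
    · rw [e0', e1, h1, h2, ← mul_assoc, ← map_mul]
      congr 2
      simp only [poleCst, halfQ, Bool.false_eq_true, if_false, Units.val_inv_eq_inv_val]
      have := q.ne_zero
      field_simp
  · refine wheel_vanish hw hF hW hP (en.ringPoint x) v1.1 hε h12 hs1 hs2 hs0' ?_ ?_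
    · rw [e1, e2, h1]; rfl
    · rw [e0', e2, h2]; rfl

theorem ptCoef_pred (ε : Bool) (v : WVar a) (p : ℕ) :
    ptCoef ε q ⟨v, p⟩ = (halfQ ε q : ℂ) ^ 2 * ptCoef ε q ⟨v, p + 1⟩ := by
  have hq0 := q.ne_zero
  cases ε
  · simp only [ptCoef, halfExp, halfQ, Bool.false_eq_true, if_false, Units.val_inv_eq_inv_val]
    rw [← zpow_natCast, inv_zpow', ← zpow_add₀ hq0]
    congr 1; push_cast; ring
  · simp only [ptCoef, halfExp, halfQ, if_true]
    rw [← zpow_natCast, ← zpow_add₀ hq0]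
    congr 1; push_cast; ring

theorem ptCoef_injective (hq : ∀ m : ℕ, 0 < m → q ^ m ≠ 1) (ε : Bool) (v : WVar a) {p p' : ℕ}
    (h : ptCoef ε q ⟨v, p⟩ = ptCoef ε q ⟨v, p'⟩) : p = p' := by
  have := units_zpow_inj hq h
  cases ε
  · simp [halfExp] at this; omega
  · simp [halfExp] at this; omega

variable {o} in
theorem chain_prod_dvd (hq : ∀ m : ℕ, 0 < m → q ^ m ≠ 1) (hw : WheelGeneric q d) (ε : Bool)
    {k : ZMod n → ℕ} {m : ∀ i, Fin (a i) → ℕ} (en : ColEnum ptCol (pts m) k) {F : RatFun (Var n)}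
    (hF : F ∈ shuffleComp k) (hW : IsWheel q d k F) {e : ℕ} {P : MvPolynomial (Var n) ℂ}
    (hP : F * poleDen k * (∏ v ∈ block 0 k, rvar v) ^ e = algebraMap _ (RatFun (Var n)) P)
    {v0 v1 : WVar a} (har : v1.1 ∈ arrowsOf ε o v0.1) :
    (∏ pp ∈ Finset.range (m v0.1 v0.2) ×ˢ Finset.Ico 1 (m v1.1 v1.2),
      linPole ε q d ⟨v0, pp.1⟩ ⟨v1, pp.2⟩) ∣ MvPolynomial.aeval (en.ringPoint (linPt ε q)) P := by
  classical
  have hv : v1 ≠ v0 := by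
    rintro rfl
    exact not_mem_arrowsOf_self o ε _ har
  let x : Pt a → MvPolynomial (WVar a ⊕ ℕ) ℂ := fun t =>
    if t.1 = v0 then MvPolynomial.X (Sum.inr t.2)
    else MvPolynomial.C (ptCoef ε q t) * MvPolynomial.X (Sum.inl t.1)
  let c : ℕ × ℕ → ℂ := fun pp => poleCst ε q d v0.1 v1.1 * ptCoef ε q ⟨v1, pp.2⟩
  let g : ℕ × ℕ → MvPolynomial (WVar a ⊕ ℕ) ℂ := fun pp =>
    MvPolynomial.C (c pp) * MvPolynomial.X (Sum.inl v1)
  have hc0 : ∀ pp, c pp ≠ 0 := fun pp => mul_ne_zero (poleCst_ne_zero _ _ _) (ptCoef_ne_zero _ _)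
  have h1 : (∏ pp ∈ Finset.range (m v0.1 v0.2) ×ˢ Finset.Ico 1 (m v1.1 v1.2),
      (MvPolynomial.X (Sum.inr pp.1) - g pp)) ∣ MvPolynomial.aeval (en.ringPoint x) P := by
    refine prod_sub_dvd_of_subst _ (fun pp : ℕ × ℕ => Sum.inr pp.1) g ?_ _ ?_
    · rintro ⟨p, p'⟩ _ ⟨r, r'⟩ _ hne h0
      simp only [g, map_sub, map_mul, MvPolynomial.algHom_C, MvPolynomial.algebraMap_eq,
        MvPolynomial.aeval_X] at h0
      rw [Function.update_of_ne (by simp : (Sum.inl v1 : WVar a ⊕ ℕ) ≠ Sum.inr r)] at h0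
      by_cases hpr : p = r
      · subst hpr
        rw [Function.update_self] at h0
        have h2 := (C_mul_X_inj (hc0 _) (sub_eq_zero.1 h0)).2
        have h3 := ptCoef_injective hq ε v1 (mul_left_cancel₀ (poleCst_ne_zero _ _ _) h2)
        simp only at h3
        exact hne (by rw [h3])
      · rw [Function.update_of_ne (by simpa using hpr), ← one_mul (MvPolynomial.X (Sum.inr p)),
          ← MvPolynomial.C_1] at h0
        have h2 := (C_mul_X_inj one_ne_zero (sub_eq_zero.1 h0)).1
        simp at h2
    · rintro ⟨p, p'⟩ hpp
      rw [Finset.mem_product, Finset.mem_range, Finset.mem_Ico] at hpp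
      simp only at hpp
      obtain ⟨hp, hp1, hp'⟩ := hpp
      obtain ⟨r, rfl⟩ : ∃ r, p' = r + 1 := ⟨p' - 1, by omega⟩
      rw [en.aeval_ringPoint]
      have hx1 : ∀ r', MvPolynomial.aeval (R := ℂ) (Function.update MvPolynomial.X (Sum.inr p)
          (g (p, r + 1))) (x ⟨v1, r'⟩) =
          MvPolynomial.C (ptCoef ε q ⟨v1, r'⟩) * MvPolynomial.X (Sum.inl v1) := by
        intro r'
        simp only [x, hv, if_false, map_mul, MvPolynomial.algHom_C, MvPolynomial.algebraMap_eq,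
          MvPolynomial.aeval_X]
        rw [Function.update_of_ne (by simp)]
      refine wheel_vanish_chain (p := p) (p' := r) hw ε en hF hW hP _ har hp hp' ?_ ?_
      · rw [Function.comp_apply, Function.comp_apply, hx1, hx1, ptCoef_pred, map_mul, mul_assoc]
        rfl
      · rw [Function.comp_apply, Function.comp_apply, hx1]
        simp only [x, if_true, MvPolynomial.aeval_X, Function.update_self, g, c, map_mul, mul_assoc]
        rfl
  have h2 := map_dvd (MvPolynomial.aeval (R := ℂ) (Sum.elim (MvPolynomial.X (R := ℂ))
    (fun p => linPt ε q (⟨v0, p⟩ : Pt a)))) h1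
  rw [en.aeval_ringPoint, map_prod] at h2
  have h3 : (MvPolynomial.aeval (R := ℂ) (Sum.elim (MvPolynomial.X (R := ℂ))
      (fun p => linPt ε q (⟨v0, p⟩ : Pt a)))) ∘ x = linPt ε q := by
    funext t
    rw [Function.comp_apply]
    by_cases ht : t.1 = v0
    · obtain ⟨v, p⟩ := t
      simp only at ht
      subst ht
      simp [x]
    · simp only [x, ht, if_false, map_mul, MvPolynomial.algHom_C, MvPolynomial.aeval_X, Sum.elim_inl,
        MvPolynomial.algebraMap_eq]
      rfl
  rw [h3] at h2
  refine dvd_trans (dvd_of_eq (Finset.prod_congr rfl fun pp _ => ?_)) h2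
  simp only [g, c, map_sub, map_mul, MvPolynomial.algHom_C, MvPolynomial.aeval_X, Sum.elim_inl,
    Sum.elim_inr, MvPolynomial.algebraMap_eq, linPole]
  unfold linPt ptCol
  rw [mul_assoc]

variable {o} in
theorem chains_prod_dvd (hq : ∀ m : ℕ, 0 < m → q ^ m ≠ 1) (hw : WheelGeneric q d) (ε : Bool)
    {k : ZMod n → ℕ} {m : ∀ i, Fin (a i) → ℕ} (en : ColEnum ptCol (pts m) k) {F : RatFun (Var n)}
    (hF : F ∈ shuffleComp k) (hW : IsWheel q d k F) {e : ℕ} {P : MvPolynomial (Var n) ℂ}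
    (hP : F * poleDen k * (∏ v ∈ block 0 k, rvar v) ^ e = algebraMap _ (RatFun (Var n)) P) :
    (∏ vv ∈ (Finset.univ : Finset (WVar a × WVar a)) with vv.2.1 ∈ arrowsOf ε o vv.1.1,
      ∏ pp ∈ Finset.range (m vv.1.1 vv.1.2) ×ˢ Finset.Ico 1 (m vv.2.1 vv.2.2),
      linPole ε q d ⟨vv.1, pp.1⟩ ⟨vv.2, pp.2⟩) ∣ MvPolynomial.aeval (en.ringPoint (linPt ε q)) P := by
  classical
  refine Finset.prod_dvd_of_isRelPrime ?_ ?_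
  · rintro ⟨v0, v1⟩ h ⟨u0, u1⟩ h' hne
    simp only [Finset.coe_filter, Finset.mem_univ, true_and, Set.mem_ofPred_eq] at h h'
    refine IsRelPrime.prod_left fun pp _ => IsRelPrime.prod_right fun rr _ => ?_
    have hv : v0 ≠ v1 := by rintro rfl; exact not_mem_arrowsOf_self o ε _ h
    have hu : u0 ≠ u1 := by rintro rfl; exact not_mem_arrowsOf_self o ε _ h'
    unfold linPole linPt
    rw [← mul_assoc, ← map_mul, ← mul_assoc, ← map_mul]
    refine isRelPrime_linear (ptCoef_ne_zero _ _) (mul_ne_zero (poleCst_ne_zero _ _ _)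
      (ptCoef_ne_zero _ _)) (ptCoef_ne_zero _ _) hv hu ?_ ?_
    · rintro ⟨h1, h2⟩
      exact hne (by rw [Prod.mk.injEq]; exact ⟨h1, h2⟩)
    · rintro ⟨h1, h2⟩
      simp only at h1 h2
      subst h1 h2
      exact (arrowsOf_xor (adj_of_mem_arrowsOf h)).1 h h'
  · rintro ⟨v0, v1⟩ h
    exact chain_prod_dvd hq hw ε en hF hW hP (Finset.mem_filter.1 h).2

theorem poleTerm_ne_zero (ε : Bool) {t t' : Pt a} (h : ptCol t' ∈ arrowsOf ε o (ptCol t)) :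
    poleTerm ε q d t t' ≠ 0 :=
  halfPt_sub_ne_zero ε (fun h' => ne_of_adj (adj_of_mem_arrowsOf h) (congrArg Sigma.fst h').symm) _

/-- The poles with `p' = 0` are cancelled by the numerators. -/
theorem poles_multiple (ε : Bool) (m : ∀ i, Fin (a i) → ℕ) : MultipleOf (fnAlg q a)
    ((∏ t ∈ pts m, ∏ v, if v.1 ∈ arrowsOf ε o (ptCol t) then poleTerm ε q d t ⟨v, 0⟩ else 1) *
        (∏ t ∈ pts m, ∏ t' ∈ pts m,
          if ptCol t' ∈ arrowsOf ε o (ptCol t) then (poleTerm ε q d t t')⁻¹ else 1))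
    (∏ vv ∈ (Finset.univ : Finset (WVar a × WVar a)) with vv.2.1 ∈ arrowsOf ε o vv.1.1,
      ∏ pp ∈ Finset.range (m vv.1.1 vv.1.2) ×ˢ Finset.Ico 1 (m vv.2.1 vv.2.2),
      (poleTerm ε q d ⟨vv.1, pp.1⟩ ⟨vv.2, pp.2⟩)⁻¹) := by
  classical
  rw [← Finset.prod_mul_distrib]
  have h1 : (∏ vv ∈ (Finset.univ : Finset (WVar a × WVar a)) with vv.2.1 ∈ arrowsOf ε o vv.1.1,
      ∏ pp ∈ Finset.range (m vv.1.1 vv.1.2) ×ˢ Finset.Ico 1 (m vv.2.1 vv.2.2),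
      (poleTerm ε q d ⟨vv.1, pp.1⟩ ⟨vv.2, pp.2⟩)⁻¹) =
      ∏ t ∈ pts m, ∏ v : WVar a, if v.1 ∈ arrowsOf ε o (ptCol t) then
        ∏ p' ∈ Finset.Ico 1 (m v.1 v.2), (poleTerm ε q d t ⟨v, p'⟩)⁻¹ else 1 := by
    rw [Finset.prod_filter, ← Finset.univ_product_univ, Finset.prod_product]
    unfold pts
    rw [Finset.prod_sigma]
    refine Finset.prod_congr rfl fun v0 _ => ?_
    rw [Finset.prod_comm]
    refine Finset.prod_congr rfl fun v1 _ => ?_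
    by_cases har : v1.1 ∈ arrowsOf ε o v0.1
    · rw [if_pos har, Finset.prod_product]
      exact (Finset.prod_congr rfl fun p _ => if_pos har).symm
    · rw [if_neg har]
      exact ((Finset.prod_congr rfl fun p _ => if_neg har).trans Finset.prod_const_one).symm
  rw [h1]
  refine .prod _ fun t _ => ?_
  have h2 : (∏ t' ∈ pts m, if ptCol t' ∈ arrowsOf ε o (ptCol t) then (poleTerm ε q d t t')⁻¹ else 1) =
      ∏ v : WVar a, ∏ p ∈ Finset.range (m v.1 v.2), if v.1 ∈ arrowsOf ε o (ptCol t) then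
        (poleTerm ε q d t ⟨v, p⟩)⁻¹ else 1 := by
    unfold pts
    rw [Finset.prod_sigma]
    rfl
  rw [h2, ← Finset.prod_mul_distrib]
  refine .prod _ fun v _ => ?_
  by_cases har : v.1 ∈ arrowsOf ε o (ptCol t)
  · simp only [har, if_true]
    rcases Nat.eq_zero_or_pos (m v.1 v.2) with h0 | h0
    · rw [h0, Finset.range_zero, Finset.Ico_eq_empty (by simp), Finset.prod_empty, mul_one]
      exact .of_mem (poleTerm_mem _ _ _)
    · rw [Finset.range_eq_Ico, Finset.prod_eq_prod_Ico_succ_bot h0, ← mul_assoc,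
        mul_inv_cancel₀ (poleTerm_ne_zero (t := t) (t' := ⟨v, 0⟩) o ε har), one_mul]
      exact .refl _
  · simp only [har, if_false, Finset.prod_const_one, mul_one]
    exact .refl _

theorem hat_mem_of_wheel (hq : ∀ m : ℕ, 0 < m → q ^ m ≠ 1) (hw : WheelGeneric q d) (ε : Bool)
    {E : Shuffle (n := n) q d} (hE : E ∈ wheelSet (n := n) q d) :
    hat (a := a) z o hq ε E ∈ diffAlg q a := by
  classical
  rw [← DirectSum.sum_support_of E, map_sum]
  refine sum_mem fun k _ => ?_
  rw [hat_of]
  refine sum_mem fun m hm => term_mem ?_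
  obtain ⟨en⟩ := ColEnum.exists_enum_of_eq (mem_splittings.1 hm)
  obtain ⟨e, P, -, hP⟩ := exists_numerator (E k).val_mem
  refine ((halfCoeff_factor z o hq ε en (E k) hP).trans
    ((poles_multiple o ε m).mul (.refl _))).mem ?_
  obtain ⟨Q, hQ⟩ := chains_prod_dvd (o := o) hq hw ε en (E k).val_mem (fun i ε => hE k i ε) hP
  have h1 : MvPolynomial.aeval (en.point (halfPt ε q)) P =
      MvPolynomial.aeval (fun v : WVar a => wv v.1 v.2)
        (MvPolynomial.aeval (en.ringPoint (linPt ε q)) P) := by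
    rw [en.aeval_ringPoint]
    congr 1
    congr 1
    funext v
    unfold ColEnum.point ColEnum.ringPoint
    split_ifs
    · exact (aeval_linPt ε _).symm
    · rfl
  rw [h1, hQ, map_mul, map_prod, ← mul_assoc, ← Finset.prod_mul_distrib]
  have h2 : ∀ vv ∈ (Finset.univ : Finset (WVar a × WVar a)).filter
      (fun vv => vv.2.1 ∈ arrowsOf ε o vv.1.1),
      ((∏ pp ∈ Finset.range (m vv.1.1 vv.1.2) ×ˢ Finset.Ico 1 (m vv.2.1 vv.2.2),
        (poleTerm ε q d ⟨vv.1, pp.1⟩ ⟨vv.2, pp.2⟩)⁻¹) *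
      MvPolynomial.aeval (fun v : WVar a => wv v.1 v.2)
        (∏ pp ∈ Finset.range (m vv.1.1 vv.1.2) ×ˢ Finset.Ico 1 (m vv.2.1 vv.2.2),
      linPole ε q d ⟨vv.1, pp.1⟩ ⟨vv.2, pp.2⟩)) = 1 := by
    intro vv hvv
    rw [map_prod, ← Finset.prod_mul_distrib]
    refine Finset.prod_eq_one fun pp _ => ?_
    rw [aeval_linPole, inv_mul_cancel₀]
    exact poleTerm_ne_zero o ε (Finset.mem_filter.1 hvv).2
  rw [Finset.prod_congr rfl h2, Finset.prod_const_one, one_mul]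
  exact aeval_mem (fun v => wv_mem _ _) Q

end WheelPoles

/-! the algebra of elements subject to the wheel conditions -/

section WheelAlgebra

variable {n : ℕ} [NeZero n] [Fact (3 ≤ n)] {q d : ℂˣ}

theorem zeta_wheel_self {L : Type} [Field L] [Algebra ℂ L] (i : ZMod n) (y : L) :
    zeta q d i i y (algebraMap ℂ L ((q : ℂ) ^ 2) * y) = 0 := by
  rw [zeta_same, Algebra.smul_def, ← mul_assoc, ← map_mul]
  have : (q : ℂ) ^ (-2 : ℤ) * (q : ℂ) ^ 2 = 1 := by
    rw [← zpow_natCast, ← zpow_add₀ q.ne_zero]; simp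
  rw [this, map_one, one_mul, sub_self, zero_div]

theorem zeta_wheel_out {L : Type} [Field L] [Algebra ℂ L] (i : ZMod n) {ε : ℤ}
    (hε : ε = 1 ∨ ε = -1) (y : L) :
    zeta q d i (i + (ε : ZMod n)) (algebraMap ℂ L ((q : ℂ) ^ 2) * y)
      (algebraMap ℂ L ((q : ℂ) * (d : ℂ) ^ (-ε)) * y) = 0 := by
  have hd := d.ne_zero
  rcases hε with rfl | rfl
  · have : i + ((1 : ℤ) : ZMod n) = i + 1 := by simp
    rw [this, zeta_succ, Algebra.smul_def, Algebra.smul_def, ← mul_assoc, ← mul_assoc, ← map_mul,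
      ← map_mul]
    have h : (d : ℂ)⁻¹ * (q : ℂ) ^ 2 = (q : ℂ) * ((q : ℂ) * (d : ℂ) ^ (-1 : ℤ)) := by
      rw [zpow_neg_one]; ring
    rw [h, sub_self, zero_div]
  · have : i + ((-1 : ℤ) : ZMod n) = i - 1 := by simp [sub_eq_add_neg]
    rw [this, zeta_pred, Algebra.smul_def, ← mul_assoc, ← map_mul]
    have h : (q : ℂ) * (d : ℂ)⁻¹ * ((q : ℂ) * (d : ℂ) ^ (- (-1) : ℤ)) = (q : ℂ) ^ 2 := by
      rw [neg_neg, zpow_one]; field_simp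
    rw [h, sub_self, zero_div]

theorem zeta_wheel_in {L : Type} [Field L] [Algebra ℂ L] (i : ZMod n) {ε : ℤ}
    (hε : ε = 1 ∨ ε = -1) (y : L) :
    zeta q d (i + (ε : ZMod n)) i (algebraMap ℂ L ((q : ℂ) * (d : ℂ) ^ (-ε)) * y) y = 0 := by
  have hd := d.ne_zero
  rcases hε with rfl | rfl
  · have h1 : i = i + ((1 : ℤ) : ZMod n) - 1 := by simp
    have h2 : zeta q d (i + ((1 : ℤ) : ZMod n)) i
        (algebraMap ℂ L ((q : ℂ) * (d : ℂ) ^ (-1 : ℤ)) * y) y =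
        zeta q d (i + ((1 : ℤ) : ZMod n)) (i + ((1 : ℤ) : ZMod n) - 1)
        (algebraMap ℂ L ((q : ℂ) * (d : ℂ) ^ (-1 : ℤ)) * y) y := by rw [← h1]
    rw [h2, zeta_pred, Algebra.smul_def, zpow_neg_one, sub_self, zero_div]
  · have h1 : i = i + ((-1 : ℤ) : ZMod n) + 1 := by simp
    have h2 : zeta q d (i + ((-1 : ℤ) : ZMod n)) i
        (algebraMap ℂ L ((q : ℂ) * (d : ℂ) ^ (- (-1) : ℤ)) * y) y =
        zeta q d (i + ((-1 : ℤ) : ZMod n)) (i + ((-1 : ℤ) : ZMod n) + 1)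
        (algebraMap ℂ L ((q : ℂ) * (d : ℂ) ^ (- (-1) : ℤ)) * y) y := by rw [← h1]
    rw [h2, zeta_succ, Algebra.smul_def, Algebra.smul_def, ← mul_assoc, ← map_mul]
    have h : (d : ℂ)⁻¹ * ((q : ℂ) * (d : ℂ) ^ (- (-1) : ℤ)) = (q : ℂ) := by
      rw [neg_neg, zpow_one]; field_simp
    rw [h, sub_self, zero_div]

theorem valueAt_wheel {ι : Type} [DecidableEq ι] {L : Type} [Field L] [Algebra ℂ L]
    (hw : WheelGeneric q d) {E : Shuffle (n := n) q d} (hE : E ∈ wheelSet (n := n) q d)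
    {col : ι → ZMod n} {x : ι → L} {T : Finset ι} (hx : Set.InjOn x T) (h0 : ∀ t ∈ T, x t ≠ 0)
    {s t u : ι} (hs : s ∈ T) (ht : t ∈ T) (hu : u ∈ T) (hst : s ≠ t) {i : ZMod n} {ε : ℤ}
    (hε : ε = 1 ∨ ε = -1) (hcs : col s = i) (hct : col t = i) (hcu : col u = i + ε)
    (h1 : x s = algebraMap ℂ L ((q : ℂ) ^ 2) * x t)
    (h2 : x u = algebraMap ℂ L ((q : ℂ) * (d : ℂ) ^ (-ε)) * x t) : valueAt col x T E = 0 := by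
  obtain ⟨e⟩ := ColEnum.exists_enum col T
  rw [valueAt_eq e hx h0]
  obtain ⟨r, P, -, hP⟩ := exists_numerator (E (colourCount col T)).val_mem
  rw [(hasEval_of_numerator hP (e.generic hx h0)).evalRat_eq]
  have key : ∀ v (hv : v ∈ T), ∃ p, p < colourCount col T (col v) ∧
      e.point x ⟨col v, p⟩ = x v ∧ ∀ w (hw : w ∈ T), e.equiv.symm ⟨w, hw⟩ = e.equiv.symm ⟨v, hv⟩ ∨
        (e.equiv.symm ⟨w, hw⟩).1 ≠ ⟨col v, p⟩ := by
    intro v hv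
    have hc := e.col_symm ⟨v, hv⟩
    have heq : (⟨col v, (e.equiv.symm ⟨v, hv⟩).1.2⟩ : Var n) = (e.equiv.symm ⟨v, hv⟩).1 :=
      Sigma.ext hc.symm (by simp)
    refine ⟨(e.equiv.symm ⟨v, hv⟩).1.2, ?_, ?_, ?_⟩
    · have := (e.equiv.symm ⟨v, hv⟩).2
      rwa [hc] at this
    · rw [heq, e.point_of_lt]; simp
    · intro w hw
      rw [heq, or_iff_not_imp_left]
      exact fun h h' => h (Subtype.ext h')
  obtain ⟨ps, hps, hxs, -⟩ := key s hs
  obtain ⟨pt, hpt, hxt, -⟩ := key t ht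
  obtain ⟨pu, hpu, hxu, -⟩ := key u hu
  rw [hcs] at hps hxs
  rw [hct] at hpt hxt
  rw [hcu] at hpu hxu
  have hne : ps ≠ pt := by
    rintro rfl
    exact hst (hx hs ht (by rw [← hxs, hxt]))
  rw [wheel_vanish hw (E _).val_mem (fun i ε => hE _ i ε) hP (e.point x) i hε hne hps hpt hpu
    (by rw [hxs, hxt, h1]) (by rw [hxu, hxt, h2]), zero_div]

/-- The enumeration of the variables `x_{i,r}` with `r < k_i` by themselves. -/
def selfEnum (k : ZMod n → ℕ) : ColEnum (Sigma.fst : Var n → ZMod n) (block 0 k) k :=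
  ⟨Equiv.subtypeEquivRight fun v => by simp [mem_block], fun _ => rfl⟩

theorem valueAt_block {L : Type} [Field L] [Algebra ℂ L] {k : ZMod n → ℕ} {x : Var n → L}
    (h : Generic k x) (E : Shuffle (n := n) q d) :
    valueAt Sigma.fst x (block 0 k) E = evalRat x (E k).val := by
  have hm : ∀ {v}, v ∈ block 0 k → v ∈ varSet k := fun {v} hv => by rw [← coe_block]; exact hv
  rw [valueAt_eq (selfEnum k) (h.injOn.mono fun v hv => hm hv) (fun v hv => h.ne_zero v (hm hv))]
  refine (evalRat_congr (E k).val_mem h fun v hv => ?_).symm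
  rw [(selfEnum k).point_of_lt x ⟨v, hv⟩]
  rfl

theorem wheelSet_mul (hw : WheelGeneric q d) {E F : Shuffle (n := n) q d}
    (hE : E ∈ wheelSet (n := n) q d) (hF : F ∈ wheelSet (n := n) q d) :
    E * F ∈ wheelSet (n := n) q d := by
  intro k i ε hε h2 h1
  have hg := generic_wheelPoint hw k i hε
  have hm : ∀ {v}, v ∈ block 0 k ↔ v ∈ varSet k := fun {v} => by rw [← coe_block]; rfl
  set x : Var n → RatFun (Var n) := wheelPoint q d i ε with hxdef
  have hx : Set.InjOn x (block 0 k : Finset (Var n)) := hg.injOn.mono fun v hv => hm.1 hv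
  have h0 : ∀ v ∈ block 0 k, x v ≠ 0 := fun v hv => hg.ne_zero v (hm.1 hv)
  have hne := add_unit_ne i hε
  have hs : (⟨i, 0⟩ : Var n) ∈ block 0 k := hm.2 (by change 0 < k i; omega)
  have ht : (⟨i, 1⟩ : Var n) ∈ block 0 k := hm.2 (by change 1 < k i; omega)
  have hu : (⟨i + ε, 0⟩ : Var n) ∈ block 0 k := hm.2 (by change 0 < k (i + ε); omega)
  have hxt : x ⟨i, 1⟩ = xv i 1 := by
    rw [hxdef]; unfold wheelPoint
    rw [if_neg (by simp), if_neg fun h => hne (congrArg Sigma.fst h).symm]; rfl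
  have hxs : x ⟨i, 0⟩ = algebraMap ℂ (RatFun (Var n)) ((q : ℂ) ^ 2) * x ⟨i, 1⟩ := by
    rw [hxt, hxdef, ← Algebra.smul_def]; unfold wheelPoint
    rw [if_pos rfl]
  have hxu : x ⟨i + ε, 0⟩ = algebraMap ℂ (RatFun (Var n)) ((q : ℂ) * (d : ℂ) ^ (-ε)) * x ⟨i, 1⟩ := by
    rw [hxt, hxdef, ← Algebra.smul_def]; unfold wheelPoint
    rw [if_neg fun h => hne (congrArg Sigma.fst h), if_pos rfl]
  rw [← valueAt_block hg, valueAt_mul hx h0]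
  refine Finset.sum_eq_zero fun A hA => ?_
  have hA := Finset.mem_powerset.1 hA
  have hcross : ∀ {v w : Var n}, v ∈ block 0 k → w ∈ block 0 k → v ∈ A → w ∉ A →
      zeta q d v.1 w.1 (x v) (x w) = 0 →
      zetaCross q d Sigma.fst x A (block 0 k \ A) = 0 := by
    intro v w _ hw hvA hwA hz
    exact Finset.prod_eq_zero hvA (Finset.prod_eq_zero (Finset.mem_sdiff.2 ⟨hw, hwA⟩) hz)
  by_cases htA : (⟨i, 1⟩ : Var n) ∈ A
  · by_cases hsA : (⟨i, 0⟩ : Var n) ∈ A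
    · by_cases huA : (⟨i + ε, 0⟩ : Var n) ∈ A
      · rw [valueAt_wheel hw hE (hx.mono hA) (fun v hv => h0 v (hA hv)) hsA htA huA (by simp) hε
          rfl rfl rfl hxs hxu, zero_mul, zero_mul]
      · rw [hcross hs hu hsA huA (by rw [hxs, hxu]; exact zeta_wheel_out i hε _), mul_zero]
    · rw [hcross ht hs htA hsA (by rw [hxs]; exact zeta_wheel_self i _), mul_zero]
  · by_cases huA : (⟨i + ε, 0⟩ : Var n) ∈ A
    · rw [hcross hu ht huA htA (by rw [hxu]; exact zeta_wheel_in i hε _), mul_zero]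
    · by_cases hsA : (⟨i, 0⟩ : Var n) ∈ A
      · rw [hcross hs hu hsA huA (by rw [hxs, hxu]; exact zeta_wheel_out i hε _), mul_zero]
      · rw [valueAt_wheel hw hF (hx.mono Finset.sdiff_subset)
          (fun v hv => h0 v (Finset.sdiff_subset hv))
          (Finset.mem_sdiff.2 ⟨hs, hsA⟩) (Finset.mem_sdiff.2 ⟨ht, htA⟩)
          (Finset.mem_sdiff.2 ⟨hu, huA⟩) (by simp) hε rfl rfl rfl hxs hxu, mul_zero, zero_mul]

theorem of_mem_wheelSet {k : ZMod n → ℕ} (hk : ∑ i, k i ≤ 1) (F : ShuffleComp q d k) :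
    DirectSum.of (ShuffleComp q d) k F ∈ wheelSet (n := n) q d := by
  intro l i ε hε h2 h1
  by_cases hkl : k = l
  · subst hkl
    have := Finset.single_le_sum (f := k) (fun _ _ => Nat.zero_le _) (Finset.mem_univ i)
    omega
  · rw [DirectSum.of_eq_of_ne _ _ _ (Ne.symm hkl), map_zero, evalRat_zero]

/-- The shuffle algebra `S^{[n]}` as a subalgebra. -/
def wheelAlg (hw : WheelGeneric q d) : Subalgebra ℂ (Shuffle (n := n) q d) where
  carrier := wheelSet q d
  mul_mem' := wheelSet_mul hw
  add_mem' {E F} hE hF k i ε hε h2 h1 := by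
    rw [DirectSum.add_apply, map_add, evalRat_add (generic_wheelPoint hw k i hε) (E k).val_mem
      (F k).val_mem, hE k i ε hε h2 h1, hF k i ε hε h2 h1, add_zero]
  algebraMap_mem' c := of_mem_wheelSet (by simp) _

theorem xpow_mem_wheelSet (i : ZMod n) (r : ℤ) :
    DirectSum.of (ShuffleComp q d) (Pi.single i 1) (xpow q d i r) ∈ wheelSet (n := n) q d :=
  of_mem_wheelSet (by simp) _

end WheelAlgebra

/-! the homomorphisms to difference operators -/

section HatHom

variable {n : ℕ} [NeZero n] [Fact (3 ≤ n)] {q d : ℂˣ} {a : ZMod n → ℕ} {N : ZMod n → ℕ}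
  (z : ∀ i, Fin (N i) → ℂˣ) (o : ZMod n → Bool) (hq : ∀ m : ℕ, 0 < m → q ^ m ≠ 1)

/-- The homomorphism on the positive half. -/
def hatPlusHom : Shuffle (n := n) q d →ₐ[ℂ] DiffOp q a :=
  AlgHom.ofLinearMap (hat z o hq true) (hat_one z o hq true) (hat_true_mul z o hq)

/-- The homomorphism on the negative half. -/
def hatMinusHom : (Shuffle (n := n) q d)ᵐᵒᵖ →ₐ[ℂ] DiffOp q a :=
  AlgHom.ofLinearMap (hat z o hq false ∘ₗ (MulOpposite.opLinearEquiv ℂ).symm.toLinearMap)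
    (hat_one z o hq false) (fun E F => hat_false_mul z o hq F.unop E.unop)

end HatHom

/-! relations in the shuffle algebra -/

section ShuffleRelations

variable {n : ℕ} [NeZero n] [Fact (3 ≤ n)] {q d : ℂˣ} {ι : Type} [DecidableEq ι]
  {L : Type} [Field L] [Algebra ℂ L] {col : ι → ZMod n} {x : ι → L} {T : Finset ι}

/-- The value at a point, as a linear map. -/
def valueLin (hx : Set.InjOn x T) (h0 : ∀ t ∈ T, x t ≠ 0) : Shuffle (n := n) q d →ₗ[ℂ] L where
  toFun := valueAt col x T
  map_add' := valueAt_add hx h0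
  map_smul' := valueAt_smul hx h0

variable (q d) in
/-- The element `x_{i,1}^r` of the shuffle algebra. -/
def shufX (i : ZMod n) (r : ℤ) : Shuffle (n := n) q d :=
  DirectSum.of (ShuffleComp q d) (Pi.single i 1) (xpow q d i r)

theorem colourCount_singleton (t : ι) : colourCount col {t} = Pi.single (col t) 1 := by
  funext i
  unfold colourCount
  by_cases h : col t = i
  · subst h
    rw [Finset.filter_singleton, if_pos rfl, Pi.single_eq_same, Finset.card_singleton]
  · rw [Pi.single_eq_of_ne (Ne.symm h), Finset.card_eq_zero, Finset.filter_eq_empty_iff]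
    simpa using h

theorem valueAt_shufX (t : ι) (h0 : x t ≠ 0) (i : ZMod n) (r : ℤ) :
    valueAt col x {t} (shufX q d i r) = if col t = i then x t ^ r else 0 := by
  by_cases h : col t = i
  · subst h
    rw [if_pos rfl]
    obtain ⟨e⟩ := ColEnum.exists_enum_of_eq (colourCount_singleton (col := col) t)
    have h0' : ∀ s ∈ ({t} : Finset ι), x s ≠ 0 := by simpa using h0
    have hx : Set.InjOn x ({t} : Finset ι) := by simp
    unfold shufX
    rw [valueAt_of e hx h0']
    have hv : (⟨col t, 0⟩ : Var n).2 < (Pi.single (col t) 1 : ZMod n → ℕ) (col t) := by simp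
    have h1 : e.point x ⟨col t, 0⟩ = x t := by
      rw [e.point_of_lt x ⟨⟨col t, 0⟩, hv⟩]
      have := (e.equiv ⟨⟨col t, 0⟩, hv⟩).2
      rw [Finset.mem_singleton] at this
      rw [this]
    have h2 := ((HasEval.var (e.point x) (⟨col t, 0⟩ : Var n)).zpow (by rwa [h1]) r).evalRat_eq
    rw [h1] at h2
    exact h2
  · rw [if_neg h]
    refine valueAt_of_ne ?_ _
    rw [colourCount_singleton]
    intro h'
    have := congrFun h' i
    rw [Pi.single_eq_of_ne (Ne.symm h), Pi.single_eq_same] at this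
    exact zero_ne_one this

theorem valueAt_shufX_of_card (h : T.card ≠ 1) (i : ZMod n) (r : ℤ) :
    valueAt col x T (shufX q d i r) = 0 := by
  refine valueAt_of_ne (fun h' => h ?_) _
  have h1 : T.card = ∑ j, colourCount col T j :=
    Finset.card_eq_sum_card_fiberwise fun _ _ => Finset.mem_coe.2 (Finset.mem_univ _)
  rw [h1, h']
  simp

theorem valueAt_shufX_mul (hx : Set.InjOn x T) (h0 : ∀ t ∈ T, x t ≠ 0) (i : ZMod n) (r : ℤ)
    (E : Shuffle (n := n) q d) : valueAt col x T (shufX q d i r * E) =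
      ∑ t ∈ T, if col t = i then x t ^ r * valueAt col x (T.erase t) E *
        ∏ b ∈ T.erase t, zeta q d i (col b) (x t) (x b) else 0 := by
  rw [valueAt_mul hx h0]
  symm
  refine Finset.sum_of_injOn (fun t => {t}) (fun _ _ _ _ h => by simpa using h) ?_ ?_ ?_
  · intro t ht
    simpa using ht
  · intro A hA hA'
    rw [valueAt_shufX_of_card, zero_mul, zero_mul]
    intro h1
    obtain ⟨t, rfl⟩ := Finset.card_eq_one.1 h1
    refine hA' ⟨t, ?_, rfl⟩
    simpa using hA
  · intro t ht
    rw [valueAt_shufX t (h0 t ht), Finset.sdiff_singleton_eq_erase]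
    unfold zetaCross
    rw [Finset.prod_singleton]
    split_ifs with h
    · rw [h]
    · rw [zero_mul, zero_mul]

variable (q d) in
/-- The homogeneous elements of a given degree. -/
def homogeneous (k : ZMod n → ℕ) : Submodule ℂ (Shuffle (n := n) q d) :=
  LinearMap.range (DirectSum.lof ℂ (ZMod n → ℕ) (ShuffleComp q d) k)

theorem homogeneous_mul {k l m : ZMod n → ℕ} {E F : Shuffle (n := n) q d}
    (hE : E ∈ homogeneous q d k) (hF : F ∈ homogeneous q d l) (h : k + l = m) :
    E * F ∈ homogeneous q d m := by
  subst h
  obtain ⟨E, rfl⟩ := hE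
  obtain ⟨F, rfl⟩ := hF
  exact ⟨GradedMonoid.GMul.mul E F, (DirectSum.of_mul_of E F).symm⟩

theorem shufX_mem (i : ZMod n) (r : ℤ) : shufX q d i r ∈ homogeneous q d (Pi.single i 1) :=
  ⟨_, rfl⟩

theorem homogeneous_ext {k : ZMod n → ℕ} {E F : Shuffle (n := n) q d}
    (hE : E ∈ homogeneous q d k) (hF : F ∈ homogeneous q d k)
    (h : valueAt Sigma.fst rvar (block 0 k) E = valueAt Sigma.fst rvar (block 0 k) F) : E = F := by
  refine shuffle_ext fun T => ?_
  obtain ⟨E, rfl⟩ := hE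
  obtain ⟨F, rfl⟩ := hF
  rw [valueAt_block (generic_rvar k), valueAt_block (generic_rvar k),
    (HasEval.self _).evalRat_eq, (HasEval.self _).evalRat_eq] at h
  have h' : E = F := by
    have h1 := Subtype.ext h
    rwa [DirectSum.lof_apply, DirectSum.lof_apply] at h1
  rw [h']

theorem zeta_exchange (i j : ZMod n) {y w : L} (h : y ≠ w) :
    (((d : ℂ) ^ mMat i j) • y - ((q : ℂ) ^ cartan i j) • w) * zeta q d i j y w =
    (((q : ℂ) ^ cartan i j * (d : ℂ) ^ mMat i j) • y - w) * zeta q d j i w y := by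
  have h1 := sub_ne_zero.2 h
  have h2 := sub_ne_zero.2 h.symm
  have hq := (map_ne_zero (algebraMap ℂ L)).2 q.ne_zero
  have hd := (map_ne_zero (algebraMap ℂ L)).2 d.ne_zero
  by_cases hij : j = i
  · subst hij
    have e1 : cartan j j = 2 := by simp [cartan]
    have e2 : mMat j j = 0 := by
      unfold mMat
      rw [if_neg (add_one_ne j).symm, if_neg (sub_one_ne j).symm]
    rw [e1, e2, zeta_same, zeta_same]
    have e3 : ((q : ℂ) ^ (2 : ℤ)) = (q : ℂ) ^ 2 := zpow_natCast _ 2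
    simp only [zpow_neg, e3, Algebra.smul_def, map_pow, map_inv₀, zpow_zero, mul_one, map_one,
      one_mul]
    field_simp
    ring
  · by_cases hs : j = i + 1
    · subst hs
      have e1 : cartan i (i + 1) = -1 := by
        unfold cartan
        rw [if_neg (add_one_ne i), if_pos (Or.inl rfl)]
      have e2 : mMat i (i + 1) = -1 := by simp [mMat]
      have e3 : zeta q d (i + 1) i w y = zeta q d (i + 1) (i + 1 - 1) w y := by simp
      rw [e1, e2, e3, zeta_succ, zeta_pred]
      simp only [Algebra.smul_def, map_mul, zpow_neg_one, map_inv₀]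
      field_simp
      ring
    · by_cases hp : j = i - 1
      · subst hp
        have e1 : cartan i (i - 1) = -1 := by
          unfold cartan
          rw [if_neg hij, if_pos (Or.inr rfl)]
        have e2 : mMat i (i - 1) = 1 := by
          unfold mMat
          rw [if_neg hs, if_pos rfl]
        have e3 : zeta q d (i - 1) i w y = zeta q d (i - 1) (i - 1 + 1) w y := by simp
        rw [e1, e2, e3, zeta_succ, zeta_pred]
        simp only [Algebra.smul_def, map_mul, zpow_neg_one, zpow_one, map_inv₀]
        field_simp
        ring
      · have e1 : cartan i j = 0 := by
          unfold cartan
          rw [if_neg hij, if_neg (by tauto)]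
        have e2 : mMat i j = 0 := by
          unfold mMat
          rw [if_neg hs, if_neg hp]
        have e3 : zeta q d i j y w = 1 := by
          unfold zeta
          rw [if_neg hij, if_neg hs, if_neg hp]
        have e4 : zeta q d j i w y = 1 := by
          unfold zeta
          rw [if_neg (Ne.symm hij), if_neg (fun h => hp (by rw [h]; ring)),
            if_neg (fun h => hs (by rw [h]; ring))]
        rw [e1, e2, e3, e4]
        simp

theorem valueAt_shufX_mul_shufX (hx : Set.InjOn x T) (h0 : ∀ t ∈ T, x t ≠ 0) {u v : ι}
    (huv : u ≠ v) (hT : T = {u, v}) (i j : ZMod n) (r s : ℤ) :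
    valueAt col x T (shufX q d i r * shufX q d j s) =
      (if col u = i then if col v = j then x u ^ r * x v ^ s * zeta q d i j (x u) (x v) else 0
        else 0) +
      if col v = i then if col u = j then x v ^ r * x u ^ s * zeta q d i j (x v) (x u) else 0
        else 0 := by
  subst hT
  rw [valueAt_shufX_mul hx h0, Finset.sum_pair huv]
  have e1 : ({u, v} : Finset ι).erase u = {v} := by
    rw [Finset.erase_insert (by simpa using huv)]
  have e2 : ({u, v} : Finset ι).erase v = {u} := by
    rw [Finset.pair_comm, Finset.erase_insert (by simpa using huv.symm)]
  rw [e1, e2, valueAt_shufX v (h0 v (by simp)), valueAt_shufX u (h0 u (by simp)),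
    Finset.prod_singleton, Finset.prod_singleton]
  congr 1
  · split_ifs with h1 h2
    · rw [h2]
    · simp
    · rfl
  · split_ifs with h1 h2
    · rw [h2]
    · simp
    · rfl

theorem shufX_exchange (i j : ZMod n) (r s : ℤ) :
    ((d : ℂ) ^ mMat i j) • (shufX q d i (r + 1) * shufX q d j s)
      - ((q : ℂ) ^ cartan i j) • (shufX q d i r * shufX q d j (s + 1)) =
    ((q : ℂ) ^ cartan i j * (d : ℂ) ^ mMat i j) • (shufX q d j s * shufX q d i (r + 1))
      - shufX q d j (s + 1) * shufX q d i r := by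
  have hm : ∀ r s, shufX q d i r * shufX q d j s ∈ homogeneous q d (Pi.single i 1 + Pi.single j 1) :=
    fun r s => homogeneous_mul (shufX_mem _ _) (shufX_mem _ _) rfl
  have hm' : ∀ r s, shufX q d j r * shufX q d i s ∈ homogeneous q d (Pi.single i 1 + Pi.single j 1) :=
    fun r s => homogeneous_mul (shufX_mem _ _) (shufX_mem _ _) (add_comm _ _)
  refine homogeneous_ext (k := Pi.single i 1 + Pi.single j 1)
    (sub_mem (Submodule.smul_mem _ _ (hm _ _)) (Submodule.smul_mem _ _ (hm _ _)))
    (sub_mem (Submodule.smul_mem _ _ (hm' _ _)) (hm' _ _)) ?_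
  have hx : Set.InjOn rvar ((block 0 (Pi.single i 1 + Pi.single j 1) : Finset (Var n)) : Set (Var n)) :=
    rvar_injective.injOn
  have h0 : ∀ t ∈ block 0 (Pi.single i 1 + Pi.single j 1 : ZMod n → ℕ), rvar t ≠ 0 :=
    fun t _ => rvar_ne_zero t
  obtain ⟨u, v, huv, hu, hv, hT⟩ : ∃ u v : Var n, u ≠ v ∧ u.1 = i ∧ v.1 = j ∧
      block 0 (Pi.single i 1 + Pi.single j 1) = {u, v} := by
    by_cases hij : i = j
    · subst hij
      refine ⟨⟨i, 0⟩, ⟨i, 1⟩, by simp, rfl, rfl, ?_⟩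
      ext ⟨l, p⟩
      rw [mem_block]
      by_cases hl : l = i
      · subst hl
        simp
        omega
      · simp [hl]
    · refine ⟨⟨i, 0⟩, ⟨j, 0⟩, fun h => hij (congrArg Sigma.fst h), rfl, rfl, ?_⟩
      ext ⟨l, p⟩
      rw [mem_block]
      by_cases hl : l = i
      · subst hl
        simp [hij]
      · by_cases hl' : l = j
        · subst hl'
          simp [hl]
        · simp [hl, hl']
  change valueLin hx h0 _ = valueLin hx h0 _
  rw [map_sub, map_sub, map_smul, map_smul, map_smul]
  change _ • valueAt Sigma.fst _ _ _ - _ • valueAt Sigma.fst _ _ _ =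
    _ • valueAt Sigma.fst _ _ _ - valueAt Sigma.fst _ _ _
  simp only [valueAt_shufX_mul_shufX hx h0 huv hT, hu, hv, if_true]
  have h1 : rvar u ≠ rvar v := rvar_injective.ne huv
  have e1 := zeta_exchange (q := q) (d := d) i j h1
  have e2 := zeta_exchange (q := q) (d := d) i j h1.symm
  have hu0 := rvar_ne_zero u
  have hv0 := rvar_ne_zero v
  simp only [zpow_add_one₀ hu0, zpow_add_one₀ hv0]
  simp only [Algebra.smul_def] at e1 e2 ⊢
  by_cases hij : i = j
  · subst hij
    simp only [if_true]
    linear_combination (rvar u ^ r * rvar v ^ s) * e1 + (rvar v ^ r * rvar u ^ s) * e2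
  · simp only [hij, Ne.symm hij, if_false, add_zero, zero_add]
    linear_combination (rvar u ^ r * rvar v ^ s) * e1

theorem valueAt_shufX_mul₃ (hx : Set.InjOn x T) (h0 : ∀ t ∈ T, x t ≠ 0) {u v w : ι}
    (huv : u ≠ v) (huw : u ≠ w) (hvw : v ≠ w) (hT : T = {u, v, w}) (i : ZMod n) (r : ℤ)
    (E : Shuffle (n := n) q d) :
    valueAt col x T (shufX q d i r * E) =
      (if col u = i then x u ^ r * valueAt col x {v, w} E *
        (zeta q d i (col v) (x u) (x v) * zeta q d i (col w) (x u) (x w)) else 0) +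
      ((if col v = i then x v ^ r * valueAt col x {u, w} E *
        (zeta q d i (col u) (x v) (x u) * zeta q d i (col w) (x v) (x w)) else 0) +
      (if col w = i then x w ^ r * valueAt col x {u, v} E *
        (zeta q d i (col u) (x w) (x u) * zeta q d i (col v) (x w) (x v)) else 0)) := by
  subst hT
  have e1 : ({u, v, w} : Finset ι).erase u = {v, w} := by
    rw [Finset.erase_insert (by simp [huv, huw])]
  have e2 : ({u, v, w} : Finset ι).erase v = {u, w} := by
    rw [Finset.insert_comm, Finset.erase_insert (by simp [huv.symm, hvw])]
  have e3 : ({u, v, w} : Finset ι).erase w = {u, v} := by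
    rw [Finset.pair_comm, Finset.insert_comm, Finset.erase_insert (by simp [huw.symm, hvw.symm])]
  rw [valueAt_shufX_mul hx h0, Finset.sum_insert (by simp [huv, huw]), Finset.sum_pair hvw, e1, e2,
    e3, Finset.prod_pair hvw, Finset.prod_pair huw, Finset.prod_pair huv]

theorem zeta_serre {i j : ZMod n} (hij : j = i + 1 ∨ j = i - 1) {y y' w : L} (h : y ≠ y')
    (hy : y ≠ w) (hy' : y' ≠ w) :
    zeta q d i i y y' * (zeta q d i j y w * zeta q d i j y' w -
        algebraMap ℂ L ((q : ℂ) + (q : ℂ)⁻¹) * (zeta q d i j y w * zeta q d j i w y') +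
        zeta q d j i w y * zeta q d j i w y') +
      zeta q d i i y' y * (zeta q d i j y' w * zeta q d i j y w -
        algebraMap ℂ L ((q : ℂ) + (q : ℂ)⁻¹) * (zeta q d i j y' w * zeta q d j i w y) +
        zeta q d j i w y' * zeta q d j i w y) = 0 := by
  have h1 := sub_ne_zero.2 h
  have h1' := sub_ne_zero.2 h.symm
  have h2 := sub_ne_zero.2 hy
  have h2' := sub_ne_zero.2 hy.symm
  have h3 := sub_ne_zero.2 hy'
  have h3' := sub_ne_zero.2 hy'.symm
  have hq := (map_ne_zero (algebraMap ℂ L)).2 q.ne_zero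
  have hd := (map_ne_zero (algebraMap ℂ L)).2 d.ne_zero
  have n1 : y' - y = -(y - y') := by ring
  have n2 : w - y = -(y - w) := by ring
  have n3 : w - y' = -(y' - w) := by ring
  have eq2 : algebraMap ℂ L ((q : ℂ) ^ (-2 : ℤ)) = (algebraMap ℂ L q)⁻¹ ^ 2 := by
    rw [map_zpow₀, zpow_neg, inv_pow]; norm_cast
  rcases hij with rfl | rfl
  · have e3 : ∀ y, zeta q d (i + 1) i w y = zeta q d (i + 1) (i + 1 - 1) w y := by simp
    rw [e3, e3, zeta_succ, zeta_succ, zeta_pred, zeta_pred, zeta_same, zeta_same, n1, n2, n3]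
    simp only [Algebra.smul_def, map_mul, map_add, map_inv₀, eq2]
    field_simp
    ring
  · have e3 : ∀ y, zeta q d (i - 1) i w y = zeta q d (i - 1) (i - 1 + 1) w y := by simp
    rw [e3, e3, zeta_succ, zeta_succ, zeta_pred, zeta_pred, zeta_same, zeta_same, n1, n2, n3]
    simp only [Algebra.smul_def, map_mul, map_add, map_inv₀, eq2]
    field_simp
    ring

/-- The expression `x y z - (q + q⁻¹) x z y + z x y` in the shuffle algebra. -/
def shufSerre (x y z : Shuffle (n := n) q d) : Shuffle (n := n) q d :=
  x * y * z - ((q : ℂ) + (q : ℂ)⁻¹) • (x * z * y) + z * x * y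

theorem shufX_serre {i j : ZMod n} (hij : j = i + 1 ∨ j = i - 1) (r₁ r₂ s : ℤ) :
    shufSerre (shufX q d i r₁) (shufX q d i r₂) (shufX q d j s) +
      shufSerre (shufX q d i r₂) (shufX q d i r₁) (shufX q d j s) = 0 := by
  have hne : j ≠ i := by
    rcases hij with rfl | rfl
    · exact add_one_ne i
    · exact sub_one_ne i
  set k : ZMod n → ℕ := Pi.single i 1 + Pi.single i 1 + Pi.single j 1 with hk
  have hm : ∀ r₁ r₂, shufSerre (shufX q d i r₁) (shufX q d i r₂) (shufX q d j s) ∈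
      homogeneous q d k := by
    intro r₁ r₂
    refine add_mem (sub_mem ?_ (Submodule.smul_mem _ _ ?_)) ?_
    · exact homogeneous_mul (homogeneous_mul (shufX_mem _ _) (shufX_mem _ _) rfl) (shufX_mem _ _) rfl
    · refine homogeneous_mul (homogeneous_mul (shufX_mem _ _) (shufX_mem _ _) rfl) (shufX_mem _ _) ?_
      rw [hk]; abel
    · refine homogeneous_mul (homogeneous_mul (shufX_mem _ _) (shufX_mem _ _) rfl) (shufX_mem _ _) ?_
      rw [hk]; abel
  refine homogeneous_ext (add_mem (hm _ _) (hm _ _)) (zero_mem _) ?_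
  have hx : Set.InjOn rvar ((block 0 k : Finset (Var n)) : Set (Var n)) := rvar_injective.injOn
  have h0 : ∀ t ∈ block 0 k, rvar t ≠ 0 := fun t _ => rvar_ne_zero t
  have hT : block 0 k = {(⟨i, 0⟩ : Var n), ⟨i, 1⟩, ⟨j, 0⟩} := by
    ext ⟨l, p⟩
    rw [mem_block]
    by_cases hl : l = i
    · subst hl
      simp [hk, hne.symm]
      omega
    · by_cases hl' : l = j
      · subst hl'
        simp [hk, hl]
      · simp [hk, hl, hl']
  have huv : (⟨i, 0⟩ : Var n) ≠ ⟨i, 1⟩ := by simp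
  have huw : (⟨i, 0⟩ : Var n) ≠ ⟨j, 0⟩ := fun h => hne (congrArg Sigma.fst h).symm
  have hvw : (⟨i, 1⟩ : Var n) ≠ ⟨j, 0⟩ := fun h => hne (congrArg Sigma.fst h).symm
  change valueLin hx h0 _ = valueLin hx h0 _
  unfold shufSerre
  simp only [mul_assoc]
  rw [map_zero, map_add, map_add, map_add, map_sub, map_sub, map_smul, map_smul]
  change (valueAt Sigma.fst _ _ _ - _ • valueAt Sigma.fst _ _ _ + valueAt Sigma.fst _ _ _) +
    (valueAt Sigma.fst _ _ _ - _ • valueAt Sigma.fst _ _ _ + valueAt Sigma.fst _ _ _) = 0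
  have two : ∀ {u v : Var n} (huv : u ≠ v) (i j : ZMod n) (r s : ℤ), _ := fun {u v} huv i j r s =>
    valueAt_shufX_mul_shufX (q := q) (d := d) (col := Sigma.fst) (x := rvar) (T := {u, v})
      rvar_injective.injOn (fun t _ => rvar_ne_zero t) huv rfl i j r s
  simp only [valueAt_shufX_mul₃ hx h0 huv huw hvw hT, two huv, two huw, two hvw, if_true, hne,
    hne.symm, if_false, add_zero, zero_add]
  have key := zeta_serre (q := q) (d := d) hij (rvar_injective.ne huv) (rvar_injective.ne huw)
    (rvar_injective.ne hvw)
  simp only [Algebra.smul_def]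
  generalize rvar (⟨i, 0⟩ : Var n) = U at *
  generalize rvar (⟨i, 1⟩ : Var n) = V at *
  generalize rvar (⟨j, 0⟩ : Var n) = W at *
  linear_combination ((U ^ r₁ * V ^ r₂ + U ^ r₂ * V ^ r₁) * W ^ s) * key

end ShuffleRelations

/-! Laurent expansions -/

section LaurentTools

variable {K : Type} [Field K]

/-- The variable `x` whose negative powers (`true`) or positive powers (`false`) are the powers of the
formal variable. -/
def serX (K : Type) [Field K] (ε : Bool) : LaurentSeries K :=
  HahnSeries.single (if ε then -1 else 1 : ℤ) 1

/-- The coefficient of `x^{-p}`. -/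
def serCoeff (ε : Bool) (p : ℤ) (F : LaurentSeries K) : K := F.coeff (if ε then p else -p)

theorem serX_ne_zero (ε : Bool) : serX K ε ≠ 0 := HahnSeries.single_ne_zero one_ne_zero

theorem serX_inv (ε : Bool) : (serX K ε)⁻¹ = HahnSeries.single (if ε then 1 else -1 : ℤ) 1 := by
  unfold serX
  rw [HahnSeries.inv_single]
  cases ε <;> simp

theorem ser_ext (ε : Bool) {F G : LaurentSeries K} (h : ∀ p, serCoeff ε p F = serCoeff ε p G) :
    F = G := by
  refine HahnSeries.ext (funext fun p => ?_)
  have := h (if ε then p else -p)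
  unfold serCoeff at this
  cases ε <;> simpa using this

theorem serCoeff_X_mul (ε : Bool) (p : ℤ) (F : LaurentSeries K) :
    serCoeff ε p (serX K ε * F) = serCoeff ε (p + 1) F := by
  unfold serCoeff serX
  rw [HahnSeries.coeff_single_mul, one_mul]
  cases ε
  · simp only [Bool.false_eq_true, if_false]; congr 1; ring
  · simp only [if_true]; congr 1

theorem algebraMap_ser (c : K) : algebraMap K (LaurentSeries K) c = HahnSeries.C c :=
  HahnSeries.ofPowerSeries_C c

theorem serCoeff_C_mul (ε : Bool) (p : ℤ) (c : K) (F : LaurentSeries K) :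
    serCoeff ε p (algebraMap K (LaurentSeries K) c * F) = c * serCoeff ε p F := by
  unfold serCoeff
  rw [algebraMap_ser, HahnSeries.C_mul_eq_smul, HahnSeries.coeff_smul, smul_eq_mul]

theorem serCoeff_add (ε : Bool) (p : ℤ) (F G : LaurentSeries K) :
    serCoeff ε p (F + G) = serCoeff ε p F + serCoeff ε p G := HahnSeries.coeff_add

theorem serCoeff_sub (ε : Bool) (p : ℤ) (F G : LaurentSeries K) :
    serCoeff ε p (F - G) = serCoeff ε p F - serCoeff ε p G := HahnSeries.coeff_sub

theorem serCoeff_sum (ε : Bool) (p : ℤ) {ι : Type*} (s : Finset ι) (F : ι → LaurentSeries K) :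
    serCoeff ε p (∑ i ∈ s, F i) = ∑ i ∈ s, serCoeff ε p (F i) := HahnSeries.coeff_sum _

theorem serCoeff_one (ε : Bool) (p : ℤ) :
    serCoeff ε p (1 : LaurentSeries K) = if p = 0 then 1 else 0 := by
  unfold serCoeff
  rw [HahnSeries.coeff_one]
  cases ε <;> simp

theorem serCoeff_C_div (ε : Bool) (p : ℤ) (c : K) (F : LaurentSeries K) :
    serCoeff ε p (algebraMap K (LaurentSeries K) c / serX K ε * F) = c * serCoeff ε (p - 1) F := by
  have : algebraMap K (LaurentSeries K) c / serX K ε * F =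
      algebraMap K (LaurentSeries K) c * ((serX K ε)⁻¹ * F) := by ring
  rw [this, serCoeff_C_mul]
  congr 1
  have h := serCoeff_X_mul ε (p - 1) ((serX K ε)⁻¹ * F)
  rw [mul_inv_cancel_left₀ (serX_ne_zero ε), sub_add_cancel] at h
  exact h.symm

/-- The expansion of `(1 - c / x)⁻¹`. -/
def serGeom (ε : Bool) (c : K) : LaurentSeries K :=
  HahnSeries.ofSuppBddBelow
    (fun p => if ε then (if 0 ≤ p then c ^ p else 0) else (if 0 < p then -c ^ (-p) else 0)) ⟨0, by
      intro p hp
      by_contra h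
      refine hp ?_
      rw [not_le] at h
      cases ε
      · simp only [Bool.false_eq_true, if_false]
        rw [if_neg (by omega)]
      · simp only [if_true]
        rw [if_neg (by omega)]⟩

theorem serCoeff_geom (ε : Bool) (c : K) (p : ℤ) : serCoeff ε p (serGeom ε c) =
    if ε then (if 0 ≤ p then c ^ p else 0) else (if p < 0 then -c ^ p else 0) := by
  unfold serCoeff serGeom
  cases ε
  · simp [HahnSeries.ofSuppBddBelow]
  · simp [HahnSeries.ofSuppBddBelow]

theorem geom_spec (ε : Bool) {c : K} (hc : c ≠ 0) :
    (1 - algebraMap K (LaurentSeries K) c / serX K ε) * serGeom ε c = 1 := by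
  refine ser_ext ε fun p => ?_
  rw [sub_mul, one_mul, serCoeff_sub, serCoeff_C_div, serCoeff_geom, serCoeff_geom, serCoeff_one]
  have h1 : c * c ^ (p - 1) = c ^ p := by
    rw [← zpow_one_add₀ hc]; congr 1; ring
  cases ε
  · simp only [Bool.false_eq_true, if_false]
    rcases lt_trichotomy p 0 with h | h | h
    · rw [if_pos h, if_pos (by omega), if_neg (by omega), mul_neg, h1]; ring
    · subst h
      simp [hc]
    · rw [if_neg (by omega), if_neg (by omega), if_neg (by omega)]; ring
  · simp only [if_true]
    rcases lt_trichotomy p 0 with h | h | h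
    · rw [if_neg (by omega), if_neg (by omega), if_neg (by omega)]; ring
    · subst h
      simp
    · rw [if_pos (by omega), if_pos (by omega), if_neg (by omega), h1]; ring

theorem one_sub_div_ne_zero (ε : Bool) {c : K} (hc : c ≠ 0) :
    (1 - algebraMap K (LaurentSeries K) c / serX K ε) ≠ 0 := fun h => by
  have := geom_spec ε hc
  rw [h, zero_mul] at this
  exact zero_ne_one this

theorem geom_eq (ε : Bool) {c : K} (hc : c ≠ 0) :
    (1 - algebraMap K (LaurentSeries K) c / serX K ε)⁻¹ = serGeom ε c :=
  inv_eq_of_mul_eq_one_right (geom_spec ε hc)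

/-- A ring homomorphism applied to the coefficients. -/
def serMap (f : K →+* K) : LaurentSeries K →+* LaurentSeries K where
  toFun F := F.map f
  map_one' := HahnSeries.map_one f.toMonoidWithZeroHom
  map_mul' _ _ := HahnSeries.map_mul f.toNonUnitalRingHom
  map_zero' := HahnSeries.map_zero f.toZeroHom
  map_add' _ _ := HahnSeries.map_add f.toAddMonoidHom

theorem serMap_C (f : K →+* K) (c : K) : serMap f (algebraMap K (LaurentSeries K) c) =
    algebraMap K (LaurentSeries K) (f c) := by
  rw [algebraMap_ser, algebraMap_ser]
  exact HahnSeries.map_C c f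

theorem serMap_X (f : K →+* K) (ε : Bool) : serMap f (serX K ε) = serX K ε :=
  (HahnSeries.map_single f.toZeroHom).trans (by rw [show f.toZeroHom 1 = 1 from map_one f]; rfl)

variable [Algebra ℂ K]

/-- The series with coefficients in `S`, with lowest term in degree `e`, and with an invertible lowest
coefficient. -/
structure Leads (S : Subalgebra ℂ K) (e : ℤ) (F : LaurentSeries K) : Prop where
  mem : ∀ p, F.coeff p ∈ S
  lt : ∀ p, p < e → F.coeff p = 0
  ne_zero : F.coeff e ≠ 0
  inv_mem : (F.coeff e)⁻¹ ∈ S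

variable {S : Subalgebra ℂ K}

theorem Leads.mul {e e' : ℤ} {F G : LaurentSeries K} (hF : Leads S e F) (hG : Leads S e' G) :
    Leads S (e + e') (F * G) := by
  have h : (F * G).coeff (e + e') = F.coeff e * G.coeff e' := by
    rw [HahnSeries.coeff_mul]
    refine Finset.sum_eq_single (e, e') ?_ ?_
    · rintro ⟨i, j⟩ hij hne
      rw [Finset.mem_antidiagonal] at hij
      obtain ⟨-, -, h⟩ := hij
      simp only at h
      rcases lt_trichotomy i e with hi | hi | hi
      · rw [hF.lt i hi, zero_mul]
      · exact (hne (by rw [Prod.mk.injEq]; exact ⟨hi, by omega⟩)).elim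
      · rw [hG.lt j (by omega), mul_zero]
    · intro h
      rw [Finset.mem_antidiagonal] at h
      exact (h ⟨hF.ne_zero, hG.ne_zero, rfl⟩).elim
  refine ⟨fun p => ?_, fun p hp => ?_, ?_, ?_⟩
  · rw [HahnSeries.coeff_mul]
    exact sum_mem fun ij _ => mul_mem (hF.mem _) (hG.mem _)
  · rw [HahnSeries.coeff_mul]
    refine Finset.sum_eq_zero ?_
    rintro ⟨i, j⟩ hij
    rw [Finset.mem_antidiagonal] at hij
    obtain ⟨-, -, h⟩ := hij
    simp only at h
    rcases lt_or_ge i e with hi | hi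
    · rw [hF.lt i hi, zero_mul]
    · rw [hG.lt j (by omega), mul_zero]
  · rw [h]; exact mul_ne_zero hF.ne_zero hG.ne_zero
  · rw [h, mul_inv]; exact mul_mem hF.inv_mem hG.inv_mem

theorem Leads.C {c : K} (h0 : c ≠ 0) (h : c ∈ S) (h' : c⁻¹ ∈ S) :
    Leads S 0 (algebraMap K (LaurentSeries K) c) := by
  have h1 : ∀ p, (algebraMap K (LaurentSeries K) c).coeff p = if p = 0 then c else 0 := by
    intro p
    rw [algebraMap_ser, HahnSeries.C_apply, HahnSeries.coeff_single]
    split_ifs <;> rfl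
  refine ⟨fun p => ?_, fun p hp => ?_, ?_, ?_⟩
  · rw [h1]; split_ifs
    · exact h
    · exact zero_mem _
  · rw [h1, if_neg (by omega)]
  · rwa [h1, if_pos rfl]
  · rwa [h1, if_pos rfl]

theorem Leads.prod {ι : Type*} (s : Finset ι) {e : ι → ℤ} {F : ι → LaurentSeries K}
    (h : ∀ i ∈ s, Leads S (e i) (F i)) : Leads S (∑ i ∈ s, e i) (∏ i ∈ s, F i) := by
  classical
  induction s using Finset.induction_on with
  | empty =>
    rw [Finset.sum_empty, Finset.prod_empty, ← map_one (algebraMap K (LaurentSeries K))]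
    exact .C one_ne_zero (one_mem _) (by rw [inv_one]; exact one_mem _)
  | insert i s hi ih =>
    rw [Finset.sum_insert hi, Finset.prod_insert hi]
    exact (h i (Finset.mem_insert_self _ _)).mul
      (ih fun j hj => h j (Finset.mem_insert_of_mem hj))

theorem Leads.factor (ε : Bool) {c : K} (h0 : c ≠ 0) (h : c ∈ S) (h' : c⁻¹ ∈ S) :
    Leads S (if ε then 0 else -1) (1 - algebraMap K (LaurentSeries K) c / serX K ε) := by
  have h1 : ∀ p, serCoeff ε p (1 - algebraMap K (LaurentSeries K) c / serX K ε) =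
      (if p = 0 then 1 else 0) - c * if p - 1 = 0 then 1 else 0 := by
    intro p
    have := serCoeff_C_div ε p c 1
    rw [mul_one, serCoeff_one] at this
    rw [serCoeff_sub, serCoeff_one, this]
  have h2 : ∀ p, (1 - algebraMap K (LaurentSeries K) c / serX K ε).coeff p =
      serCoeff ε (if ε then p else -p) (1 - algebraMap K (LaurentSeries K) c / serX K ε) := by
    intro p; cases ε <;> simp [serCoeff]
  refine ⟨fun p => ?_, fun p hp => ?_, ?_, ?_⟩
  · rw [h2, h1]
    refine sub_mem ?_ (mul_mem h ?_) <;> split_ifs <;> first | exact one_mem _ | exact zero_mem _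
  · rw [h2, h1]
    cases ε
    · simp only [Bool.false_eq_true, if_false] at hp ⊢
      rw [if_neg (by omega), if_neg (by omega)]; ring
    · simp only [if_true] at hp ⊢
      rw [if_neg (by omega), if_neg (by omega)]; ring
  · rw [h2, h1]
    cases ε <;> simp [h0]
  · rw [h2, h1]
    cases ε
    · simpa using h'
    · simp [one_mem]

theorem Leads.factor_inv (ε : Bool) {c : K} (h0 : c ≠ 0) (h : c ∈ S) (h' : c⁻¹ ∈ S) :
    Leads S (if ε then 0 else 1) (1 - algebraMap K (LaurentSeries K) c / serX K ε)⁻¹ := by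
  rw [geom_eq ε h0]
  have h2 : ∀ p, (serGeom ε c).coeff p =
      serCoeff ε (if ε then p else -p) (serGeom ε c) := by
    intro p; cases ε <;> simp [serCoeff]
  have h3 : ∀ p : ℤ, c ^ p ∈ S := by
    intro p
    cases p with
    | ofNat p => rw [Int.ofNat_eq_natCast, zpow_natCast]; exact pow_mem h p
    | negSucc p => rw [zpow_negSucc, ← inv_pow]; exact pow_mem h' _
  refine ⟨fun p => ?_, fun p hp => ?_, ?_, ?_⟩
  · rw [h2, serCoeff_geom]
    split_ifs
    · exact h3 _
    · exact zero_mem _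
    · exact neg_mem (h3 _)
    · exact zero_mem _
  · rw [h2, serCoeff_geom]
    cases ε
    · simp only [Bool.false_eq_true, if_false] at hp ⊢
      rw [if_neg (by omega)]
    · simp only [if_true] at hp ⊢
      rw [if_neg (by omega)]
  · rw [h2, serCoeff_geom]
    cases ε <;> simp [h0]
  · rw [h2, serCoeff_geom]
    cases ε
    · simpa using h
    · simp [one_mem]

end LaurentTools

/-! partial fractions -/

section PartialFractions

variable {K : Type} [Field K] {β : Type} [DecidableEq β]

theorem exists_partial_fractions (P : Polynomial K) (B : Finset β) (c : β → K)
    (hc : Set.InjOn c B) (h0 : ∀ b ∈ B, c b ≠ 0) :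
    ∃ R : Polynomial K, P = R * (∏ b ∈ B, (1 - Polynomial.C (c b) * Polynomial.X)) +
      ∑ b ∈ B, Polynomial.C (P.eval (c b)⁻¹ / ∏ b' ∈ B.erase b, (1 - c b' / c b)) *
        ∏ b' ∈ B.erase b, (1 - Polynomial.C (c b') * Polynomial.X) := by
  set T := ∑ b ∈ B, Polynomial.C (P.eval (c b)⁻¹ / ∏ b' ∈ B.erase b, (1 - c b' / c b)) *
    ∏ b' ∈ B.erase b, (1 - Polynomial.C (c b') * Polynomial.X) with hS
  have h1 : (∏ b ∈ B, (Polynomial.X - Polynomial.C (c b)⁻¹)) ∣ P - T := by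
    refine Finset.prod_dvd_of_coprime ?_ ?_
    · intro b hb b' hb' hne
      refine Polynomial.isCoprime_X_sub_C_of_isUnit_sub (sub_ne_zero.2 fun h => ?_).isUnit
      exact hne (hc hb hb' (inv_injective h))
    · intro b hb
      rw [Polynomial.dvd_iff_isRoot, Polynomial.IsRoot.def, Polynomial.eval_sub, hS,
        Polynomial.eval_finsetSum, Finset.sum_eq_single b]
      · rw [Polynomial.eval_mul, Polynomial.eval_C, Polynomial.eval_prod]
        have h2 : ∏ b' ∈ B.erase b, Polynomial.eval (c b)⁻¹ (1 - Polynomial.C (c b') * Polynomial.X) =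
            ∏ b' ∈ B.erase b, (1 - c b' / c b) :=
          Finset.prod_congr rfl fun b' _ => by simp [div_eq_mul_inv]
        rw [h2, div_mul_cancel₀, sub_self]
        refine Finset.prod_ne_zero_iff.2 fun b' hb' h => ?_
        rw [sub_eq_zero, eq_comm, div_eq_one_iff_eq (h0 b hb)] at h
        exact Finset.ne_of_mem_erase hb' (hc (Finset.mem_of_mem_erase hb') hb h)
      · intro b' hb' hne
        have h2 : ∏ j ∈ B.erase b', Polynomial.eval (c b)⁻¹
            (1 - Polynomial.C (c j) * Polynomial.X) = 0 :=
          Finset.prod_eq_zero (Finset.mem_erase.2 ⟨hne.symm, hb⟩) (by simp [h0 b hb])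
        rw [Polynomial.eval_mul, Polynomial.eval_prod, h2, mul_zero]
      · intro h; exact (h hb).elim
  obtain ⟨R, hR⟩ := h1
  refine ⟨R * Polynomial.C (∏ b ∈ B, -(c b)⁻¹), ?_⟩
  rw [← sub_eq_iff_eq_add, hR, map_prod, mul_assoc, ← Finset.prod_mul_distrib, mul_comm R]
  congr 1
  refine Finset.prod_congr rfl fun b hb => ?_
  have : (Polynomial.C (c b)⁻¹ * Polynomial.C (c b) : Polynomial K) = 1 := by
    rw [← Polynomial.C_mul, inv_mul_cancel₀ (h0 b hb), Polynomial.C_1]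
  rw [map_neg]
  linear_combination (-Polynomial.X) * this

theorem serCoeff_aeval (ε : Bool) (p : ℤ) (R : Polynomial K) :
    serCoeff ε p (Polynomial.aeval (serX K ε)⁻¹ R) = if 0 ≤ p then R.coeff p.toNat else 0 := by
  have h1 : ∀ k : ℕ, serCoeff ε p ((serX K ε)⁻¹ ^ k) = if p = k then 1 else 0 := by
    intro k
    unfold serCoeff
    rw [serX_inv, HahnSeries.single_pow, HahnSeries.coeff_single]
    cases ε <;> simp [neg_eq_iff_eq_neg]
  rw [Polynomial.aeval_eq_sum_range, serCoeff_sum]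
  simp only [Algebra.smul_def, serCoeff_C_mul, h1]
  by_cases hp : 0 ≤ p
  · obtain ⟨k, rfl⟩ := Int.eq_ofNat_of_zero_le hp
    rw [if_pos hp]
    simp only [Nat.cast_inj, mul_ite, mul_one, mul_zero, Int.toNat_natCast]
    rw [Finset.sum_ite_eq]
    split_ifs with h
    · rfl
    · rw [Polynomial.coeff_eq_zero_of_natDegree_lt]
      simpa using h
  · rw [if_neg hp]
    refine Finset.sum_eq_zero fun k _ => ?_
    rw [if_neg (by omega), mul_zero]

/-- The two expansions of a rational function with simple poles differ by the sum over the poles. -/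
theorem serCoeff_sub_serCoeff (P : Polynomial K) (B : Finset β) (c : β → K)
    (hc : Set.InjOn c B) (h0 : ∀ b ∈ B, c b ≠ 0) (p : ℤ) :
    serCoeff true p (Polynomial.aeval (serX K true)⁻¹ P /
        ∏ b ∈ B, (1 - algebraMap K _ (c b) / serX K true)) -
      serCoeff false p (Polynomial.aeval (serX K false)⁻¹ P /
        ∏ b ∈ B, (1 - algebraMap K _ (c b) / serX K false)) =
    ∑ b ∈ B, P.eval (c b)⁻¹ / (∏ b' ∈ B.erase b, (1 - c b' / c b)) * c b ^ p := by
  obtain ⟨R, hR⟩ := exists_partial_fractions P B c hc h0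
  have key : ∀ ε, Polynomial.aeval (serX K ε)⁻¹ P /
      ∏ b ∈ B, (1 - algebraMap K _ (c b) / serX K ε) = Polynomial.aeval (serX K ε)⁻¹ R +
        ∑ b ∈ B, algebraMap K (LaurentSeries K)
          (P.eval (c b)⁻¹ / ∏ b' ∈ B.erase b, (1 - c b' / c b)) * serGeom ε (c b) := by
    intro ε
    have hb0 : ∀ b ∈ B, (1 - algebraMap K (LaurentSeries K) (c b) / serX K ε) ≠ 0 := fun b hb =>
      one_sub_div_ne_zero ε (h0 b hb)
    rw [div_eq_iff (Finset.prod_ne_zero_iff.2 hb0)]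
    conv_lhs => rw [hR]
    have h1 : ∀ b, Polynomial.aeval (serX K ε)⁻¹ (1 - Polynomial.C (c b) * Polynomial.X) =
        1 - algebraMap K (LaurentSeries K) (c b) / serX K ε := by
      intro b
      rw [map_sub, map_one, map_mul, Polynomial.aeval_C, Polynomial.aeval_X, div_eq_mul_inv]
    rw [map_add, map_mul, map_prod, map_sum, add_mul, Finset.sum_mul]
    simp only [map_mul, map_prod, h1, Polynomial.aeval_C]
    congr 1
    refine Finset.sum_congr rfl fun b hb => ?_
    rw [← Finset.mul_prod_erase B _ hb, mul_assoc]
    congr 1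
    rw [← mul_assoc, mul_comm (serGeom ε (c b)), geom_spec ε (h0 b hb), one_mul]
  rw [key, key, serCoeff_add, serCoeff_add, serCoeff_aeval, serCoeff_aeval, add_sub_add_left_eq_sub,
    serCoeff_sum, serCoeff_sum, ← Finset.sum_sub_distrib]
  refine Finset.sum_congr rfl fun b _ => ?_
  rw [serCoeff_C_mul, serCoeff_C_mul, ← mul_sub, serCoeff_geom, serCoeff_geom]
  congr 1
  rcases lt_or_ge p 0 with h | h
  · simp [h, not_le.2 h]
  · simp [h, not_lt.2 h]

end PartialFractions

/-! the images of the series `ψ` -/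

section Gamma

variable {n : ℕ} [NeZero n] [Fact (3 ≤ n)] {q d : ℂˣ} {a N : ZMod n → ℕ}
  (z : ∀ i, Fin (N i) → ℂˣ) {L : Type} [Field L] [Algebra (WField a) L]

/-- A constant, in an extension of the field of rational functions. -/
def lcst (a : ZMod n → ℕ) (L : Type) [Field L] [Algebra (WField a) L] : ℂ →+* L :=
  (algebraMap (WField a) L).comp (algebraMap ℂ (WField a))

theorem algebraMap_cst (c : ℂ) : algebraMap (WField a) L (cst a c) = lcst a L c := rfl

theorem mem_neighbours {i j : ZMod n} : j ∈ neighbours i ↔ j = i + 1 ∨ j = i - 1 := by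
  simp [neighbours]

theorem self_notMem_neighbours (i : ZMod n) : i ∉ neighbours i := by
  rw [mem_neighbours, not_or]
  exact ⟨(add_one_ne i).symm, (sub_one_ne i).symm⟩

variable (a L q d) in
/-- The dependence of the image of `ψ_i(x)` on the square root `y` of a variable of colour `l`. -/
def gammaFactor (i l : ZMod n) (y x : L) : L :=
  if l = i then y ^ 2 / ((1 - y ^ 2 / x) * (1 - y ^ 2 / (lcst a L ((q : ℂ) ^ (-2 : ℤ)) * x)))
  else if l ∈ neighbours i then
    y⁻¹ * (1 - y ^ 2 / (lcst a L ((q : ℂ)⁻¹ * (d : ℂ) ^ mMat i l) * x))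
  else 1

theorem gammaFun_eq (i : ZMod n) (x : L) : gammaFun q d a z i x = Zf q a z i x *
    ∏ u : WVar a, gammaFactor q d a L i u.1 (algebraMap (WField a) L (sqrtW u.1 u.2)) x := by
  have h1 : ∀ l, ∏ t : Fin (a l), gammaFactor q d a L i l (algebraMap (WField a) L (sqrtW l t)) x =
      (if l = i then (∏ t : Fin (a l), algebraMap (WField a) L (wv l t)) / (Wf (a := a) l x *
        Wf (a := a) l (algebraMap (WField a) L (cst a ((q : ℂ) ^ (-2 : ℤ))) * x)) else 1) *
      (if l ∈ neighbours i then (∏ t : Fin (a l), algebraMap (WField a) L (sqrtW l t)⁻¹) *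
        Wtw q d (a := a) i l x else 1) := by
    intro l
    by_cases h : l = i
    · subst h
      rw [if_pos rfl, if_neg (self_notMem_neighbours l), mul_one]
      unfold Wf
      rw [← Finset.prod_mul_distrib, ← Finset.prod_div_distrib]
      refine Finset.prod_congr rfl fun t _ => ?_
      unfold gammaFactor wv
      rw [if_pos rfl, map_pow, algebraMap_cst]
    · rw [if_neg h, one_mul]
      split_ifs with h'
      · unfold Wtw Wf
        rw [← Finset.prod_mul_distrib]
        refine Finset.prod_congr rfl fun t _ => ?_
        unfold gammaFactor wv
        rw [if_neg h, if_pos h', map_pow, map_inv₀, algebraMap_cst]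
      · refine Finset.prod_eq_one fun t _ => ?_
        unfold gammaFactor
        rw [if_neg h, if_neg h']
  rw [Fintype.prod_sigma]
  simp only [h1]
  rw [Finset.prod_mul_distrib, Finset.prod_ite_eq', if_pos (Finset.mem_univ _),
    Finset.prod_ite_mem, Finset.univ_inter, Finset.prod_mul_distrib]
  unfold gammaFun
  simp only [map_mul, map_prod]
  ring

theorem gammaFactor_exchange (i l : ZMod n) {y x : L} (hy : y ≠ 0) (hx : x ≠ 0)
    (h : ∀ e : ℤ, x - lcst a L ((q : ℂ) ^ e) * y ^ 2 ≠ 0) :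
    (lcst a L ((d : ℂ) ^ mMat i l) * x - lcst a L ((q : ℂ) ^ cartan i l) * y ^ 2) *
      gammaFactor q d a L i l y x =
    (lcst a L ((q : ℂ) ^ cartan i l * (d : ℂ) ^ mMat i l) * x - y ^ 2) *
      gammaFactor q d a L i l (lcst a L (q : ℂ)⁻¹ * y) x := by
  have hq := (map_ne_zero (lcst a L)).2 q.ne_zero
  have hd := (map_ne_zero (lcst a L)).2 d.ne_zero
  set Q := lcst a L (q : ℂ) with hQ
  unfold gammaFactor
  by_cases h1 : l = i
  · subst h1
    have e1 : cartan l l = 2 := by simp [cartan]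
    have e2 : mMat l l = 0 := by
      unfold mMat
      rw [if_neg (add_one_ne l).symm, if_neg (sub_one_ne l).symm]
    have e3 : ((q : ℂ) ^ (2 : ℤ)) = (q : ℂ) ^ 2 := zpow_natCast _ 2
    have h2 := h 0
    have h3 := h 2
    have h4 := h (-2)
    rw [e3, map_pow, ← hQ] at h3
    rw [zpow_neg, e3, map_inv₀, map_pow, ← hQ] at h4
    rw [zpow_zero, map_one, one_mul] at h2
    rw [if_pos rfl, if_pos rfl, e1, e2, zpow_neg, e3, zpow_zero, map_one, mul_one, map_inv₀, map_inv₀,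
      map_pow, ← hQ]
    have h5 : x * Q ^ 2 - y ^ 2 ≠ 0 := by
      intro h5
      apply h4
      have : x - (Q ^ 2)⁻¹ * y ^ 2 = (Q ^ 2)⁻¹ * (x * Q ^ 2 - y ^ 2) := by field_simp
      rw [this, h5, mul_zero]
    field_simp
  · rw [if_neg h1, if_neg h1]
    by_cases h2 : l ∈ neighbours i
    · rw [if_pos h2, if_pos h2]
      have e1 : cartan i l = -1 := by
        unfold cartan
        rw [if_neg h1, if_pos (mem_neighbours.1 h2)]
      rw [e1]
      have hm := zpow_ne_zero (mMat i l) hd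
      rw [zpow_neg_one, map_mul, map_inv₀, map_zpow₀, ← hQ]
      set M := lcst a L (d : ℂ) ^ mMat i l
      field_simp
    · rw [if_neg h2, if_neg h2]
      rw [mem_neighbours] at h2
      have e1 : cartan i l = 0 := by
        unfold cartan
        rw [if_neg h1, if_neg h2]
      have e2 : mMat i l = 0 := by
        unfold mMat
        rw [if_neg fun h => h2 (Or.inl h), if_neg fun h => h2 (Or.inr h)]
      rw [e1, e2]
      simp

theorem serX_sub_ne_zero (ε : Bool) {K : Type} [Field K] {c : K} (hc : c ≠ 0) :
    serX K ε - algebraMap K (LaurentSeries K) c ≠ 0 := by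
  have h := one_sub_div_ne_zero ε hc
  intro h'
  apply h
  rw [sub_eq_zero] at h'
  rw [← h', div_self (serX_ne_zero ε), sub_self]

theorem gammaFactor_ne_zero (ε : Bool) (i : ZMod n) (l : ZMod n) {y : WField a} (hy : y ≠ 0) :
    gammaFactor q d a (LaurentSeries (WField a)) i l (algebraMap _ _ y) (serX _ ε) ≠ 0 := by
  have hy' := (map_ne_zero (algebraMap (WField a) (LaurentSeries (WField a)))).2 hy
  have key : ∀ c : ℂ, c ≠ 0 → (1 - (algebraMap (WField a) (LaurentSeries (WField a)) y) ^ 2 /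
      (lcst a (LaurentSeries (WField a)) c * serX _ ε)) ≠ 0 := by
    intro c hc
    have h := one_sub_div_ne_zero ε (mul_ne_zero (pow_ne_zero 2 hy) (inv_ne_zero (cst_ne_zero (a := a) hc)))
    rwa [map_mul, map_inv₀, map_pow, algebraMap_cst, ← div_eq_mul_inv, div_div] at h
  have k1 := key 1 one_ne_zero
  rw [map_one, one_mul] at k1
  unfold gammaFactor
  split_ifs
  · exact div_ne_zero (pow_ne_zero 2 hy') (mul_ne_zero k1 (key _ (zpow_ne_zero _ q.ne_zero)))
  · exact mul_ne_zero (inv_ne_zero hy')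
      (key _ (mul_ne_zero (inv_ne_zero q.ne_zero) (zpow_ne_zero _ d.ne_zero)))
  · exact one_ne_zero

variable (q d) in
/-- The image of `ψ_i(x)`, expanded in one of the two ways. -/
def gammaSer (ε : Bool) (i : ZMod n) : LaurentSeries (WField a) :=
  gammaFun q d a z i (serX (WField a) ε)

/-- The automorphism of the series induced by the shift of variables. -/
def serScale (q : ℂˣ) (m : WVar a → ℤ) : LaurentSeries (WField a) →+* LaurentSeries (WField a) :=
  serMap (scaleHom q m : WField a →ₐ[ℂ] WField a).toRingHom

theorem serScale_C (m : WVar a → ℤ) (c : WField a) :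
    serScale q m (algebraMap _ _ c) = algebraMap _ _ (scaleHom q m c) := serMap_C _ _

theorem serScale_lcst (m : WVar a → ℤ) (c : ℂ) :
    serScale q m (lcst a _ c) = lcst a _ c := by
  rw [← algebraMap_cst, serScale_C, scaleHom_cst]

theorem serScale_X (m : WVar a → ℤ) (ε : Bool) :
    serScale q m (serX (WField a) ε) = serX (WField a) ε := serMap_X _ _

theorem serScale_Zf (m : WVar a → ℤ) (ε : Bool) (i : ZMod n) :
    serScale q m (Zf q a z i (serX (WField a) ε)) = Zf q a z i (serX (WField a) ε) := by
  unfold Zf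
  rw [map_prod]
  refine Finset.prod_congr rfl fun s _ => ?_
  rw [map_sub, map_one, map_div₀, algebraMap_cst, serScale_lcst, serScale_X]

theorem serScale_gammaFactor (m : WVar a → ℤ) (ε : Bool) (i l : ZMod n) (y : WField a) :
    serScale q m (gammaFactor q d a _ i l (algebraMap _ _ y) (serX _ ε)) =
      gammaFactor q d a _ i l (algebraMap _ _ (scaleHom q m y)) (serX _ ε) := by
  unfold gammaFactor
  split_ifs
  · simp only [map_div₀, map_mul, map_sub, map_one, map_pow, serScale_C, serScale_lcst, serScale_X]
  · rw [map_mul, map_inv₀, map_sub, map_div₀, map_mul, map_pow, map_one, serScale_C, serScale_lcst,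
      serScale_X]
  · exact map_one _

theorem serScale_gammaSer (ε : Bool) (i : ZMod n) (v : WVar a) (e : ℤ) :
    serScale q (Pi.single v e) (gammaSer q d z ε i) *
        gammaFactor q d a _ i v.1 (algebraMap _ _ (sqrtW v.1 v.2)) (serX _ ε) =
      gammaSer q d z ε i * gammaFactor q d a _ i v.1
        (lcst a _ ((q : ℂ) ^ e) * algebraMap _ _ (sqrtW v.1 v.2)) (serX _ ε) := by
  unfold gammaSer
  rw [gammaFun_eq, map_mul, serScale_Zf, map_prod,
    ← Finset.mul_prod_erase Finset.univ _ (Finset.mem_univ v),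
    ← Finset.mul_prod_erase Finset.univ _ (Finset.mem_univ v)]
  have h1 : ∏ u ∈ Finset.univ.erase v, serScale q (Pi.single v e)
        (gammaFactor q d a _ i u.1 (algebraMap _ _ (sqrtW u.1 u.2)) (serX _ ε)) =
      ∏ u ∈ Finset.univ.erase v,
        gammaFactor q d a _ i u.1 (algebraMap _ _ (sqrtW u.1 u.2)) (serX _ ε) := by
    refine Finset.prod_congr rfl fun u hu => ?_
    rw [serScale_gammaFactor, scaleHom_sqrtW, Pi.single_eq_of_ne (Finset.ne_of_mem_erase hu),
      zpow_zero, cst_one, one_mul]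
  rw [h1, serScale_gammaFactor, scaleHom_sqrtW, Pi.single_eq_same, map_mul, algebraMap_cst]
  ring

theorem serX_sub_lcst_ne_zero (ε : Bool) {c : ℂ} (hc : c ≠ 0) {y : WField a} (hy : y ≠ 0) :
    serX (WField a) ε - lcst a _ c * algebraMap _ _ y ≠ 0 := by
  rw [← algebraMap_cst, ← map_mul]
  exact serX_sub_ne_zero ε (mul_ne_zero (cst_ne_zero hc) hy)

theorem gammaSer_exchange_neg (ε : Bool) (i : ZMod n) (v : WVar a) :
    (lcst a _ ((d : ℂ) ^ mMat i v.1) * serX _ ε -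
        lcst a _ ((q : ℂ) ^ cartan i v.1) * algebraMap _ _ (wv v.1 v.2)) * gammaSer q d z ε i =
      (lcst a _ ((q : ℂ) ^ cartan i v.1 * (d : ℂ) ^ mMat i v.1) * serX _ ε -
        algebraMap _ _ (wv v.1 v.2)) * serScale q (Pi.single v (-1)) (gammaSer q d z ε i) := by
  have h0 := sqrtW_ne_zero v.1 v.2
  have h1 := gammaFactor_ne_zero (q := q) (d := d) ε i v.1 h0
  have h2 := serScale_gammaSer (q := q) (d := d) z ε i v (-1)
  have h3 := gammaFactor_exchange (q := q) (d := d) (a := a) i v.1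
    ((map_ne_zero (algebraMap (WField a) (LaurentSeries (WField a)))).2 h0)
    (serX_ne_zero (K := WField a) ε) (fun e => by
      rw [← map_pow]
      exact serX_sub_lcst_ne_zero ε (zpow_ne_zero e q.ne_zero) (pow_ne_zero 2 h0))
  unfold wv
  rw [map_pow]
  rw [zpow_neg_one] at h2
  refine mul_right_cancel₀ h1 ?_
  linear_combination gammaSer q d z ε i * h3 - (lcst a _ ((q : ℂ) ^ cartan i v.1 * (d : ℂ) ^ mMat i v.1) * serX _ ε -
        (algebraMap _ _ (sqrtW v.1 v.2)) ^ 2) * h2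

theorem gammaSer_exchange_pos (ε : Bool) (i : ZMod n) (v : WVar a) :
    (lcst a _ ((q : ℂ) ^ cartan i v.1 * (d : ℂ) ^ mMat i v.1) * serX _ ε -
        algebraMap _ _ (cst a ((q : ℂ) ^ 2) * wv v.1 v.2)) * gammaSer q d z ε i =
      (lcst a _ ((d : ℂ) ^ mMat i v.1) * serX _ ε -
        lcst a _ ((q : ℂ) ^ cartan i v.1) * algebraMap _ _ (cst a ((q : ℂ) ^ 2) * wv v.1 v.2)) *
        serScale q (Pi.single v 1) (gammaSer q d z ε i) := by
  have h0 := sqrtW_ne_zero v.1 v.2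
  have h1 := gammaFactor_ne_zero (q := q) (d := d) ε i v.1 h0
  have h2 := serScale_gammaSer (q := q) (d := d) z ε i v 1
  have hq0 := cst_ne_zero (a := a) q.ne_zero
  have h3 := gammaFactor_exchange (q := q) (d := d) (a := a) i v.1
    ((map_ne_zero (algebraMap (WField a) (LaurentSeries (WField a)))).2 (mul_ne_zero hq0 h0))
    (serX_ne_zero (K := WField a) ε) (fun e => by
      rw [← map_pow]
      exact serX_sub_lcst_ne_zero ε (zpow_ne_zero e q.ne_zero) (pow_ne_zero 2 (mul_ne_zero hq0 h0)))
  have h4 : lcst a (LaurentSeries (WField a)) (q : ℂ)⁻¹ * algebraMap (WField a) (LaurentSeries (WField a))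
      (cst a (q : ℂ) * sqrtW v.1 v.2) = algebraMap _ _ (sqrtW v.1 v.2) := by
    rw [map_mul, algebraMap_cst, ← mul_assoc, ← map_mul, inv_mul_cancel₀ q.ne_zero, map_one, one_mul]
  rw [h4] at h3
  have h5 : algebraMap (WField a) (LaurentSeries (WField a)) (cst a ((q : ℂ) ^ 2) * wv v.1 v.2) =
      algebraMap (WField a) (LaurentSeries (WField a)) (cst a (q : ℂ) * sqrtW v.1 v.2) ^ 2 := by
    unfold wv
    rw [← map_pow, mul_pow, cst_pow]
  rw [h5]
  rw [zpow_one, ← algebraMap_cst, ← map_mul] at h2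
  refine mul_right_cancel₀ h1 ?_
  linear_combination (-gammaSer q d z ε i) * h3 - (lcst a _ ((d : ℂ) ^ mMat i v.1) * serX _ ε -
        lcst a _ ((q : ℂ) ^ cartan i v.1) *
        (algebraMap (WField a) (LaurentSeries (WField a)) (cst a (q : ℂ) * sqrtW v.1 v.2)) ^ 2) * h2

variable (q d) in
/-- The coefficient of `x^{-p}` in the image of `ψ_i(x)`. -/
def psiCoeff (ε : Bool) (i : ZMod n) (p : ℤ) : WField a := serCoeff ε p (gammaSer q d z ε i)

theorem psiPlusImage_eq (i : ZMod n) (p : ℤ) :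
    psiPlusImage q d a z i p = func q a (psiCoeff q d z true i p) := rfl

theorem psiMinusImage_eq (i : ZMod n) (p : ℤ) :
    psiMinusImage q d a z i p = func q a (psiCoeff q d z false i p) := rfl

theorem serCoeff_linear (ε : Bool) (p : ℤ) (α β : WField a) (F : LaurentSeries (WField a)) :
    serCoeff ε p ((algebraMap _ _ α * serX _ ε - algebraMap _ _ β) * F) =
      α * serCoeff ε (p + 1) F - β * serCoeff ε p F := by
  rw [sub_mul, serCoeff_sub, mul_assoc, serCoeff_C_mul, serCoeff_C_mul, serCoeff_X_mul]

theorem psiCoeff_exchange_neg (ε : Bool) (i : ZMod n) (v : WVar a) (p : ℤ) :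
    cst a ((d : ℂ) ^ mMat i v.1) * psiCoeff q d z ε i (p + 1) -
        cst a ((q : ℂ) ^ cartan i v.1) * wv v.1 v.2 * psiCoeff q d z ε i p =
      cst a ((q : ℂ) ^ cartan i v.1 * (d : ℂ) ^ mMat i v.1) *
        scaleHom q (Pi.single v (-1)) (psiCoeff q d z ε i (p + 1)) -
        wv v.1 v.2 * scaleHom q (Pi.single v (-1)) (psiCoeff q d z ε i p) := by
  have h := congrArg (serCoeff ε p) (gammaSer_exchange_neg (q := q) (d := d) z ε i v)
  rw [← algebraMap_cst, ← algebraMap_cst, ← algebraMap_cst, ← map_mul, serCoeff_linear,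
    serCoeff_linear] at h
  exact h

theorem psiCoeff_exchange_pos (ε : Bool) (i : ZMod n) (v : WVar a) (p : ℤ) :
    cst a ((q : ℂ) ^ cartan i v.1 * (d : ℂ) ^ mMat i v.1) * psiCoeff q d z ε i (p + 1) -
        cst a ((q : ℂ) ^ 2) * wv v.1 v.2 * psiCoeff q d z ε i p =
      cst a ((d : ℂ) ^ mMat i v.1) * scaleHom q (Pi.single v 1) (psiCoeff q d z ε i (p + 1)) -
        cst a ((q : ℂ) ^ cartan i v.1) * (cst a ((q : ℂ) ^ 2) * wv v.1 v.2) *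
          scaleHom q (Pi.single v 1) (psiCoeff q d z ε i p) := by
  have h := congrArg (serCoeff ε p) (gammaSer_exchange_pos (q := q) (d := d) z ε i v)
  rw [← algebraMap_cst, ← algebraMap_cst, ← algebraMap_cst, ← map_mul (algebraMap _ _) (cst a ((q : ℂ) ^ cartan i v.1)),
    serCoeff_linear, serCoeff_linear] at h
  exact h

theorem Leads.factor_lcst (ε : Bool) {S : Subalgebra ℂ (WField a)} {w : WField a} (h0 : w ≠ 0)
    (h : w ∈ S) (h' : w⁻¹ ∈ S) {c : ℂ} (hc : c ≠ 0) :
    Leads S (if ε then 0 else -1) (1 - algebraMap _ (LaurentSeries (WField a)) w /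
      (lcst a _ c * serX _ ε)) ∧
    Leads S (if ε then 0 else 1) (1 - algebraMap _ (LaurentSeries (WField a)) w /
      (lcst a _ c * serX _ ε))⁻¹ := by
  have e : algebraMap _ (LaurentSeries (WField a)) w / (lcst a _ c * serX _ ε) =
      algebraMap _ (LaurentSeries (WField a)) (w * cst a c⁻¹) / serX _ ε := by
    rw [map_mul, algebraMap_cst, map_inv₀, ← div_eq_mul_inv, div_div]
  have h1 := mul_ne_zero h0 (cst_ne_zero (a := a) (inv_ne_zero hc))
  have h2 := mul_mem h (cst_mem S c⁻¹)
  have h3 : (w * cst a c⁻¹)⁻¹ ∈ S := by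
    rw [mul_inv, ← cst_inv, inv_inv]
    exact mul_mem h' (cst_mem S c)
  rw [e]
  exact ⟨.factor ε h1 h2 h3, .factor_inv ε h1 h2 h3⟩

theorem leads_gammaFactor (ε : Bool) (i : ZMod n) (u : WVar a) :
    Leads (fnAlg q a) (if ε then 0 else (if u.1 = i then 2 else 0) +
        (if u.1 ∈ neighbours i then -1 else 0))
      (gammaFactor q d a _ i u.1 (algebraMap _ _ (sqrtW u.1 u.2)) (serX _ ε)) := by
  have h0 := wv_ne_zero u.1 u.2
  have hw := wv_mem (q := q) u.1 u.2
  have hw' := wv_inv_mem (q := q) u.1 u.2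
  have h1 := (Leads.factor_lcst ε h0 hw hw' one_ne_zero).2
  rw [map_one, one_mul] at h1
  have h2 := (Leads.factor_lcst ε h0 hw hw' (zpow_ne_zero (-2) q.ne_zero)).2
  have h3 := fun m : ℤ => (Leads.factor_lcst ε h0 hw hw'
    (mul_ne_zero (inv_ne_zero q.ne_zero) (zpow_ne_zero m d.ne_zero))).1
  have e : algebraMap (WField a) (LaurentSeries (WField a)) (sqrtW u.1 u.2) ^ 2 =
      algebraMap _ _ (wv u.1 u.2) := by unfold wv; rw [map_pow]
  unfold gammaFactor
  rw [e]
  by_cases hi : u.1 = i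
  · have hn : u.1 ∉ neighbours i := by rw [hi]; exact self_notMem_neighbours i
    rw [if_pos hi, if_pos hi, if_neg hn, div_eq_mul_inv, mul_inv]
    have := (Leads.C h0 hw hw').mul (h1.mul h2)
    cases ε <;> exact this
  · rw [if_neg hi, if_neg hi]
    by_cases hn : u.1 ∈ neighbours i
    · rw [if_pos hn, if_pos hn, ← map_inv₀]
      have h4 := (Leads.C (inv_ne_zero (sqrtW_ne_zero u.1 u.2)) (sqrtW_inv_mem (q := q) u.1 u.2)
        (by rw [inv_inv]; exact sqrtW_mem u.1 u.2)).mul (h3 (mMat i u.1))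
      cases ε <;> exact h4
    · rw [if_neg hn, if_neg hn]
      have h4 := Leads.C (S := fnAlg q a) one_ne_zero (one_mem _) (by rw [inv_one]; exact one_mem _)
      rw [map_one] at h4
      cases ε <;> exact h4

theorem leads_Zf (ε : Bool) (i : ZMod n) :
    Leads (fnAlg q a) (if ε then 0 else -(N i : ℤ)) (Zf q a z i (serX (WField a) ε)) := by
  unfold Zf
  have := Leads.prod (S := fnAlg q a) (Finset.univ : Finset (Fin (N i)))
    (e := fun _ => if ε then 0 else -1)
    (F := fun s => 1 - algebraMap (WField a) (LaurentSeries (WField a)) (cst a (q * z i s)) / serX _ ε)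
    (fun s _ => by
      have h0 : (q : ℂ) * z i s ≠ 0 := mul_ne_zero q.ne_zero (z i s).ne_zero
      refine .factor ε (cst_ne_zero h0) (cst_mem _ _) ?_
      rw [← cst_inv]
      exact cst_mem _ _)
  rw [Finset.sum_const, Finset.card_univ, Fintype.card_fin] at this
  cases ε
  · simpa using this
  · simpa using this

theorem leads_gamma {b : ZMod n → ℤ}
    (hN : ∀ i, (N i : ℤ) = b i + 2 * (a i : ℤ) - (a (i - 1) : ℤ) - (a (i + 1) : ℤ)) (ε : Bool)
    (i : ZMod n) : Leads (fnAlg q a) (if ε then 0 else -b i) (gammaSer q d z ε i) := by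
  unfold gammaSer
  rw [gammaFun_eq]
  have h := (leads_Zf (q := q) (a := a) z ε i).mul (Leads.prod Finset.univ
    (fun u _ => leads_gammaFactor (q := q) (d := d) ε i u))
  have e : (if ε then 0 else -(N i : ℤ)) + (∑ u : WVar a, if ε then 0 else
      (if u.1 = i then 2 else 0) + (if u.1 ∈ neighbours i then -1 else 0)) =
      if ε then 0 else -b i := by
    cases ε
    · simp only [Bool.false_eq_true, if_false]
      rw [Fintype.sum_sigma]
      have hl : ∀ l : ZMod n, (∑ _ : Fin (a l), ((if l = i then 2 else 0) +
          (if l ∈ neighbours i then -1 else 0)) : ℤ) = (if l = i then 2 * (a l : ℤ) else 0) +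
          (if l ∈ neighbours i then -(a l : ℤ) else 0) := by
        intro l
        rw [Finset.sum_const, Finset.card_univ, Fintype.card_fin, nsmul_eq_mul]
        split_ifs <;> ring
      simp only [hl]
      rw [Finset.sum_add_distrib, Finset.sum_ite_eq', if_pos (Finset.mem_univ _), Finset.sum_ite_mem, Finset.univ_inter]
      unfold neighbours
      rw [Finset.sum_pair (add_one_ne_sub_one i), hN]
      ring
    · simp
  rwa [e] at h

end Gamma

/-! the commutator of the images of `e` and `f` -/

section Commutator

variable {n : ℕ} [NeZero n] [Fact (3 ≤ n)] (q d : ℂˣ) {a N : ZMod n → ℕ}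
  (z : ∀ i, Fin (N i) → ℂˣ) (o : ZMod n → Bool)

/-- The coefficient of `D_u⁻¹` in the image of `e`, without the power of `w_u`. -/
def eCoef (u : WVar a) : WField a :=
  cst a (-(q : ℂ) / (1 - (q : ℂ) ^ 2)) * (∏ t, wv u.1 t) *
      (∏ j ∈ arrowsInto o u.1, ∏ t : Fin (a j), (sqrtW j t)⁻¹) *
    ((Zf q a z u.1 (wv u.1 u.2) / Wr u.1 u.2 (wv u.1 u.2)) *
        ∏ j ∈ arrowsInto o u.1, Wtw q d (a := a) u.1 j (wv u.1 u.2))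

/-- The coefficient of `D_u` in the image of `f`, without the power of `q² w_u`. -/
def fCoef (u : WVar a) : WField a :=
  cst a (1 / (1 - (q : ℂ) ^ 2)) * (∏ j ∈ arrowsFrom o u.1, ∏ t : Fin (a j), (sqrtW j t)⁻¹) *
    ((1 / Wr u.1 u.2 (wv u.1 u.2)) *
        ∏ j ∈ arrowsFrom o u.1, Wtw q d (a := a) u.1 j (cst a ((q : ℂ) ^ 2) * wv u.1 u.2))

theorem eImage_eq (i : ZMod n) (p : ℤ) : eImage q d a z o i p =
    ∑ r, term q (Pi.single ⟨i, r⟩ (-1)) (eCoef q d z o ⟨i, r⟩ * wv i r ^ p) := by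
  unfold eImage
  rw [Finset.mul_sum]
  refine Finset.sum_congr rfl fun r _ => ?_
  rw [← mul_assoc, ← func_mul]
  unfold term eCoef
  congr 2
  ring

theorem fImage_eq (i : ZMod n) (p : ℤ) : fImage q d a o i p =
    ∑ r, term q (Pi.single ⟨i, r⟩ 1) (fCoef q d o ⟨i, r⟩ * (cst a ((q : ℂ) ^ 2) * wv i r) ^ p) := by
  unfold fImage
  rw [Finset.mul_sum]
  refine Finset.sum_congr rfl fun r _ => ?_
  rw [← mul_assoc, ← func_mul]
  unfold term fCoef
  congr 2
  ring

/-- The dependence of `eCoef u` on the square root of another variable of colour `l`. -/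
def eFactor (u : WVar a) (l : ZMod n) (y : WField a) : WField a :=
  if l = u.1 then y ^ 2 / (1 - y ^ 2 / wv u.1 u.2)
  else if l ∈ arrowsInto o u.1 then
    y⁻¹ * (1 - y ^ 2 / (cst a ((q : ℂ)⁻¹ * (d : ℂ) ^ mMat u.1 l) * wv u.1 u.2))
  else 1

/-- The dependence of `fCoef u` on the square root of another variable of colour `l`. -/
def fFactor (u : WVar a) (l : ZMod n) (y : WField a) : WField a :=
  if l = u.1 then 1 / (1 - y ^ 2 / wv u.1 u.2)
  else if l ∈ arrowsFrom o u.1 then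
    y⁻¹ * (1 - y ^ 2 / (cst a ((q : ℂ)⁻¹ * (d : ℂ) ^ mMat u.1 l) *
      (cst a ((q : ℂ) ^ 2) * wv u.1 u.2)))
  else 1

theorem self_notMem_arrowsInto (i : ZMod n) : i ∉ arrowsInto o i := fun h =>
  ne_of_adj (adj_of_mem_arrowsOf (ε := true) h) rfl

theorem self_notMem_arrowsFrom (i : ZMod n) : i ∉ arrowsFrom o i := fun h =>
  ne_of_adj (adj_of_mem_arrowsOf (ε := false) h) rfl

theorem prod_univ_erase_sigma {M : Type*} [CommMonoid M] (u : WVar a) (s : Finset (ZMod n))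
    (hs : u.1 ∉ s) (f g : WVar a → M) :
    (∏ v ∈ Finset.univ.erase u, if v.1 = u.1 then f v else if v.1 ∈ s then g v else 1) =
      (∏ t ∈ Finset.univ.erase u.2, f ⟨u.1, t⟩) * ∏ j ∈ s, ∏ t : Fin (a j), g ⟨j, t⟩ := by
  set h : WVar a → M := fun v => if v = u then 1 else
    if v.1 = u.1 then f v else if v.1 ∈ s then g v else 1 with hh
  have h1 : (∏ v ∈ Finset.univ.erase u, if v.1 = u.1 then f v else if v.1 ∈ s then g v else 1) =
      ∏ v ∈ Finset.univ.erase u, h v :=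
    Finset.prod_congr rfl fun v hv => (if_neg (Finset.ne_of_mem_erase hv)).symm
  have h2 : ∀ l, ∏ t : Fin (a l), h ⟨l, t⟩ =
      (if l = u.1 then ∏ t ∈ Finset.univ.erase u.2, f ⟨u.1, t⟩ else 1) *
        if l ∈ s then ∏ t : Fin (a l), g ⟨l, t⟩ else 1 := by
    intro l
    by_cases hl : l = u.1
    · obtain ⟨i, r⟩ := u
      subst hl
      rw [if_pos rfl, if_neg hs, mul_one, ← Finset.prod_erase Finset.univ (a := r)]
      · refine Finset.prod_congr rfl fun t ht => ?_
        have : (⟨l, t⟩ : WVar a) ≠ ⟨l, r⟩ := by simpa using Finset.ne_of_mem_erase ht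
        rw [hh]
        simp only [if_neg this, if_true]
      · simp [hh]
    · have hne : ∀ t, (⟨l, t⟩ : WVar a) ≠ u := by rintro t rfl; exact hl rfl
      rw [if_neg hl, one_mul]
      split_ifs with hls
      · exact Finset.prod_congr rfl fun t _ => by simp only [hh, if_neg (hne t), if_neg hl, if_pos hls]
      · exact Finset.prod_eq_one fun t _ => by simp only [hh, if_neg (hne t), if_neg hl, if_neg hls]
  rw [h1, Finset.prod_erase _ (by simp [hh]), Fintype.prod_sigma]
  simp only [h2]
  rw [Finset.prod_mul_distrib, Finset.prod_ite_eq', if_pos (Finset.mem_univ _), Finset.prod_ite_mem,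
    Finset.univ_inter]

theorem eCoef_eq (u : WVar a) : eCoef q d z o u = cst a (-(q : ℂ) / (1 - (q : ℂ) ^ 2)) *
    (wv u.1 u.2 * Zf q a z u.1 (wv u.1 u.2)) *
    ∏ v ∈ Finset.univ.erase u, eFactor q d o u v.1 (sqrtW v.1 v.2) := by
  unfold eFactor
  rw [prod_univ_erase_sigma u _ (self_notMem_arrowsInto o u.1)
    (fun v => sqrtW v.1 v.2 ^ 2 / (1 - sqrtW v.1 v.2 ^ 2 / wv u.1 u.2))
    (fun v => (sqrtW v.1 v.2)⁻¹ * (1 - sqrtW v.1 v.2 ^ 2 /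
      (cst a ((q : ℂ)⁻¹ * (d : ℂ) ^ mMat u.1 v.1) * wv u.1 u.2)))]
  simp only [Finset.prod_mul_distrib, Finset.prod_div_distrib]
  unfold eCoef
  rw [← Finset.mul_prod_erase Finset.univ (fun t => wv u.1 t) (Finset.mem_univ u.2)]
  unfold Wtw Wf Wr wv
  simp only [Algebra.algebraMap_self_apply]
  ring

theorem fCoef_eq (u : WVar a) : fCoef q d o u = cst a (1 / (1 - (q : ℂ) ^ 2)) *
    ∏ v ∈ Finset.univ.erase u, fFactor q d o u v.1 (sqrtW v.1 v.2) := by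
  unfold fFactor
  rw [prod_univ_erase_sigma u _ (self_notMem_arrowsFrom o u.1)
    (fun v => 1 / (1 - sqrtW v.1 v.2 ^ 2 / wv u.1 u.2))
    (fun v => (sqrtW v.1 v.2)⁻¹ * (1 - sqrtW v.1 v.2 ^ 2 /
      (cst a ((q : ℂ)⁻¹ * (d : ℂ) ^ mMat u.1 v.1) * (cst a ((q : ℂ) ^ 2) * wv u.1 u.2))))]
  simp only [Finset.prod_mul_distrib, Finset.prod_div_distrib, Finset.prod_const_one]
  unfold fCoef
  unfold Wtw Wf Wr wv
  simp only [Algebra.algebraMap_self_apply]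
  ring

theorem scale_eFactor (u v : WVar a) (e : ℤ) (h : v ≠ u) (l : ZMod n) (y : WField a) :
    scaleHom q (Pi.single v e) (eFactor q d o u l y) =
      eFactor q d o u l (scaleHom q (Pi.single v e) y) := by
  have h1 : scaleHom q (Pi.single v e) (wv u.1 u.2) = wv u.1 u.2 := by
    rw [scaleHom_wv, Pi.single_eq_of_ne h.symm, mul_zero, zpow_zero, cst_one, one_mul]
  unfold eFactor
  split_ifs
  · rw [map_div₀, map_sub, map_div₀, map_one, map_pow, h1]
  · rw [map_mul, map_sub, map_div₀, map_one, map_pow, map_mul, map_inv₀, h1, scaleHom_cst]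
  · exact map_one _

theorem scale_fFactor (u v : WVar a) (e : ℤ) (h : v ≠ u) (l : ZMod n) (y : WField a) :
    scaleHom q (Pi.single v e) (fFactor q d o u l y) =
      fFactor q d o u l (scaleHom q (Pi.single v e) y) := by
  have h1 : scaleHom q (Pi.single v e) (wv u.1 u.2) = wv u.1 u.2 := by
    rw [scaleHom_wv, Pi.single_eq_of_ne h.symm, mul_zero, zpow_zero, cst_one, one_mul]
  unfold fFactor
  split_ifs
  · rw [map_div₀, map_sub, map_div₀, map_one, map_pow, h1]
  · rw [map_mul, map_sub, map_div₀, map_one, map_pow, map_mul, map_mul, map_inv₀, h1, scaleHom_cst,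
      scaleHom_cst]
  · exact map_one _

theorem scale_Zf (m : WVar a → ℤ) (i : ZMod n) (x : WField a) :
    scaleHom q m (Zf q a z i x) = Zf q a z i (scaleHom q m x) := by
  unfold Zf
  simp only [Algebra.algebraMap_self_apply, map_prod, map_sub, map_div₀, map_one, scaleHom_cst]

theorem scale_eCoef (u v : WVar a) (e : ℤ) (h : v ≠ u) :
    scaleHom q (Pi.single v e) (eCoef q d z o u) * eFactor q d o u v.1 (sqrtW v.1 v.2) =
      eCoef q d z o u * eFactor q d o u v.1 (cst a ((q : ℂ) ^ e) * sqrtW v.1 v.2) := by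
  have h1 : scaleHom q (Pi.single v e) (wv u.1 u.2) = wv u.1 u.2 := by
    rw [scaleHom_wv, Pi.single_eq_of_ne h.symm, mul_zero, zpow_zero, cst_one, one_mul]
  have hv : v ∈ Finset.univ.erase u := Finset.mem_erase.2 ⟨h, Finset.mem_univ _⟩
  rw [eCoef_eq, ← Finset.mul_prod_erase _ _ hv]
  simp only [map_mul, map_prod, scaleHom_cst, h1, scale_Zf, scale_eFactor q d o u v e h,
    scaleHom_sqrtW]
  have h2 : ∏ x ∈ (Finset.univ.erase u).erase v, eFactor q d o u x.1
      (cst a ((q : ℂ) ^ (Pi.single v e : WVar a → ℤ) ⟨x.1, x.2⟩) * sqrtW x.1 x.2) =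
      ∏ x ∈ (Finset.univ.erase u).erase v, eFactor q d o u x.1 (sqrtW x.1 x.2) := by
    refine Finset.prod_congr rfl fun x hx => ?_
    rw [Pi.single_eq_of_ne (Finset.ne_of_mem_erase hx), zpow_zero, cst_one, one_mul]
  rw [h2, Pi.single_eq_same]
  ring

theorem scale_fCoef (u v : WVar a) (e : ℤ) (h : v ≠ u) :
    scaleHom q (Pi.single v e) (fCoef q d o u) * fFactor q d o u v.1 (sqrtW v.1 v.2) =
      fCoef q d o u * fFactor q d o u v.1 (cst a ((q : ℂ) ^ e) * sqrtW v.1 v.2) := by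
  have hv : v ∈ Finset.univ.erase u := Finset.mem_erase.2 ⟨h, Finset.mem_univ _⟩
  rw [fCoef_eq, ← Finset.mul_prod_erase _ _ hv]
  simp only [map_mul, map_prod, scaleHom_cst, scale_fFactor q d o u v e h, scaleHom_sqrtW]
  have h2 : ∏ x ∈ (Finset.univ.erase u).erase v, fFactor q d o u x.1
      (cst a ((q : ℂ) ^ (Pi.single v e : WVar a → ℤ) ⟨x.1, x.2⟩) * sqrtW x.1 x.2) =
      ∏ x ∈ (Finset.univ.erase u).erase v, fFactor q d o u x.1 (sqrtW x.1 x.2) := by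
    refine Finset.prod_congr rfl fun x hx => ?_
    rw [Pi.single_eq_of_ne (Finset.ne_of_mem_erase hx), zpow_zero, cst_one, one_mul]
  rw [h2, Pi.single_eq_same]
  ring

variable {q d} in
theorem cst_mul_wv_sub_ne_zero {c c' : ℂ} (hc : c ≠ 0) {u v : WVar a} (h : u ≠ v) :
    cst a c * wv u.1 u.2 - cst a c' * wv v.1 v.2 ≠ 0 := fun h' =>
  h (cst_mul_wv_inj hc (sub_eq_zero.1 h')).1

theorem eFactor_fFactor (u v : WVar a) (h : u ≠ v) :
    eFactor q d o u v.1 (sqrtW v.1 v.2) ≠ 0 ∧ fFactor q d o v u.1 (sqrtW u.1 u.2) ≠ 0 ∧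
    eFactor q d o u v.1 (cst a (q : ℂ) * sqrtW v.1 v.2) * fFactor q d o v u.1 (sqrtW u.1 u.2) =
      eFactor q d o u v.1 (sqrtW v.1 v.2) *
        fFactor q d o v u.1 (cst a (q : ℂ)⁻¹ * sqrtW u.1 u.2) := by
  have hq := cst_ne_zero (a := a) q.ne_zero
  have hd := cst_ne_zero (a := a) d.ne_zero
  have hu := sqrtW_ne_zero u.1 u.2
  have hv := sqrtW_ne_zero v.1 v.2
  have key : ∀ c c' : ℂ, c ≠ 0 →
      cst a c * sqrtW u.1 u.2 ^ 2 - cst a c' * sqrtW v.1 v.2 ^ 2 ≠ 0 := fun c c' hc =>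
    cst_mul_wv_sub_ne_zero hc h
  unfold eFactor fFactor wv
  by_cases hc : v.1 = u.1
  · rw [if_pos hc, if_pos hc, if_pos hc.symm, if_pos hc.symm]
    have k1 := key 1 1 one_ne_zero
    have k2 := key 1 (q ^ 2) one_ne_zero
    have k1' : sqrtW v.1 v.2 ^ 2 - sqrtW u.1 u.2 ^ 2 ≠ 0 := by
      rw [cst_one, one_mul, one_mul] at k1
      intro h'; apply k1; rw [← neg_eq_zero, neg_sub, h']
    have k2' : cst a (q : ℂ) ^ 2 * sqrtW v.1 v.2 ^ 2 - sqrtW u.1 u.2 ^ 2 ≠ 0 := by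
      rw [cst_one, one_mul, cst_pow] at k2
      intro h'; apply k2; rw [← neg_eq_zero, neg_sub, h']
    rw [cst_one, one_mul, one_mul] at k1
    rw [cst_one, one_mul, cst_pow] at k2
    refine ⟨?_, ?_, ?_⟩
    · refine div_ne_zero (pow_ne_zero 2 hv) ?_
      intro h'; apply k1
      field_simp at h'
      rwa [mul_zero] at h'
    · refine div_ne_zero one_ne_zero ?_
      intro h'; apply k1'
      field_simp at h'
      rwa [mul_zero] at h'
    · rw [cst_inv]
      have e1 : 1 - sqrtW v.1 v.2 ^ 2 / sqrtW u.1 u.2 ^ 2 =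
        (sqrtW u.1 u.2 ^ 2 - sqrtW v.1 v.2 ^ 2) / sqrtW u.1 u.2 ^ 2 := by field_simp
      have e2 : 1 - (cst a (q : ℂ) * sqrtW v.1 v.2) ^ 2 / sqrtW u.1 u.2 ^ 2 =
        (sqrtW u.1 u.2 ^ 2 - cst a (q : ℂ) ^ 2 * sqrtW v.1 v.2 ^ 2) / sqrtW u.1 u.2 ^ 2 := by
        field_simp
      have e3 : 1 - sqrtW u.1 u.2 ^ 2 / sqrtW v.1 v.2 ^ 2 =
        -(sqrtW u.1 u.2 ^ 2 - sqrtW v.1 v.2 ^ 2) / sqrtW v.1 v.2 ^ 2 := by field_simp; ring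
      have e4 : 1 - ((cst a (q : ℂ))⁻¹ * sqrtW u.1 u.2) ^ 2 / sqrtW v.1 v.2 ^ 2 =
        -(sqrtW u.1 u.2 ^ 2 - cst a (q : ℂ) ^ 2 * sqrtW v.1 v.2 ^ 2) /
          (cst a (q : ℂ) ^ 2 * sqrtW v.1 v.2 ^ 2) := by field_simp; ring
      rw [e1, e2, e3, e4]
      field_simp
  · rw [if_neg hc, if_neg hc, if_neg (Ne.symm hc), if_neg (Ne.symm hc)]
    by_cases hv' : v.1 ∈ arrowsInto o u.1
    · have hu' : u.1 ∈ arrowsFrom o v.1 := mem_arrowsFrom.2 hv'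
      rw [if_pos hv', if_pos hv', if_pos hu', if_pos hu',
        mMat_adj (adj_of_mem_arrowsOf (ε := true) hv')]
      set m := mMat u.1 v.1
      have k1 := key ((q : ℂ)⁻¹ * (d : ℂ) ^ m) 1 (mul_ne_zero (inv_ne_zero q.ne_zero)
        (zpow_ne_zero _ d.ne_zero))
      rw [cst_one, one_mul, cst_mul, cst_inv, cst_zpow] at k1
      simp only [zpow_neg, cst_mul, cst_inv, cst_zpow, cst_pow]
      have hM := zpow_ne_zero m hd
      set M := cst a (d : ℂ) ^ m
      refine ⟨?_, ?_, ?_⟩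
      · refine mul_ne_zero (inv_ne_zero hv) ?_
        intro h'
        apply k1
        have : (cst a (q : ℂ))⁻¹ * M * sqrtW u.1 u.2 ^ 2 - sqrtW v.1 v.2 ^ 2 =
          ((cst a (q : ℂ))⁻¹ * M * sqrtW u.1 u.2 ^ 2) *
            (1 - sqrtW v.1 v.2 ^ 2 / ((cst a (q : ℂ))⁻¹ * M * sqrtW u.1 u.2 ^ 2)) := by
          field_simp
        rw [this, h', mul_zero]
      · refine mul_ne_zero (inv_ne_zero hu) ?_
        intro h'
        apply k1
        have : (cst a (q : ℂ))⁻¹ * M * sqrtW u.1 u.2 ^ 2 - sqrtW v.1 v.2 ^ 2 =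
          -sqrtW v.1 v.2 ^ 2 * (1 - sqrtW u.1 u.2 ^ 2 /
            ((cst a (q : ℂ))⁻¹ * M⁻¹ * (cst a (q : ℂ) ^ 2 * sqrtW v.1 v.2 ^ 2))) := by
          field_simp
          ring
        rw [this, h', mul_zero]
      · field_simp
        ring
    · have hu' : u.1 ∉ arrowsFrom o v.1 := fun h => hv' (mem_arrowsFrom.1 h)
      rw [if_neg hv', if_neg hv', if_neg hu', if_neg hu']
      exact ⟨one_ne_zero, one_ne_zero, rfl⟩

theorem eCoef_fCoef_comm (u v : WVar a) (h : u ≠ v) :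
    eCoef q d z o u * scaleHom q (Pi.single u (-1)) (fCoef q d o v) =
      fCoef q d o v * scaleHom q (Pi.single v 1) (eCoef q d z o u) := by
  obtain ⟨h1, h2, h3⟩ := eFactor_fFactor q d o u v h
  have h4 := scale_eCoef q d z o u v 1 h.symm
  have h5 := scale_fCoef q d o v u (-1) h
  rw [zpow_one] at h4
  rw [zpow_neg_one] at h5
  refine mul_right_cancel₀ (mul_ne_zero h1 h2) ?_
  linear_combination eCoef q d z o u * eFactor q d o u v.1 (sqrtW v.1 v.2) * h5
    - fCoef q d o v * fFactor q d o v u.1 (sqrtW u.1 u.2) * h4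
    - eCoef q d z o u * fCoef q d o v * h3

end Commutator

/-! the relations between the images of `e`, `f` and `ψ` -/

section Residues

variable {n : ℕ} [NeZero n] [Fact (3 ≤ n)] (q d : ℂˣ) {a N : ZMod n → ℕ}
  (z : ∀ i, Fin (N i) → ℂˣ) (o : ZMod n → Bool)

/-- The numerator of the image of `ψ_i(x)`, as a polynomial in `x⁻¹`. -/
def gammaNum (i : ZMod n) : Polynomial (WField a) :=
  Polynomial.C ((∏ t, wv i t) * ∏ j ∈ neighbours i, ∏ t : Fin (a j), (sqrtW j t)⁻¹) *
    ((∏ s, (1 - Polynomial.C (cst a (q * z i s)) * Polynomial.X)) *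
      ∏ j ∈ neighbours i, ∏ t : Fin (a j),
        (1 - Polynomial.C (wv j t / cst a ((q : ℂ)⁻¹ * (d : ℂ) ^ mMat i j)) * Polynomial.X))

/-- The poles of the image of `ψ_i(x)`. -/
def gammaPole (i : ZMod n) (b : Fin (a i) × Bool) : WField a :=
  cst a (if b.2 then (q : ℂ) ^ 2 else 1) * wv i b.1

theorem cst_sub_cst (x y : ℂ) : cst a x - cst a y = cst a (x - y) := (map_sub _ _ _).symm

theorem neg_cst (x : ℂ) : -cst a x = cst a (-x) := (map_neg (algebraMap ℂ (WField a)) x).symm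

theorem aeval_gammaNum {L : Type} [Field L] [Algebra (WField a) L] (i : ZMod n) (x : L) :
    Polynomial.aeval x⁻¹ (gammaNum (a := a) q d z i) =
    algebraMap (WField a) L
      ((∏ t, wv i t) * ∏ j ∈ neighbours i, ∏ t : Fin (a j), (sqrtW j t)⁻¹) *
      (Zf q a z i x * ∏ j ∈ neighbours i, Wtw q d (a := a) i j x) := by
  have h1 : ∀ j : ZMod n, ∏ t : Fin (a j), (1 - algebraMap (WField a) L (wv j t /
      cst a ((q : ℂ)⁻¹ * (d : ℂ) ^ mMat i j)) * x⁻¹) = Wtw q d (a := a) i j x := fun j => by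
    unfold Wtw Wf
    refine Finset.prod_congr rfl fun t _ => ?_
    rw [map_div₀, ← div_eq_mul_inv, div_div]
  have h2 : ∏ s, (1 - algebraMap (WField a) L (cst a (q * z i s)) * x⁻¹) = Zf q a z i x :=
    Finset.prod_congr rfl fun t _ => by rw [← div_eq_mul_inv]
  rw [← h2, ← Finset.prod_congr rfl fun j _ => h1 j]
  unfold gammaNum
  generalize (∏ t, wv i t) * ∏ j ∈ neighbours i, ∏ t : Fin (a j), (sqrtW j t)⁻¹ = C
  simp only [map_mul, map_prod, map_sub, map_one, Polynomial.aeval_C, Polynomial.aeval_X]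

theorem eval_gammaNum (i : ZMod n) (x : WField a) :
    Polynomial.eval x⁻¹ (gammaNum (a := a) q d z i) =
      ((∏ t, wv i t) * ∏ j ∈ neighbours i, ∏ t : Fin (a j), (sqrtW j t)⁻¹) *
      (Zf q a z i x * ∏ j ∈ neighbours i, Wtw q d (a := a) i j x) := by
  have := aeval_gammaNum (a := a) q d z i x
  rwa [Polynomial.coe_aeval_eq_eval] at this

theorem gammaSer_eq (ε : Bool) (i : ZMod n) : gammaSer q d z ε i =
    Polynomial.aeval (serX (WField a) ε)⁻¹ (gammaNum (a := a) q d z i) /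
      ∏ b : Fin (a i) × Bool, (1 - algebraMap _ _ (gammaPole q i b) / serX (WField a) ε) := by
  have h : ∏ b : Fin (a i) × Bool, (1 - algebraMap _ (LaurentSeries (WField a)) (gammaPole q i b) /
      serX (WField a) ε) = Wf (a := a) i (serX (WField a) ε) *
        Wf (a := a) i (algebraMap (WField a) _ (cst a ((q : ℂ) ^ (-2 : ℤ))) * serX (WField a) ε) := by
    rw [Fintype.prod_prod_type]
    unfold Wf gammaPole
    rw [← Finset.prod_mul_distrib]
    refine Finset.prod_congr rfl fun t _ => ?_
    rw [Fintype.prod_bool, mul_comm, if_pos rfl, if_neg Bool.false_ne_true, cst_one, one_mul,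
      zpow_neg, cst_inv, map_inv₀, map_mul, ← div_div, div_inv_eq_mul,
      mul_comm (algebraMap (WField a) (LaurentSeries (WField a)) (wv i t)), zpow_ofNat]
  rw [aeval_gammaNum, h]
  unfold gammaSer gammaFun
  ring

theorem gammaPole_injective (hq2 : (q : ℂ) ^ 2 ≠ 1) (i : ZMod n) :
    Function.Injective (gammaPole (a := a) q i) := by
  rintro ⟨t, β⟩ ⟨t', β'⟩ h
  unfold gammaPole at h
  obtain ⟨h1, h2⟩ := cst_mul_wv_inj (v := ⟨i, t⟩) (v' := ⟨i, t'⟩)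
    (by split_ifs <;> simp) h
  have h3 : t = t' := by simpa using h1
  rw [Prod.mk.injEq]
  refine ⟨h3, ?_⟩
  cases β <;> cases β' <;> simp_all [eq_comm]

theorem gammaPole_ne_zero (i : ZMod n) (b : Fin (a i) × Bool) : gammaPole q i b ≠ 0 :=
  mul_ne_zero (cst_ne_zero (by split_ifs <;> simp)) (wv_ne_zero _ _)

theorem psiCoeff_sub (hq2 : (q : ℂ) ^ 2 ≠ 1) (i : ZMod n) (p : ℤ) :
    psiCoeff (a := a) q d z true i p - psiCoeff q d z false i p =
      ∑ b : Fin (a i) × Bool, Polynomial.eval (gammaPole q i b)⁻¹ (gammaNum (a := a) q d z i) /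
        (∏ b' ∈ Finset.univ.erase b, (1 - gammaPole q i b' / gammaPole q i b)) *
          gammaPole q i b ^ p := by
  unfold psiCoeff
  rw [gammaSer_eq, gammaSer_eq]
  exact serCoeff_sub_serCoeff _ _ _ (gammaPole_injective q hq2 i).injOn
    (fun b _ => gammaPole_ne_zero q i b) p

theorem prod_erase_prod_bool {ι M : Type*} [Fintype ι] [DecidableEq ι] [CommMonoid M]
    (f : ι × Bool → M) (t : ι) (β : Bool) : ∏ b ∈ Finset.univ.erase (t, β), f b =
      f (t, !β) * ((∏ s ∈ Finset.univ.erase t, f (s, false)) *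
        ∏ s ∈ Finset.univ.erase t, f (s, true)) := by
  set g : ι × Bool → M := fun b => if b = (t, β) then 1 else f b with hg
  have h1 : ∏ b ∈ Finset.univ.erase (t, β), f b = ∏ b ∈ Finset.univ.erase (t, β), g b :=
    Finset.prod_congr rfl fun b hb => (if_neg (Finset.ne_of_mem_erase hb)).symm
  rw [h1, Finset.prod_erase _ (by simp [hg]), Fintype.prod_prod_type,
    ← Finset.mul_prod_erase Finset.univ _ (Finset.mem_univ t), ← Finset.prod_mul_distrib]
  congr 1
  · rw [Fintype.prod_bool]
    cases β <;> simp [hg]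
  · refine Finset.prod_congr rfl fun s hs => ?_
    have := Finset.ne_of_mem_erase hs
    rw [Fintype.prod_bool, mul_comm]
    simp [hg, this]

theorem scale_Wr (i : ZMod n) (r : Fin (a i)) (e : ℤ) (x : WField a) :
    scaleHom q (Pi.single ⟨i, r⟩ e) (Wr i r x) = Wr i r (scaleHom q (Pi.single ⟨i, r⟩ e) x) := by
  unfold Wr
  simp only [Algebra.algebraMap_self_apply, map_prod, map_sub, map_div₀, map_one, scaleHom_wv]
  refine Finset.prod_congr rfl fun t ht => ?_
  have : (⟨i, t⟩ : WVar a) ≠ ⟨i, r⟩ := by simpa using Finset.ne_of_mem_erase ht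
  rw [Pi.single_eq_of_ne this, mul_zero, zpow_zero, cst_one, one_mul]

theorem scale_Wtw (u : WVar a) (e : ℤ) {i j : ZMod n} (hj : j ≠ u.1) (x : WField a) :
    scaleHom q (Pi.single u e) (Wtw q d (a := a) i j x) =
      Wtw q d (a := a) i j (scaleHom q (Pi.single u e) x) := by
  unfold Wtw Wf
  simp only [Algebra.algebraMap_self_apply, map_prod, map_sub, map_div₀, map_one, map_mul,
    scaleHom_wv, scaleHom_cst]
  refine Finset.prod_congr rfl fun t _ => ?_
  have : (⟨j, t⟩ : WVar a) ≠ u := by rintro rfl; exact hj rfl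
  rw [Pi.single_eq_of_ne this, mul_zero, zpow_zero, cst_one, one_mul]

theorem scale_sqrt_prod (u : WVar a) (e : ℤ) (s : Finset (ZMod n)) (hs : u.1 ∉ s) :
    scaleHom q (Pi.single u e) (∏ j ∈ s, ∏ t : Fin (a j), (sqrtW j t)⁻¹) =
      ∏ j ∈ s, ∏ t : Fin (a j), (sqrtW j t)⁻¹ := by
  simp only [map_prod, map_inv₀, scaleHom_sqrtW]
  refine Finset.prod_congr rfl fun j hj => Finset.prod_congr rfl fun t _ => ?_
  have : (⟨j, t⟩ : WVar a) ≠ u := by rintro rfl; exact hs hj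
  rw [Pi.single_eq_of_ne this, zpow_zero, cst_one, one_mul]

theorem scale_wv_prod (i : ZMod n) (r : Fin (a i)) (e : ℤ) :
    scaleHom q (Pi.single ⟨i, r⟩ e) (∏ t, wv i t) = cst a ((q : ℂ) ^ (2 * e)) * ∏ t, wv i t := by
  rw [← Finset.mul_prod_erase Finset.univ _ (Finset.mem_univ r), map_mul, map_prod, scaleHom_wv,
    Pi.single_eq_same, mul_assoc]
  congr 2
  refine Finset.prod_congr rfl fun t ht => ?_
  have : (⟨i, t⟩ : WVar a) ≠ ⟨i, r⟩ := by simpa using Finset.ne_of_mem_erase ht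
  rw [scaleHom_wv, Pi.single_eq_of_ne this, mul_zero, zpow_zero, cst_one, one_mul]

theorem prod_neighbours {M : Type*} [CommMonoid M] (i : ZMod n) (g : ZMod n → M) :
    ∏ j ∈ neighbours i, g j = (∏ j ∈ arrowsInto o i, g j) * ∏ j ∈ arrowsFrom o i, g j := by
  have hd : Disjoint (arrowsInto o i) (arrowsFrom o i) := by
    rw [Finset.disjoint_left]
    intro j h1 h2
    exact (arrowsOf_xor (ε := true) (adj_of_mem_arrowsOf (ε := true) h1)).1 h1 (mem_arrowsFrom.1 h2)
  rw [← Finset.prod_union hd]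
  refine Finset.prod_congr ?_ fun _ _ => rfl
  ext j
  rw [mem_neighbours, Finset.mem_union]
  constructor
  · intro h
    by_cases h1 : j ∈ arrowsInto o i
    · exact Or.inl h1
    · refine Or.inr (mem_arrowsFrom.2 ?_)
      by_contra h2
      exact h1 ((arrowsOf_xor (ε := true) (o := o) h).2 h2)
  · rintro (h | h)
    · exact adj_of_mem_arrowsOf (ε := true) h
    · exact adj_of_mem_arrowsOf (ε := false) h

theorem scale_Wtw_prod (u : WVar a) (e : ℤ) (s : Finset (ZMod n)) (hs : u.1 ∉ s) (x : WField a) :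
    scaleHom q (Pi.single u e) (∏ j ∈ s, Wtw q d (a := a) u.1 j x) =
      ∏ j ∈ s, Wtw q d (a := a) u.1 j (scaleHom q (Pi.single u e) x) := by
  rw [map_prod]
  exact Finset.prod_congr rfl fun j hj => scale_Wtw q d u e (by rintro rfl; exact hs hj) x

theorem cst_two_mul_cst_neg_two (x : WField a) : cst a ((q : ℂ) ^ 2) *
    (cst a ((q : ℂ) ^ (2 * (-1) : ℤ)) * x) = x := by
  rw [← mul_assoc, ← cst_mul, ← zpow_natCast, ← zpow_add₀ q.ne_zero]
  simp [cst_one]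

theorem eCoef_fCoef_diag (hq2 : (q : ℂ) ^ 2 ≠ 1) (i : ZMod n) (t : Fin (a i)) :
    eCoef q d z o ⟨i, t⟩ * scaleHom q (Pi.single ⟨i, t⟩ (-1)) (fCoef q d o ⟨i, t⟩) =
      cst a ((q : ℂ) - (q : ℂ)⁻¹)⁻¹ *
      (Polynomial.eval (gammaPole q i (t, false))⁻¹ (gammaNum (a := a) q d z i) /
        (∏ b' ∈ Finset.univ.erase (t, false), (1 - gammaPole q i b' / gammaPole q i (t, false)))) := by
  have hw := wv_ne_zero i t
  have hp : gammaPole q i (t, false) = wv i t := by simp [gammaPole, cst_one]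
  have h1 : ∏ s ∈ Finset.univ.erase t, (1 - gammaPole q i (s, true) / wv i t) =
      Wr i t (cst a ((q : ℂ) ^ (2 * (-1) : ℤ)) * wv i t) := by
    unfold Wr gammaPole
    refine Finset.prod_congr rfl fun s _ => ?_
    rw [if_pos rfl, Algebra.algebraMap_self_apply, mul_neg_one, zpow_neg, cst_inv, ← div_div,
      div_inv_eq_mul, mul_comm]
    rfl
  have h2 : ∏ s ∈ Finset.univ.erase t, (1 - gammaPole q i (s, false) / wv i t) =
      Wr i t (wv i t) := by
    unfold Wr gammaPole
    refine Finset.prod_congr rfl fun s _ => ?_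
    rw [Algebra.algebraMap_self_apply]
    simp [cst_one]
  have h3 : gammaPole q i (t, true) / wv i t = cst a ((q : ℂ) ^ 2) := by
    simp [gammaPole, hw]
  rw [hp, prod_erase_prod_bool, Bool.not_false, h1, h2, h3, eval_gammaNum, prod_neighbours o,
    prod_neighbours o]
  unfold eCoef fCoef
  simp only [map_mul, map_div₀, map_one, scaleHom_cst, scale_Wr, scaleHom_wv, Pi.single_eq_same]
  rw [scale_sqrt_prod q ⟨i, t⟩ _ _ (self_notMem_arrowsFrom o i),
    scale_Wtw_prod q d ⟨i, t⟩ _ _ (self_notMem_arrowsFrom o i)]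
  simp only [map_mul, scaleHom_cst, scaleHom_wv, Pi.single_eq_same, cst_two_mul_cst_neg_two]
  have hc : cst a (-(q : ℂ) / (1 - (q : ℂ) ^ 2)) * cst a (1 / (1 - (q : ℂ) ^ 2)) =
      cst a ((q : ℂ) - (q : ℂ)⁻¹)⁻¹ * (1 - cst a ((q : ℂ) ^ 2))⁻¹ := by
    rw [← cst_one (a := a), cst_sub_cst, ← cst_mul, ← cst_inv, ← cst_mul]
    congr 1
    have hq0 := q.ne_zero
    have e1 : 1 - (q : ℂ) ^ 2 ≠ 0 := sub_ne_zero.2 hq2.symm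
    have e2 : (q : ℂ) - (q : ℂ)⁻¹ ≠ 0 := by
      intro h; apply hq2
      field_simp at h
      linear_combination h
    have e3 : (q : ℂ) - (q : ℂ)⁻¹ = -(1 - (q : ℂ) ^ 2) / q := by field_simp; ring
    rw [e3]
    field_simp
  generalize (1 - cst a ((q : ℂ) ^ 2)) = Q at *
  generalize cst a (-(q : ℂ) / (1 - (q : ℂ) ^ 2)) = c1 at *
  generalize cst a (1 / (1 - (q : ℂ) ^ 2)) = c2 at *
  generalize cst a ((q : ℂ) - (q : ℂ)⁻¹)⁻¹ = c3 at *
  simp only [div_eq_mul_inv, mul_inv, one_mul]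
  linear_combination ((∏ t, wv i t) * (∏ j ∈ arrowsInto o i, ∏ t : Fin (a j), (sqrtW j t)⁻¹) *
    (∏ j ∈ arrowsFrom o i, ∏ t : Fin (a j), (sqrtW j t)⁻¹) * Zf q a z i (wv i t) *
    (∏ j ∈ arrowsInto o i, Wtw q d (a := a) i j (wv i t)) *
    (∏ j ∈ arrowsFrom o i, Wtw q d (a := a) i j (wv i t)) * (Wr i t (wv i t))⁻¹ *
    (Wr i t (cst a ((q : ℂ) ^ (2 * (-1) : ℤ)) * wv i t))⁻¹) * hc

theorem fCoef_eCoef_diag (hq2 : (q : ℂ) ^ 2 ≠ 1) (i : ZMod n) (t : Fin (a i)) :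
    fCoef q d o ⟨i, t⟩ * scaleHom q (Pi.single ⟨i, t⟩ 1) (eCoef q d z o ⟨i, t⟩) =
      -cst a ((q : ℂ) - (q : ℂ)⁻¹)⁻¹ *
      (Polynomial.eval (gammaPole q i (t, true))⁻¹ (gammaNum (a := a) q d z i) /
        (∏ b' ∈ Finset.univ.erase (t, true), (1 - gammaPole q i b' / gammaPole q i (t, true)))) := by
  have hw := wv_ne_zero i t
  have hq2' := cst_ne_zero (a := a) (pow_ne_zero 2 q.ne_zero)
  have hp : gammaPole q i (t, true) = cst a ((q : ℂ) ^ 2) * wv i t := by simp [gammaPole]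
  have h1 : ∏ s ∈ Finset.univ.erase t, (1 - gammaPole q i (s, true) / (cst a ((q : ℂ) ^ 2) * wv i t)) =
      Wr i t (wv i t) := by
    unfold Wr gammaPole
    refine Finset.prod_congr rfl fun s _ => ?_
    rw [if_pos rfl, Algebra.algebraMap_self_apply, mul_div_mul_left _ _ hq2']
  have h2 : ∏ s ∈ Finset.univ.erase t, (1 - gammaPole q i (s, false) / (cst a ((q : ℂ) ^ 2) * wv i t)) =
      Wr i t (cst a ((q : ℂ) ^ 2) * wv i t) := by
    unfold Wr gammaPole
    refine Finset.prod_congr rfl fun s _ => ?_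
    rw [Algebra.algebraMap_self_apply]
    simp [cst_one]
  have h3 : gammaPole q i (t, false) / (cst a ((q : ℂ) ^ 2) * wv i t) = (cst a ((q : ℂ) ^ 2))⁻¹ := by
    simp only [gammaPole, Bool.false_eq_true, if_false, cst_one, one_mul]
    field_simp
  have e2 : cst a ((q : ℂ) ^ (2 * 1 : ℤ)) = cst a ((q : ℂ) ^ 2) := by
    rw [mul_one, ← zpow_natCast]; rfl
  rw [hp, prod_erase_prod_bool, Bool.not_true, h1, h2, h3, eval_gammaNum, prod_neighbours o,
    prod_neighbours o]
  unfold eCoef fCoef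
  simp only [map_mul, map_div₀, scaleHom_cst, scale_Wr, scaleHom_wv, Pi.single_eq_same, scale_Zf,
    scale_wv_prod, e2]
  rw [scale_sqrt_prod q ⟨i, t⟩ _ _ (self_notMem_arrowsInto o i),
    scale_Wtw_prod q d ⟨i, t⟩ _ _ (self_notMem_arrowsInto o i)]
  simp only [scaleHom_wv, Pi.single_eq_same, e2]
  have hc : cst a (1 / (1 - (q : ℂ) ^ 2)) * (cst a (-(q : ℂ) / (1 - (q : ℂ) ^ 2)) *
      cst a ((q : ℂ) ^ 2)) =
      -cst a ((q : ℂ) - (q : ℂ)⁻¹)⁻¹ * (1 - (cst a ((q : ℂ) ^ 2))⁻¹)⁻¹ := by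
    rw [← cst_inv, ← cst_one (a := a), cst_sub_cst, ← cst_mul, ← cst_mul, ← cst_inv, neg_mul,
      ← cst_mul, neg_cst]
    congr 1
    have hq0 := q.ne_zero
    have e1 : 1 - (q : ℂ) ^ 2 ≠ 0 := sub_ne_zero.2 hq2.symm
    have e3 : (q : ℂ) - (q : ℂ)⁻¹ = -(1 - (q : ℂ) ^ 2) / q := by field_simp; ring
    have e4 : 1 - ((q : ℂ) ^ 2)⁻¹ = -(1 - (q : ℂ) ^ 2) / q ^ 2 := by field_simp; ring
    rw [e3, e4]
    field_simp
  generalize (1 - (cst a ((q : ℂ) ^ 2))⁻¹) = Q at *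
  generalize cst a (-(q : ℂ) / (1 - (q : ℂ) ^ 2)) = c1 at *
  generalize cst a (1 / (1 - (q : ℂ) ^ 2)) = c2 at *
  generalize cst a ((q : ℂ) - (q : ℂ)⁻¹)⁻¹ = c3 at *
  simp only [div_eq_mul_inv, mul_inv, one_mul]
  linear_combination ((∏ t, wv i t) * (∏ j ∈ arrowsInto o i, ∏ t : Fin (a j), (sqrtW j t)⁻¹) *
    (∏ j ∈ arrowsFrom o i, ∏ t : Fin (a j), (sqrtW j t)⁻¹) *
    Zf q a z i (cst a ((q : ℂ) ^ 2) * wv i t) *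
    (∏ j ∈ arrowsInto o i, Wtw q d (a := a) i j (cst a ((q : ℂ) ^ 2) * wv i t)) *
    (∏ j ∈ arrowsFrom o i, Wtw q d (a := a) i j (cst a ((q : ℂ) ^ 2) * wv i t)) *
    (Wr i t (wv i t))⁻¹ * (Wr i t (cst a ((q : ℂ) ^ 2) * wv i t))⁻¹) * hc

theorem e_mul_f (r s : ℤ) (u v : WVar a) :
    term q (Pi.single u (-1)) (eCoef q d z o u * wv u.1 u.2 ^ r) *
      term q (Pi.single v 1) (fCoef q d o v * (cst a ((q : ℂ) ^ 2) * wv v.1 v.2) ^ s) =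
    term q (Pi.single u (-1) + Pi.single v 1)
      (eCoef q d z o u * scaleHom q (Pi.single u (-1)) (fCoef q d o v) * (wv u.1 u.2 ^ r *
        (cst a ((q : ℂ) ^ 2) * scaleHom q (Pi.single u (-1)) (wv v.1 v.2)) ^ s)) := by
  rw [term_mul_term, map_mul, map_zpow₀, map_mul, scaleHom_cst]
  congr 1
  ring

theorem f_mul_e (r s : ℤ) (u v : WVar a) :
    term q (Pi.single v 1) (fCoef q d o v * (cst a ((q : ℂ) ^ 2) * wv v.1 v.2) ^ s) *
    term q (Pi.single u (-1)) (eCoef q d z o u * wv u.1 u.2 ^ r) =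
    term q (Pi.single u (-1) + Pi.single v 1)
      (fCoef q d o v * scaleHom q (Pi.single v 1) (eCoef q d z o u) *
        (scaleHom q (Pi.single v 1) (wv u.1 u.2) ^ r *
        (cst a ((q : ℂ) ^ 2) * wv v.1 v.2) ^ s)) := by
  rw [term_mul_term, map_mul, map_zpow₀, add_comm]
  congr 1
  ring

theorem e_f_comm (r s : ℤ) {u v : WVar a} (h : u ≠ v) :
    term q (Pi.single u (-1)) (eCoef q d z o u * wv u.1 u.2 ^ r) *
      term q (Pi.single v 1) (fCoef q d o v * (cst a ((q : ℂ) ^ 2) * wv v.1 v.2) ^ s) =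
    term q (Pi.single v 1) (fCoef q d o v * (cst a ((q : ℂ) ^ 2) * wv v.1 v.2) ^ s) *
      term q (Pi.single u (-1)) (eCoef q d z o u * wv u.1 u.2 ^ r) := by
  rw [e_mul_f q d z o, f_mul_e q d z o, eCoef_fCoef_comm q d z o u v h, scaleHom_wv,
    scaleHom_wv, Pi.single_eq_of_ne h, Pi.single_eq_of_ne h.symm]
  simp only [mul_zero, zpow_zero, cst_one, one_mul]

theorem eImage_fImage_ne {i j : ZMod n} (h : i ≠ j) (r s : ℤ) :
    eImage q d a z o i r * fImage q d a o j s - fImage q d a o j s * eImage q d a z o i r = 0 := by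
  rw [eImage_eq, fImage_eq, sub_eq_zero, Finset.sum_mul_sum, Finset.sum_mul_sum, Finset.sum_comm]
  refine Finset.sum_congr rfl fun t _ => Finset.sum_congr rfl fun t' _ => ?_
  exact e_f_comm q d z o r s (u := ⟨i, t'⟩) (v := ⟨j, t⟩) fun h' => h (congrArg Sigma.fst h')

theorem eImage_fImage_same (hq2 : (q : ℂ) ^ 2 ≠ 1) (i : ZMod n) (r s : ℤ) :
    eImage q d a z o i r * fImage q d a o i s - fImage q d a o i s * eImage q d a z o i r =
      ((q : ℂ) - (q : ℂ)⁻¹)⁻¹ •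
        (psiPlusImage q d a z i (r + s) - psiMinusImage q d a z i (r + s)) := by
  rw [psiPlusImage_eq, psiMinusImage_eq, ← func_sub, psiCoeff_sub q d z hq2, ← func_smul,
    smul_eq_cst_mul, eImage_eq, fImage_eq, Finset.sum_mul_sum, Finset.sum_mul_sum]
  rw [Finset.sum_comm (f := fun t t' => term q (Pi.single (⟨i, t⟩ : WVar a) 1) _ * _),
    ← Finset.sum_sub_distrib, Fintype.sum_prod_type, Finset.mul_sum, func_sum]
  refine Finset.sum_congr rfl fun t _ => ?_
  rw [← Finset.sum_sub_distrib, Finset.sum_eq_single t]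
  · have hq0 := q.ne_zero
    have e1 := e_mul_f q d z o r s ⟨i, t⟩ ⟨i, t⟩
    have e2 := f_mul_e q d z o r s ⟨i, t⟩ ⟨i, t⟩
    simp only at e1 e2
    have h0 : (Pi.single (⟨i, t⟩ : WVar a) (-1 : ℤ) + Pi.single (⟨i, t⟩ : WVar a) 1 : WVar a → ℤ) = 0 := by
      rw [← Pi.single_add]; simp
    rw [e1, e2, h0, ← term_sub, ← func_eq_term, Fintype.sum_bool]
    congr 1
    have h1 := eCoef_fCoef_diag q d z o hq2 i t
    have h2 := fCoef_eCoef_diag q d z o hq2 i t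
    rw [h1, h2, scaleHom_wv, scaleHom_wv, Pi.single_eq_same, Pi.single_eq_same,
      cst_two_mul_cst_neg_two]
    have e3 : cst a ((q : ℂ) ^ (2 * 1 : ℤ)) = cst a ((q : ℂ) ^ 2) := by
      rw [mul_one, ← zpow_natCast]; rfl
    have hw := wv_ne_zero i t
    have hq2' := cst_ne_zero (a := a) (pow_ne_zero 2 q.ne_zero)
    have p1 : gammaPole q i (t, false) = wv i t := by simp [gammaPole, cst_one]
    have p2 : gammaPole q i (t, true) = cst a ((q : ℂ) ^ 2) * wv i t := by simp [gammaPole]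
    rw [e3, ← zpow_add₀ hw, ← zpow_add₀ (mul_ne_zero hq2' hw), p1, p2]
    ring
  · intro t' _ ht
    refine sub_eq_zero.2 (e_f_comm q d z o r s (u := ⟨i, t⟩) (v := ⟨i, t'⟩) ?_)
    simpa using ht.symm
  · intro h; exact (h (Finset.mem_univ _)).elim

theorem exchange_sum {A ι : Type*} [Ring A] [Algebra ℂ A] [Fintype ι] (s₁ s₂ s₃ s₄ : ℂ) (x y : A)
    (u v : ι → A) (h : ∀ t, s₁ • (x * u t) - s₂ • (y * v t) = s₃ • (u t * x) - s₄ • (v t * y)) :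
    s₁ • (x * ∑ t, u t) - s₂ • (y * ∑ t, v t) = s₃ • ((∑ t, u t) * x) - s₄ • ((∑ t, v t) * y) := by
  simp only [Finset.mul_sum, Finset.sum_mul, Finset.smul_sum, ← Finset.sum_sub_distrib]
  exact Finset.sum_congr rfl fun t _ => h t

theorem term_mul_func (m : WVar a → ℤ) (c c' : WField a) :
    term q m c * func q a c' = term q m (c * scaleHom q m c') := by
  rw [func_eq_term, term_mul_term, add_zero]

theorem term_exchange (s₁ s₂ s₃ s₄ : ℂ) (m : WVar a → ℤ) {x y E w : WField a} (hw : w ≠ 0) (s : ℤ)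
    (h : cst a s₁ * x - cst a s₂ * w * y =
      cst a s₃ * scaleHom q m x - cst a s₄ * w * scaleHom q m y) :
    s₁ • (func q a x * term q m (E * w ^ s)) - s₂ • (func q a y * term q m (E * w ^ (s + 1))) =
      s₃ • (term q m (E * w ^ s) * func q a x) - s₄ • (term q m (E * w ^ (s + 1)) * func q a y) := by
  rw [func_mul_term, func_mul_term, term_mul_func, term_mul_func, ← term_smul, ← term_smul,
    ← term_smul, ← term_smul, ← term_sub, ← term_sub]
  congr 1
  rw [smul_eq_cst_mul, smul_eq_cst_mul, smul_eq_cst_mul, smul_eq_cst_mul, zpow_add_one₀ hw]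
  linear_combination (E * w ^ s) * h

theorem psi_eImage (ε : Bool) (i j : ZMod n) (r s : ℤ) :
    ((d : ℂ) ^ mMat i j) • (func q a (psiCoeff q d z ε i (r + 1)) * eImage q d a z o j s)
        - ((q : ℂ) ^ cartan i j) • (func q a (psiCoeff q d z ε i r) * eImage q d a z o j (s + 1)) =
      ((q : ℂ) ^ cartan i j * (d : ℂ) ^ mMat i j) •
        (eImage q d a z o j s * func q a (psiCoeff q d z ε i (r + 1)))
        - eImage q d a z o j (s + 1) * func q a (psiCoeff q d z ε i r) := by
  rw [← one_smul ℂ (eImage q d a z o j (s + 1) * func q a (psiCoeff q d z ε i r)), eImage_eq,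
    eImage_eq]
  refine exchange_sum _ _ _ _ _ _ _ _ fun t => term_exchange q _ _ _ _ _ (wv_ne_zero j t) s ?_
  rw [cst_one, one_mul]
  exact psiCoeff_exchange_neg z ε i ⟨j, t⟩ r

theorem psi_fImage (ε : Bool) (i j : ZMod n) (r s : ℤ) :
    ((q : ℂ) ^ cartan i j * (d : ℂ) ^ mMat i j) •
        (func q a (psiCoeff q d z ε i (r + 1)) * fImage q d a o j s)
        - func q a (psiCoeff q d z ε i r) * fImage q d a o j (s + 1) =
      ((d : ℂ) ^ mMat i j) • (fImage q d a o j s * func q a (psiCoeff q d z ε i (r + 1)))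
        - ((q : ℂ) ^ cartan i j) • (fImage q d a o j (s + 1) * func q a (psiCoeff q d z ε i r)) := by
  rw [← one_smul ℂ (func q a (psiCoeff q d z ε i r) * fImage q d a o j (s + 1)), fImage_eq,
    fImage_eq]
  refine exchange_sum _ _ _ _ _ _ _ _ fun t => term_exchange q _ _ _ _ _
    (mul_ne_zero (cst_ne_zero (pow_ne_zero 2 q.ne_zero)) (wv_ne_zero j t)) s ?_
  rw [cst_one, one_mul]
  exact psiCoeff_exchange_pos z ε i ⟨j, t⟩ r

end Residues

/-! the generators as images of elements of the shuffle algebra -/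

section GeneratorImages

variable {n : ℕ} [NeZero n] [Fact (3 ≤ n)] {q d : ℂˣ} {a N : ZMod n → ℕ}
  (z : ∀ i, Fin (N i) → ℂˣ) (o : ZMod n → Bool)

/-- The family with a single nonzero member, equal to `1`. -/
def unitFam (v : WVar a) (i : ZMod n) (r : Fin (a i)) : ℕ := if (⟨i, r⟩ : WVar a) = v then 1 else 0

theorem pts_unitFam (v : WVar a) : pts (unitFam v) = {⟨v, 0⟩} := by
  ext ⟨w, p⟩
  rw [mem_pts, Finset.mem_singleton]
  unfold unitFam
  by_cases h : w = v
  · subst h; simp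
  · simp [h]

theorem splittings_single (i : ZMod n) :
    splittings a (Pi.single i 1) = Finset.univ.image fun r : Fin (a i) => unitFam ⟨i, r⟩ := by
  ext m
  rw [mem_splittings, Finset.mem_image]
  constructor
  · intro h
    have h1 : (pts m).card = 1 := by
      rw [Finset.card_eq_sum_card_fiberwise (f := ptCol) (t := Finset.univ)
        fun _ _ => Finset.mem_coe.2 (Finset.mem_univ _)]
      change ∑ j, colourCount ptCol (pts m) j = 1
      rw [h]; simp
    obtain ⟨⟨v, p⟩, ht⟩ := Finset.card_eq_one.1 h1
    have h2 : (⟨v, p⟩ : Pt a) ∈ pts m := by rw [ht]; exact Finset.mem_singleton_self _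
    rw [mem_pts] at h2
    have h3 : (⟨v, 0⟩ : Pt a) ∈ pts m := mem_pts.2 (lt_of_le_of_lt (Nat.zero_le _) h2)
    rw [ht, Finset.mem_singleton] at h3
    have h4 : m = unitFam v := pts_injective (by rw [ht, ← h3, pts_unitFam])
    have h5 := h
    rw [ht, colourCount_singleton] at h5
    have h6 : v.1 = i := by
      by_contra hne
      have := congrFun h5 v.1
      rw [Pi.single_eq_of_ne hne] at this
      simp [ptCol] at this
    obtain ⟨j, r⟩ := v
    obtain rfl : j = i := h6
    exact ⟨r, Finset.mem_univ _, h4.symm⟩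
  · rintro ⟨r, _, rfl⟩
    rw [pts_unitFam, colourCount_singleton]
    rfl

theorem unitFam_injective (i : ZMod n) :
    Function.Injective fun r : Fin (a i) => unitFam (⟨i, r⟩ : WVar a) := by
  intro r s h
  have h1 := congrArg pts h
  simp only [pts_unitFam] at h1
  simpa using h1

theorem expOf_unitFam (s : ℤ) (v : WVar a) : expOf s (unitFam v) = Pi.single v s := by
  funext w
  unfold expOf unitFam
  by_cases h : w = v
  · subst h; simp
  · simp [h]

theorem halfK_self (ε : Bool) (t : Pt a) : halfK q d o ε t t = cst a (halfW ε q) := by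
  unfold halfK
  have : ptCol t ∉ arrowsOf ε o (ptCol t) := by
    cases ε
    · exact self_notMem_arrowsFrom o _
    · exact self_notMem_arrowsInto o _
  simp [this]

theorem hat_shufX (hq : ∀ m : ℕ, 0 < m → q ^ m ≠ 1) (ε : Bool) (i : ZMod n) (p : ℤ) :
    hat (a := a) z o hq ε (shufX q d i p) = ∑ r : Fin (a i), term q (Pi.single ⟨i, r⟩ (halfSign ε))
      (halfY q d z o ε ⟨⟨i, r⟩, 0⟩ * cst a (halfW ε q) * halfPt ε q ⟨⟨i, r⟩, 0⟩ ^ p) := by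
  unfold shufX
  rw [hat_of, splittings_single, Finset.sum_image fun r _ s _ h => unitFam_injective i h]
  refine Finset.sum_congr rfl fun r _ => ?_
  rw [expOf_unitFam]
  unfold halfCoeff halfC
  rw [pts_unitFam, Finset.prod_singleton, Finset.prod_singleton, Finset.prod_singleton, halfK_self]
  have := valueAt_shufX (col := ptCol) (x := halfPt ε q) (q := q) (d := d) (⟨⟨i, r⟩, 0⟩ : Pt a)
    (halfPt_ne_zero ε q _) i p
  unfold shufX at this
  rw [this, if_pos (show ptCol (⟨⟨i, r⟩, 0⟩ : Pt a) = i from rfl)]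

theorem halfPt_true_zero (v : WVar a) : halfPt true q ⟨v, 0⟩ = wv v.1 v.2 := by
  unfold halfPt ptPlus
  simp [cst_one]

theorem halfPt_false_zero (v : WVar a) :
    halfPt false q ⟨v, 0⟩ = cst a ((q : ℂ) ^ 2) * wv v.1 v.2 := by
  unfold halfPt ptMinus
  simp

theorem eImage_eq_hat (hq : ∀ m : ℕ, 0 < m → q ^ m ≠ 1) (i : ZMod n) (p : ℤ) :
    eImage q d a z o i p = hat z o hq true (shufX q d i p) := by
  rw [hat_shufX, eImage_eq]
  refine Finset.sum_congr rfl fun r _ => ?_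
  have hq2 : (q : ℂ) ^ 2 ≠ 1 := fun h => hq 2 two_pos (Units.ext (by simpa using h))
  have hq0 := q.ne_zero
  have e1 : 1 - (q : ℂ) ^ 2 ≠ 0 := sub_ne_zero.2 hq2.symm
  have hc : cst a (-(q : ℂ) / (1 - (q : ℂ) ^ 2)) =
      cst a (q : ℂ) * cst a (1 / ((q : ℂ) - (q : ℂ)⁻¹)) * cst a (q : ℂ)⁻¹ := by
    rw [← cst_mul, ← cst_mul]
    congr 1
    have e3 : (q : ℂ) - (q : ℂ)⁻¹ = -(1 - (q : ℂ) ^ 2) / q := by field_simp; ring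
    rw [e3]
    field_simp
  rw [show halfSign true = -1 from rfl, halfPt_true_zero]
  unfold halfY eCoef Yfun
  rw [if_pos rfl, halfPt_true_zero, hc, show halfW true q = (q : ℂ)⁻¹ from rfl]
  congr 1
  ring

theorem fImage_eq_hat (hq : ∀ m : ℕ, 0 < m → q ^ m ≠ 1) (i : ZMod n) (p : ℤ) :
    fImage q d a o i p = hat z o hq false (shufX q d i p) := by
  rw [hat_shufX, fImage_eq]
  refine Finset.sum_congr rfl fun r _ => ?_
  rw [show halfSign false = 1 from rfl, halfPt_false_zero]
  unfold halfY fCoef YfunMinus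
  have h : cst a ((q : ℂ) ^ (-2 : ℤ)) * (cst a ((q : ℂ) ^ 2) * wv i r) = wv i r := by
    rw [← mul_assoc, ← cst_mul, ← zpow_natCast, ← zpow_add₀ q.ne_zero]
    simp [cst_one]
  rw [if_neg Bool.false_ne_true, halfPt_false_zero, show halfW false q = 1 from rfl, cst_one, h]
  congr 1
  ring

section Relations

variable (hq : ∀ m : ℕ, 0 < m → q ^ m ≠ 1)

include hq

theorem eImage_mem (hw : WheelGeneric q d) (i : ZMod n) (p : ℤ) :
    eImage q d a z o i p ∈ diffAlg q a := by
  rw [eImage_eq_hat z o hq]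
  exact hat_mem_of_wheel z o hq hw true (xpow_mem_wheelSet i p)

theorem fImage_mem (hw : WheelGeneric q d) (i : ZMod n) (p : ℤ) :
    fImage q d a o i p ∈ diffAlg q a := by
  rw [fImage_eq_hat (N := 0) (fun _ => Fin.elim0) o hq]
  exact hat_mem_of_wheel _ o hq hw false (xpow_mem_wheelSet i p)

theorem eImage_exchange (i j : ZMod n) (r s : ℤ) :
    ((d : ℂ) ^ mMat i j) • (eImage q d a z o i (r + 1) * eImage q d a z o j s)
      - ((q : ℂ) ^ cartan i j) • (eImage q d a z o i r * eImage q d a z o j (s + 1)) =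
    ((q : ℂ) ^ cartan i j * (d : ℂ) ^ mMat i j) •
        (eImage q d a z o j s * eImage q d a z o i (r + 1))
      - eImage q d a z o j (s + 1) * eImage q d a z o i r := by
  have h := congrArg (hat (a := a) z o hq true) (shufX_exchange (q := q) (d := d) i j r s)
  simpa only [map_sub, map_smul, hat_true_mul, ← eImage_eq_hat z o hq] using h

theorem fImage_exchange (i j : ZMod n) (r s : ℤ) :
    ((q : ℂ) ^ cartan i j * (d : ℂ) ^ mMat i j) •
        (fImage q d a o i (r + 1) * fImage q d a o j s)
      - fImage q d a o i r * fImage q d a o j (s + 1) =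
    ((d : ℂ) ^ mMat i j) • (fImage q d a o j s * fImage q d a o i (r + 1))
      - ((q : ℂ) ^ cartan i j) • (fImage q d a o j (s + 1) * fImage q d a o i r) := by
  have h := congrArg (hat (a := a) (N := 0) (fun _ => Fin.elim0) o hq false)
    (shufX_exchange (q := q) (d := d) i j r s)
  simp only [map_sub, map_smul, hat_false_mul, ← fImage_eq_hat _ o hq] at h
  exact h.symm

theorem eImage_serre {i j : ZMod n} (hij : j = i + 1 ∨ j = i - 1) (r₁ r₂ s : ℤ) :
    serre q (eImage q d a z o i r₁) (eImage q d a z o i r₂) (eImage q d a z o j s) +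
      serre q (eImage q d a z o i r₂) (eImage q d a z o i r₁) (eImage q d a z o j s) = 0 := by
  have h := congrArg (hat (a := a) z o hq true) (shufX_serre (q := q) (d := d) hij r₁ r₂ s)
  unfold shufSerre at h
  simp only [map_sub, map_add, map_smul, map_zero, hat_true_mul, ← eImage_eq_hat z o hq] at h
  exact h

theorem fImage_serre {i j : ZMod n} (hij : j = i + 1 ∨ j = i - 1) (r₁ r₂ s : ℤ) :
    serre q (fImage q d a o i r₁) (fImage q d a o i r₂) (fImage q d a o j s) +
      serre q (fImage q d a o i r₂) (fImage q d a o i r₁) (fImage q d a o j s) = 0 := by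
  have h := congrArg (hat (a := a) (N := 0) (fun _ => Fin.elim0) o hq false)
    (shufX_serre (q := q) (d := d) hij r₁ r₂ s)
  unfold shufSerre at h
  simp only [map_sub, map_add, map_smul, map_zero, hat_false_mul, ← fImage_eq_hat _ o hq,
    ← mul_assoc] at h
  rw [← h]
  unfold serre
  abel

end Relations

end GeneratorImages

/-! the homomorphism from the shifted toroidal algebra -/

section GKLOHom

variable {n : ℕ} [NeZero n] [Fact (3 ≤ n)] (q d : ℂˣ) {a N : ZMod n → ℕ}
  (z : ∀ i, Fin (N i) → ℂˣ) (o : ZMod n → Bool) (b : ZMod n → ℤ)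

/-- The images of the generators. -/
def genImage : Gen 0 b → DiffOp q a
  | .e i r => eImage q d a z o i r
  | .f i r => fImage q d a o i r
  | .psiP i r => func q a (psiCoeff q d z true i r)
  | .psiM i r => func q a (psiCoeff q d z false i r)
  | .psiPInv i => func q a (psiCoeff q d z true i 0)⁻¹
  | .psiMInv i => func q a (psiCoeff q d z false i (b i))⁻¹

/-- The homomorphism from the free algebra. -/
def freeHom : FreeAlgebra ℂ (Gen 0 b) →ₐ[ℂ] DiffOp q a :=
  FreeAlgebra.lift ℂ (genImage (a := a) q d z o b)

theorem freeHom_e (i : ZMod n) (r : ℤ) :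
    freeHom q d z o b (Gen.eF 0 b i r) = eImage q d a z o i r := FreeAlgebra.lift_ι_apply _ _

theorem freeHom_f (i : ZMod n) (r : ℤ) :
    freeHom q d z o b (Gen.fF 0 b i r) = fImage q d a o i r := FreeAlgebra.lift_ι_apply _ _

variable {b} in
theorem psiCoeff_eq_zero
    (hN : ∀ i, (N i : ℤ) = b i + 2 * (a i : ℤ) - (a (i - 1) : ℤ) - (a (i + 1) : ℤ))
    (ε : Bool) (i : ZMod n) {r : ℤ} (hr : if ε then r < 0 else b i < r) :
    psiCoeff (a := a) q d z ε i r = 0 := by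
  refine (leads_gamma (q := q) (d := d) z hN ε i).lt _ ?_
  cases ε
  · simpa using hr
  · simpa using hr

variable {b} in
theorem psiCoeff_mem
    (hN : ∀ i, (N i : ℤ) = b i + 2 * (a i : ℤ) - (a (i - 1) : ℤ) - (a (i + 1) : ℤ))
    (ε : Bool) (i : ZMod n) (r : ℤ) : psiCoeff q d z ε i r ∈ fnAlg q a :=
  (leads_gamma (q := q) (d := d) z hN ε i).mem _

variable {b} in
theorem psiCoeff_lead
    (hN : ∀ i, (N i : ℤ) = b i + 2 * (a i : ℤ) - (a (i - 1) : ℤ) - (a (i + 1) : ℤ))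
    (ε : Bool) (i : ZMod n) : psiCoeff (a := a) q d z ε i (if ε then 0 else b i) ≠ 0 ∧
      (psiCoeff q d z ε i (if ε then 0 else b i))⁻¹ ∈ fnAlg q a := by
  have h := leads_gamma (q := q) (d := d) z hN ε i
  cases ε
  · exact ⟨h.ne_zero, h.inv_mem⟩
  · exact ⟨h.ne_zero, h.inv_mem⟩

theorem func_mul_func_comm (x y : WField a) :
    func q a x * func q a y = func q a y * func q a x := by
  rw [← func_mul, ← func_mul, mul_comm]

theorem func_mul_inv {x : WField a} (h : x ≠ 0) : func q a x * func q a x⁻¹ = 1 := by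
  rw [← func_mul, mul_inv_cancel₀ h, func_one]

theorem func_inv_mul {x : WField a} (h : x ≠ 0) : func q a x⁻¹ * func q a x = 1 := by
  rw [← func_mul, inv_mul_cancel₀ h, func_one]

variable {b} (hN : ∀ i, (N i : ℤ) = b i + 2 * (a i : ℤ) - (a (i - 1) : ℤ) - (a (i + 1) : ℤ))

include hN in
theorem freeHom_psi (ε : Bool) (i : ZMod n) (r : ℤ) :
    freeHom q d z o b (Gen.psiF 0 b ε i r) = func q a (psiCoeff q d z ε i r) := by
  unfold Gen.psiF
  cases ε
  · rw [if_neg Bool.false_ne_true]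
    by_cases h : r ≤ b i
    · rw [dif_pos h]
      exact FreeAlgebra.lift_ι_apply _ _
    · rw [dif_neg h, map_zero, psiCoeff_eq_zero q d z hN false i (by simpa using h), func_zero]
  · rw [if_pos rfl]
    by_cases h : -(0 : ZMod n → ℤ) i ≤ r
    · rw [dif_pos h]
      exact FreeAlgebra.lift_ι_apply _ _
    · rw [dif_neg h, map_zero, psiCoeff_eq_zero q d z hN true i (by simpa using h), func_zero]

include hN in
theorem freeHom_rel (hq : ∀ m : ℕ, 0 < m → q ^ m ≠ 1) {x y : FreeAlgebra ℂ (Gen 0 b)}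
    (h : Rel q d 0 b x y) : freeHom (a := a) q d z o b x = freeHom q d z o b y := by
  have hq2 : (q : ℂ) ^ 2 ≠ 1 := fun h => hq 2 two_pos (Units.ext (by simpa using h))
  have hψ := freeHom_psi q d z o hN
  have hP := fun i => (psiCoeff_lead q d z hN true i).1
  have hM := fun i => (psiCoeff_lead q d z hN false i).1
  have hPI : ∀ i, freeHom q d z o b (FreeAlgebra.ι ℂ (Gen.psiPInv i)) =
    func q a (psiCoeff q d z true i 0)⁻¹ := fun i => FreeAlgebra.lift_ι_apply _ _
  have hMI : ∀ i, freeHom q d z o b (FreeAlgebra.ι ℂ (Gen.psiMInv i)) =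
    func q a (psiCoeff q d z false i (b i))⁻¹ := fun i => FreeAlgebra.lift_ι_apply _ _
  have h0 : ∀ i : ZMod n, -(0 : ZMod n → ℤ) i = 0 := fun _ => neg_zero
  cases h with
  | T1_comm ε ε' i j r s => rw [map_mul, map_mul, hψ, hψ, func_mul_func_comm]
  | T1_plus_right i => rw [map_mul, map_one, hψ, hPI, h0]; exact func_mul_inv q (hP i)
  | T1_plus_left i => rw [map_mul, map_one, hψ, hPI, h0]; exact func_inv_mul q (hP i)
  | T1_minus_right i => rw [map_mul, map_one, hψ, hMI]; exact func_mul_inv q (hM i)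
  | T1_minus_left i => rw [map_mul, map_one, hψ, hMI]; exact func_inv_mul q (hM i)
  | T2 i j r s =>
    simp only [map_sub, map_smul, map_mul, freeHom_e]
    exact eImage_exchange z o hq i j r s
  | T3 i j r s =>
    simp only [map_sub, map_smul, map_mul, freeHom_f]
    exact fImage_exchange o hq i j r s
  | T4 ε i j r s =>
    simp only [map_sub, map_smul, map_mul, freeHom_e, hψ]
    exact psi_eImage q d z o ε i j r s
  | T5 ε i j r s =>
    simp only [map_sub, map_smul, map_mul, freeHom_f, hψ]
    exact psi_fImage q d z o ε i j r s
  | T6_same i r s =>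
    simp only [map_sub, map_smul, map_mul, freeHom_e, freeHom_f, hψ]
    exact eImage_fImage_same q d z o hq2 i r s
  | T6_ne i j hij r s =>
    simp only [map_sub, map_mul, map_zero, freeHom_e, freeHom_f]
    exact eImage_fImage_ne q d z o hij r s
  | T7 i j hij r₁ r₂ s =>
    unfold serre
    simp only [map_add, map_sub, map_smul, map_mul, map_zero, freeHom_e]
    exact eImage_serre z o hq hij r₁ r₂ s
  | T8 i j hij r₁ r₂ s =>
    unfold serre
    simp only [map_add, map_sub, map_smul, map_mul, map_zero, freeHom_f]
    exact fImage_serre o hq hij r₁ r₂ s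

/-- The homomorphism from the shifted toroidal algebra to difference operators. -/
def gkloHom (hq : ∀ m : ℕ, 0 < m → q ^ m ≠ 1) : Toroidal q d b →ₐ[ℂ] DiffOp q a :=
  RingQuot.liftAlgHom ℂ ⟨freeHom q d z o b, fun _ _ h => freeHom_rel q d z o hN hq h⟩

variable (hq : ∀ m : ℕ, 0 < m → q ^ m ≠ 1)

theorem gkloHom_proj (x : FreeAlgebra ℂ (Gen 0 b)) :
    gkloHom q d z o hN hq (ToroidalTwo.proj q d 0 b x) = freeHom (a := a) q d z o b x :=
  RingQuot.liftAlgHom_mkAlgHom_apply _ _ _ _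

theorem proj_surjective : Function.Surjective (ToroidalTwo.proj q d 0 b) :=
  RingQuot.mkAlgHom_surjective ℂ (Rel q d 0 b)

theorem gkloHom_mem (hw : WheelGeneric q d) (x : Toroidal q d b) :
    gkloHom q d z o hN hq x ∈ diffAlg q a := by
  obtain ⟨x, rfl⟩ := proj_surjective q d x
  rw [gkloHom_proj]
  induction x using FreeAlgebra.induction with
  | grade0 c => rw [AlgHom.commutes]; exact Subalgebra.algebraMap_mem _ c
  | add x y hx hy => rw [map_add]; exact add_mem hx hy
  | mul x y hx hy => rw [map_mul]; exact mul_mem hx hy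
  | grade1 g =>
    unfold freeHom
    rw [FreeAlgebra.lift_ι_apply]
    cases g with
    | e i r => exact eImage_mem z o hq hw i r
    | f i r => exact fImage_mem o hq hw i r
    | psiP i r => exact psiCoeff_mem q d z hN true i r
    | psiM i r => exact psiCoeff_mem q d z hN false i r
    | psiPInv i => exact (psiCoeff_lead q d z hN true i).2
    | psiMInv i => exact (psiCoeff_lead q d z hN false i).2

theorem gkloHom_isGKLO (hw : WheelGeneric q d) :
    IsGKLO q d z o ((gkloHom (a := a) q d z o hN hq).codRestrict _
      (gkloHom_mem q d z o hN hq hw)) where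
  map_e i p := (gkloHom_proj q d z o hN hq _).trans (freeHom_e q d z o b i p)
  map_f i p := (gkloHom_proj q d z o hN hq _).trans (freeHom_f q d z o b i p)
  map_psiPlus i p := (gkloHom_proj q d z o hN hq _).trans
    ((freeHom_psi q d z o hN true i p).trans (psiPlusImage_eq z i p).symm)
  map_psiMinus i p := (gkloHom_proj q d z o hN hq _).trans
    ((freeHom_psi q d z o hN false i p).trans (psiMinusImage_eq z i p).symm)

variable {q d z o} in
theorem IsGKLO.unique {Φ Φ' : Toroidal q d b →ₐ[ℂ] diffAlg q a} (h : IsGKLO q d z o Φ)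
    (h' : IsGKLO q d z o Φ') : Φ = Φ' := by
  have hψP : ∀ i p, Φ (Toroidal.psi q d b true i p) = Φ' (Toroidal.psi q d b true i p) :=
    fun i p => Subtype.ext ((h.map_psiPlus i p).trans (h'.map_psiPlus i p).symm)
  have hψM : ∀ i p, Φ (Toroidal.psi q d b false i p) = Φ' (Toroidal.psi q d b false i p) :=
    fun i p => Subtype.ext ((h.map_psiMinus i p).trans (h'.map_psiMinus i p).symm)
  have inv : ∀ {x y : Toroidal q d b}, x * y = 1 → y * x = 1 → Φ x = Φ' x → Φ y = Φ' y := by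
    intro x y h1 h2 h3
    refine left_inv_eq_right_inv (a := Φ x) ?_ ?_
    · rw [← map_mul, h2, map_one]
    · rw [h3, ← map_mul, h1, map_one]
  have rel : ∀ {x y : FreeAlgebra ℂ (Gen 0 b)}, Rel q d 0 b x y →
      ToroidalTwo.proj q d 0 b x = ToroidalTwo.proj q d 0 b y :=
    fun h => RingQuot.mkAlgHom_rel ℂ h
  have hc : Φ.comp (ToroidalTwo.proj q d 0 b) = Φ'.comp (ToroidalTwo.proj q d 0 b) := by
    refine FreeAlgebra.hom_ext (funext fun g => ?_)
    change Φ (ToroidalTwo.proj q d 0 b (FreeAlgebra.ι ℂ g)) =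
      Φ' (ToroidalTwo.proj q d 0 b (FreeAlgebra.ι ℂ g))
    cases g with
    | e i r => exact Subtype.ext ((h.map_e i r).trans (h'.map_e i r).symm)
    | f i r => exact Subtype.ext ((h.map_f i r).trans (h'.map_f i r).symm)
    | psiP i r =>
      have := hψP i r
      unfold Toroidal.psi Gen.psiF at this
      rwa [if_pos rfl, dif_pos r.2] at this
    | psiM i r =>
      have := hψM i r
      unfold Toroidal.psi Gen.psiF at this
      rwa [if_neg Bool.false_ne_true, dif_pos r.2] at this
    | psiPInv i =>
      refine inv ?_ ?_ (hψP i (-(0 : ZMod n → ℤ) i))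
      · have := rel (.T1_plus_right i)
        rwa [map_mul, map_one] at this
      · have := rel (.T1_plus_left i)
        rwa [map_mul, map_one] at this
    | psiMInv i =>
      refine inv ?_ ?_ (hψM i (b i))
      · have := rel (.T1_minus_right i)
        rwa [map_mul, map_one] at this
      · have := rel (.T1_minus_left i)
        rwa [map_mul, map_one] at this
  refine AlgHom.ext fun x => ?_
  obtain ⟨x, rfl⟩ := proj_surjective q d x
  exact DFunLike.congr_fun hc x

end GKLOHom

/-! injectivity of the maps to difference operators -/

section Injectivity

variable {n : ℕ} [NeZero n] [Fact (3 ≤ n)] {q d : ℂˣ} {a N : ZMod n → ℕ}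
  (z : ∀ i, Fin (N i) → ℂˣ) (o : ZMod n → Bool)

theorem one_sub_wv_div_ne_zero {u v : WVar a} (h : v ≠ u) {c : ℂ} (hc : c ≠ 0) :
    1 - algebraMap (WField a) (WField a) (wv v.1 v.2) / (cst a c * wv u.1 u.2) ≠ 0 := by
  rw [Algebra.algebraMap_self_apply, sub_ne_zero]
  intro h1
  rw [eq_comm, div_eq_one_iff_eq (mul_ne_zero (cst_ne_zero hc) (wv_ne_zero _ _))] at h1
  exact h (cst_mul_wv_inj (c := 1) (c' := c) one_ne_zero (by rw [cst_one, one_mul]; exact h1)).1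

theorem one_sub_cst_div_ne_zero (hq : ∀ m : ℕ, 0 < m → q ^ m ≠ 1) (u : WVar a) {c c' : ℂ}
    (hc : c ≠ 0) : 1 - algebraMap (WField a) (WField a) (cst a c') / (cst a c * wv u.1 u.2) ≠ 0 := by
  rw [Algebra.algebraMap_self_apply, sub_ne_zero]
  intro h1
  rw [eq_comm, div_eq_one_iff_eq (mul_ne_zero (cst_ne_zero hc) (wv_ne_zero _ _))] at h1
  have h2 := congrArg (scaleHom q (Pi.single u 1)) h1
  rw [scaleHom_cst, h1, map_mul, scaleHom_cst, scaleHom_wv, Pi.single_eq_same, mul_one,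
    ← mul_assoc, ← cst_mul] at h2
  have h3 := (cst_mul_wv_inj hc h2).2
  rw [left_eq_mul₀ hc] at h3
  exact hq 2 two_pos (Units.ext (by push_cast; exact h3))

theorem Wr_ne_zero (u : WVar a) {c : ℂ} (hc : c ≠ 0) :
    Wr u.1 u.2 (cst a c * wv u.1 u.2) ≠ 0 :=
  Finset.prod_ne_zero_iff.2 fun t ht => one_sub_wv_div_ne_zero (u := u) (v := ⟨u.1, t⟩)
    (fun h => Finset.ne_of_mem_erase ht (eq_of_heq (Sigma.mk.inj h).2)) hc

theorem Wtw_ne_zero (u : WVar a) {j : ZMod n} (hj : j ≠ u.1) {c : ℂ} (hc : c ≠ 0) :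
    Wtw q d (a := a) u.1 j (cst a c * wv u.1 u.2) ≠ 0 := by
  unfold Wtw
  rw [Algebra.algebraMap_self_apply, ← mul_assoc, ← cst_mul]
  exact Finset.prod_ne_zero_iff.2 fun t _ => one_sub_wv_div_ne_zero (u := u) (v := ⟨j, t⟩)
    (fun h => hj (congrArg Sigma.fst h))
    (mul_ne_zero (mul_ne_zero (inv_ne_zero q.ne_zero) (zpow_ne_zero _ d.ne_zero)) hc)

theorem prod_sqrtW_inv_ne_zero (s : Finset (ZMod n)) :
    (∏ j ∈ s, ∏ t : Fin (a j), (sqrtW j t)⁻¹) ≠ 0 :=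
  Finset.prod_ne_zero_iff.2 fun _ _ => Finset.prod_ne_zero_iff.2 fun _ _ =>
    inv_ne_zero (sqrtW_ne_zero _ _)

variable (hq : ∀ m : ℕ, 0 < m → q ^ m ≠ 1)

include hq in
theorem halfY_ne_zero (ε : Bool) (t : Pt a) : halfY q d z o ε t ≠ 0 := by
  have hq2 : (q : ℂ) ^ 2 ≠ 1 := fun h => hq 2 two_pos (Units.ext (by simpa using h))
  have hq0 := q.ne_zero
  have e1 : 1 - (q : ℂ) ^ 2 ≠ 0 := sub_ne_zero.2 hq2.symm
  have hc : (halfQ ε q : ℂ) ^ (-2 * (t.2 : ℤ)) * (halfBase ε q : ℂ) ≠ 0 :=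
    mul_ne_zero (zpow_ne_zero _ (Units.ne_zero _)) (Units.ne_zero _)
  unfold halfY
  cases ε
  · rw [if_neg Bool.false_ne_true]
    unfold YfunMinus
    rw [halfPt_eq]
    refine mul_ne_zero (mul_ne_zero (cst_ne_zero (one_div_ne_zero e1)) (prod_sqrtW_inv_ne_zero _))
      (div_ne_zero (Finset.prod_ne_zero_iff.2 fun j hj => Wtw_ne_zero t.1 ?_ hc) ?_)
    · rintro rfl; exact self_notMem_arrowsFrom o _ hj
    · rw [← mul_assoc, ← cst_mul]
      exact Wr_ne_zero t.1 (mul_ne_zero (zpow_ne_zero _ hq0) hc)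
  · rw [if_pos rfl]
    unfold Yfun
    rw [halfPt_eq]
    have e2 : (q : ℂ) - (q : ℂ)⁻¹ ≠ 0 := by
      intro h; apply hq2
      field_simp at h
      linear_combination h
    refine mul_ne_zero (cst_ne_zero hq0) (mul_ne_zero (mul_ne_zero (mul_ne_zero
      (cst_ne_zero (one_div_ne_zero e2)) (Finset.prod_ne_zero_iff.2 fun t _ => wv_ne_zero _ _))
      (prod_sqrtW_inv_ne_zero _)) (div_ne_zero (mul_ne_zero (Finset.prod_ne_zero_iff.2 fun s _ =>
        one_sub_cst_div_ne_zero hq t.1 hc) (Finset.prod_ne_zero_iff.2 fun j hj =>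
        Wtw_ne_zero t.1 ?_ hc)) (Wr_ne_zero t.1 hc)))
    rintro rfl; exact self_notMem_arrowsInto o _ hj

include hq in
theorem halfC_ne_zero (ε : Bool) {m : ∀ i, Fin (a i) → ℕ} (hm : ∀ t ∈ pts m, t.2 = 0) :
    halfC q d z o ε m ≠ 0 := by
  refine mul_ne_zero (Finset.prod_ne_zero_iff.2 fun t _ => halfY_ne_zero z o hq ε t)
    (Finset.prod_ne_zero_iff.2 fun t ht => Finset.prod_ne_zero_iff.2 fun t' ht' => ?_)
  have hw : cst a (halfW ε q) ≠ 0 := cst_ne_zero (by unfold halfW; split_ifs <;> simp)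
  by_cases h : t.1 = t'.1
  · obtain rfl : t = t' := by
      obtain ⟨v, p⟩ := t
      obtain ⟨v', p'⟩ := t'
      have h1 := hm _ ht
      have h2 := hm _ ht'
      simp only at h h1 h2
      rw [h, h1, h2]
    rw [halfK_self]
    exact hw
  · have hz := inv_ne_zero (halfZ_ne_zero (q := q) (d := d) ε h)
    have hn : cst a (halfNorm ε q) ≠ 0 := cst_ne_zero (by unfold halfNorm; split_ifs <;> simp)
    unfold halfK
    refine mul_ne_zero (mul_ne_zero (mul_ne_zero ?_ ?_) ?_) ?_ <;> split_ifs
    all_goals first | exact hw | exact one_ne_zero | exact hz | exact mul_ne_zero hn hz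

variable (q) in
/-- The coefficient of a difference operator at a monomial. -/
def opCoeff (e : WVar a → ℤ) : DiffOp q a →+ WField a where
  toFun x := (show SkewMonoidAlgebra (WField a) (ShiftGroup q a) from x).coeff
    (ShiftGroup.ofExp q e)
  map_zero' := rfl
  map_add' x y := DFunLike.congr_fun (SkewMonoidAlgebra.coeff_add x y) _

theorem opCoeff_term (e m : WVar a → ℤ) (c : WField a) :
    opCoeff q e (term q m c) = if m = e then c else 0 := by
  classical
  rw [term_eq_single]
  refine (SkewMonoidAlgebra.coeff_single_apply
    (a := ShiftGroup.ofExp q m) (a' := ShiftGroup.ofExp q e)).trans ?_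
  exact if_congr Iff.rfl rfl rfl

theorem expOf_injective (ε : Bool) : Function.Injective (expOf (a := a) (halfSign ε)) := by
  intro m m' h
  funext i r
  have := congrFun h ⟨i, r⟩
  unfold expOf halfSign at this
  cases ε <;> simpa using this

theorem opCoeff_hat (ε : Bool) (m : ∀ i, Fin (a i) → ℕ) (E : Shuffle (n := n) q d) :
    opCoeff q (expOf (halfSign ε) m) (hat z o hq ε E) = halfCoeff q d z o ε m E := by
  have hx := (halfPt_injective (a := a) hq ε).injOn (s := (pts m : Set (Pt a)))
  have h0 := fun (t : Pt a) (_ : t ∈ pts m) => halfPt_ne_zero ε q t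
  unfold halfCoeff
  induction E using DirectSum.induction_on with
  | zero =>
    have := (valueLin (q := q) (d := d) (col := ptCol) hx h0).map_zero
    rw [map_zero, map_zero, show valueAt ptCol (halfPt ε q) (pts m) (0 : Shuffle q d) = 0 from this,
      mul_zero]
  | add E F hE hF => rw [map_add, map_add, hE, hF, valueAt_add hx h0, mul_add]
  | of k F =>
    rw [hat_of, map_sum]
    simp only [opCoeff_term, (expOf_injective ε).eq_iff]
    rw [Finset.sum_ite_eq']
    split_ifs with h
    · rfl
    · rw [valueAt_of_ne (fun h' => h (mem_splittings.2 h')) F, mul_zero]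

theorem algebraicIndependent_rvar (X : Type) :
    AlgebraicIndependent ℂ (rvar : X → RatFun X) := by
  have h : (MvPolynomial.aeval (rvar : X → RatFun X) : MvPolynomial X ℂ →ₐ[ℂ] RatFun X) =
      Algebra.algHom ℂ (MvPolynomial X ℂ) (RatFun X) := by
    refine MvPolynomial.algHom_ext fun v => ?_
    rw [MvPolynomial.aeval_X]
    rfl
  unfold AlgebraicIndependent
  rw [h]
  exact IsFractionRing.injective (MvPolynomial X ℂ) (RatFun X)

theorem algebraicIndependent_cst_mul_wv {ι : Type} {u : ι → WVar a} (hu : Function.Injective u)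
    {c : ι → ℂ} (hc : ∀ i, c i ≠ 0) :
    AlgebraicIndependent ℂ fun i => cst a (c i) * wv (u i).1 (u i).2 := by
  have h := ((algebraicIndependent_rvar (WVar a)).comp u hu).polynomial_aeval_of_transcendental
    (f := fun i => Polynomial.C (c i) * Polynomial.X ^ 2) fun i => ?_
  · convert! h using 2 with i
    simp only [map_mul, map_pow, Polynomial.aeval_X, Polynomial.aeval_C]
    rfl
  · refine Polynomial.transcendental _ ?_ ?_
    · rw [Polynomial.natDegree_C_mul_X_pow _ _ (hc i)]; exact two_ne_zero
    · rw [Polynomial.leadingCoeff_C_mul_X_pow]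
      exact mem_nonZeroDivisors_of_ne_zero (hc i)

theorem eq_zero_of_evalRat {L : Type} [Field L] [Algebra ℂ L] {k : ZMod n → ℕ}
    {F : RatFun (Var n)} (hF : F ∈ shuffleComp k) {p : Var n → L} (hp : Generic k p)
    (hi : AlgebraicIndependent ℂ fun v : VarIn k => p v.1) (h : evalRat p F = 0) : F = 0 := by
  obtain ⟨e, P, hPs, hP⟩ := exists_numerator hF
  rw [(hasEval_of_numerator hP hp).evalRat_eq,
    div_eq_zero_iff, or_iff_left (mul_ne_zero hp.poleDenAt_ne_zero (hp.prod_ne_zero e))] at h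
  rw [MvPolynomial.supported_eq_range_rename] at hPs
  obtain ⟨P', rfl⟩ := hPs
  replace h : MvPolynomial.aeval (p ∘ (Subtype.val : varSet k → Var n)) P' = 0 :=
    (MvPolynomial.aeval_rename _ _ _).symm.trans h
  have h1 : P' = 0 := hi ((h.trans (map_zero _).symm))
  have h2 : F * poleDen k * (∏ v ∈ block 0 k, rvar v) ^ e = 0 := by
    rw [hP, h1]; simp
  rw [mul_assoc] at h2
  exact (mul_eq_zero.1 h2).resolve_right
    (mul_ne_zero (poleDen_ne_zero k) ((generic_rvar k).prod_ne_zero e))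

/-- The family with `k_i` ones in colour `i`. -/
def onesFam (k : ZMod n → ℕ) (i : ZMod n) (r : Fin (a i)) : ℕ := if (r : ℕ) < k i then 1 else 0

theorem snd_of_mem_onesFam {k : ZMod n → ℕ} {t : Pt a} (h : t ∈ pts (onesFam k)) : t.2 = 0 := by
  rw [mem_pts] at h
  unfold onesFam at h
  split_ifs at h <;> omega

theorem colourCount_onesFam {k : ZMod n → ℕ} (hk : ∀ i, k i ≤ a i) :
    colourCount ptCol (pts (onesFam (a := a) k)) = k := by
  funext i
  rw [colourCount_pts]
  unfold onesFam
  rw [Finset.sum_boole, Fin.card_filter_val_lt, Nat.cast_id, min_eq_right (hk i)]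

theorem component_eq_zero_of_hat {k : ZMod n → ℕ} (hk : ∀ i, k i ≤ a i) (ε : Bool)
    {E : Shuffle (n := n) q d} (h : hat (a := a) z o hq ε E = 0) : E k = 0 := by
  have hx := (halfPt_injective (a := a) hq ε).injOn (s := ((pts (onesFam k) : Finset (Pt a)) : Set (Pt a)))
  have h0 := fun (t : Pt a) (_ : t ∈ pts (onesFam k)) => halfPt_ne_zero ε q t
  obtain ⟨e⟩ := ColEnum.exists_enum_of_eq (colourCount_onesFam hk)
  have h1 := opCoeff_hat (a := a) z o hq ε (onesFam k) E
  rw [h, map_zero] at h1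
  unfold halfCoeff at h1
  have h2 := (mul_eq_zero.1 h1.symm).resolve_left
    (halfC_ne_zero z o hq ε fun t ht => snd_of_mem_onesFam ht)
  rw [valueAt_eq e hx h0] at h2
  refine Subtype.ext (eq_zero_of_evalRat (E k).val_mem (e.generic hx h0) ?_ h2)
  have h3 := algebraicIndependent_cst_mul_wv (u := fun v : VarIn k => (e.equiv v).1.1)
    (c := fun v => (halfQ ε q : ℂ) ^ (-2 * ((e.equiv v).1.2 : ℤ)) * (halfBase ε q : ℂ)) ?_ ?_
  · convert! h3 using 2 with v
    rw [e.point_of_lt, halfPt_eq]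
  · intro v v' hv
    refine e.equiv.injective (Subtype.ext ?_)
    have p1 := snd_of_mem_onesFam (e.equiv v).2
    have p2 := snd_of_mem_onesFam (e.equiv v').2
    exact Sigma.ext hv (heq_of_eq (p1.trans p2.symm))
  · intro v
    exact mul_ne_zero (zpow_ne_zero _ (Units.ne_zero _)) (Units.ne_zero _)

end Injectivity

/-! the homomorphism to the shuffle algebra -/

section ToShuffle

theorem exists_lift_adjoin {U T P : Type*} [Semiring U] [Algebra ℂ U] [Semiring T] [Algebra ℂ T]
    [Semiring P] [Algebra ℂ P] (W : Subalgebra ℂ T) {J : T →ₐ[ℂ] P} (hJ : Function.Injective J)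
    (φ : U →ₐ[ℂ] P) {G : Set U} (hG : ∀ g ∈ G, ∃ t ∈ W, J t = φ g) :
    ∃ Υ : Algebra.adjoin ℂ G →ₐ[ℂ] T, (∀ u, Υ u ∈ W) ∧ ∀ u, J (Υ u) = φ u := by
  have h : Algebra.adjoin ℂ G ≤ (W.map J).comap φ := Algebra.adjoin_le fun g hg => hG g hg
  have hr : ∀ u : Algebra.adjoin ℂ G, φ u ∈ J.range := fun u => by
    obtain ⟨t, -, ht⟩ := h u.2
    exact ⟨t, ht⟩
  let Υ : Algebra.adjoin ℂ G →ₐ[ℂ] T := (AlgEquiv.ofInjective J hJ).symm.toAlgHom.comp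
    ((φ.comp (Algebra.adjoin ℂ G).val).codRestrict J.range hr)
  have hΥ : ∀ u, J (Υ u) = φ u := fun u =>
    congrArg Subtype.val ((AlgEquiv.ofInjective J hJ).apply_symm_apply ⟨φ u, hr u⟩)
  refine ⟨Υ, fun u => ?_, hΥ⟩
  obtain ⟨t, htW, ht⟩ := h u.2
  rwa [hJ ((hΥ u).trans ht.symm)]

variable {n : ℕ} [NeZero n] [Fact (3 ≤ n)] {q d : ℂˣ} {N : ZMod n → ℕ}
  (z : ∀ i, Fin (N i) → ℂˣ) (o : ZMod n → Bool) (b : ZMod n → ℤ)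

/-- The dimension vectors `a` with `N_i = b_i + 2 a_i - a_{i-1} - a_{i+1}`. -/
abbrev DimVec (N : ZMod n → ℕ) (b : ZMod n → ℤ) : Type :=
  {a : ZMod n → ℕ // ∀ i, (N i : ℤ) = b i + 2 * (a i : ℤ) - (a (i - 1) : ℤ) - (a (i + 1) : ℤ)}

variable {b}

/-- The dimension vector with all entries increased by `c`. -/
def DimVec.add (a : DimVec N b) (c : ℕ) : DimVec N b :=
  ⟨fun i => a.1 i + c, fun i => by rw [a.2 i]; push_cast; ring⟩

variable (hq : ∀ m : ℕ, 0 < m → q ^ m ≠ 1)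

theorem eq_of_hat (a : DimVec N b) (ε : Bool) {E F : Shuffle (n := n) q d}
    (h : ∀ a' : DimVec N b, hat (a := a'.1) z o hq ε E = hat z o hq ε F) : E = F := by
  refine sub_eq_zero.1 (DFinsupp.ext fun k => ?_)
  refine component_eq_zero_of_hat (a := (a.add (∑ i, k i)).1) z o hq (fun i => ?_) ε
    (by rw [map_sub, h, sub_self])
  exact (Finset.single_le_sum (fun _ _ => Nat.zero_le _) (Finset.mem_univ i)).trans
    (Nat.le_add_left _ _)

theorem exists_toShuffle_pos (hw : WheelGeneric q d) (a : DimVec N b) :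
    ∃ Υ : Toroidal.pos q d b →ₐ[ℂ] Shuffle (n := n) q d,
      (∀ (i : ZMod n) (r : ℤ), Υ (Toroidal.ePos q d b i r) = shufX q d i r) ∧
      (∀ u, Υ u ∈ wheelSet q d) ∧
      ∀ u, hat (a := a.1) z o hq true (Υ u) = gkloHom q d z o a.2 hq (u : Toroidal q d b) := by
  let J : Shuffle (n := n) q d →ₐ[ℂ] ∀ a : DimVec N b, DiffOp q a.1 :=
    AlgHom.ofLinearMap (LinearMap.pi fun a => (hatPlusHom (a := a.1) z o hq).toLinearMap)
      (funext fun a => map_one (hatPlusHom z o hq))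
      (fun E F => funext fun a => map_mul (hatPlusHom z o hq) E F)
  let φ : Toroidal q d b →ₐ[ℂ] ∀ a : DimVec N b, DiffOp q a.1 :=
    AlgHom.ofLinearMap (LinearMap.pi fun a => (gkloHom q d z o a.2 hq).toLinearMap)
      (funext fun a => map_one (gkloHom q d z o a.2 hq))
      (fun x y => funext fun a => map_mul (gkloHom q d z o a.2 hq) x y)
  have hJ : Function.Injective J := fun E F h => eq_of_hat z o hq a true fun a' => congrFun h a'
  have hX : ∀ i r, J (shufX q d i r) = φ (Toroidal.e q d b i r) := fun i r => funext fun a' =>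
    (eImage_eq_hat z o hq i r).symm.trans
      ((gkloHom_proj q d z o a'.2 hq _).trans (freeHom_e q d z o b i r)).symm
  obtain ⟨Υ, h1, h2⟩ := exists_lift_adjoin (wheelAlg hw) hJ φ
    (G := Set.range fun ir : ZMod n × ℤ => Toroidal.e q d b ir.1 ir.2) (by
      rintro _ ⟨⟨i, r⟩, rfl⟩
      exact ⟨shufX q d i r, xpow_mem_wheelSet i r, hX i r⟩)
  exact ⟨Υ, fun i r => hJ ((h2 _).trans (hX i r).symm), h1, fun u => congrFun (h2 u) a⟩

theorem exists_toShuffle_neg (hw : WheelGeneric q d) (a : DimVec N b) :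
    ∃ Υ : Toroidal.neg q d b →ₐ[ℂ] (Shuffle (n := n) q d)ᵐᵒᵖ,
      (∀ (i : ZMod n) (r : ℤ), Υ (Toroidal.fNeg q d b i r) = MulOpposite.op (shufX q d i r)) ∧
      (∀ u, (Υ u).unop ∈ wheelSet q d) ∧
      ∀ u, hat (a := a.1) z o hq false (Υ u).unop =
        gkloHom q d z o a.2 hq (u : Toroidal q d b) := by
  let J : (Shuffle (n := n) q d)ᵐᵒᵖ →ₐ[ℂ] ∀ a : DimVec N b, DiffOp q a.1 :=
    AlgHom.ofLinearMap (LinearMap.pi fun a => (hatMinusHom (a := a.1) z o hq).toLinearMap)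
      (funext fun a => map_one (hatMinusHom z o hq))
      (fun E F => funext fun a => map_mul (hatMinusHom z o hq) E F)
  let φ : Toroidal q d b →ₐ[ℂ] ∀ a : DimVec N b, DiffOp q a.1 :=
    AlgHom.ofLinearMap (LinearMap.pi fun a => (gkloHom q d z o a.2 hq).toLinearMap)
      (funext fun a => map_one (gkloHom q d z o a.2 hq))
      (fun x y => funext fun a => map_mul (gkloHom q d z o a.2 hq) x y)
  have hJ : Function.Injective J := fun E F h =>
    MulOpposite.unop_injective (eq_of_hat z o hq a false fun a' => congrFun h a')
  have hX : ∀ i r, J (MulOpposite.op (shufX q d i r)) = φ (Toroidal.f q d b i r) := fun i r =>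
    funext fun a' => (fImage_eq_hat z o hq i r).symm.trans
      ((gkloHom_proj q d z o a'.2 hq _).trans (freeHom_f q d z o b i r)).symm
  obtain ⟨Υ, h1, h2⟩ := exists_lift_adjoin (wheelAlg hw).op hJ φ
    (G := Set.range fun ir : ZMod n × ℤ => Toroidal.f q d b ir.1 ir.2) (by
      rintro _ ⟨⟨i, r⟩, rfl⟩
      exact ⟨MulOpposite.op (shufX q d i r), xpow_mem_wheelSet i r, hX i r⟩)
  exact ⟨Υ, fun i r => hJ ((h2 _).trans (hX i r).symm), h1, fun u => congrFun (h2 u) a⟩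

end ToShuffle

end ToroidalShuffle
end

open ToroidalShuffle
theorem theorem4p5 (n : ℕ) [NeZero n] [Fact (3 ≤ n)] (q d : ℂˣ)
    (hq : ∀ m : ℕ, 0 < m → q ^ m ≠ 1)
    (hqd : ∀ m : ℕ, 0 < m → (q * d) ^ m ≠ 1)
    (hqd' : ∀ m : ℕ, 0 < m → (q * d⁻¹) ^ m ≠ 1)
    (b : ZMod n → ℤ) (a N : ZMod n → ℕ)
    (hN : ∀ i, (N i : ℤ) = b i + 2 * (a i : ℤ) - (a (i - 1) : ℤ) - (a (i + 1) : ℤ))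
    (z : ∀ i, Fin (N i) → ℂˣ) (o : ZMod n → Bool) :
    ∃ Φ : Toroidal q d b →ₐ[ℂ] diffAlg q a,
      (IsGKLO q d z o Φ ∧ ∀ Φ' : Toroidal q d b →ₐ[ℂ] diffAlg q a, IsGKLO q d z o Φ' → Φ' = Φ) ∧
      (∃ Ψ : Shuffle (n := n) q d →ₐ[ℂ] diffAlgLoc q d a,
        (∀ (k : ZMod n → ℕ) (E : ShuffleComp q d k),
          (Ψ (DirectSum.of (ShuffleComp q d) k E) : DiffOp q a) = hatPlus q d a z o k E.val) ∧
        (∀ E ∈ wheelSet (n := n) q d, (Ψ E : DiffOp q a) ∈ diffAlg q a) ∧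
        ∃ Υ : Toroidal.pos q d b →ₐ[ℂ] Shuffle (n := n) q d,
          (∀ (i : ZMod n) (r : ℤ), Υ (Toroidal.ePos q d b i r) =
            DirectSum.of (ShuffleComp q d) (Pi.single i 1) (xpow q d i r)) ∧
          (∀ u, Υ u ∈ wheelSet q d) ∧
          ∀ u : Toroidal.pos q d b,
            (Ψ (Υ u) : DiffOp q a) = (Φ (u : Toroidal q d b) : DiffOp q a)) ∧
      (∃ Ψ : (Shuffle (n := n) q d)ᵐᵒᵖ →ₐ[ℂ] diffAlgLoc q d a,
        (∀ (k : ZMod n → ℕ) (F : ShuffleComp q d k),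
          (Ψ (MulOpposite.op (DirectSum.of (ShuffleComp q d) k F)) : DiffOp q a) =
            hatMinus q d a o k F.val) ∧
        (∀ F ∈ wheelSet (n := n) q d, (Ψ (MulOpposite.op F) : DiffOp q a) ∈ diffAlg q a) ∧
        ∃ Υ : Toroidal.neg q d b →ₐ[ℂ] (Shuffle (n := n) q d)ᵐᵒᵖ,
          (∀ (i : ZMod n) (r : ℤ), Υ (Toroidal.fNeg q d b i r) =
            MulOpposite.op (DirectSum.of (ShuffleComp q d) (Pi.single i 1) (xpow q d i r))) ∧
          (∀ u, (Υ u).unop ∈ wheelSet q d) ∧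
          ∀ u : Toroidal.neg q d b,
            (Ψ (Υ u) : DiffOp q a) = (Φ (u : Toroidal q d b) : DiffOp q a)) := by
  have hw : WheelGeneric q d := .of_roots hq hqd hqd'
  obtain ⟨Υ, hΥ⟩ := exists_toShuffle_pos z o hq hw ⟨a, hN⟩
  obtain ⟨Υ', hΥ'⟩ := exists_toShuffle_neg z o hq hw ⟨a, hN⟩
  refine ⟨_, ⟨gkloHom_isGKLO q d z o hN hq hw, fun Φ' h =>
    h.unique (gkloHom_isGKLO q d z o hN hq hw)⟩, ?_, ?_⟩
  · exact ⟨(hatPlusHom z o hq).codRestrict _ (hat_mem_loc z o hq true), hat_true_of z o hq,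
      fun E hE => hat_mem_of_wheel z o hq hw true hE, Υ, hΥ.1, hΥ.2.1, hΥ.2.2⟩
  · exact ⟨(hatMinusHom z o hq).codRestrict _ (fun F => hat_mem_loc z o hq false F.unop),
      hat_false_of z o hq, fun F hF => hat_mem_of_wheel z o hq hw false hF, Υ', hΥ'.1, hΥ'.2.1,
      hΥ'.2.2⟩
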